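/- Let $N\ge 1$, let $p>1$, with $p\le\frac{N-2}{N-4}$ if $N\ge5$, and let $p'=\frac{p}{p-1}$. Consider the Cauchy problem $$\partial_t^2u-a(t)^2\Delta u+b(t)\partial_tu=|u|^p\ \text{ in }\mathbb R^N\times(0,T),\qquad (u,\partial_tu)(0)=(\varepsilon f,\varepsilon g),\tag{P}$$ for real-valued $u$, and put $A(t)=\int_0^ta(r)\,dr$. A strong solution of (P) in $(0,T)$ is a function $$u\in C([0,T);H^2(\mathbb R^N))\cap C^1([0,T);H^1(\mathbb R^N))\cap C^2([0,T);L^2(\mathbb R^N))\cap C([0,T);L^{2p}(\mathbb R^N))$$ that satisfies the equation in $C([0,T);L^2(\mathbb R^N))$ and the initial conditions $u(0)=\varepsilon f$, $\partial_tu(0)=\varepsilon g$. The lifespan $T_\varepsilon\in[0,\infty]$ is the supremum of all $T>0$ for which a strong solution in $(0,T)$ exists. Consider the conditions (A1) $0<a\in C^2([0,\infty))$ and $0\le b\in C^1([0,\infty))\cap L^1((0,\infty))$; (A2) $\frac{d^2}{dt^2}(a^{-1}),\ \frac{d}{dt}(a^{-1}b)\in L^1((0,\infty))$ and $\frac{d}{dt}(a^{-1/2})\in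 L^2((0,\infty))$; (A3) $\lim_{t\to\infty}\frac{d}{dt}(a^{-1})=\lim_{t\to\infty}a^{-1}b=0$. Assume (A1), and let $(f,g)\in H^2(\mathbb R^N)\times H^1(\mathbb R^N)$ satisfy $f,g\ge0$, $f+g\not\equiv0$ and $\operatorname{supp}f\cup\operatorname{supp}g\subset B(0,r_0)$ for some $r_0$. Write $M_f=\int_{\mathbb R^N}f\,dx$ and $M_g=\int_{\mathbb R^N}g\,dx$. Then there exist constants $\varepsilon_0>0$ and $C>0$, independent of $\varepsilon$, such that for every $\varepsilon\in(0,\varepsilon_0]$ $$M_g\,\varepsilon+M_f^p\,\varepsilon^p\le C\,T_\varepsilon^{-\frac{p+1}{p-1}}A(T_\varepsilon)^N .$$ If moreover (A2) and (A3) hold, then also, for every $\varepsilon\in(0,\varepsilon_0]$, $$\varepsilon\le C\,T_\varepsilon^{-\frac{p^2+1}{p(p-1)}}A(T_\varepsilon)^{\frac Np}\left(\int_0^{T_\varepsilon}a(t)^{\frac{p'}2}\,[1+A(t)]^{N-1-\frac{N-1}2p'}\,dt\right)^{\frac1{p'}} .$$ If $T_\varepsilon=\infty$, each inequality is understood to hold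 with $T_\varepsilon$ replaced by $T$, for all sufficiently large finite $T$ (with the same constant $C$). -/

import Mathlib

open MeasureTheory Set Filter Topology
open scoped ENNReal ContDiff

namespace SemilinearWave

/-- The real Hilbert space `L²(ℝ^N)`. -/
abbrev L2 (N : ℕ) : Type := Lp ℝ 2 (volume : Measure (EuclideanSpace ℝ (Fin N)))

/-- The partial derivative `∂_{α 0} ⋯ ∂_{α (j-1)} φ` of a smooth function on `ℝ^N`. -/
noncomputable def partialDeriv {N j : ℕ} (α : Fin j → Fin N)
    (φ : EuclideanSpace ℝ (Fin N) → ℝ) (x : EuclideanSpace ℝ (Fin N)) : ℝ :=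
  iteratedFDeriv ℝ j φ x (fun i => EuclideanSpace.single (α i) (1 : ℝ))

/-- `v ∈ L²` is the weak derivative `∂_{α 0} ⋯ ∂_{α (j-1)} w` of `w ∈ L²`. -/
def HasWeakDeriv {N j : ℕ} (α : Fin j → Fin N) (w v : L2 N) : Prop :=
  ∀ φ : EuclideanSpace ℝ (Fin N) → ℝ, ContDiff ℝ ∞ φ → HasCompactSupport φ →
    ∫ x, w x * partialDeriv α φ x = (-1 : ℝ) ^ j * ∫ x, v x * φ x

theorem integrable_mul_test {N : ℕ} (w : L2 N) {ψ : EuclideanSpace ℝ (Fin N) → ℝ}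
    (hψ : Continuous ψ) (hc : HasCompactSupport ψ) : Integrable (fun x => w x * ψ x) :=
  (Lp.memLp w).integrable_mul ((hψ.memLp_of_hasCompactSupport hc : MemLp ψ 2 volume))

theorem continuous_partialDeriv {N j : ℕ} (α : Fin j → Fin N)
    {φ : EuclideanSpace ℝ (Fin N) → ℝ} (hφ : ContDiff ℝ ∞ φ) :
    Continuous (partialDeriv α φ) := by
  have h : Continuous (iteratedFDeriv ℝ j φ) :=
    hφ.continuous_iteratedFDeriv (by exact_mod_cast le_top)
  exact (ContinuousMultilinearMap.apply ℝ (fun _ : Fin j => EuclideanSpace ℝ (Fin N)) ℝ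
    (fun i => EuclideanSpace.single (α i) (1 : ℝ))).continuous.comp h

theorem hasCompactSupport_partialDeriv {N j : ℕ} (α : Fin j → Fin N)
    {φ : EuclideanSpace ℝ (Fin N) → ℝ} (hc : HasCompactSupport φ) :
    HasCompactSupport (partialDeriv α φ) :=
  (hc.iteratedFDeriv (𝕜 := ℝ) j).comp_left
    (g := fun T : ContinuousMultilinearMap ℝ (fun _ : Fin j => EuclideanSpace ℝ (Fin N)) ℝ =>
      T (fun i => EuclideanSpace.single (α i) (1 : ℝ))) rfl

theorem HasWeakDeriv.add {N j : ℕ} {α : Fin j → Fin N} {w v w' v' : L2 N}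
    (h : HasWeakDeriv α w v) (h' : HasWeakDeriv α w' v') :
    HasWeakDeriv α (w + w') (v + v') := by
  intro φ hφ hc
  have key : ∀ (f g : L2 N) (ψ : EuclideanSpace ℝ (Fin N) → ℝ), Continuous ψ →
      HasCompactSupport ψ →
      ∫ x, (f + g : L2 N) x * ψ x = (∫ x, f x * ψ x) + ∫ x, g x * ψ x := by
    intro f g ψ h1 h2
    rw [← integral_add (integrable_mul_test f h1 h2) (integrable_mul_test g h1 h2)]
    refine integral_congr_ae ?_
    filter_upwards [Lp.coeFn_add f g] with x hx
    rw [hx, Pi.add_apply, add_mul]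
  rw [key _ _ _ (continuous_partialDeriv α hφ) (hasCompactSupport_partialDeriv α hc),
    key _ _ _ hφ.continuous hc, h φ hφ hc, h' φ hφ hc, mul_add]

theorem HasWeakDeriv.smul {N j : ℕ} {α : Fin j → Fin N} {w v : L2 N} (c : ℝ)
    (h : HasWeakDeriv α w v) : HasWeakDeriv α (c • w) (c • v) := by
  intro φ hφ hc
  have key : ∀ (f : L2 N) (ψ : EuclideanSpace ℝ (Fin N) → ℝ),
      ∫ x, (c • f : L2 N) x * ψ x = c * ∫ x, f x * ψ x := by
    intro f ψ
    rw [← integral_const_mul]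
    refine integral_congr_ae ?_
    filter_upwards [Lp.coeFn_smul c f] with x hx
    rw [hx, Pi.smul_apply, smul_eq_mul, mul_assoc]
  rw [key, key, h φ hφ hc, mul_left_comm]

theorem HasWeakDeriv.zero {N j : ℕ} (α : Fin j → Fin N) :
    HasWeakDeriv α (0 : L2 N) (0 : L2 N) := by
  have h0 : HasWeakDeriv α ((0 : ℝ) • (0 : L2 N)) ((0 : ℝ) • (0 : L2 N)) := by
    intro φ _ _
    have key : ∀ ψ : EuclideanSpace ℝ (Fin N) → ℝ,
        ∫ x, ((0 : ℝ) • (0 : L2 N) : L2 N) x * ψ x = 0 := by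
      intro ψ
      rw [smul_zero]
      refine (integral_congr_ae ?_).trans (integral_zero _ _)
      filter_upwards [Lp.coeFn_zero ℝ 2 (volume : Measure (EuclideanSpace ℝ (Fin N)))] with x hx
      rw [hx]; simp
    rw [key, key, mul_zero]
  simpa using h0

/-- The differential monomials of order at most `k`: an order `j ≤ k` and a word of `j` directions. -/
abbrev DerivIndex (N k : ℕ) : Type := Σ j : Fin (k + 1), (Fin (j : ℕ) → Fin N)

/-- The empty word, i.e. no derivative at all. -/
def noDeriv (N k : ℕ) : DerivIndex N k := ⟨0, fun i => Fin.elim0 i⟩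

/-- The Sobolev space `H^k(ℝ^N)` (real-valued functions), realized as the space of the families
consisting of a function `w ∈ L²` (the entry at the empty word) and all its weak derivatives of
order at most `k`, which are required to lie in `L²`. The norm is
`‖w‖² = ∑_{order ≤ k} ‖∂^α w‖²_{L²}`. -/
noncomputable def Sobolev (N k : ℕ) : Submodule ℝ (PiLp 2 (fun _ : DerivIndex N k => L2 N)) where
  carrier := {F | ∀ α : DerivIndex N k, HasWeakDeriv α.2 (F (noDeriv N k)) (F α)}
  add_mem' hF hG α := (hF α).add (hG α)
  zero_mem' α := HasWeakDeriv.zero α.2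
  smul_mem' c _ hF α := (hF α).smul c

/-- The underlying `L²` function of an element of `H^k`. -/
noncomputable def toL2 {N k : ℕ} (w : Sobolev N k) : L2 N :=
  (w : PiLp 2 (fun _ : DerivIndex N k => L2 N)) (noDeriv N k)

/-- The inclusion `H²(ℝ^N) ⊆ H¹(ℝ^N)`: forget the second derivatives. -/
noncomputable def toH1 {N : ℕ} (w : Sobolev N 2) : Sobolev N 1 :=
  ⟨WithLp.toLp 2 (fun α : DerivIndex N 1 =>
      (w : PiLp 2 (fun _ : DerivIndex N 2 => L2 N)) ⟨Fin.castLE (by norm_num) α.1, α.2⟩),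
    fun α => w.2 ⟨Fin.castLE (by norm_num) α.1, α.2⟩⟩

/-- The Laplacian `Δ : H²(ℝ^N) → L²(ℝ^N)`, the sum of the weak derivatives `∂_i ∂_i`. -/
noncomputable def laplacian {N : ℕ} (w : Sobolev N 2) : L2 N :=
  ∑ i : Fin N, (w : PiLp 2 (fun _ : DerivIndex N 2 => L2 N)) ⟨2, fun _ => i⟩

/-- Assumption (A1) on the coefficients. -/
structure AssumptionA1 (a b : ℝ → ℝ) : Prop where
  a_pos : ∀ t, 0 ≤ t → 0 < a t
  a_smooth : ContDiffOn ℝ 2 a (Ici 0)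
  b_nonneg : ∀ t, 0 ≤ t → 0 ≤ b t
  b_smooth : ContDiffOn ℝ 1 b (Ici 0)
  b_integrable : IntegrableOn b (Ioi 0)

/-- Assumption (A2) on the coefficients. -/
structure AssumptionA2 (a b : ℝ → ℝ) : Prop where
  deriv2_inv_a : IntegrableOn (iteratedDeriv 2 (fun t => (a t)⁻¹)) (Ioi 0)
  deriv_b_div_a : IntegrableOn (deriv (fun t => (a t)⁻¹ * b t)) (Ioi 0)
  deriv_rsqrt_a : MemLp (deriv (fun t => a t ^ (-(1 / 2) : ℝ))) 2 (volume.restrict (Ioi 0))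

/-- Assumption (A3) on the coefficients. -/
structure AssumptionA3 (a b : ℝ → ℝ) : Prop where
  deriv_inv_a : Tendsto (deriv (fun t => (a t)⁻¹)) atTop (𝓝 0)
  b_div_a : Tendsto (fun t => (a t)⁻¹ * b t) atTop (𝓝 0)

/-- `A(t) = ∫_0^t a(r) dr`. -/
noncomputable def primitiveA (a : ℝ → ℝ) (t : ℝ) : ℝ := ∫ r in (0 : ℝ)..t, a r

/-- `u` (only its values on `[0,T)` matter) is a strong solution in `(0,T)` of
`∂_t² u - a(t)² Δu + b(t) ∂_t u = |u|^p`, `(u, ∂_t u)(0) = (u₀, u₁)`. -/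
structure IsStrongSolution (N : ℕ) (a b : ℝ → ℝ) (p : ℝ) (u₀ : Sobolev N 2) (u₁ : Sobolev N 1)
    (T : ℝ) (u : ℝ → Sobolev N 2) : Prop where
  /-- `u ∈ C([0,T); H²)` -/
  continuous_H2 : ContinuousOn u (Ico 0 T)
  /-- `u ∈ C¹([0,T); H¹)` -/
  contDiff_H1 : ContDiffOn ℝ 1 (fun t => toH1 (u t)) (Ico 0 T)
  /-- `u ∈ C²([0,T); L²)` -/
  contDiff_L2 : ContDiffOn ℝ 2 (fun t => toL2 (u t)) (Ico 0 T)
  /-- `u(t) ∈ L^{2p}` -/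
  memLp : ∀ t ∈ Ico 0 T, MemLp (toL2 (u t)) (ENNReal.ofReal (2 * p)) volume
  /-- `t ↦ u(t)` is continuous into `L^{2p}` -/
  continuous_Lp : ∀ t ∈ Ico 0 T, Tendsto
    (fun s => eLpNorm (toL2 (u s) - toL2 (u t) : L2 N) (ENNReal.ofReal (2 * p)) volume)
    (𝓝[Ico 0 T] t) (𝓝 0)
  /-- the equation, as an identity in `L²` for every `t ∈ [0,T)` -/
  equation : ∀ t ∈ Ico 0 T,
    (iteratedDerivWithin 2 (fun s => toL2 (u s)) (Ico 0 T) t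
        - a t ^ 2 • laplacian (u t)
        + b t • derivWithin (fun s => toL2 (u s)) (Ico 0 T) t : L2 N)
      =ᵐ[volume] fun x => |toL2 (u t) x| ^ p
  initial_u : u 0 = u₀
  initial_ut : derivWithin (fun s => toH1 (u s)) (Ico 0 T) 0 = u₁

/-- The lifespan: the supremum in `[0,∞]` of all `T > 0` such that a strong solution in `(0,T)`
with data `(ε f, ε g)` exists. -/
noncomputable def lifespan (N : ℕ) (a b : ℝ → ℝ) (p : ℝ) (f : Sobolev N 2) (g : Sobolev N 1)
    (ε : ℝ) : ℝ≥0∞ :=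
  sSup (ENNReal.ofReal '' {T : ℝ | 0 < T ∧
    ∃ u : ℝ → Sobolev N 2, IsStrongSolution N a b p (ε • f) (ε • g) T u})

/-- The relation `P` holds at the time `τ ∈ [0,∞]`; for `τ = ∞` this is understood as: `P T` holds
for all sufficiently large finite `T`. -/
def HoldsAtTime (τ : ℝ≥0∞) (P : ℝ → Prop) : Prop :=
  (τ ≠ ⊤ → P τ.toReal) ∧ (τ = ⊤ → ∀ᶠ T : ℝ in atTop, P T)

end SemilinearWave

/-!
The proof compares two moments of a solution with `∫ |u|^p`.

**The first estimate.** By finite speed of propagation `u(t)` is supported in the ball of radius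
`r₀ + A(t)`, so that the average `y = ∫ u` satisfies `y'' + b y' = G` with `G = ∫ |u|^p`, and
`y ≤ G^{1/p} (c (r₀ + A)^N)^{1/p'}` by Hölder's inequality. In the time scale `s = ∫ e^{-∫ b}`, which
is comparable with `t` since `b` is integrable, the damping disappears. Testing the equation with
`(1 - (s/S)²)^k` and absorbing `y` by Young's inequality bounds `y'(0)` and the integral of `G` over a
fixed fraction `[0, κT]` of the time interval by `T^{-(p+1)/(p-1)} A(T)^N`
(`IsDampedSolution.integral_le`, `AssumptionA1.exists_average_bound`); since `y` does not fall below
its initial value, `y(0)^p` obeys the same bound.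

**The second estimate.** Let `φ` be the radial solution of `Δφ = φ`, given by a power series of Bessel
type, with `φ(x) ≤ C (1 + |x|)^{-(N-1)/2} e^{|x|}` (`exists_besselSeries_growth`). The moment
`z = ∫ u φ` solves `z'' + b z' = a² z + F` with `F ≥ 0`. Under (A2) and (A3) the equation is a small
perturbation of an exactly factorized one, and `z ≥ c ε a^{-1/2} e^A` for large times
(`AssumptionA1.exists_exponential_lower_bound`). On the other hand Hölder's inequality bounds `z` by
`G^{1/p}` times the `L^{p'}` mass of `φ` on the ball of radius `r₀ + A`. The factors `e^A` cancel;
integrating over the second half of `[0, κT]` and inserting the bound for the integral of `G` gives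
the second estimate (`exists_second_estimate`).

**Finite speed of propagation.** The energy with the weight `e^{s² ⟪e, x⟫}`, `|e| ≤ 1`, grows at the
rate `2 s² a + O(s)` (`exists_energy_growth`). As `s → ∞` this excludes any mass in the half spaces
`⟪e, x⟫ > r₀ + A(t)` (`IsVelocity.finite_speed`). The weights are truncated to keep the multiplication
operators bounded.

**Short times.** Both right-hand sides are bounded below on compact sets of positive times, but may tend
to `0` as `T → 0`. So the lifespan has to be bounded below uniformly in `ε ≤ 1`, which is local
existence (`exists_local_solution`). The change of time `σ = A(t)` turns the equation into
`w'' - Δw = -β w' + c |w|^p`. On the Fourier side it is a semilinear perturbation of the unitary groups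
`e^{∓ i t (4π² - Δ)^{1/2}}`. The nonlinearity maps `H²` to `L²` and is Lipschitz with respect to the
`H¹` distance on bounded subsets of `H²`, by Sobolev embedding under the restriction on `p`
(`exists_powL2_estimate`). The Picard iteration therefore runs in bounded sets of the Favard class of
the group (the vectors with Lipschitz orbit), which is closed under limits in the weaker norm in which
the iteration contracts (`IsometryGroup.exists_mild`); the Favard class is the domain of the generator,
and the mild solutions found are strong ones (`mild_regularity`).

The estimates are proved for every `T` below the lifespan with constants independent of `T`, and pass
to the lifespan itself by continuity (`holdsAtTime_of_forall`).
-/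

set_option linter.unusedSectionVars false

namespace SemilinearWave

open scoped FourierTransform SchwartzMap LineDeriv NNReal

/-! ### Mild solutions for strongly continuous groups of isometries -/

/-- A strongly continuous one-parameter group of linear isometries of a Banach space. -/
structure IsometryGroup (E : Type*) [NormedAddCommGroup E] [NormedSpace ℝ E] where
  /-- The operator at time `t`. -/
  toFun : ℝ → E →ₗᵢ[ℝ] E
  map_zero' : ∀ x, toFun 0 x = x
  map_add' : ∀ s t x, toFun (s + t) x = toFun s (toFun t x)
  continuous' : ∀ x, Continuous fun t => toFun t x

theorem continuous_of_lipschitz {E : Type*} [NormedAddCommGroup E] {F : ℝ → E} {ℓ : ℝ}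
    (hL : ∀ s t, ‖F s - F t‖ ≤ ℓ * |s - t|) : Continuous F := by
  have h0 : 0 ≤ ℓ := by simpa using (norm_nonneg _).trans (hL 1 0)
  refine (LipschitzWith.of_dist_le_mul (K := ⟨ℓ, h0⟩) fun s t => ?_).continuous
  rw [dist_eq_norm, Real.dist_eq]
  exact hL s t

namespace IsometryGroup

variable {E : Type*} [NormedAddCommGroup E] [NormedSpace ℝ E] (R : IsometryGroup E)

theorem norm_apply (t : ℝ) (x : E) : ‖R.toFun t x‖ = ‖x‖ := (R.toFun t).norm_map x

theorem continuous_uncurry : Continuous fun q : ℝ × E => R.toFun q.1 q.2 := by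
  rw [continuous_iff_continuousAt]
  rintro ⟨t₀, x₀⟩
  rw [ContinuousAt, tendsto_iff_norm_sub_tendsto_zero]
  have h1 : Tendsto (fun q : ℝ × E => ‖q.2 - x₀‖ + ‖R.toFun q.1 x₀ - R.toFun t₀ x₀‖)
      (𝓝 (t₀, x₀)) (𝓝 0) := by
    have hc : Continuous (fun q : ℝ × E => ‖q.2 - x₀‖ + ‖R.toFun q.1 x₀ - R.toFun t₀ x₀‖) :=
      (continuous_snd.sub continuous_const).norm.add
        (((R.continuous' x₀).comp continuous_fst).sub continuous_const).norm
    simpa using hc.tendsto (t₀, x₀)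
  refine squeeze_zero (fun _ => norm_nonneg _) (fun q => ?_) h1
  have : R.toFun q.1 q.2 - R.toFun t₀ x₀
      = R.toFun q.1 (q.2 - x₀) + (R.toFun q.1 x₀ - R.toFun t₀ x₀) := by
    rw [map_sub]; abel
  rw [this]
  exact (norm_add_le _ _).trans (by rw [R.norm_apply])

theorem continuous_comp {X : Type*} [TopologicalSpace X] {f : X → ℝ} {g : X → E}
    (hf : Continuous f) (hg : Continuous g) : Continuous fun x => R.toFun (f x) (g x) :=
  R.continuous_uncurry.comp (hf.prodMk hg)

/-- The Favard class with constant `K`: the orbit of `z` is Lipschitz at time `0` with constant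
`K`. In a Hilbert space this is the ball of radius `K` of the domain of the generator for the
graph seminorm, but it is stable under pointwise limits by its very form. -/
def Fav (K : ℝ) (z : E) : Prop := ∀ h, 0 ≤ h → ‖R.toFun h z - z‖ ≤ K * h

/-- The Duhamel integral `∫_0^t R(t-s) F(s) ds`. -/
noncomputable def duhamel (F : ℝ → E) (t : ℝ) : E := ∫ s in (0 : ℝ)..t, R.toFun (t - s) (F s)

variable {R} in
theorem Fav.mono {K K' : ℝ} {z : E} (h : R.Fav K z) (hK : K ≤ K') : R.Fav K' z := fun t ht =>
  (h t ht).trans (mul_le_mul_of_nonneg_right hK ht)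

variable {F : ℝ → E}

theorem continuous_integrand (hF : Continuous F) (t : ℝ) :
    Continuous fun s => R.toFun (t - s) (F s) :=
  R.continuous_comp (continuous_const.sub continuous_id) hF

theorem norm_integral_le {M : ℝ} (hM : ∀ s, ‖F s‖ ≤ M) {a b : ℝ} (hab : a ≤ b)
    (t : ℝ) : ‖∫ s in a..b, R.toFun (t - s) (F s)‖ ≤ M * (b - a) := by
  have := intervalIntegral.norm_integral_le_of_norm_le_const (a := a) (b := b) (C := M)
    (f := fun s => R.toFun (t - s) (F s)) (fun s _ => by rw [R.norm_apply]; exact hM s)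
  rwa [abs_of_nonneg (sub_nonneg.2 hab)] at this

theorem apply_intervalIntegral [CompleteSpace E] (t : ℝ) {G : ℝ → E} (hG : Continuous G)
    (a b : ℝ) : R.toFun t (∫ s in a..b, G s) = ∫ s in a..b, R.toFun t (G s) :=
  ((R.toFun t).toContinuousLinearMap.intervalIntegral_comp_comm
    (hG.intervalIntegrable a b)).symm

theorem duhamel_add [CompleteSpace E] (hF : Continuous F) (t h : ℝ) :
    R.duhamel F (t + h) = R.toFun h (R.duhamel F t) + R.duhamel (fun s => F (t + s)) h := by
  unfold duhamel
  rw [R.apply_intervalIntegral h (R.continuous_integrand hF t),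
    ← intervalIntegral.integral_add_adjacent_intervals (b := t)
      ((R.continuous_integrand hF (t + h)).intervalIntegrable _ _)
      ((R.continuous_integrand hF (t + h)).intervalIntegrable _ _)]
  congr 1
  · refine intervalIntegral.integral_congr fun s _ => ?_
    rw [← R.map_add']
    congr 2
    ring
  · have := intervalIntegral.integral_comp_add_left (a := 0) (b := h)
      (fun s => R.toFun (t + h - s) (F s)) t
    rw [add_zero] at this
    rw [← this]
    refine intervalIntegral.integral_congr fun s _ => ?_
    simp only
    congr 2
    ring

theorem duhamel_eq (F : ℝ → E) (t : ℝ) :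
    R.duhamel F t = ∫ r in (0 : ℝ)..t, R.toFun r (F (t - r)) := by
  have := intervalIntegral.integral_comp_sub_left (a := 0) (b := t)
    (fun s => R.toFun (t - s) (F s)) t
  simp only [sub_self, sub_zero, sub_sub_cancel] at this
  rw [duhamel, this]

/-- The Duhamel integral of a Lipschitz forcing is Lipschitz in time. -/
theorem norm_duhamel_sub_le {ℓ M : ℝ} (hF : Continuous F)
    (hL : ∀ s t, ‖F s - F t‖ ≤ ℓ * |s - t|) (hM : ∀ s, ‖F s‖ ≤ M) {s t : ℝ} (hs : 0 ≤ s)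
    (hst : s ≤ t) : ‖R.duhamel F t - R.duhamel F s‖ ≤ (M + ℓ * s) * (t - s) := by
  have hc : ∀ t, Continuous fun r => R.toFun r (F (t - r)) := fun t =>
    R.continuous_comp continuous_id (hF.comp (continuous_const.sub continuous_id))
  rw [duhamel_eq, duhamel_eq, ← intervalIntegral.integral_add_adjacent_intervals (b := s)
    ((hc t).intervalIntegrable _ _) ((hc t).intervalIntegrable _ _), add_sub_right_comm,
    ← intervalIntegral.integral_sub ((hc t).intervalIntegrable _ _)
      ((hc s).intervalIntegrable _ _)]
  have h1 : ‖∫ r in (0 : ℝ)..s, (R.toFun r (F (t - r)) - R.toFun r (F (s - r)))‖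
      ≤ ℓ * (t - s) * |s - 0| := by
    refine intervalIntegral.norm_integral_le_of_norm_le_const fun r _ => ?_
    rw [← map_sub, R.norm_apply]
    refine (hL _ _).trans (le_of_eq ?_)
    rw [sub_sub_sub_cancel_right, abs_of_nonneg (sub_nonneg.2 hst)]
  have h2 : ‖∫ r in s..t, R.toFun r (F (t - r))‖ ≤ M * |t - s| :=
    intervalIntegral.norm_integral_le_of_norm_le_const fun r _ => by
      rw [R.norm_apply]; exact hM _
  rw [sub_zero, abs_of_nonneg hs] at h1
  rw [abs_of_nonneg (sub_nonneg.2 hst)] at h2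
  refine (norm_add_le _ _).trans ?_
  nlinarith

theorem norm_duhamel_le {M : ℝ} (hM : ∀ s, ‖F s‖ ≤ M) {t : ℝ} (ht : 0 ≤ t) :
    ‖R.duhamel F t‖ ≤ M * t := by
  simpa [duhamel] using R.norm_integral_le hM ht t

/-- The Duhamel integral of a Lipschitz forcing lies in a Favard class: the group acting on it
differs from its time shift by the forcing of a short time interval only. -/
theorem fav_duhamel [CompleteSpace E] {ℓ M : ℝ} (hF : Continuous F)
    (hL : ∀ s t, ‖F s - F t‖ ≤ ℓ * |s - t|) (hM : ∀ s, ‖F s‖ ≤ M) {t : ℝ} (ht : 0 ≤ t) :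
    R.Fav (2 * M + ℓ * t) (R.duhamel F t) := by
  intro h hh
  have h1 := R.norm_duhamel_sub_le hF hL hM ht (le_add_of_nonneg_right hh)
  have h2 := R.norm_duhamel_le (F := fun s => F (t + s)) (fun s => hM _) hh
  have : R.toFun h (R.duhamel F t) - R.duhamel F t
      = (R.duhamel F (t + h) - R.duhamel F t) - R.duhamel (fun s => F (t + s)) h := by
    rw [R.duhamel_add hF]; abel
  rw [this]
  refine (norm_sub_le _ _).trans ?_
  rw [add_sub_cancel_left] at h1
  linarith

variable {R} in
theorem Fav.apply {K : ℝ} {z : E} (hz : R.Fav K z) (t : ℝ) : R.Fav K (R.toFun t z) := by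
  intro h hh
  rw [← R.map_add', add_comm, R.map_add', ← map_sub, R.norm_apply]
  exact hz h hh

variable {R} in
theorem Fav.add {K K' : ℝ} {z z' : E} (hz : R.Fav K z) (hz' : R.Fav K' z') :
    R.Fav (K + K') (z + z') := by
  intro h hh
  rw [map_add, add_sub_add_comm, add_mul]
  exact (norm_add_le _ _).trans (add_le_add (hz h hh) (hz' h hh))

/-- Joint local Lipschitz continuity of a nonlinearity on bounded subsets of the Favard class,
on the time interval `[0, S]`. -/
def LocLip (S : ℝ) (N : ℝ → E → E) : Prop :=
  ∀ K : ℝ, ∃ L : ℝ, 0 ≤ L ∧ ∀ s ∈ Icc 0 S, ∀ t ∈ Icc 0 S, ∀ z w : E,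
    ‖z‖ ≤ K → R.Fav K z → ‖w‖ ≤ K → R.Fav K w → ‖N s z - N t w‖ ≤ L * (|s - t| + ‖z - w‖)

/-- The curves in which the fixed point argument takes place. -/
structure IsAdmissible (T K : ℝ) (z : ℝ → E) : Prop where
  norm_le : ∀ t ∈ Icc 0 T, ‖z t‖ ≤ K
  fav : ∀ t ∈ Icc 0 T, R.Fav K (z t)
  lip : ∀ s ∈ Icc 0 T, ∀ t ∈ Icc 0 T, ‖z s - z t‖ ≤ K * |s - t|

/-- The projection of the line onto `[0, T]`. -/
def clamp (T t : ℝ) : ℝ := max 0 (min t T)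

theorem clamp_mem {T : ℝ} (hT : 0 ≤ T) (t : ℝ) : clamp T t ∈ Icc 0 T :=
  ⟨le_max_left _ _, max_le hT (min_le_right _ _)⟩

theorem clamp_of_mem {T t : ℝ} (ht : t ∈ Icc 0 T) : clamp T t = t := by
  rw [clamp, min_eq_left ht.2, max_eq_right ht.1]

theorem abs_clamp_sub_le (T s t : ℝ) : |clamp T s - clamp T t| ≤ |s - t| := by
  unfold clamp
  refine (abs_max_sub_max_le_max _ _ _ _).trans ?_
  rw [sub_self, abs_zero, max_eq_right (abs_nonneg _)]
  refine (abs_min_sub_min_le_max _ _ _ _).trans ?_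
  rw [sub_self, abs_zero, max_eq_left (abs_nonneg _)]

/-- One step of the Picard iteration. -/
noncomputable def picard (T : ℝ) (N : ℝ → E → E) (z₀ : E) (z : ℝ → E) (t : ℝ) : E :=
  R.toFun t z₀ + R.duhamel (fun s => N (clamp T s) (z (clamp T s))) t

variable {R} in
theorem forcing_lipschitz {S T K L : ℝ} {N : ℝ → E → E} {z : ℝ → E} (hT : 0 ≤ T) (hTS : T ≤ S)
    (hL0 : 0 ≤ L)
    (hL : ∀ s ∈ Icc 0 S, ∀ t ∈ Icc 0 S, ∀ z w : E,
      ‖z‖ ≤ K → R.Fav K z → ‖w‖ ≤ K → R.Fav K w → ‖N s z - N t w‖ ≤ L * (|s - t| + ‖z - w‖))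
    (hz : R.IsAdmissible T K z) (hK : 0 ≤ K) (s t : ℝ) :
    ‖N (clamp T s) (z (clamp T s)) - N (clamp T t) (z (clamp T t))‖ ≤ L * (1 + K) * |s - t| := by
  have hs := clamp_mem hT s
  have ht := clamp_mem hT t
  refine (hL _ ⟨hs.1, hs.2.trans hTS⟩ _ ⟨ht.1, ht.2.trans hTS⟩ _ _ (hz.norm_le _ hs)
    (hz.fav _ hs) (hz.norm_le _ ht) (hz.fav _ ht)).trans ?_
  have h1 := hz.lip _ hs _ ht
  have h2 := abs_clamp_sub_le T s t
  rw [mul_assoc]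
  refine mul_le_mul_of_nonneg_left ?_ hL0
  nlinarith [mul_le_mul_of_nonneg_left h2 hK]

/-- Existence of mild solutions with Favard class regularity for nonlinearities that are locally
Lipschitz only on bounded subsets of the Favard class, on a time interval that depends only on
the size of the initial value. -/
theorem exists_mild [CompleteSpace E] {S : ℝ} (hS : 0 < S) {N : ℝ → E → E} (hN : R.LocLip S N)
    (K₀ : ℝ) : ∃ T > 0, T ≤ S ∧ ∃ K : ℝ, ∀ z₀ : E, ‖z₀‖ ≤ K₀ → R.Fav K₀ z₀ →
      ∃ z : ℝ → E, R.IsAdmissible T K z ∧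
        ∀ t ∈ Icc 0 T, z t = R.toFun t z₀ + R.duhamel (fun s => N (clamp T s) (z (clamp T s))) t := by
  by_cases hK₀ : 0 ≤ K₀
  swap
  · exact ⟨S, hS, le_rfl, 0, fun z₀ h => absurd ((norm_nonneg _).trans h) hK₀⟩
  obtain ⟨L₀, hL₀, hN₀⟩ := hN K₀
  set M₀ : ℝ := ‖N 0 0‖ + L₀ * K₀ with hM₀
  have hM₀0 : 0 ≤ M₀ := by positivity
  -- `M₀` bounds the forcing at the initial value. The bound `K` leaves room for the Duhamel term, and
  -- `T` is small compared with the inverse of the Lipschitz constant `L` on the set described by `K`.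
  set K : ℝ := K₀ + 2 * M₀ + 1 with hKdef
  have hK0 : 0 ≤ K := by positivity
  have hKK₀ : K₀ ≤ K := by linarith
  obtain ⟨L, hL0, hL⟩ := hN K
  set ℓ : ℝ := L * (1 + K) with hℓ
  have hℓ0 : 0 ≤ ℓ := by positivity
  set T : ℝ := min S (min 1 (1 / (3 * ℓ + 2 * L + 1))) with hTdef
  have hden : 0 < 3 * ℓ + 2 * L + 1 := by positivity
  have hT : 0 < T := by positivity
  have hTS : T ≤ S := min_le_left _ _
  have hT1 : T ≤ 1 := (min_le_right _ _).trans (min_le_left _ _)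
  have hT2 : (3 * ℓ + 2 * L + 1) * T ≤ 1 := by
    have : T ≤ 1 / (3 * ℓ + 2 * L + 1) := (min_le_right _ _).trans (min_le_right _ _)
    rwa [le_div_iff₀ hden, mul_comm] at this
  have hT3 : 3 * ℓ * T ≤ 1 := by nlinarith [mul_nonneg hL0 hT.le]
  have hT4 : L * T ≤ 1 / 2 := by nlinarith [mul_nonneg hℓ0 hT.le]
  refine ⟨T, hT, hTS, K, fun z₀ hz₀ hFz₀ => ?_⟩
  -- bounds for the forcing along an admissible curve that starts at `z₀`
  have hNz₀ : ‖N 0 z₀‖ ≤ M₀ := by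
    have h := hN₀ 0 ⟨le_rfl, hS.le⟩ 0 ⟨le_rfl, hS.le⟩ z₀ 0 hz₀ hFz₀ (by simpa using hK₀)
      (fun h hh => by simpa using mul_nonneg hK₀ hh)
    simp only [sub_self, abs_zero, zero_add, sub_zero] at h
    calc ‖N 0 z₀‖ = ‖(N 0 z₀ - N 0 0) + N 0 0‖ := by rw [sub_add_cancel]
      _ ≤ L₀ * ‖z₀‖ + ‖N 0 0‖ := (norm_add_le _ _).trans (add_le_add h le_rfl)
      _ ≤ M₀ := by nlinarith
  have hforce : ∀ z, R.IsAdmissible T K z → z 0 = z₀ →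
      ∀ s, ‖N (clamp T s) (z (clamp T s))‖ ≤ M₀ + ℓ * T := by
    intro z hz hz0 s
    have h1 := forcing_lipschitz hT.le hTS hL0 hL hz hK0 (clamp T s) 0
    have h0 : clamp T 0 = 0 := clamp_of_mem ⟨le_rfl, hT.le⟩
    have hcc : clamp T (clamp T s) = clamp T s := clamp_of_mem (clamp_mem hT.le s)
    rw [h0, hz0, hcc, sub_zero, abs_of_nonneg (clamp_mem hT.le s).1] at h1
    calc ‖N (clamp T s) (z (clamp T s))‖
        = ‖(N (clamp T s) (z (clamp T s)) - N 0 z₀) + N 0 z₀‖ := by rw [sub_add_cancel]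
      _ ≤ ℓ * clamp T s + M₀ := (norm_add_le _ _).trans (add_le_add h1 hNz₀)
      _ ≤ M₀ + ℓ * T := by nlinarith [mul_le_mul_of_nonneg_left (clamp_mem hT.le s).2 hℓ0]
  -- the Picard step preserves the admissible curves that start at `z₀`
  have hstep : ∀ z, R.IsAdmissible T K z → z 0 = z₀ →
      R.IsAdmissible T K (R.picard T N z₀ z) ∧ R.picard T N z₀ z 0 = z₀ := by
    intro z hz hz0
    have hlip := forcing_lipschitz hT.le hTS hL0 hL hz hK0
    have hM := hforce z hz hz0
    have hc := continuous_of_lipschitz hlip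
    have hM0 : 0 ≤ M₀ + ℓ * T := by positivity
    have hlip' : ∀ s ∈ Icc 0 T, ∀ t ∈ Icc 0 T, s ≤ t →
        ‖R.picard T N z₀ z t - R.picard T N z₀ z s‖ ≤ K * (t - s) := by
      intro s hs t ht hst
      have e1 : ‖R.toFun t z₀ - R.toFun s z₀‖ ≤ K₀ * (t - s) := by
        have : t = s + (t - s) := by ring
        rw [this, R.map_add', ← map_sub, R.norm_apply, add_sub_cancel_left]
        exact hFz₀ _ (sub_nonneg.2 hst)
      have e2 := R.norm_duhamel_sub_le hc hlip hM hs.1 hst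
      unfold picard
      rw [add_sub_add_comm]
      refine (norm_add_le _ _).trans ((add_le_add e1 e2).trans ?_)
      rw [← add_mul]
      refine mul_le_mul_of_nonneg_right ?_ (sub_nonneg.2 hst)
      have : ℓ * s ≤ ℓ * T := mul_le_mul_of_nonneg_left hs.2 hℓ0
      linarith
    refine ⟨⟨fun t ht => ?_, fun t ht => ?_, fun s hs t ht => ?_⟩, ?_⟩
    · refine (norm_add_le _ _).trans ?_
      rw [R.norm_apply]
      refine (add_le_add hz₀ (R.norm_duhamel_le hM ht.1)).trans ?_
      have : (M₀ + ℓ * T) * t ≤ (M₀ + ℓ * T) * 1 :=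
        mul_le_mul_of_nonneg_left (ht.2.trans hT1) hM0
      linarith
    · refine ((hFz₀.apply t).add (R.fav_duhamel hc hlip hM ht.1)).mono ?_
      have : ℓ * t ≤ ℓ * T := mul_le_mul_of_nonneg_left ht.2 hℓ0
      linarith
    · rcases le_total s t with h | h
      · rw [norm_sub_rev, abs_sub_comm, abs_of_nonneg (sub_nonneg.2 h)]
        exact hlip' s hs t ht h
      · rw [abs_of_nonneg (sub_nonneg.2 h)]
        exact hlip' t ht s hs h
    · simp [picard, duhamel, R.map_zero']
  -- the Picard step halves uniform distances
  have hcontr : ∀ z w, R.IsAdmissible T K z → R.IsAdmissible T K w → z 0 = z₀ → w 0 = z₀ →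
      ∀ D : ℝ, (∀ t ∈ Icc 0 T, ‖z t - w t‖ ≤ D) →
      ∀ t ∈ Icc 0 T, ‖R.picard T N z₀ z t - R.picard T N z₀ w t‖ ≤ D / 2 := by
    intro z w hz hw hz0 hw0 D hD t ht
    have hcz := continuous_of_lipschitz (forcing_lipschitz hT.le hTS hL0 hL hz hK0)
    have hcw := continuous_of_lipschitz (forcing_lipschitz hT.le hTS hL0 hL hw hK0)
    have hD0 : 0 ≤ D := (norm_nonneg _).trans (hD 0 ⟨le_rfl, hT.le⟩)
    unfold picard duhamel
    rw [add_sub_add_left_eq_sub, ← intervalIntegral.integral_sub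
      ((R.continuous_integrand hcz t).intervalIntegrable _ _)
      ((R.continuous_integrand hcw t).intervalIntegrable _ _)]
    have : ‖∫ s in (0 : ℝ)..t, (R.toFun (t - s) (N (clamp T s) (z (clamp T s)))
        - R.toFun (t - s) (N (clamp T s) (w (clamp T s))))‖ ≤ L * D * |t - 0| := by
      refine intervalIntegral.norm_integral_le_of_norm_le_const fun s _ => ?_
      rw [← map_sub, R.norm_apply]
      have hs := clamp_mem hT.le s
      refine (hL _ ⟨hs.1, hs.2.trans hTS⟩ _ ⟨hs.1, hs.2.trans hTS⟩ _ _ (hz.norm_le _ hs)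
        (hz.fav _ hs) (hw.norm_le _ hs) (hw.fav _ hs)).trans ?_
      rw [sub_self, abs_zero, zero_add]
      exact mul_le_mul_of_nonneg_left (hD _ hs) hL0
    rw [sub_zero, abs_of_nonneg ht.1] at this
    refine this.trans ?_
    have h5 : L * t ≤ 1 / 2 := (mul_le_mul_of_nonneg_left ht.2 hL0).trans hT4
    nlinarith
  -- the Picard iterates
  let Z : ℕ → ℝ → E := fun n => (R.picard T N z₀)^[n] fun _ => z₀
  have hZs : ∀ n, Z (n + 1) = R.picard T N z₀ (Z n) := fun n =>
    Function.iterate_succ_apply' _ _ _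
  have hZ : ∀ n, R.IsAdmissible T K (Z n) ∧ Z n 0 = z₀ := by
    intro n
    induction n with
    | zero =>
      refine ⟨⟨fun t _ => hz₀.trans hKK₀, fun t _ => hFz₀.mono hKK₀, fun s _ t _ => ?_⟩, rfl⟩
      change ‖z₀ - z₀‖ ≤ _
      rw [sub_self, norm_zero]
      positivity
    | succ n ih => rw [hZs]; exact hstep _ ih.1 ih.2
  have hdist : ∀ n, ∀ t ∈ Icc 0 T, ‖Z n t - Z (n + 1) t‖ ≤ 2 * K / 2 ^ n := by
    intro n
    induction n with
    | zero =>
      intro t ht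
      have h1 := (hZ 0).1.norm_le t ht
      have h2 := (hZ 1).1.norm_le t ht
      have := norm_sub_le (Z 0 t) (Z 1 t)
      simp only [zero_add, pow_zero, div_one]
      linarith
    | succ n ih =>
      intro t ht
      have := hcontr _ _ (hZ n).1 (hZ (n + 1)).1 (hZ n).2 (hZ (n + 1)).2 _ ih t ht
      rw [← hZs, ← hZs] at this
      refine this.trans (le_of_eq ?_)
      rw [pow_succ]
      field_simp
  have hlim : ∀ t ∈ Icc 0 T, ∃ x, Tendsto (fun n => Z n t) atTop (𝓝 x) := by
    intro t ht
    refine cauchySeq_tendsto_of_complete (cauchySeq_of_le_geometric_two (C := 4 * K) fun n => ?_)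
    rw [dist_eq_norm]
    refine (hdist n t ht).trans (le_of_eq (by ring))
  have hlim' : ∀ t, ∃ x, t ∈ Icc 0 T → Tendsto (fun n => Z n t) atTop (𝓝 x) := by
    intro t
    by_cases ht : t ∈ Icc 0 T
    · obtain ⟨x, hx⟩ := hlim t ht
      exact ⟨x, fun _ => hx⟩
    · exact ⟨0, fun h => absurd h ht⟩
  choose z hz using hlim'
  -- the conditions that define admissible curves are closed under pointwise limits
  have hzadm : R.IsAdmissible T K z := by
    refine ⟨fun t ht => ?_, fun t ht h hh => ?_, fun s hs t ht => ?_⟩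
    · exact le_of_tendsto (hz t ht).norm (Eventually.of_forall fun n => (hZ n).1.norm_le t ht)
    · have hc : Continuous fun x : E => ‖R.toFun h x - x‖ :=
        ((R.toFun h).continuous.sub continuous_id).norm
      exact le_of_tendsto ((hc.tendsto _).comp (hz t ht))
        (Eventually.of_forall fun n => (hZ n).1.fav t ht h hh)
    · exact le_of_tendsto ((hz s hs).sub (hz t ht)).norm
        (Eventually.of_forall fun n => (hZ n).1.lip s hs t ht)
  have hz0 : z 0 = z₀ := by
    refine tendsto_nhds_unique (hz 0 ⟨le_rfl, hT.le⟩) ?_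
    simp only [(hZ _).2]
    exact tendsto_const_nhds
  have hrate : ∀ n, ∀ t ∈ Icc 0 T, ‖Z n t - z t‖ ≤ 4 * K / 2 ^ n := by
    intro n t ht
    have := dist_le_of_le_geometric_two_of_tendsto (C := 4 * K) (f := fun n => Z n t)
      (fun n => by rw [dist_eq_norm]; exact (hdist n t ht).trans (le_of_eq (by ring))) (hz t ht) n
    rwa [dist_eq_norm] at this
  refine ⟨z, hzadm, fun t ht => ?_⟩
  change z t = R.picard T N z₀ z t
  refine tendsto_nhds_unique ((hz t ht).comp (tendsto_add_atTop_nat 1)) ?_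
  rw [tendsto_iff_norm_sub_tendsto_zero]
  have h0 : Tendsto (fun n : ℕ => 4 * K / 2 ^ n / 2) atTop (𝓝 0) := by
    have := (tendsto_pow_atTop_nhds_zero_of_lt_one (r := (1 / 2 : ℝ)) (by norm_num)
      (by norm_num)).const_mul (4 * K / 2)
    simp only [mul_zero] at this
    refine this.congr fun n => ?_
    rw [one_div, inv_pow]; ring
  refine squeeze_zero (fun _ => norm_nonneg _) (fun n => ?_) h0
  have := hcontr _ _ (hZ n).1 hzadm (hZ n).2 hz0 _ (hrate n) t ht
  rwa [← hZs] at this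

end IsometryGroup

/-! ### Multiplication operators on `L²` -/

section Multiplication

variable {α : Type*} [MeasurableSpace α] {μ : Measure α} {𝕜 : Type*} [RCLike 𝕜]

theorem memLp_bounded_mul {m : α → 𝕜} (hm : AEStronglyMeasurable m μ) {C : ℝ}
    (hC : ∀ x, ‖m x‖ ≤ C) {f : α → 𝕜} {p : ℝ≥0∞} (hf : MemLp f p μ) :
    MemLp (fun x => m x * f x) p μ :=
  hf.of_le_mul (c := C) (hm.mul hf.1) (Eventually.of_forall fun x => by
    rw [norm_mul]; exact mul_le_mul_of_nonneg_right (hC x) (norm_nonneg _))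

/-- Multiplication by the bounded measurable function `m`, as an operator on `L²`. -/
noncomputable def mulOp (m : α → 𝕜) (hm : AEStronglyMeasurable m μ) (C : ℝ)
    (hC : ∀ x, ‖m x‖ ≤ C) : Lp 𝕜 2 μ →L[𝕜] Lp 𝕜 2 μ :=
  LinearMap.mkContinuous
    { toFun := fun f => (memLp_bounded_mul hm hC (Lp.memLp f)).toLp
      map_add' := fun f g => by
        apply Lp.ext
        refine (MemLp.coeFn_toLp _).trans ?_
        filter_upwards [Lp.coeFn_add f g, Lp.coeFn_add (memLp_bounded_mul hm hC (Lp.memLp f)).toLp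
          (memLp_bounded_mul hm hC (Lp.memLp g)).toLp,
          (memLp_bounded_mul hm hC (Lp.memLp f)).coeFn_toLp,
          (memLp_bounded_mul hm hC (Lp.memLp g)).coeFn_toLp] with x h1 h2 h3 h4
        rw [h2, Pi.add_apply, h3, h4, h1, Pi.add_apply, mul_add]
      map_smul' := fun c f => by
        apply Lp.ext
        refine (MemLp.coeFn_toLp _).trans ?_
        filter_upwards [Lp.coeFn_smul c f,
          Lp.coeFn_smul c (memLp_bounded_mul hm hC (Lp.memLp f)).toLp,
          (memLp_bounded_mul hm hC (Lp.memLp f)).coeFn_toLp] with x h1 h2 h3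
        rw [RingHom.id_apply, h2, Pi.smul_apply, h3, h1, Pi.smul_apply, smul_eq_mul, smul_eq_mul,
          mul_left_comm] }
    C fun f => by
      refine Lp.norm_le_mul_norm_of_ae_le_mul ?_
      have h0 := (memLp_bounded_mul hm hC (Lp.memLp f)).coeFn_toLp
      filter_upwards [h0] with x h1
      change ‖((memLp_bounded_mul hm hC (Lp.memLp f)).toLp _ : Lp 𝕜 2 μ) x‖ ≤ _
      rw [h1, norm_mul]
      exact mul_le_mul_of_nonneg_right (hC x) (norm_nonneg _)

theorem coeFn_mulOp {m : α → 𝕜} (hm : AEStronglyMeasurable m μ) {C : ℝ} (hC : ∀ x, ‖m x‖ ≤ C)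
    (f : Lp 𝕜 2 μ) : mulOp m hm C hC f =ᵐ[μ] fun x => m x * f x :=
  (memLp_bounded_mul hm hC (Lp.memLp f)).coeFn_toLp

theorem norm_mulOp_le {m : α → 𝕜} (hm : AEStronglyMeasurable m μ) {C : ℝ} (hC : ∀ x, ‖m x‖ ≤ C)
    (f : Lp 𝕜 2 μ) : ‖mulOp m hm C hC f‖ ≤ C * ‖f‖ := by
  refine Lp.norm_le_mul_norm_of_ae_le_mul ?_
  filter_upwards [coeFn_mulOp hm hC f] with x h1
  rw [h1, norm_mul]
  exact mul_le_mul_of_nonneg_right (hC x) (norm_nonneg _)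

/-- Dominated convergence for multiplication operators in `L²`. The pointwise statements hold
everywhere, so that uncountable index sets cause no trouble with null sets. -/
theorem tendsto_norm_of_dominated {ι : Type*} {l : Filter ι} [l.IsCountablyGenerated]
    {F : ι → Lp 𝕜 2 μ} {G : ι → α → 𝕜} (hFG : ∀ i, F i =ᵐ[μ] G i) {g : α → ℝ} (hg : MemLp g 2 μ)
    (hb : ∀ᶠ i in l, ∀ x, ‖G i x‖ ≤ g x)
    (hlim : ∀ x, Tendsto (fun i => G i x) l (𝓝 0)) : Tendsto (fun i => ‖F i‖) l (𝓝 0) := by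
  have key : Tendsto (fun i => ∫⁻ x, ‖G i x‖ₑ ^ (2 : ℝ) ∂μ) l (𝓝 (∫⁻ _, 0 ∂μ)) := by
    refine tendsto_lintegral_filter_of_dominated_convergence' (fun x => ‖g x‖ₑ ^ (2 : ℝ))
      (Eventually.of_forall fun i => ?_) ?_ ?_ ?_
    · exact (((Lp.aestronglyMeasurable (F i)).congr (hFG i)).enorm.pow_const _)
    · filter_upwards [hb] with i hi
      refine Eventually.of_forall fun x => ?_
      gcongr
      rw [← ofReal_norm, ← ofReal_norm]
      exact ENNReal.ofReal_le_ofReal ((hi x).trans (Real.le_norm_self _))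
    · have := hg.eLpNorm_lt_top
      rw [eLpNorm_lt_top_iff_lintegral_rpow_enorm_lt_top (by norm_num) (by norm_num)] at this
      simpa using this.ne
    · refine Eventually.of_forall fun x => ?_
      have h1 : Tendsto (fun i => ‖G i x‖ₑ) l (𝓝 0) := by
        simpa using (hlim x).enorm
      have h2 := ((ENNReal.continuous_rpow_const (y := (2 : ℝ))).tendsto 0).comp h1
      rwa [ENNReal.zero_rpow_of_pos (by norm_num)] at h2
  rw [lintegral_zero] at key
  have h2 : ∀ i, ‖F i‖ = ((∫⁻ x, ‖G i x‖ₑ ^ (2 : ℝ) ∂μ) ^ (1 / 2 : ℝ)).toReal := by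
    intro i
    rw [Lp.norm_def, eLpNorm_congr_ae (hFG i),
      eLpNorm_eq_lintegral_rpow_enorm_toReal (by norm_num) (by norm_num)]
    simp
  simp only [h2]
  have h3 := (ENNReal.continuous_rpow_const (y := (1 / 2 : ℝ))).tendsto 0 |>.comp key
  rw [ENNReal.zero_rpow_of_pos (by norm_num)] at h3
  exact (ENNReal.tendsto_toReal (by simp)).comp h3

end Multiplication

/-! ### The unitary group `e^{-itθ}` and its generator -/

section UnitaryGroup

variable {α : Type*} [MeasurableSpace α] {μ : Measure α} {θ : α → ℝ}

/-- The symbol `e^{-itθ}`. -/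
noncomputable def phase (θ : α → ℝ) (t : ℝ) (x : α) : ℂ := Complex.exp (Complex.I * ((-(t * θ x) : ℝ) : ℂ))

theorem norm_phase (t : ℝ) (x : α) : ‖phase θ t x‖ = 1 := by
  unfold phase
  rw [mul_comm]
  exact Complex.norm_exp_ofReal_mul_I _

theorem phase_add (s t : ℝ) (x : α) : phase θ (s + t) x = phase θ s x * phase θ t x := by
  unfold phase
  rw [← Complex.exp_add]
  congr 1
  push_cast
  ring

theorem measurable_phase (hθ : Measurable θ) (t : ℝ) : Measurable (phase θ t) := by
  unfold phase
  fun_prop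

theorem norm_phase_sub_one_le (t : ℝ) (x : α) : ‖phase θ t x - 1‖ ≤ |t * θ x| := by
  have := Real.norm_exp_I_mul_ofReal_sub_one_le (x := -(t * θ x))
  rwa [Real.norm_eq_abs, abs_neg] at this

/-- The operator of multiplication by `e^{-itθ}` on complex `L²`. -/
noncomputable def phaseOp (μ : Measure α) (hθ : Measurable θ) (t : ℝ) : Lp ℂ 2 μ →L[ℂ] Lp ℂ 2 μ :=
  mulOp (phase θ t) (measurable_phase hθ t).aestronglyMeasurable 1 fun x => (norm_phase t x).le

theorem coeFn_phaseOp (hθ : Measurable θ) (t : ℝ) (f : Lp ℂ 2 μ) :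
    phaseOp μ hθ t f =ᵐ[μ] fun x => phase θ t x * f x := coeFn_mulOp _ _ _

theorem continuous_phase (x : α) : Continuous fun t => phase θ t x := by
  unfold phase
  fun_prop

/-- The strongly continuous group of the operators of multiplication by `e^{-itθ}`. -/
noncomputable def phaseGroup (μ : Measure α) (hθ : Measurable θ) : IsometryGroup (Lp ℂ 2 μ) where
  toFun t :=
    { ((phaseOp μ hθ t).restrictScalars ℝ : Lp ℂ 2 μ →ₗ[ℝ] Lp ℂ 2 μ) with
      norm_map' := fun f => by
        change ‖phaseOp μ hθ t f‖ = ‖f‖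
        rw [Lp.norm_def, Lp.norm_def]
        congr 1
        refine eLpNorm_congr_norm_ae ?_
        filter_upwards [coeFn_phaseOp hθ t f] with x hx
        rw [hx, norm_mul, norm_phase, one_mul] }
  map_zero' f := by
    change phaseOp μ hθ 0 f = f
    apply Lp.ext
    filter_upwards [coeFn_phaseOp hθ 0 f] with x hx
    rw [hx]; simp [phase]
  map_add' s t f := by
    change phaseOp μ hθ (s + t) f = phaseOp μ hθ s (phaseOp μ hθ t f)
    apply Lp.ext
    filter_upwards [coeFn_phaseOp hθ (s + t) f, coeFn_phaseOp hθ t f,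
      coeFn_phaseOp hθ s (phaseOp μ hθ t f)] with x h1 h2 h3
    rw [h1, h3, h2, phase_add, mul_assoc]
  continuous' f := by
    change Continuous fun t => phaseOp μ hθ t f
    rw [continuous_iff_continuousAt]
    intro t₀
    rw [ContinuousAt, tendsto_iff_norm_sub_tendsto_zero]
    refine tendsto_norm_of_dominated (G := fun t x => (phase θ t x - phase θ t₀ x) * f x)
      (fun t => ?_) (g := fun x => 2 * ‖f x‖) ((Lp.memLp f).norm.const_mul 2)
      (Eventually.of_forall fun t x => ?_) fun x => ?_
    · filter_upwards [coeFn_phaseOp hθ t f, coeFn_phaseOp hθ t₀ f,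
        Lp.coeFn_sub (phaseOp μ hθ t f) (phaseOp μ hθ t₀ f)] with x h1 h2 h3
      rw [h3, Pi.sub_apply, h1, h2, ← sub_mul]
    · rw [norm_mul]
      refine mul_le_mul_of_nonneg_right ((norm_sub_le _ _).trans ?_) (norm_nonneg _)
      rw [norm_phase, norm_phase]; norm_num
    · have h1 : Continuous fun t => (phase θ t x - phase θ t₀ x) * f x :=
        ((continuous_phase x).sub continuous_const).mul continuous_const
      simpa using h1.tendsto t₀

theorem phaseGroup_apply (hθ : Measurable θ) (t : ℝ) (f : Lp ℂ 2 μ) :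
    (phaseGroup μ hθ).toFun t f = phaseOp μ hθ t f := rfl

/-- The `L²` functions `z` in the domain of multiplication by `θ`. -/
def InDom (θ : α → ℝ) (z : Lp ℂ 2 μ) : Prop := MemLp (fun x => (θ x : ℂ) * z x) 2 μ

open Classical in
/-- The unbounded operator of multiplication by `θ`, with value `0` off its domain. -/
noncomputable def gen (θ : α → ℝ) (z : Lp ℂ 2 μ) : Lp ℂ 2 μ :=
  if h : InDom θ z then MemLp.toLp _ h else 0

theorem coeFn_gen {z : Lp ℂ 2 μ} (h : InDom θ z) : gen θ z =ᵐ[μ] fun x => (θ x : ℂ) * z x := by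
  unfold gen
  rw [dif_pos h]
  exact MemLp.coeFn_toLp _

theorem gen_eq_of_ae {z y : Lp ℂ 2 μ} (h : y =ᵐ[μ] fun x => (θ x : ℂ) * z x) :
    InDom θ z ∧ gen θ z = y := by
  have h1 : InDom θ z := (Lp.memLp y).ae_eq h
  exact ⟨h1, Lp.ext ((coeFn_gen h1).trans h.symm)⟩

theorem gen_add {z y : Lp ℂ 2 μ} (hz : InDom θ z) (hy : InDom θ y) :
    InDom θ (z + y) ∧ gen θ (z + y) = gen θ z + gen θ y := by
  refine gen_eq_of_ae ?_
  filter_upwards [coeFn_gen hz, coeFn_gen hy, Lp.coeFn_add z y,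
    Lp.coeFn_add (gen θ z) (gen θ y)] with x h1 h2 h3 h4
  rw [h4, h3, Pi.add_apply, Pi.add_apply, h1, h2, mul_add]

theorem gen_phaseOp (hθ : Measurable θ) {z : Lp ℂ 2 μ} (hz : InDom θ z) (t : ℝ) :
    InDom θ (phaseOp μ hθ t z) ∧ gen θ (phaseOp μ hθ t z) = phaseOp μ hθ t (gen θ z) := by
  refine gen_eq_of_ae ?_
  filter_upwards [coeFn_gen hz, coeFn_phaseOp hθ t z, coeFn_phaseOp hθ t (gen θ z)] with x h1 h2 h3
  rw [h3, h2, h1, mul_left_comm]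

theorem hasDerivAt_phase (x : α) (t : ℝ) :
    HasDerivAt (fun t => phase θ t x) (phase θ t x * (-Complex.I * θ x)) t := by
  unfold phase
  have h1 : HasDerivAt (fun t : ℝ => Complex.I * ((-(t * θ x) : ℝ) : ℂ)) (-Complex.I * θ x) t := by
    have h2 : HasDerivAt (fun t : ℝ => (-(t * θ x))) (-(1 * θ x)) t :=
      ((hasDerivAt_id t).mul_const (θ x)).neg
    have h3 := (h2.ofReal_comp).const_mul Complex.I
    refine h3.congr_deriv ?_
    push_cast
    ring
  exact h1.cexp

/-- A member of the Favard class lies in the domain of the generator, by Fatou's lemma. -/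
theorem Fav.inDom (hθ : Measurable θ) {K : ℝ} {z : Lp ℂ 2 μ}
    (hz : (phaseGroup μ hθ).Fav K z) : InDom θ z ∧ ‖gen θ z‖ ≤ K := by
  have hK : 0 ≤ K := by simpa using (norm_nonneg _).trans (hz 1 zero_le_one)
  -- The difference quotients `f n` are bounded by `K` in `L²` and converge pointwise to `-iθz`.
  set h : ℕ → ℝ := fun n => 1 / ((n : ℝ) + 1) with hh
  have hpos : ∀ n, 0 < h n := fun n => by positivity
  have hlim : Tendsto h atTop (𝓝 0) := tendsto_one_div_add_atTop_nhds_zero_nat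
  set f : ℕ → Lp ℂ 2 μ := fun n => ((h n)⁻¹ : ℝ) • ((phaseGroup μ hθ).toFun (h n) z - z) with hf
  have hfn : ∀ n, ‖f n‖ ≤ K := by
    intro n
    rw [hf]
    simp only
    rw [norm_smul, norm_inv, Real.norm_eq_abs, abs_of_pos (hpos n)]
    rw [inv_mul_le_iff₀ (hpos n), mul_comm]
    exact hz _ (hpos n).le
  have hfae : ∀ᵐ x ∂μ, ∀ n, f n x = ((h n)⁻¹ : ℝ) • (phase θ (h n) x * z x - z x) := by
    rw [ae_all_iff]
    intro n
    filter_upwards [Lp.coeFn_smul ((h n)⁻¹ : ℝ) ((phaseGroup μ hθ).toFun (h n) z - z),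
      Lp.coeFn_sub ((phaseGroup μ hθ).toFun (h n) z) z, coeFn_phaseOp hθ (h n) z] with x h1 h2 h3
    rw [h1, Pi.smul_apply, h2, Pi.sub_apply]
    erw [h3]
  have hptw : ∀ᵐ x ∂μ, Tendsto (fun n => f n x) atTop (𝓝 (-Complex.I * θ x * z x)) := by
    filter_upwards [hfae] with x hx
    have h1 := (hasDerivAt_phase (θ := θ) x 0).tendsto_slope_zero
    have h2 : Tendsto h atTop (𝓝[≠] 0) :=
      tendsto_nhdsWithin_iff.2 ⟨hlim, Eventually.of_forall fun n => (hpos n).ne'⟩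
    have h3 := (h1.comp h2).mul_const (z x)
    have h4 : phase θ 0 x = 1 := by simp [phase]
    rw [h4, one_mul] at h3
    refine h3.congr fun n => ?_
    simp only [Function.comp, zero_add, hx n, smul_mul_assoc, sub_mul, one_mul]
  have h1 := Lp.eLpNorm_lim_le_liminf_eLpNorm (p := 2) (fun n => Lp.aestronglyMeasurable (f n))
    _ hptw
  have h2 : eLpNorm (fun x => -Complex.I * θ x * z x) 2 μ ≤ ENNReal.ofReal K := by
    refine h1.trans ?_
    refine (liminf_le_liminf (v := fun _ => ENNReal.ofReal K) (Eventually.of_forall fun n => ?_)).trans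
      (le_of_eq (by simp))
    rw [← ENNReal.ofReal_toReal (Lp.eLpNorm_ne_top (f n))]
    exact ENNReal.ofReal_le_ofReal (hfn n)
  have hnorm : eLpNorm (fun x => -Complex.I * θ x * z x) 2 μ
      = eLpNorm (fun x => (θ x : ℂ) * z x) 2 μ :=
    eLpNorm_congr_norm_ae (Eventually.of_forall fun x => by simp)
  rw [hnorm] at h2
  have hdom : InDom θ z := by
    refine ⟨?_, h2.trans_lt ENNReal.ofReal_lt_top⟩
    exact (Complex.measurable_ofReal.comp hθ).aestronglyMeasurable.mul (Lp.aestronglyMeasurable z)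
  refine ⟨hdom, ?_⟩
  rw [Lp.norm_def, eLpNorm_congr_ae (coeFn_gen hdom)]
  exact ENNReal.toReal_le_of_le_ofReal hK h2

theorem InDom.fav (hθ : Measurable θ) {z : Lp ℂ 2 μ} (hz : InDom θ z) :
    (phaseGroup μ hθ).Fav ‖gen θ z‖ z := by
  intro t ht
  rw [phaseGroup_apply, mul_comm]
  refine Lp.norm_le_mul_norm_of_ae_le_mul ?_
  filter_upwards [coeFn_gen hz, coeFn_phaseOp hθ t z, Lp.coeFn_sub (phaseOp μ hθ t z) z]
    with x h1 h2 h3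
  rw [h3, Pi.sub_apply, h2, h1, norm_mul, ← mul_assoc, ← sub_one_mul, norm_mul]
  refine mul_le_mul_of_nonneg_right ((norm_phase_sub_one_le t x).trans ?_) (norm_nonneg _)
  rw [abs_mul, abs_of_nonneg ht, Complex.norm_real, Real.norm_eq_abs]

/-- On the domain of `θ`, the orbit is differentiable in `L²` with derivative `-iθz`. -/
theorem hasDerivAt_phaseOp (hθ : Measurable θ) {z : Lp ℂ 2 μ} (hz : InDom θ z) :
    HasDerivAt (fun t => phaseOp μ hθ t z) (-Complex.I • gen θ z) 0 := by
  rw [hasDerivAt_iff_tendsto_slope_zero, tendsto_iff_norm_sub_tendsto_zero]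
  have hz0 : phaseOp μ hθ 0 z = z := (phaseGroup μ hθ).map_zero' z
  simp only [zero_add, hz0]
  refine tendsto_norm_of_dominated
    (G := fun t x => (t⁻¹ : ℝ) • ((phase θ t x - 1) * z x) - -Complex.I * (θ x * z x))
    (fun t => ?_) (g := fun x => 2 * ‖(θ x : ℂ) * z x‖) (hz.norm.const_mul 2) ?_ fun x => ?_
  · filter_upwards [coeFn_gen hz, coeFn_phaseOp hθ t z, Lp.coeFn_sub (phaseOp μ hθ t z) z,
      Lp.coeFn_smul (t⁻¹ : ℝ) (phaseOp μ hθ t z - z), Lp.coeFn_smul (-Complex.I) (gen θ z),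
      Lp.coeFn_sub ((t⁻¹ : ℝ) • (phaseOp μ hθ t z - z)) (-Complex.I • gen θ z)]
      with x h1 h2 h3 h4 h5 h6
    rw [h6, Pi.sub_apply, h4, h5, Pi.smul_apply, Pi.smul_apply, h3, Pi.sub_apply, h2, h1,
      smul_eq_mul, sub_one_mul]
  · filter_upwards [self_mem_nhdsWithin] with t ht x
    have ht' : 0 < |t| := abs_pos.2 ht
    refine (norm_sub_le _ _).trans ?_
    have h1 : ‖(t⁻¹ : ℝ) • ((phase θ t x - 1) * z x)‖ ≤ ‖(θ x : ℂ) * z x‖ := by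
      rw [norm_smul, norm_mul, norm_mul, norm_inv, Real.norm_eq_abs, ← mul_assoc]
      refine mul_le_mul_of_nonneg_right ?_ (norm_nonneg _)
      rw [inv_mul_le_iff₀ ht', Complex.norm_real, Real.norm_eq_abs, ← abs_mul]
      exact norm_phase_sub_one_le t x
    have h2 : ‖-Complex.I * ((θ x : ℂ) * z x)‖ = ‖(θ x : ℂ) * z x‖ := by simp
    rw [h2]
    linarith
  · have h1 := (hasDerivAt_phase (θ := θ) x 0).tendsto_slope_zero
    have h4 : phase θ 0 x = 1 := by simp [phase]
    have h3 := (h1.mul_const (z x)).sub_const (-Complex.I * (θ x * z x))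
    rw [h4, one_mul] at h3
    have h5 : -Complex.I * (θ x : ℂ) * z x - -Complex.I * (θ x * z x) = 0 := by ring
    rw [h5] at h3
    refine h3.congr fun t => ?_
    simp only [zero_add, smul_mul_assoc]

end UnitaryGroup

/-! ### Regularity of mild solutions -/

namespace IsometryGroup

variable {E : Type*} [NormedAddCommGroup E] [NormedSpace ℝ E] [CompleteSpace E]
  (R : IsometryGroup E)

theorem duhamel_eq_apply {F : ℝ → E} (hF : Continuous F) (t : ℝ) :
    R.duhamel F t = R.toFun t (∫ r in (0 : ℝ)..t, R.toFun (-r) (F r)) := by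
  rw [R.apply_intervalIntegral t (R.continuous_comp continuous_neg hF)]
  refine intervalIntegral.integral_congr fun s _ => ?_
  rw [← R.map_add', sub_eq_add_neg]

theorem hasDerivAt_apply_sub {w : ℝ → E} {w' : E} {t : ℝ} (hw : HasDerivAt w w' t) :
    HasDerivAt (fun s => R.toFun s (w s - w t)) (R.toFun t w') t := by
  rw [hasDerivAt_iff_tendsto_slope]
  have h3 := hasDerivAt_iff_tendsto_slope.1 hw
  have h4 : Tendsto (fun s => R.toFun s (slope w t s)) (𝓝[≠] t) (𝓝 (R.toFun t w')) :=
    (R.continuous_uncurry.tendsto (t, w')).comp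
      ((tendsto_id.mono_left nhdsWithin_le_nhds).prodMk_nhds h3)
  refine h4.congr fun s => ?_
  rw [slope_def_module, slope_def_module, sub_self, map_zero, sub_zero, map_smul]

/-- For a constant forcing the Favard constant of the Duhamel integral tends to `0` with the length
of the time interval, as the increments of the group in the two time variables commute. -/
theorem fav_duhamel_const (x : E) (h : ℝ) :
    R.Fav ‖R.toFun h x - x‖ (R.duhamel (fun _ => x) h) := by
  intro η hη
  have hc : Continuous fun r => R.toFun r x := R.continuous' x
  have hi : ∀ a b, IntervalIntegrable (fun r => R.toFun r x) volume a b := fun a b =>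
    hc.intervalIntegrable a b
  have e1 : R.toFun η (∫ r in (0 : ℝ)..h, R.toFun r x) = ∫ r in η..(h + η), R.toFun r x := by
    rw [R.apply_intervalIntegral η hc]
    have := intervalIntegral.integral_comp_add_right (a := 0) (b := h) (fun r => R.toFun r x) η
    rw [zero_add] at this
    rw [← this]
    refine intervalIntegral.integral_congr fun r _ => ?_
    rw [← R.map_add', add_comm]
  have e2 : R.toFun h (∫ r in (0 : ℝ)..η, R.toFun r x) = ∫ r in h..(h + η), R.toFun r x := by
    rw [R.apply_intervalIntegral h hc]
    have := intervalIntegral.integral_comp_add_left (a := 0) (b := η) (fun r => R.toFun r x) h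
    rw [add_zero] at this
    rw [← this]
    refine intervalIntegral.integral_congr fun r _ => ?_
    rw [← R.map_add']
  have e3 : R.toFun η (∫ r in (0 : ℝ)..h, R.toFun r x) - ∫ r in (0 : ℝ)..h, R.toFun r x
      = ∫ r in (0 : ℝ)..η, R.toFun r (R.toFun h x - x) := by
    have e4 : (∫ r in (0 : ℝ)..η, R.toFun r (R.toFun h x - x))
        = R.toFun h (∫ r in (0 : ℝ)..η, R.toFun r x) - ∫ r in (0 : ℝ)..η, R.toFun r x := by
      rw [R.apply_intervalIntegral h hc, ← intervalIntegral.integral_sub _ (hi _ _)]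
      · refine intervalIntegral.integral_congr fun r _ => ?_
        rw [map_sub, ← R.map_add', ← R.map_add', add_comm]
      · exact ((R.toFun h).continuous.comp hc).intervalIntegrable _ _
    rw [e4, e1, e2,
      eq_sub_of_add_eq' (intervalIntegral.integral_add_adjacent_intervals (hi 0 η) (hi η (h + η))),
      eq_sub_of_add_eq' (intervalIntegral.integral_add_adjacent_intervals (hi 0 h) (hi h (h + η)))]
    abel
  rw [duhamel_eq, e3]
  have := intervalIntegral.norm_integral_le_of_norm_le_const (a := 0) (b := η)
    (f := fun r => R.toFun r (R.toFun h x - x)) (C := ‖R.toFun h x - x‖)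
    (fun r _ => (R.norm_apply _ _).le)
  rwa [sub_zero, abs_of_nonneg hη] at this

/-- Over a short time `h` the Favard constant of the Duhamel integral tends to `0` with `h`. Applied
between two nearby times, this makes the generator continuous along a mild solution. -/
theorem fav_duhamel_short {F : ℝ → E} {ℓ : ℝ} (hL : ∀ s t, ‖F s - F t‖ ≤ ℓ * |s - t|) (s : ℝ)
    {h : ℝ} (hh : 0 ≤ h) :
    R.Fav (‖R.toFun h (F s) - F s‖ + 3 * ℓ * h) (R.duhamel (fun r => F (s + r)) h) := by
  have hℓ : 0 ≤ ℓ := by simpa using (norm_nonneg _).trans (hL 1 0)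
  have hc := continuous_of_lipschitz hL
  -- the forcing is frozen at `s`; the rest is at most `ℓ h` on `[0, h]`
  set G : ℝ → E := fun r => F (s + clamp h r) - F s with hG
  have hGl : ∀ r r', ‖G r - G r'‖ ≤ ℓ * |r - r'| := by
    intro r r'
    rw [hG]
    simp only [sub_sub_sub_cancel_right]
    refine (hL _ _).trans (mul_le_mul_of_nonneg_left ?_ hℓ)
    rw [add_sub_add_left_eq_sub]
    exact abs_clamp_sub_le _ _ _
  have hGM : ∀ r, ‖G r‖ ≤ ℓ * h := by
    intro r
    refine (hL _ _).trans (mul_le_mul_of_nonneg_left ?_ hℓ)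
    rw [add_sub_cancel_left, abs_of_nonneg (clamp_mem hh r).1]
    exact (clamp_mem hh r).2
  have hGc := continuous_of_lipschitz hGl
  have h1 := (R.fav_duhamel_const (F s) h).add (R.fav_duhamel hGc hGl hGM hh)
  have h2 : R.duhamel (fun _ => F s) h + R.duhamel G h = R.duhamel (fun r => F (s + r)) h := by
    unfold duhamel
    rw [← intervalIntegral.integral_add
      ((R.continuous_integrand continuous_const h).intervalIntegrable _ _)
      ((R.continuous_integrand hGc h).intervalIntegrable _ _)]
    refine intervalIntegral.integral_congr fun r hr => ?_
    rw [uIcc_of_le hh] at hr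
    simp only [hG]
    rw [← map_add, clamp_of_mem hr, add_sub_cancel]
  rw [h2] at h1
  exact h1.mono (by linarith)

end IsometryGroup

section Regularity

variable {α : Type*} [MeasurableSpace α] {μ : Measure α} {θ : α → ℝ}

/-- Mild solutions with Lipschitz forcing that stay in a Favard class are classical: `θz` is
continuous in `L²`, and `z' = -iθz + F`. -/
theorem mild_regularity (hθ : Measurable θ) {F z : ℝ → Lp ℂ 2 μ} {z₀ : Lp ℂ 2 μ} {ℓ T K : ℝ}
    (hL : ∀ s t, ‖F s - F t‖ ≤ ℓ * |s - t|)
    (hz : ∀ t ∈ Icc 0 T, z t = (phaseGroup μ hθ).toFun t z₀ + (phaseGroup μ hθ).duhamel F t)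
    (hK : ∀ t ∈ Icc 0 T, (phaseGroup μ hθ).Fav K (z t)) :
    ContinuousOn (fun t => gen θ (z t)) (Icc 0 T) ∧
      ∀ t ∈ Icc 0 T, HasDerivWithinAt z (-Complex.I • gen θ (z t) + F t) (Icc 0 T) t := by
  set R := phaseGroup μ hθ with hR
  have hc := continuous_of_lipschitz hL
  have hℓ : 0 ≤ ℓ := by simpa using (norm_nonneg _).trans (hL 1 0)
  -- `w` is the solution in the interaction picture, where the group has been removed
  set w : ℝ → Lp ℂ 2 μ := fun t => z₀ + ∫ r in (0 : ℝ)..t, R.toFun (-r) (F r) with hw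
  have hzw : ∀ t ∈ Icc 0 T, z t = R.toFun t (w t) := by
    intro t ht
    rw [hz t ht, R.duhamel_eq_apply hc, ← map_add]
  have hdom : ∀ t ∈ Icc 0 T, InDom θ (z t) := fun t ht => (Fav.inDom hθ (hK t ht)).1
  -- the evolution from `s` to a later time `t`
  have hstep : ∀ s ∈ Icc 0 T, ∀ t ∈ Icc 0 T, s ≤ t →
      ‖gen θ (z t) - R.toFun (t - s) (gen θ (z s))‖
        ≤ ‖R.toFun (t - s) (F s) - F s‖ + 3 * ℓ * (t - s) := by
    intro s hs t ht hst
    have hts : 0 ≤ t - s := sub_nonneg.2 hst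
    have e1 : z t = R.toFun (t - s) (z s) + R.duhamel (fun r => F (s + r)) (t - s) := by
      have h1 := R.duhamel_add hc s (t - s)
      rw [add_sub_cancel] at h1
      rw [hz t ht, hz s hs, h1, map_add, ← R.map_add', sub_add_cancel, add_assoc]
    obtain ⟨hd, hn⟩ := Fav.inDom hθ (R.fav_duhamel_short hL s hts)
    obtain ⟨hd', hn'⟩ := gen_phaseOp hθ (hdom s hs) (t - s)
    have h2 := (gen_add hd' hd).2
    rw [e1]
    change ‖gen θ (phaseOp μ hθ (t - s) (z s) + _) - phaseOp μ hθ (t - s) (gen θ (z s))‖ ≤ _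
    rw [h2, hn', add_sub_cancel_left]
    exact hn
  refine ⟨fun t ht => ?_, fun t ht => ?_⟩
  · -- continuity at `t`, from either side
    rw [ContinuousWithinAt, tendsto_iff_norm_sub_tendsto_zero]
    set y := gen θ (z t) with hy
    have hb : ∀ s ∈ Icc 0 T, ‖gen θ (z s) - y‖
        ≤ ‖R.toFun (s - t) y - y‖ + (‖R.toFun |s - t| (F t) - F t‖ + 5 * ℓ * |s - t|) := by
      intro s hs
      rcases le_total t s with h | h
      · have h1 := hstep t ht s hs h
        rw [abs_of_nonneg (sub_nonneg.2 h)]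
        have h2 : gen θ (z s) - y = (R.toFun (s - t) y - y)
            + (gen θ (z s) - R.toFun (s - t) y) := by abel
        rw [h2]
        refine (norm_add_le _ _).trans (add_le_add le_rfl (h1.trans ?_))
        have := mul_nonneg hℓ (sub_nonneg.2 h)
        linarith
      · have h1 := hstep s hs t ht h
        rw [abs_of_nonpos (sub_nonpos.2 h), neg_sub]
        have h2 : gen θ (z s) - y = (R.toFun (s - t) y - y)
            - R.toFun (s - t) (y - R.toFun (t - s) (gen θ (z s))) := by
          rw [map_sub, ← R.map_add', show s - t + (t - s) = 0 by ring, R.map_zero']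
          abel
        rw [h2]
        refine (norm_sub_le _ _).trans (add_le_add le_rfl ?_)
        rw [R.norm_apply]
        refine h1.trans ?_
        have h3 : R.toFun (t - s) (F s) - F s
            = R.toFun (t - s) (F s - F t) + ((R.toFun (t - s) (F t) - F t) + (F t - F s)) := by
          rw [map_sub]; abel
        have h4 : ‖R.toFun (t - s) (F s) - F s‖
            ≤ ‖F s - F t‖ + (‖R.toFun (t - s) (F t) - F t‖ + ‖F t - F s‖) := by
          rw [h3]
          refine (norm_add_le _ _).trans (add_le_add (R.norm_apply _ _).le (norm_add_le _ _))
        have h5 := hL s t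
        have h6 := hL t s
        rw [abs_sub_comm, abs_of_nonneg (sub_nonneg.2 h)] at h5
        rw [abs_of_nonneg (sub_nonneg.2 h)] at h6
        linarith
    have hlim : Tendsto (fun s => ‖R.toFun (s - t) y - y‖
        + (‖R.toFun |s - t| (F t) - F t‖ + 5 * ℓ * |s - t|)) (𝓝[Icc 0 T] t) (𝓝 0) := by
      have hcont : Continuous (fun s => ‖R.toFun (s - t) y - y‖
          + (‖R.toFun |s - t| (F t) - F t‖ + 5 * ℓ * |s - t|)) := by
        refine Continuous.add ?_ (Continuous.add ?_ (by fun_prop))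
        · exact (((R.continuous' y).comp (continuous_id.sub continuous_const)).sub
            continuous_const).norm
        · exact (((R.continuous' (F t)).comp (continuous_id.sub continuous_const).abs).sub
            continuous_const).norm
      have := (hcont.tendsto t).mono_left (nhdsWithin_le_nhds (s := Icc 0 T))
      simpa [R.map_zero'] using this
    refine squeeze_zero' (Eventually.of_forall fun _ => norm_nonneg _) ?_ hlim
    filter_upwards [self_mem_nhdsWithin] with s hs using hb s hs
  · -- `z s = R (s - t) (z t) + R s (w s - w t)`
    have hwd : HasDerivAt w (R.toFun (-t) (F t)) t :=
      (intervalIntegral.integral_hasDerivAt_right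
        ((R.continuous_comp continuous_neg hc).intervalIntegrable _ _)
        ((R.continuous_comp continuous_neg hc).stronglyMeasurableAtFilter _ _)
        (R.continuous_comp continuous_neg hc).continuousAt).const_add z₀
    have h1 : HasDerivAt (fun s => R.toFun (s - t) (z t)) (-Complex.I • gen θ (z t)) t := by
      have := hasDerivAt_phaseOp hθ (hdom t ht)
      rw [← sub_self t] at this
      have h2 := HasDerivAt.scomp (h := fun s : ℝ => s - t) t this ((hasDerivAt_id' t).sub_const t)
      rw [one_smul] at h2
      exact h2
    have h2 : HasDerivAt (fun s => R.toFun s (w s - w t)) (F t) t := by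
      have h3 := R.hasDerivAt_apply_sub hwd
      rwa [← R.map_add', add_neg_cancel, R.map_zero'] at h3
    refine ((h1.add h2).hasDerivWithinAt (s := Icc 0 T)).congr (fun s hs => ?_) ?_
    · rw [Pi.add_apply, hzw t ht, hzw s hs, ← R.map_add', sub_add_cancel, ← map_add,
        add_sub_cancel]
    · rw [Pi.add_apply, sub_self t, sub_self (w t), R.map_zero', map_zero, add_zero]

end Regularity

/-! ### Cutoff functions -/

section Cutoff

variable {N : ℕ}

/-- Smooth cutoff functions: equal to `1` on the ball of radius `n + 1`, with compact support and
gradient `O(1 / n)`. -/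
theorem exists_cutoff (N : ℕ) : ∃ C : ℝ, ∃ χ : ℕ → EuclideanSpace ℝ (Fin N) → ℝ,
    (∀ n, ContDiff ℝ ∞ (χ n)) ∧ (∀ n, HasCompactSupport (χ n)) ∧
    (∀ n x, 0 ≤ χ n x ∧ χ n x ≤ 1) ∧ (∀ (n : ℕ) x, ‖x‖ ≤ (n : ℝ) + 1 → χ n x = 1) ∧
    (∀ (n : ℕ) x, ‖fderiv ℝ (χ n) x‖ ≤ C / ((n : ℝ) + 1)) ∧
    ∀ x, Tendsto (fun n => χ n x) atTop (𝓝 1) := by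
  let b : ContDiffBump (0 : EuclideanSpace ℝ (Fin N)) := ⟨1, 2, one_pos, one_lt_two⟩
  have hb : ContDiff ℝ ∞ b := b.contDiff
  have hcont : Continuous (fderiv ℝ b) := hb.continuous_fderiv (by simp)
  obtain ⟨C, hC⟩ := (b.hasCompactSupport.fderiv (𝕜 := ℝ)).exists_bound_of_continuous hcont
  have hpos : ∀ n : ℕ, (0 : ℝ) < (n : ℝ) + 1 := fun n => by positivity
  have h1 : ∀ (n : ℕ) (x : EuclideanSpace ℝ (Fin N)), ‖x‖ ≤ n + 1 → b (((n : ℝ) + 1)⁻¹ • x) = 1 := by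
    intro n x hx
    refine b.one_of_mem_closedBall ?_
    rw [mem_closedBall_zero_iff, norm_smul, norm_inv, Real.norm_eq_abs, abs_of_pos (hpos n),
      inv_mul_le_iff₀ (hpos n)]
    change ‖x‖ ≤ ((n : ℝ) + 1) * 1
    linarith
  refine ⟨C, fun n x => b (((n : ℝ) + 1)⁻¹ • x), fun n => hb.comp (contDiff_const_smul _),
    fun n => ?_, fun n x => ⟨b.nonneg, b.le_one⟩, h1, fun n x => ?_, fun x => ?_⟩
  · exact b.hasCompactSupport.comp_smul (inv_ne_zero (hpos n).ne')
  · have h2 : HasFDerivAt (fun y : EuclideanSpace ℝ (Fin N) => ((n : ℝ) + 1)⁻¹ • y)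
        (((n : ℝ) + 1)⁻¹ • ContinuousLinearMap.id ℝ _) x :=
      (((n : ℝ) + 1)⁻¹ • ContinuousLinearMap.id ℝ (EuclideanSpace ℝ (Fin N))).hasFDerivAt
    have h3 := ((hb.differentiable (by simp)) (((n : ℝ) + 1)⁻¹ • x)).hasFDerivAt.comp x h2
    have h4 := h3.fderiv
    rw [Function.comp_def] at h4
    rw [h4, ContinuousLinearMap.comp_smul, ContinuousLinearMap.comp_id, norm_smul, norm_inv,
      Real.norm_eq_abs, abs_of_pos (hpos n), div_eq_inv_mul]
    exact mul_le_mul_of_nonneg_left (hC _) (inv_nonneg.2 (hpos n).le)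
  · refine tendsto_const_nhds.congr' ?_
    obtain ⟨m, hm⟩ := exists_nat_ge ‖x‖
    filter_upwards [eventually_ge_atTop m] with n hn
    refine (h1 n x ?_).symm
    have : (m : ℝ) ≤ n := by exact_mod_cast hn
    linarith

end Cutoff

/-! ### First order derivatives of test functions -/

section TestFunctions

variable {N : ℕ}

/-- The one-letter word `i`. -/
def word (i : Fin N) : Fin 1 → Fin N := fun _ => i

theorem partialDeriv_word (i : Fin N) (φ : EuclideanSpace ℝ (Fin N) → ℝ)
    (x : EuclideanSpace ℝ (Fin N)) :
    partialDeriv (word i) φ x = fderiv ℝ φ x (EuclideanSpace.single i 1) := by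
  simp [partialDeriv, word, iteratedFDeriv_one_apply]

theorem partialDeriv_zero (α : Fin 0 → Fin N) (φ : EuclideanSpace ℝ (Fin N) → ℝ) :
    partialDeriv α φ = φ := by
  ext x; simp [partialDeriv]

theorem partialDeriv_two (α : Fin 2 → Fin N) {φ : EuclideanSpace ℝ (Fin N) → ℝ}
    (hφ : ContDiff ℝ ∞ φ) :
    partialDeriv α φ = partialDeriv (word (α 0)) (partialDeriv (word (α 1)) φ) := by
  ext x
  rw [partialDeriv_word, funext (partialDeriv_word (α 1) φ)]
  have h1 : DifferentiableAt ℝ (fderiv ℝ φ) x :=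
    (hφ.fderiv_right (m := ∞) (by simp)).differentiable (by simp) x
  rw [fderiv_clm_apply h1 (differentiableAt_const _)]
  simp [partialDeriv, iteratedFDeriv_two_apply]

theorem abs_partialDeriv_word_le (i : Fin N) (φ : EuclideanSpace ℝ (Fin N) → ℝ)
    (x : EuclideanSpace ℝ (Fin N)) : |partialDeriv (word i) φ x| ≤ ‖fderiv ℝ φ x‖ := by
  rw [partialDeriv_word, ← Real.norm_eq_abs]
  refine (ContinuousLinearMap.le_opNorm _ _).trans ?_
  simp

theorem partialDeriv_word_mul (i : Fin N) {φ ψ : EuclideanSpace ℝ (Fin N) → ℝ}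
    (hφ : ContDiff ℝ ∞ φ) (hψ : ContDiff ℝ ∞ ψ) (x : EuclideanSpace ℝ (Fin N)) :
    partialDeriv (word i) (fun x => φ x * ψ x) x
      = φ x * partialDeriv (word i) ψ x + partialDeriv (word i) φ x * ψ x := by
  rw [partialDeriv_word, partialDeriv_word, partialDeriv_word,
    fderiv_fun_mul (hφ.differentiable (by simp) x) (hψ.differentiable (by simp) x)]
  simp
  ring

theorem contDiff_partialDeriv_word (i : Fin N) {φ : EuclideanSpace ℝ (Fin N) → ℝ}
    (hφ : ContDiff ℝ ∞ φ) : ContDiff ℝ ∞ (partialDeriv (word i) φ) := by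
  rw [funext (partialDeriv_word i φ)]
  exact (hφ.fderiv_right (m := ∞) (by simp)).clm_apply contDiff_const

/-- The defining identity of a first order weak derivative extends to smooth functions which are in
`L²` together with the derivative. -/
theorem HasWeakDeriv.integral_eq {i : Fin N} {w v : L2 N} (h : HasWeakDeriv (word i) w v)
    {f : EuclideanSpace ℝ (Fin N) → ℝ} (hf : ContDiff ℝ ∞ f) (hf2 : MemLp f 2 volume)
    (hf2' : MemLp (partialDeriv (word i) f) 2 volume) :
    ∫ x, w x * partialDeriv (word i) f x = - ∫ x, v x * f x := by
  obtain ⟨C, χ, hχ, hχc, hχ01, hχ1, hχd, hχl⟩ := exists_cutoff N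
  have hC : 0 ≤ C := by simpa using (norm_nonneg _).trans (hχd 0 0)
  have hχ' : ∀ n x, |χ n x| ≤ 1 := fun n x => by
    rw [abs_of_nonneg (hχ01 n x).1]; exact (hχ01 n x).2
  have hχd' : ∀ n x, |partialDeriv (word i) (χ n) x| ≤ C := fun n x =>
    (abs_partialDeriv_word_le _ _ _).trans ((hχd n x).trans
      (div_le_self hC (by norm_cast; omega)))
  have hχdl : ∀ x, Tendsto (fun n => partialDeriv (word i) (χ n) x) atTop (𝓝 0) := by
    intro x
    have h1 : Tendsto (fun n : ℕ => C * (1 / ((n : ℝ) + 1))) atTop (𝓝 (C * 0)) :=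
      tendsto_one_div_add_atTop_nhds_zero_nat.const_mul C
    rw [mul_zero] at h1
    refine squeeze_zero_norm (fun n => ?_) h1
    rw [mul_one_div]
    exact (abs_partialDeriv_word_le _ _ _).trans (hχd n x)
  have e : ∀ n, (∫ x, w x * (χ n x * partialDeriv (word i) f x + partialDeriv (word i) (χ n) x * f x))
      = - ∫ x, v x * (χ n x * f x) := by
    intro n
    have := h (fun x => χ n x * f x) ((hχ n).mul hf) ((hχc n).mul_right)
    simp only [partialDeriv_word_mul i (hχ n) hf] at this
    rw [this, pow_one, neg_one_mul]
  have l1 : Tendsto (fun n => ∫ x, w x * (χ n x * partialDeriv (word i) f x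
      + partialDeriv (word i) (χ n) x * f x)) atTop (𝓝 (∫ x, w x * partialDeriv (word i) f x)) := by
    refine tendsto_integral_of_dominated_convergence
      (fun x => ‖w x * partialDeriv (word i) f x‖ + C * ‖w x * f x‖) (fun n => ?_) ?_ (fun n => ?_) ?_
    · refine (Lp.aestronglyMeasurable w).mul (Continuous.aestronglyMeasurable ?_)
      exact ((hχ n).continuous.mul (continuous_partialDeriv _ hf)).add
        ((continuous_partialDeriv _ (hχ n)).mul hf.continuous)
    · exact ((Lp.memLp w).integrable_mul hf2').norm.add
        (((Lp.memLp w).integrable_mul hf2).norm.const_mul C)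
    · refine Eventually.of_forall fun x => ?_
      rw [mul_add]
      refine (norm_add_le _ _).trans (add_le_add ?_ ?_)
      · rw [norm_mul, norm_mul, norm_mul]
        have := hχ' n x
        rw [← Real.norm_eq_abs] at this
        exact mul_le_mul_of_nonneg_left (mul_le_of_le_one_left (norm_nonneg _) this) (norm_nonneg _)
      · rw [norm_mul, norm_mul, norm_mul, mul_left_comm]
        exact mul_le_mul_of_nonneg_right (hχd' n x) (by positivity)
    · refine Eventually.of_forall fun x => ?_
      have := ((hχl x).mul_const (partialDeriv (word i) f x)).add ((hχdl x).mul_const (f x))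
      simpa using this.const_mul (w x)
  have l2 : Tendsto (fun n => - ∫ x, v x * (χ n x * f x)) atTop (𝓝 (- ∫ x, v x * f x)) := by
    refine (tendsto_integral_of_dominated_convergence (fun x => ‖v x * f x‖) (fun n => ?_) ?_
      (fun n => ?_) ?_).neg
    · exact (Lp.aestronglyMeasurable v).mul
        ((hχ n).continuous.mul hf.continuous).aestronglyMeasurable
    · exact ((Lp.memLp v).integrable_mul hf2).norm
    · refine Eventually.of_forall fun x => ?_
      rw [norm_mul, norm_mul, norm_mul]
      have := hχ' n x
      rw [← Real.norm_eq_abs] at this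
      exact mul_le_mul_of_nonneg_left (mul_le_of_le_one_left (norm_nonneg _) this) (norm_nonneg _)
    · refine Eventually.of_forall fun x => ?_
      simpa using ((hχl x).mul_const (f x)).const_mul (v x)
  exact tendsto_nhds_unique l1 (l2.congr fun n => (e n).symm)

end TestFunctions

/-! ### Sobolev spaces on the Fourier side -/

section Fourier

variable {N : ℕ}

/-- The complex Hilbert space `L²(ℝ^N; ℂ)`. -/
abbrev CL2 (N : ℕ) : Type := Lp ℂ 2 (volume : Measure (EuclideanSpace ℝ (Fin N)))

/-- The embedding of real into complex `L²` functions. -/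
noncomputable def toComplex : L2 N →L[ℝ] CL2 N := Complex.ofRealCLM.compLpL 2 volume

/-- The real part of a complex `L²` function. -/
noncomputable def rePart : CL2 N →L[ℝ] L2 N := Complex.reCLM.compLpL 2 volume

theorem coeFn_toComplex (f : L2 N) : toComplex f =ᵐ[volume] fun x => (f x : ℂ) :=
  Complex.ofRealCLM.coeFn_compLpL f

theorem coeFn_rePart (f : CL2 N) : rePart f =ᵐ[volume] fun x => (f x).re :=
  Complex.reCLM.coeFn_compLpL f

theorem rePart_toComplex (f : L2 N) : rePart (toComplex f) = f := by
  apply Lp.ext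
  filter_upwards [coeFn_toComplex f, coeFn_rePart (toComplex f)] with x h1 h2
  rw [h2, h1, Complex.ofReal_re]

theorem norm_toComplex (f : L2 N) : ‖toComplex f‖ = ‖f‖ := by
  rw [Lp.norm_def, Lp.norm_def]
  congr 1
  refine eLpNorm_congr_norm_ae ?_
  filter_upwards [coeFn_toComplex f] with x h1
  rw [h1, Complex.norm_real]

theorem norm_rePart_le (f : CL2 N) : ‖rePart f‖ ≤ ‖f‖ := by
  have := Lp.norm_le_mul_norm_of_ae_le_mul (f := rePart f) (g := f) (c := 1) (by
    filter_upwards [coeFn_rePart f] with x h1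
    rw [h1, one_mul]
    exact Complex.abs_re_le_norm _)
  rwa [one_mul] at this

/-- The symbol `∏ 2πi ξ_{α j}` of the differential monomial `∂_α`. -/
noncomputable def symb {j : ℕ} (α : Fin j → Fin N) (ξ : EuclideanSpace ℝ (Fin N)) : ℂ :=
  ∏ l, (2 * Real.pi * Complex.I * (ξ (α l) : ℂ))

/-- The frequency `2π (1 + |ξ|²)^{1/2}`, the symbol of `(4π² - Δ)^{1/2}`. -/
noncomputable def freq (ξ : EuclideanSpace ℝ (Fin N)) : ℝ :=
  2 * Real.pi * (1 + ‖ξ‖ ^ 2) ^ (1 / 2 : ℝ)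

theorem freq_sq (ξ : EuclideanSpace ℝ (Fin N)) :
    freq ξ ^ 2 = 4 * Real.pi ^ 2 * (1 + ‖ξ‖ ^ 2) := by
  unfold freq
  rw [mul_pow, ← Real.rpow_natCast ((1 + ‖ξ‖ ^ 2) ^ (1 / 2 : ℝ)), ← Real.rpow_mul (by positivity)]
  norm_num
  left
  ring

theorem one_le_freq (ξ : EuclideanSpace ℝ (Fin N)) : 1 ≤ freq ξ := by
  unfold freq
  have h1 : (1 : ℝ) ≤ (1 + ‖ξ‖ ^ 2) ^ (1 / 2 : ℝ) :=
    Real.one_le_rpow (by nlinarith [sq_nonneg ‖ξ‖]) (by norm_num)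
  nlinarith [Real.pi_gt_three]

theorem freq_pos (ξ : EuclideanSpace ℝ (Fin N)) : 0 < freq ξ := one_pos.trans_le (one_le_freq ξ)

theorem measurable_freq : Measurable (freq (N := N)) := by
  unfold freq
  fun_prop

theorem continuous_symb {j : ℕ} (α : Fin j → Fin N) : Continuous (symb α) := by
  unfold symb
  fun_prop

theorem norm_symb_le {j : ℕ} (α : Fin j → Fin N) (ξ : EuclideanSpace ℝ (Fin N)) :
    ‖symb α ξ‖ ≤ freq ξ ^ j := by
  unfold symb
  rw [norm_prod]
  calc ∏ l, ‖2 * Real.pi * Complex.I * (ξ (α l) : ℂ)‖ ≤ ∏ _l : Fin j, freq ξ := by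
        refine Finset.prod_le_prod (fun _ _ => norm_nonneg _) fun l _ => ?_
        have h1 : ‖(2 * Real.pi * Complex.I * (ξ (α l) : ℂ))‖ = 2 * Real.pi * ‖ξ (α l)‖ := by
          rw [norm_mul, norm_mul, norm_mul, Complex.norm_I, Complex.norm_real, Complex.norm_real,
            Real.norm_of_nonneg Real.pi_pos.le]
          norm_num
        rw [h1]
        refine abs_le_of_sq_le_sq' ?_ (freq_pos ξ).le |>.2
        rw [freq_sq, mul_pow, mul_pow]
        have h2 : ‖ξ (α l)‖ ≤ ‖ξ‖ := PiLp.norm_apply_le ξ (α l)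
        have h3 : ‖ξ (α l)‖ ^ 2 ≤ ‖ξ‖ ^ 2 := by gcongr
        nlinarith [Real.pi_pos, sq_nonneg Real.pi]
    _ = freq ξ ^ j := by simp

theorem conj_symb {j : ℕ} (α : Fin j → Fin N) (ξ : EuclideanSpace ℝ (Fin N)) :
    (starRingEnd ℂ) (symb α ξ) = (-1) ^ j * symb α ξ := by
  unfold symb
  rw [map_prod]
  have : ∀ l, (starRingEnd ℂ) (2 * Real.pi * Complex.I * (ξ (α l) : ℂ))
      = (-1) * (2 * Real.pi * Complex.I * (ξ (α l) : ℂ)) := by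
    intro l
    simp only [map_mul, Complex.conj_ofReal, Complex.conj_I, Complex.conj_ofNat]
    ring
  simp only [this]
  rw [Finset.prod_mul_distrib]
  simp

/-- The Fourier transform turns differential monomials into multiplication by their symbols. -/
theorem fourier_iteratedLineDeriv {j : ℕ} (α : Fin j → Fin N)
    (f : 𝓢(EuclideanSpace ℝ (Fin N), ℂ)) (ξ : EuclideanSpace ℝ (Fin N)) :
    𝓕 (LineDeriv.iteratedLineDerivOp (fun l => EuclideanSpace.single (α l) (1 : ℝ)) f) ξ
      = symb α ξ * 𝓕 f ξ := by
  induction j with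
  | zero => simp [symb]
  | succ j ih =>
    rw [LineDeriv.iteratedLineDerivOp_succ_left, SchwartzMap.fourier_lineDerivOp_eq]
    have ht : Function.HasTemperateGrowth
        (inner ℝ · (EuclideanSpace.single (α 0) (1 : ℝ)) : EuclideanSpace ℝ (Fin N) → ℝ) := by
      fun_prop
    have := ih (fun l => α l.succ)
    simp only [smul_apply, SchwartzMap.smulLeftCLM_apply_apply ht]
    change _ • (_ • 𝓕 (LineDeriv.iteratedLineDerivOp
      (fun l : Fin j => EuclideanSpace.single (α l.succ) (1 : ℝ)) f) ξ) = _
    rw [this]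
    have h2 : inner ℝ ξ (EuclideanSpace.single (α 0) (1 : ℝ)) = ξ (α 0) := by
      simp [EuclideanSpace.inner_single_right]
    rw [h2]
    unfold symb
    rw [Fin.prod_univ_succ]
    simp only [smul_eq_mul, Complex.real_smul]
    ring

end Fourier

/-! ### The Fourier transform of weak derivatives -/

section Fourier

variable {N : ℕ}

theorem inner_toComplex (f g : L2 N) : inner ℂ (toComplex f) (toComplex g) = ((inner ℝ f g : ℝ) : ℂ) := by
  rw [L2.inner_def, L2.inner_def, ← integral_complex_ofReal]
  refine integral_congr_ae ?_
  filter_upwards [coeFn_toComplex f, coeFn_toComplex g] with x h1 h2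
  rw [h1, h2]
  simp

theorem inner_eq_integral (f g : L2 N) : inner ℝ f g = ∫ x, f x * g x := by
  rw [L2.inner_def]
  refine integral_congr_ae (Eventually.of_forall fun x => ?_)
  simp [mul_comm]

/-- The Schwartz function associated with a real test function. -/
noncomputable def testSchwartz (φ : EuclideanSpace ℝ (Fin N) → ℝ) (hφ : ContDiff ℝ ∞ φ)
    (hc : HasCompactSupport φ) : 𝓢(EuclideanSpace ℝ (Fin N), ℂ) :=
  HasCompactSupport.toSchwartzMap (f := fun x => (φ x : ℂ)) (hc.comp_left Complex.ofReal_zero)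
    (Complex.ofRealCLM.contDiff.comp hφ)

theorem testSchwartz_apply (φ : EuclideanSpace ℝ (Fin N) → ℝ) (hφ : ContDiff ℝ ∞ φ)
    (hc : HasCompactSupport φ) (x : EuclideanSpace ℝ (Fin N)) : testSchwartz φ hφ hc x = φ x := rfl

theorem integral_rePart_mul (w : CL2 N) (f : 𝓢(EuclideanSpace ℝ (Fin N), ℂ))
    {ψ : EuclideanSpace ℝ (Fin N) → ℝ} (hf : ∀ x, f x = ψ x) :
    ∫ x, rePart w x * ψ x = (inner ℂ (f.toLp 2) w).re := by
  have hi := L2.integrable_inner (𝕜 := ℂ) (f.toLp 2 volume) w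
  rw [L2.inner_def, ← RCLike.re_eq_complex_re, ← integral_re hi]
  refine integral_congr_ae ?_
  filter_upwards [coeFn_rePart w, f.coeFn_toLp 2] with x h1 h2
  rw [h1, h2, hf]
  simp

theorem partialDeriv_eq_iteratedLineDeriv {j : ℕ} (α : Fin j → Fin N)
    {φ : EuclideanSpace ℝ (Fin N) → ℝ} (hφ : ContDiff ℝ ∞ φ) (hc : HasCompactSupport φ)
    (x : EuclideanSpace ℝ (Fin N)) :
    LineDeriv.iteratedLineDerivOp (fun l => EuclideanSpace.single (α l) (1 : ℝ))
      (testSchwartz φ hφ hc) x = (partialDeriv α φ x : ℂ) := by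
  rw [SchwartzMap.iteratedLineDerivOp_eq_iteratedFDeriv]
  have h := Complex.ofRealCLM.iteratedFDeriv_comp_left (f := φ) (x := x) hφ.contDiffAt
    (i := j) (by exact_mod_cast le_top)
  change iteratedFDeriv ℝ j (Complex.ofRealCLM ∘ φ) x _ = _
  rw [h]
  rfl

/-- If the Fourier transforms differ by the factor `symb α`, then the real parts differ by a weak
derivative `∂_α`. -/
theorem hasWeakDeriv_of_fourier {j : ℕ} {α : Fin j → Fin N} {G G' : CL2 N}
    (h : G' =ᵐ[volume] fun ξ => symb α ξ * G ξ) :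
    HasWeakDeriv α (rePart (𝓕⁻ G)) (rePart (𝓕⁻ G')) := by
  intro φ hφ hc
  set f := testSchwartz φ hφ hc with hf
  rw [integral_rePart_mul _ _ (partialDeriv_eq_iteratedLineDeriv α hφ hc),
    integral_rePart_mul _ f (testSchwartz_apply φ hφ hc),
    ← Lp.inner_fourier_eq _ (𝓕⁻ G), ← Lp.inner_fourier_eq _ (𝓕⁻ G'), SchwartzMap.toLp_fourier_eq,
    SchwartzMap.toLp_fourier_eq, FourierTransform.fourier_fourierInv_eq,
    FourierTransform.fourier_fourierInv_eq]
  have : inner ℂ ((𝓕 (LineDeriv.iteratedLineDerivOp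
        (fun l => EuclideanSpace.single (α l) (1 : ℝ)) f)).toLp 2 volume) G
      = (-1) ^ j * inner ℂ ((𝓕 f).toLp 2 volume) G' := by
    rw [L2.inner_def, L2.inner_def, ← integral_const_mul]
    refine integral_congr_ae ?_
    filter_upwards [h, (𝓕 f).coeFn_toLp 2 volume, (𝓕 (LineDeriv.iteratedLineDerivOp
        (fun l => EuclideanSpace.single (α l) (1 : ℝ)) f)).coeFn_toLp 2 volume] with ξ h1 h2 h3
    rw [h1, h2, h3, fourier_iteratedLineDeriv]
    simp only [RCLike.inner_apply, map_mul]
    rw [conj_symb]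
    ring
  rw [this]
  have h2 : ((-1 : ℂ) ^ j) = (((-1 : ℝ) ^ j : ℝ) : ℂ) := by push_cast; rfl
  rw [h2, Complex.re_ofReal_mul]

/-- A first order weak derivative against complex Schwartz functions. -/
theorem HasWeakDeriv.inner_schwartz {i : Fin N} {w v : L2 N} (h : HasWeakDeriv (word i) w v)
    (f : 𝓢(EuclideanSpace ℝ (Fin N), ℂ)) :
    inner ℂ ((LineDeriv.lineDerivOp (EuclideanSpace.single i (1 : ℝ)) f).toLp 2 volume)
      (toComplex w) = - inner ℂ (f.toLp 2 volume) (toComplex v) := by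
  set g : 𝓢(EuclideanSpace ℝ (Fin N), ℂ) :=
    LineDeriv.lineDerivOp (EuclideanSpace.single i (1 : ℝ)) f with hg
  have hfs : ContDiff ℝ ∞ f := f.smooth ⊤
  have hgf : ∀ x, g x = fderiv ℝ f x (EuclideanSpace.single i 1) := fun x =>
    SchwartzMap.lineDerivOp_apply_eq_fderiv _ _ _
  have hd : ∀ x, HasFDerivAt f (fderiv ℝ f x) x := fun x => f.hasFDerivAt x
  -- real and imaginary parts
  have hre : ∀ x, partialDeriv (word i) (fun x => (f x).re) x = (g x).re := by
    intro x
    have h1 : HasFDerivAt (fun x => (f x).re) _ x := Complex.reCLM.hasFDerivAt.comp x (hd x)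
    rw [partialDeriv_word, hgf, h1.fderiv]
    rfl
  have him : ∀ x, partialDeriv (word i) (fun x => (f x).im) x = (g x).im := by
    intro x
    have h1 : HasFDerivAt (fun x => (f x).im) _ x := Complex.imCLM.hasFDerivAt.comp x (hd x)
    rw [partialDeriv_word, hgf, h1.fderiv]
    rfl
  have e1 := h.integral_eq (f := fun x => (f x).re) (Complex.reCLM.contDiff.comp hfs)
    (f.memLp 2 volume).re (by rw [funext hre]; exact (g.memLp 2 volume).re)
  have e2 := h.integral_eq (f := fun x => (f x).im) (Complex.imCLM.contDiff.comp hfs)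
    (f.memLp 2 volume).im (by rw [funext him]; exact (g.memLp 2 volume).im)
  rw [funext hre] at e1
  rw [funext him] at e2
  have split : ∀ (k : 𝓢(EuclideanSpace ℝ (Fin N), ℂ)) (y : L2 N),
      inner ℂ (k.toLp 2 volume) (toComplex y)
        = ((∫ x, y x * (k x).re : ℝ) : ℂ) - Complex.I * ((∫ x, y x * (k x).im : ℝ) : ℂ) := by
    intro k y
    have i1 : Integrable (fun x => y x * (k x).re) :=
      (Lp.memLp y).integrable_mul (k.memLp 2 volume).re
    have i2 : Integrable (fun x => y x * (k x).im) :=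
      (Lp.memLp y).integrable_mul (k.memLp 2 volume).im
    rw [L2.inner_def, ← integral_complex_ofReal, ← integral_complex_ofReal, ← integral_const_mul,
      ← integral_sub i1.ofReal (i2.ofReal.const_mul _)]
    refine integral_congr_ae ?_
    filter_upwards [coeFn_toComplex y, k.coeFn_toLp 2 volume] with x h1 h2
    rw [h1, h2]
    apply Complex.ext <;> simp
  rw [split, split, e1, e2]
  push_cast
  ring

/-- On the Fourier side a first order weak derivative is multiplication by its symbol. The identity
is tested against the inverse Fourier transforms of test functions, which are Schwartz functions. -/
theorem fourier_of_hasWeakDeriv {i : Fin N} {w v : L2 N} (h : HasWeakDeriv (word i) w v) :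
    (𝓕 (toComplex v) : CL2 N) =ᵐ[volume] fun ξ => symb (word i) ξ * (𝓕 (toComplex w) : CL2 N) ξ := by
  set a : CL2 N := 𝓕 (toComplex w) with ha
  set b : CL2 N := 𝓕 (toComplex v) with hb
  have hloc : LocallyIntegrable (fun ξ => symb (word i) ξ * a ξ) volume := by
    have h1 : LocallyIntegrable a volume := (Lp.memLp a).locallyIntegrable (by norm_num)
    intro x
    obtain ⟨s, hs, hsi⟩ := h1 x
    obtain ⟨K, hK, hKs⟩ := exists_compact_mem_nhds x
    refine ⟨s ∩ K, Filter.inter_mem hs hKs, ?_⟩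
    obtain ⟨C, hC⟩ := hK.exists_bound_of_continuousOn (continuous_symb (word i)).continuousOn
    have := (hsi.mono_set (inter_subset_left (t := K))).bdd_mul (c := C)
      (f := symb (word i)) (continuous_symb _).aestronglyMeasurable ?_
    · exact this
    · refine ae_restrict_of_ae_restrict_of_subset (t := K) inter_subset_right ?_
      exact (ae_restrict_iff' hK.measurableSet).2 (Eventually.of_forall fun x hx => hC x hx)
  have hlocb : LocallyIntegrable b volume := (Lp.memLp b).locallyIntegrable (by norm_num)
  refine ae_eq_of_integral_contDiff_smul_eq hlocb hloc fun ψ hψ hc => ?_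
  set p := testSchwartz ψ hψ hc with hp
  -- pull the test function back to physical space
  set f : 𝓢(EuclideanSpace ℝ (Fin N), ℂ) := 𝓕⁻ p with hf
  have h1 := h.inner_schwartz f
  rw [← Lp.inner_fourier_eq, ← Lp.inner_fourier_eq (f.toLp 2 volume), SchwartzMap.toLp_fourier_eq,
    SchwartzMap.toLp_fourier_eq, hf, FourierTransform.fourier_fourierInv_eq, ← ha, ← hb,
    L2.inner_def, L2.inner_def, ← integral_neg] at h1
  have h2 : ∀ ξ, 𝓕 (LineDeriv.lineDerivOp (EuclideanSpace.single i (1 : ℝ)) (𝓕⁻ p)) ξ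
      = symb (word i) ξ * p ξ := by
    intro ξ
    have := fourier_iteratedLineDeriv (word i) (𝓕⁻ p) ξ
    rw [FourierTransform.fourier_fourierInv_eq] at this
    exact this
  have e1 : (∫ x, ψ x • b x) = - ∫ x, -inner ℂ ((p.toLp 2 volume : CL2 N) x) (b x) := by
    rw [← integral_neg]
    refine integral_congr_ae ?_
    filter_upwards [p.coeFn_toLp 2 volume] with x hx
    rw [hx, hp, testSchwartz_apply]
    simp [mul_comm]
  rw [e1, ← h1, ← integral_neg]
  refine integral_congr_ae ?_
  filter_upwards [(𝓕 (LineDeriv.lineDerivOp (EuclideanSpace.single i (1 : ℝ)) (𝓕⁻ p))).coeFn_toLp 2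
    volume] with x hx
  rw [hx, h2, hp, testSchwartz_apply]
  have h3 := conj_symb (word i) x
  simp only [RCLike.inner_apply, map_mul, h3, Complex.conj_ofReal, Complex.real_smul]
  ring

/-- Integration by parts for weak derivatives in `L²`. -/
theorem HasWeakDeriv.inner_eq_neg {i : Fin N} {y y' g g' : L2 N} (hy : HasWeakDeriv (word i) y y')
    (hg : HasWeakDeriv (word i) g g') : inner ℝ y g' = - inner ℝ y' g := by
  have : ((inner ℝ y g' : ℝ) : ℂ) = ((- inner ℝ y' g : ℝ) : ℂ) := by
    rw [Complex.ofReal_neg, ← inner_toComplex, ← inner_toComplex, ← Lp.inner_fourier_eq,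
      ← Lp.inner_fourier_eq (toComplex y'), L2.inner_def, L2.inner_def, ← integral_neg]
    refine integral_congr_ae ?_
    filter_upwards [fourier_of_hasWeakDeriv hy, fourier_of_hasWeakDeriv hg] with x h1 h2
    rw [h1, h2]
    simp only [RCLike.inner_apply, map_mul, conj_symb]
    ring
  exact_mod_cast this

/-- A second order weak derivative of `w` is a first order weak derivative of a first order one. -/
theorem HasWeakDeriv.tail {α : Fin 2 → Fin N} {w v v₁ : L2 N} (h : HasWeakDeriv α w v)
    (h₁ : HasWeakDeriv (word (α 1)) w v₁) : HasWeakDeriv (word (α 0)) v₁ v := by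
  intro φ hφ hc
  have hsymm : partialDeriv α φ = partialDeriv (word (α 1)) (partialDeriv (word (α 0)) φ) := by
    ext x
    have hs : IsSymmSndFDerivAt ℝ φ x := hφ.contDiffAt.isSymmSndFDerivAt (by
      rw [minSmoothness_of_isRCLikeNormedField]
      exact ENat.LEInfty.out)
    have := partialDeriv_two (fun l => α (1 - l)) hφ
    simp only [sub_zero, sub_self] at this
    rw [← this]
    unfold partialDeriv
    rw [iteratedFDeriv_two_apply, iteratedFDeriv_two_apply]
    simp only [sub_zero, sub_self]
    exact hs _ _
  have e1 := h φ hφ hc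
  have e2 := h₁ (partialDeriv (word (α 0)) φ) (contDiff_partialDeriv_word _ hφ)
    (hasCompactSupport_partialDeriv _ hc)
  rw [hsymm] at e1
  rw [e1] at e2
  rw [pow_one, neg_one_mul]
  simp only [even_two, Even.neg_pow, one_pow, one_mul, pow_one, neg_one_mul] at e2
  rw [e2, neg_neg]

end Fourier

/-! ### Sobolev functions as Bessel potentials -/

section Bessel

variable {N : ℕ}

/-- The weak derivative at the word `α`, as a bounded operator on `H^k`. -/
noncomputable def coord {k : ℕ} (α : DerivIndex N k) : Sobolev N k →L[ℝ] L2 N :=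
  (PiLp.proj 2 (fun _ : DerivIndex N k => L2 N) α : PiLp 2 (fun _ : DerivIndex N k => L2 N) →L[ℝ] L2 N)
    ∘L (Sobolev N k).subtypeL

theorem coord_noDeriv {k : ℕ} (w : Sobolev N k) : coord (noDeriv N k) w = toL2 w := rfl

theorem norm_coord_le {k : ℕ} (α : DerivIndex N k) (w : Sobolev N k) : ‖coord α w‖ ≤ ‖w‖ :=
  PiLp.norm_apply_le (w : PiLp 2 (fun _ : DerivIndex N k => L2 N)) α

theorem sobolev_ext {k : ℕ} {w v : Sobolev N k} (h : ∀ α, coord α w = coord α v) : w = v := by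
  apply Subtype.ext
  ext1 α
  exact h α

/-- The first derivatives of an element of `H¹`. -/
def firstIndex {k : ℕ} (i : Fin N) : DerivIndex N (k + 1) := ⟨⟨1, by omega⟩, word i⟩

theorem hasWeakDeriv_coord {k : ℕ} (α : DerivIndex N k) (w : Sobolev N k) :
    HasWeakDeriv α.2 (toL2 w) (coord α w) := w.2 α

theorem hasWeakDeriv_first {k : ℕ} (i : Fin N) (w : Sobolev N (k + 1)) :
    HasWeakDeriv (word i) (toL2 w) (coord (firstIndex i) w) := hasWeakDeriv_coord (firstIndex i) w

theorem coord_zero {k : ℕ} (β : Fin 0 → Fin N) (w : Sobolev N k) :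
    coord ⟨0, β⟩ w = toL2 w := by
  have : (⟨0, β⟩ : DerivIndex N k) = noDeriv N k := by
    unfold noDeriv
    congr 1
    exact Subsingleton.elim (α := Fin 0 → Fin N) _ _
  rw [← coord_noDeriv, this]

/-- The bounded multiplier `symb α / freq ^ k`, for words of length at most `k`. -/
noncomputable def besselSymb (k : ℕ) {j : ℕ} (α : Fin j → Fin N) (ξ : EuclideanSpace ℝ (Fin N)) : ℂ :=
  symb α ξ * ((freq ξ ^ k : ℝ) : ℂ)⁻¹

theorem norm_besselSymb_le {k j : ℕ} (hj : j ≤ k) (α : Fin j → Fin N)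
    (ξ : EuclideanSpace ℝ (Fin N)) : ‖besselSymb k α ξ‖ ≤ 1 := by
  unfold besselSymb
  have h := pow_pos (freq_pos ξ) k
  rw [norm_mul, norm_inv, Complex.norm_real, Real.norm_of_nonneg h.le,
    mul_inv_le_iff₀ h, one_mul]
  exact (norm_symb_le α ξ).trans (pow_le_pow_right₀ (one_le_freq ξ) hj)

theorem aestronglyMeasurable_besselSymb {k j : ℕ} (α : Fin j → Fin N) :
    AEStronglyMeasurable (besselSymb k α) volume := by
  unfold besselSymb
  refine ((continuous_symb α).measurable.mul ?_).aestronglyMeasurable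
  exact (Complex.measurable_ofReal.comp (measurable_freq.pow_const k)).inv

/-- Multiplication by `symb α / freq ^ k`. -/
noncomputable def besselMul (k : ℕ) {j : ℕ} (hj : j ≤ k) (α : Fin j → Fin N) : CL2 N →L[ℂ] CL2 N :=
  mulOp (besselSymb k α) (aestronglyMeasurable_besselSymb α) 1 (norm_besselSymb_le hj α)

theorem coeFn_besselMul {k j : ℕ} (hj : j ≤ k) (α : Fin j → Fin N) (G : CL2 N) :
    besselMul k hj α G =ᵐ[volume] fun ξ => besselSymb k α ξ * G ξ := coeFn_mulOp _ _ _

/-- The real part of the inverse Fourier transform. -/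
noncomputable def reFourierInv : CL2 N →L[ℝ] L2 N :=
  rePart ∘L ((FourierTransform.fourierInvCLM ℂ (CL2 N)).restrictScalars ℝ : CL2 N →L[ℝ] CL2 N)

theorem reFourierInv_apply (G : CL2 N) : reFourierInv G = rePart (𝓕⁻ G) := rfl

theorem norm_fourierInv (G : CL2 N) : ‖(𝓕⁻ G : CL2 N)‖ = ‖G‖ := by
  rw [← Lp.norm_fourier_eq, FourierTransform.fourier_fourierInv_eq]

theorem norm_reFourierInv_le (G : CL2 N) : ‖reFourierInv G‖ ≤ ‖G‖ := by
  rw [reFourierInv_apply]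
  exact (norm_rePart_le _).trans (norm_fourierInv G).le

/-- The real part of `(4π² - Δ)^{-k/2} 𝓕⁻ G`, as an element of `H^k`. -/
noncomputable def bessel (k : ℕ) : CL2 N →L[ℝ] Sobolev N k :=
  ContinuousLinearMap.codRestrict
    (((PiLp.continuousLinearEquiv 2 ℝ (fun _ : DerivIndex N k => L2 N)).symm :
        (DerivIndex N k → L2 N) →L[ℝ] PiLp 2 (fun _ : DerivIndex N k => L2 N)) ∘L
      ContinuousLinearMap.pi fun α : DerivIndex N k =>
        reFourierInv ∘L ((besselMul k (Nat.lt_succ_iff.1 α.1.2) α.2).restrictScalars ℝ :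
          CL2 N →L[ℝ] CL2 N))
    (Sobolev N k) (by
      intro G α
      change HasWeakDeriv α.2
        (rePart (𝓕⁻ (besselMul k (Nat.lt_succ_iff.1 (noDeriv N k).1.2) (noDeriv N k).2 G)))
        (rePart (𝓕⁻ (besselMul k (Nat.lt_succ_iff.1 α.1.2) α.2 G)))
      refine hasWeakDeriv_of_fourier ?_
      filter_upwards [coeFn_besselMul (Nat.lt_succ_iff.1 (noDeriv N k).1.2) (noDeriv N k).2 G,
        coeFn_besselMul (Nat.lt_succ_iff.1 α.1.2) α.2 G] with ξ h1 h2
      rw [h1, h2]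
      have : symb (noDeriv N k).2 ξ = 1 := by
        unfold symb
        exact Fin.prod_univ_zero _
      simp only [besselSymb, this]
      ring)

theorem coord_bessel {k : ℕ} (α : DerivIndex N k) (G : CL2 N) :
    coord α (bessel k G) = reFourierInv (besselMul k (Nat.lt_succ_iff.1 α.1.2) α.2 G) := rfl

theorem toL2_bessel {k : ℕ} (G : CL2 N) :
    toL2 (bessel k G) = reFourierInv (besselMul k (Nat.zero_le k) (noDeriv N k).2 G) := rfl

/-- Division by the frequency. -/
noncomputable def divFreq : CL2 N →L[ℂ] CL2 N := besselMul 1 (Nat.zero_le 1) Fin.elim0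

theorem coeFn_divFreq (G : CL2 N) : divFreq G =ᵐ[volume] fun ξ => (freq ξ : ℂ)⁻¹ * G ξ := by
  filter_upwards [coeFn_besselMul (Nat.zero_le 1) (Fin.elim0 : Fin 0 → Fin N) G] with ξ h
  rw [divFreq, h]
  simp [besselSymb, symb]

theorem norm_divFreq_le (G : CL2 N) : ‖divFreq G‖ ≤ ‖G‖ := by
  have := norm_mulOp_le (aestronglyMeasurable_besselSymb (k := 1) (Fin.elim0 : Fin 0 → Fin N))
    (norm_besselSymb_le (Nat.zero_le 1) _) G
  rwa [one_mul] at this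

theorem gen_divFreq (G : CL2 N) : InDom freq (divFreq G) ∧ gen freq (divFreq G) = G := by
  refine gen_eq_of_ae ?_
  filter_upwards [coeFn_divFreq G] with ξ h
  rw [h, mul_inv_cancel_left₀]
  exact_mod_cast (freq_pos ξ).ne'

theorem divFreq_gen {z : CL2 N} (hz : InDom freq z) : divFreq (gen freq z) = z := by
  apply Lp.ext
  filter_upwards [coeFn_divFreq (gen freq z), coeFn_gen hz] with ξ h1 h2
  rw [h1, h2, inv_mul_cancel_left₀]
  exact_mod_cast (freq_pos ξ).ne'

theorem coeFn_ext_besselMul {k j : ℕ} (hj : j ≤ k) (α : Fin j → Fin N) {G G' : CL2 N}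
    (h : ∀ᵐ ξ, G' ξ = besselSymb k α ξ * G ξ) : besselMul k hj α G = G' :=
  Lp.ext ((coeFn_besselMul hj α G).trans (by filter_upwards [h] with ξ h1 using h1.symm))

theorem toH1_bessel (G : CL2 N) : toH1 (bessel 2 G) = bessel 1 (divFreq G) := by
  refine sobolev_ext fun α => ?_
  rw [coord_bessel]
  change reFourierInv (besselMul 2 ((Nat.lt_succ_iff.1 α.1.2).trans one_le_two) α.2 G) = _
  congr 1
  refine coeFn_ext_besselMul _ _ ?_
  filter_upwards [coeFn_besselMul (Nat.lt_succ_iff.1 α.1.2) α.2 (divFreq G), coeFn_divFreq G]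
    with ξ h1 h2
  rw [h1, h2]
  simp only [besselSymb]
  push_cast
  rw [pow_two, mul_inv, pow_one]
  ring

theorem toL2_bessel_zero_one (G : CL2 N) : toL2 (bessel 1 G) = reFourierInv (divFreq G) := by
  rw [toL2_bessel]
  congr 2

theorem toL2_toH1 (w : Sobolev N 2) : toL2 (toH1 w) = toL2 w := by
  rw [← coord_noDeriv, ← coord_noDeriv]
  rfl

/-- The Fourier transform of the weak derivatives of an element of `H²`. -/
theorem fourier_coord_two (w : Sobolev N 2) (α : DerivIndex N 2) :
    (𝓕 (toComplex (coord α w)) : CL2 N)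
      =ᵐ[volume] fun ξ => symb α.2 ξ * (𝓕 (toComplex (toL2 w)) : CL2 N) ξ := by
  obtain ⟨⟨j, hj⟩, β⟩ := α
  have h1 : ∀ i : Fin N, (𝓕 (toComplex (coord (firstIndex i) w)) : CL2 N)
      =ᵐ[volume] fun ξ => symb (word i) ξ * (𝓕 (toComplex (toL2 w)) : CL2 N) ξ := fun i =>
    fourier_of_hasWeakDeriv (hasWeakDeriv_first (k := 1) i w)
  interval_cases j
  · have := coord_zero (k := 2) β w
    change (𝓕 (toComplex (coord ⟨0, β⟩ w)) : CL2 N) =ᵐ[volume] _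
    rw [this]
    refine Eventually.of_forall fun ξ => ?_
    simp [symb]
  · have hβ : β = word (β 0) := by
      ext l; rw [word, Subsingleton.elim l 0]
    have := h1 (β 0)
    unfold firstIndex at this
    rw [← hβ] at this
    exact this
  · have h2 := (hasWeakDeriv_coord (⟨⟨2, hj⟩, β⟩ : DerivIndex N 2) w).tail
      (hasWeakDeriv_first (k := 1) (β 1) w)
    have h3 := fourier_of_hasWeakDeriv h2
    filter_upwards [h3, h1 (β 1)] with ξ e1 e2
    rw [e1, e2]
    simp only [symb, word, Fin.prod_univ_succ]
    simp
    ring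

theorem fourier_coord_one (w : Sobolev N 1) (α : DerivIndex N 1) :
    (𝓕 (toComplex (coord α w)) : CL2 N)
      =ᵐ[volume] fun ξ => symb α.2 ξ * (𝓕 (toComplex (toL2 w)) : CL2 N) ξ := by
  obtain ⟨⟨j, hj⟩, β⟩ := α
  interval_cases j
  · have := coord_zero (k := 1) β w
    change (𝓕 (toComplex (coord ⟨0, β⟩ w)) : CL2 N) =ᵐ[volume] _
    rw [this]
    refine Eventually.of_forall fun ξ => ?_
    simp [symb]
  · have hβ : β = word (β 0) := by
      ext l; rw [word, Subsingleton.elim l 0]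
    have := fourier_of_hasWeakDeriv (hasWeakDeriv_first (k := 0) (β 0) w)
    unfold firstIndex at this
    rw [← hβ] at this
    exact this

/-- An element of `H^k` is recovered as a Bessel potential from `freq ^ k` times the Fourier
transform of its underlying function. -/
theorem eq_bessel_of_fourier {k : ℕ} {w : Sobolev N k} {G : CL2 N}
    (hw : ∀ α : DerivIndex N k, (𝓕 (toComplex (coord α w)) : CL2 N)
      =ᵐ[volume] fun ξ => symb α.2 ξ * (𝓕 (toComplex (toL2 w)) : CL2 N) ξ)
    (hG : G =ᵐ[volume] fun ξ => ((freq ξ ^ k : ℝ) : ℂ) * (𝓕 (toComplex (toL2 w)) : CL2 N) ξ) :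
    bessel k G = w := by
  refine sobolev_ext fun α => ?_
  rw [coord_bessel]
  have : besselMul k (Nat.lt_succ_iff.1 α.1.2) α.2 G = 𝓕 (toComplex (coord α w)) := by
    refine coeFn_ext_besselMul _ _ ?_
    filter_upwards [hw α, hG] with ξ h1 h2
    rw [h1, h2, besselSymb, mul_assoc, inv_mul_cancel_left₀]
    exact_mod_cast (pow_pos (freq_pos ξ) k).ne'
  rw [this, reFourierInv_apply, FourierTransform.fourierInv_fourier_eq, rePart_toComplex]

theorem symb_diag (i : Fin N) (ξ : EuclideanSpace ℝ (Fin N)) :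
    symb (fun _ : Fin 2 => i) ξ = -(4 * Real.pi ^ 2 * ξ i ^ 2 : ℝ) := by
  simp only [symb, Fin.prod_univ_two]
  push_cast
  linear_combination (4 * (Real.pi : ℂ) ^ 2 * (ξ i : ℂ) ^ 2) * Complex.I_sq

theorem freq_sq_eq (ξ : EuclideanSpace ℝ (Fin N)) :
    ((freq ξ ^ 2 : ℝ) : ℂ) = 4 * Real.pi ^ 2 - ∑ i, symb (fun _ : Fin 2 => i) ξ := by
  simp only [symb_diag]
  rw [freq_sq, EuclideanSpace.norm_sq_eq, Finset.sum_neg_distrib, ← Complex.ofReal_sum,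
    ← Finset.mul_sum]
  simp only [Real.norm_eq_abs, sq_abs]
  push_cast
  ring

/-- Every element of `H²` is a Bessel potential. -/
theorem exists_bessel_two (N : ℕ) : ∃ C : ℝ, 0 ≤ C ∧ ∀ w : Sobolev N 2, ∃ G : CL2 N,
    bessel 2 G = w ∧ ‖G‖ ≤ C * ‖w‖ := by
  refine ⟨4 * Real.pi ^ 2 + N, by positivity, fun w => ?_⟩
  set d : Fin N → L2 N := fun i => coord (⟨2, fun _ => i⟩ : DerivIndex N 2) w with hd
  set F : L2 N → CL2 N := fun f => 𝓕 (toComplex f) with hF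
  have hFn : ∀ f, ‖F f‖ = ‖f‖ := fun f => by rw [hF]; simp only; rw [Lp.norm_fourier_eq, norm_toComplex]
  -- `freq ^ 2 = 4π² - ∑ (symb i) (symb i)`, so `G` is the Fourier transform of `4π² w - Δ w`
  refine ⟨(4 * Real.pi ^ 2 : ℝ) • F (toL2 w) - ∑ i, F (d i), ?_, ?_⟩
  · refine eq_bessel_of_fourier (fourier_coord_two w) ?_
    have h1 : ∀ᵐ ξ, ∀ i, F (d i) ξ = symb (fun _ : Fin 2 => i) ξ * F (toL2 w) ξ := by
      rw [ae_all_iff]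
      exact fun i => fourier_coord_two w ⟨2, fun _ => i⟩
    filter_upwards [h1, Lp.coeFn_sub ((4 * Real.pi ^ 2 : ℝ) • F (toL2 w)) (∑ i, F (d i)),
      Lp.coeFn_smul (4 * Real.pi ^ 2 : ℝ) (F (toL2 w)),
      Lp.coeFn_fun_finsetSum Finset.univ (fun i => F (d i))] with ξ e1 e2 e3 e4
    rw [e2, Pi.sub_apply, e3, Pi.smul_apply, e4, freq_sq_eq, sub_mul, Finset.sum_mul]
    simp only [e1, Complex.real_smul]
    push_cast
    rfl
  · refine (norm_sub_le _ _).trans ?_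
    rw [add_mul]
    refine add_le_add ?_ ?_
    · rw [norm_smul, hFn, Real.norm_of_nonneg (by positivity)]
      exact mul_le_mul_of_nonneg_left (norm_coord_le (noDeriv N 2) w) (by positivity)
    · refine (norm_sum_le _ _).trans ?_
      calc ∑ i, ‖F (d i)‖ ≤ ∑ _i : Fin N, ‖w‖ := by
            refine Finset.sum_le_sum fun i _ => ?_
            rw [hFn]
            exact norm_coord_le _ w
        _ = N * ‖w‖ := by simp

/-- Every element of `H¹` is a Bessel potential. -/
theorem exists_bessel_one (N : ℕ) : ∃ C : ℝ, 0 ≤ C ∧ ∀ w : Sobolev N 1, ∃ G : CL2 N,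
    bessel 1 G = w ∧ ‖G‖ ≤ C * ‖w‖ := by
  refine ⟨4 * Real.pi ^ 2 + N, by positivity, fun w => ?_⟩
  set F : L2 N → CL2 N := fun f => 𝓕 (toComplex f) with hF
  have hFn : ∀ f, ‖F f‖ = ‖f‖ := fun f => by rw [hF]; simp only; rw [Lp.norm_fourier_eq, norm_toComplex]
  set d : Fin N → L2 N := fun i => coord (firstIndex (k := 0) i) w with hd
  -- `freq = (4π² - ∑ (symb i) (symb i)) / freq`
  refine ⟨(4 * Real.pi ^ 2 : ℝ) • divFreq (F (toL2 w))
    - ∑ i, besselMul 1 le_rfl (word i) (F (d i)), ?_, ?_⟩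
  · refine eq_bessel_of_fourier (fourier_coord_one w) ?_
    have h1 : ∀ᵐ ξ, ∀ i, F (d i) ξ = symb (word i) ξ * F (toL2 w) ξ := by
      rw [ae_all_iff]
      exact fun i => fourier_coord_one w (firstIndex i)
    have h2 : ∀ᵐ ξ, ∀ i, besselMul 1 le_rfl (word i) (F (d i)) ξ
        = besselSymb 1 (word i) ξ * F (d i) ξ := by
      rw [ae_all_iff]
      exact fun i => coeFn_besselMul le_rfl (word i) (F (d i))
    filter_upwards [h1, h2, Lp.coeFn_sub ((4 * Real.pi ^ 2 : ℝ) • divFreq (F (toL2 w)))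
        (∑ i, besselMul 1 le_rfl (word i) (F (d i))),
      Lp.coeFn_smul (4 * Real.pi ^ 2 : ℝ) (divFreq (F (toL2 w))), coeFn_divFreq (F (toL2 w)),
      Lp.coeFn_fun_finsetSum Finset.univ (fun i => besselMul 1 le_rfl (word i) (F (d i)))]
      with ξ e1 e2 e3 e4 e5 e6
    rw [e3, Pi.sub_apply, e4, Pi.smul_apply, e6, e5]
    simp only [e1, e2, Complex.real_smul]
    have h3 : (freq ξ : ℂ) ≠ 0 := by exact_mod_cast (freq_pos ξ).ne'
    have h4 := freq_sq_eq ξ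
    have h5 : ∀ i : Fin N, besselSymb 1 (word i) ξ * (symb (word i) ξ * F (toL2 w) ξ)
        = symb (fun _ : Fin 2 => i) ξ * ((freq ξ : ℂ)⁻¹ * F (toL2 w) ξ) := by
      intro i
      simp only [besselSymb, symb, word, Fin.prod_univ_two, Fin.prod_univ_one, pow_one]
      ring
    simp only [h5]
    rw [← Finset.sum_mul]
    push_cast at h4 ⊢
    rw [← sub_mul, ← h4, pow_one]
    field_simp
    rfl
  · refine (norm_sub_le _ _).trans ?_
    rw [add_mul]
    refine add_le_add ?_ ?_
    · rw [norm_smul, Real.norm_of_nonneg (by positivity)]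
      refine mul_le_mul_of_nonneg_left ((norm_divFreq_le _).trans ?_) (by positivity)
      rw [hFn]
      exact norm_coord_le (noDeriv N 1) w
    · refine (norm_sum_le _ _).trans ?_
      calc ∑ i, ‖besselMul 1 le_rfl (word i) (F (d i))‖ ≤ ∑ _i : Fin N, ‖w‖ := by
            refine Finset.sum_le_sum fun i _ => ?_
            refine (norm_mulOp_le _ _ _).trans ?_
            rw [one_mul, hFn]
            exact norm_coord_le _ w
        _ = N * ‖w‖ := by simp

end Bessel

/-! ### The Gagliardo–Nirenberg–Sobolev inequality for Bessel potentials -/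

section SobolevInequality

/-- Interpolation of `L^p` norms with a crude constant, from the pointwise inequality
`y^s ≤ D^(s-a) y^a + D^(s-b) y^b` for `a ≤ s ≤ b`. -/
theorem eLpNorm_interpolate {α E : Type*} [MeasurableSpace α] {μ : Measure α}
    [NormedAddCommGroup E] {f : α → E} (hf : AEStronglyMeasurable f μ) {a s b : ℝ} (ha0 : 0 < a)
    (has : a ≤ s) (hsb : s ≤ b) (hs : 1 ≤ s) {D : ℝ≥0∞} (ha : eLpNorm f (ENNReal.ofReal a) μ ≤ D)
    (hb : eLpNorm f (ENNReal.ofReal b) μ ≤ D) : eLpNorm f (ENNReal.ofReal s) μ ≤ 2 * D := by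
  have hs0 : 0 < s := by linarith
  have hb0 : 0 < b := by linarith
  rcases eq_or_ne D ⊤ with rfl | hDt
  · simp
  rcases eq_or_ne D 0 with rfl | hD0
  · have h0 : f =ᵐ[μ] 0 :=
      (eLpNorm_eq_zero_iff hf (by simpa using ha0)).1 (le_antisymm ha zero_le)
    rw [eLpNorm_congr_ae h0]
    simp
  have hpow : ∀ {c : ℝ}, 0 < c → eLpNorm f (ENNReal.ofReal c) μ ≤ D →
      ∫⁻ x, ‖f x‖ₑ ^ c ∂μ ≤ D ^ c := by
    intro c hc h
    rw [eLpNorm_eq_lintegral_rpow_enorm_toReal (by simpa using hc) ENNReal.ofReal_ne_top,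
      ENNReal.toReal_ofReal hc.le, one_div, ENNReal.rpow_inv_le_iff hc] at h
    exact h
  have key : ∀ y : ℝ≥0∞, y ≠ ⊤ → y ^ s ≤ D ^ (s - a) * y ^ a + D ^ (s - b) * y ^ b := by
    intro y hy
    rcases eq_or_ne y 0 with rfl | hy0
    · rw [ENNReal.zero_rpow_of_pos hs0]; exact zero_le
    rcases le_total y D with h | h
    · refine le_add_right ?_
      have : y ^ s = y ^ (s - a) * y ^ a := by
        rw [← ENNReal.rpow_add _ _ hy0 hy, sub_add_cancel]
      rw [this]
      gcongr
    · refine le_add_left ?_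
      have : y ^ s = y ^ (s - b) * y ^ b := by
        rw [← ENNReal.rpow_add _ _ hy0 hy, sub_add_cancel]
      rw [this]
      gcongr ?_ * _
      rw [← neg_sub, ENNReal.rpow_neg, ENNReal.rpow_neg, ENNReal.inv_le_inv]
      gcongr
  have hmeas : AEMeasurable (fun x => D ^ (s - a) * ‖f x‖ₑ ^ a) μ :=
    (hf.enorm.pow_const _).const_mul _
  have hint : ∫⁻ x, ‖f x‖ₑ ^ s ∂μ ≤ 2 * D ^ s := by
    calc ∫⁻ x, ‖f x‖ₑ ^ s ∂μ
        ≤ ∫⁻ x, (D ^ (s - a) * ‖f x‖ₑ ^ a + D ^ (s - b) * ‖f x‖ₑ ^ b) ∂μ :=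
          lintegral_mono fun x => key _ enorm_ne_top
      _ = D ^ (s - a) * ∫⁻ x, ‖f x‖ₑ ^ a ∂μ + D ^ (s - b) * ∫⁻ x, ‖f x‖ₑ ^ b ∂μ := by
          rw [lintegral_add_left' hmeas, lintegral_const_mul'' _ (hf.enorm.pow_const _),
            lintegral_const_mul'' _ (hf.enorm.pow_const _)]
      _ ≤ D ^ (s - a) * D ^ a + D ^ (s - b) * D ^ b := by
          gcongr
          · exact hpow ha0 ha
          · exact hpow hb0 hb
      _ = 2 * D ^ s := by
          rw [← ENNReal.rpow_add _ _ hD0 hDt, ← ENNReal.rpow_add _ _ hD0 hDt, sub_add_cancel,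
            sub_add_cancel, two_mul]
  rw [eLpNorm_eq_lintegral_rpow_enorm_toReal (by simpa using hs0) ENNReal.ofReal_ne_top,
    ENNReal.toReal_ofReal hs0.le, one_div, ENNReal.rpow_inv_le_iff hs0,
    ENNReal.mul_rpow_of_nonneg _ _ hs0.le]
  refine hint.trans ?_
  gcongr
  calc (2 : ℝ≥0∞) = 2 ^ (1 : ℝ) := by simp
    _ ≤ 2 ^ s := ENNReal.rpow_le_rpow_of_exponent_le (by norm_num) hs

variable {N : ℕ}

/-- The operator `T` on `L²` maps boundedly into `L^q`. -/
def MapsInto (T : CL2 N →L[ℂ] CL2 N) (q : ℝ≥0∞) : Prop :=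
  ∃ C : ℝ≥0, ∀ G, eLpNorm (T G) q volume ≤ C * ‖G‖ₑ

/-- A bound into `L^q` on Schwartz functions extends to `L²`, by density and Fatou's lemma. -/
theorem MapsInto.of_schwartz {T : CL2 N →L[ℂ] CL2 N} {q : ℝ≥0∞} {C : ℝ≥0}
    (h : ∀ f : 𝓢(EuclideanSpace ℝ (Fin N), ℂ),
      eLpNorm (T (f.toLp 2 volume)) q volume ≤ C * ‖f.toLp 2 volume‖ₑ) : MapsInto T q := by
  refine ⟨C, fun G => ?_⟩
  have hd : DenseRange (SchwartzMap.toLpCLM ℝ ℂ 2 (volume : Measure (EuclideanSpace ℝ (Fin N)))) :=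
    SchwartzMap.denseRange_toLpCLM (by norm_num)
  obtain ⟨x, hx, hxG⟩ := mem_closure_iff_seq_limit.1 (hd G)
  choose f hf using hx
  have hTx : Tendsto (fun n => T (x n)) atTop (𝓝 (T G)) := (T.continuous.tendsto G).comp hxG
  obtain ⟨ns, hns, hae⟩ := (tendstoInMeasure_of_tendsto_Lp hTx).exists_seq_tendsto_ae
  refine (Lp.eLpNorm_lim_le_liminf_eLpNorm
    (fun n => Lp.aestronglyMeasurable (T (x (ns n)))) _ hae).trans ?_
  have hlim : Tendsto (fun n => (C : ℝ≥0∞) * ‖x (ns n)‖ₑ) atTop (𝓝 (C * ‖G‖ₑ)) :=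
    ENNReal.Tendsto.const_mul ((hxG.comp hns.tendsto_atTop).enorm) (Or.inr ENNReal.coe_ne_top)
  rw [← hlim.liminf_eq]
  refine liminf_le_liminf (Eventually.of_forall fun n => ?_)
  have := h (f (ns n))
  have e : (f (ns n)).toLp 2 volume = x (ns n) := hf (ns n)
  rwa [e] at this

theorem eLpNorm_two_eq (G : CL2 N) : eLpNorm G 2 volume = ‖G‖ₑ := by
  rw [← ofReal_norm, Lp.norm_def, ENNReal.ofReal_toReal (Lp.eLpNorm_ne_top G)]

theorem mapsInto_two (T : CL2 N →L[ℂ] CL2 N) : MapsInto T (ENNReal.ofReal 2) := by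
  refine ⟨‖T‖₊, fun G => ?_⟩
  rw [show ENNReal.ofReal 2 = 2 by norm_num, eLpNorm_two_eq]
  exact T.le_opENorm G

theorem MapsInto.comp {T : CL2 N →L[ℂ] CL2 N} {q : ℝ≥0∞} (h : MapsInto T q)
    (S : CL2 N →L[ℂ] CL2 N) : MapsInto (T ∘L S) q := by
  obtain ⟨C, hC⟩ := h
  refine ⟨C * ‖S‖₊, fun G => (hC (S G)).trans ?_⟩
  rw [ENNReal.coe_mul, mul_assoc]
  gcongr
  exact S.le_opENorm G

theorem MapsInto.interpolate {T : CL2 N →L[ℂ] CL2 N} {s b : ℝ} (h2s : 2 ≤ s) (hsb : s ≤ b)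
    (hb : MapsInto T (ENNReal.ofReal b)) : MapsInto T (ENNReal.ofReal s) := by
  obtain ⟨C, hC⟩ := hb
  obtain ⟨C', hC'⟩ := mapsInto_two T
  refine ⟨2 * (max C C'), fun G => ?_⟩
  have := eLpNorm_interpolate (D := (max C C' : ℝ≥0) * ‖G‖ₑ) (Lp.aestronglyMeasurable (T G))
    two_pos h2s hsb (by linarith) ((hC' G).trans (by gcongr; exact le_max_right _ _))
    ((hC G).trans (by gcongr; exact le_max_left _ _))
  refine this.trans (le_of_eq ?_)
  push_cast
  ring

/-- The Gagliardo–Nirenberg–Sobolev inequality for Schwartz functions. -/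
theorem schwartz_gns (N : ℕ) {s t : ℝ} (hs : 1 ≤ s) (ht : 0 < t) (hN : 0 < N)
    (hst : t⁻¹ = s⁻¹ - (N : ℝ)⁻¹) : ∃ C : ℝ≥0, ∀ g : 𝓢(EuclideanSpace ℝ (Fin N), ℂ),
      eLpNorm g (ENNReal.ofReal t) volume ≤ C * eLpNorm (fderiv ℝ g) (ENNReal.ofReal s) volume := by
  set C := SNormLESNormFDerivOfEqConst ℂ (volume : Measure (EuclideanSpace ℝ (Fin N))) s.toNNReal
    with hC
  refine ⟨C, fun g => ?_⟩
  obtain ⟨B, χ, hχ, hχc, hχ01, hχ1, hχd, hχl⟩ := exists_cutoff N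
  have hB : 0 ≤ B := by simpa using (norm_nonneg _).trans (hχd 0 0)
  have hgs : ContDiff ℝ ∞ g := g.smooth ⊤
  have hs1 : (1 : ℝ≥0∞) ≤ ENNReal.ofReal s := by
    rw [← ENNReal.ofReal_one]; exact ENNReal.ofReal_le_ofReal hs
  have hgd : Continuous (fderiv ℝ g) := hgs.continuous_fderiv (by simp)
  -- The inequality holds for the compactly supported functions `χ n • g`. The gradient of the cutoff
  -- costs `B / (n + 1)`, which disappears in the limit.
  have hstep : ∀ n : ℕ, eLpNorm (fun x => χ n x • g x) (ENNReal.ofReal t) volume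
      ≤ C * (eLpNorm (fderiv ℝ g) (ENNReal.ofReal s) volume
        + ENNReal.ofReal (B / ((n : ℝ) + 1)) * eLpNorm g (ENNReal.ofReal s) volume) := by
    intro n
    have h1 := eLpNorm_le_eLpNorm_fderiv_of_eq (volume : Measure (EuclideanSpace ℝ (Fin N)))
      (u := fun x => χ n x • g x) (p := s.toNNReal) (p' := t.toNNReal)
      (((hχ n).smul hgs).of_le (by simp)) ((hχc n).smul_right) (by simpa using hs)
      (by simpa using hN) (by
        rw [Real.coe_toNNReal _ ht.le, NNReal.coe_inv, Real.coe_toNNReal _ (by linarith), hst]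
        simp)
    refine h1.trans ?_
    gcongr
    have h2 : ∀ x, fderiv ℝ (fun x => χ n x • g x) x
        = χ n x • fderiv ℝ g x + (fderiv ℝ (χ n) x).smulRight (g x) := fun x =>
      fderiv_fun_smul ((hχ n).differentiable (by simp) x) (hgs.differentiable (by simp) x)
    rw [funext h2]
    have hm1 : AEStronglyMeasurable (fun x => χ n x • fderiv ℝ g x) volume :=
      ((hχ n).continuous.smul hgd).aestronglyMeasurable
    have hm2 : AEStronglyMeasurable (fun x => (fderiv ℝ (χ n) x).smulRight (g x)) volume := by
      refine Continuous.aestronglyMeasurable ?_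
      have : Continuous (fderiv ℝ (χ n)) := (hχ n).continuous_fderiv (by simp)
      exact ((ContinuousLinearMap.smulRightL ℝ _ _).continuous₂).comp
        (this.prodMk g.continuous)
    refine (eLpNorm_add_le hm1 hm2 hs1).trans (add_le_add ?_ ?_)
    · refine eLpNorm_mono fun x => ?_
      rw [norm_smul]
      refine mul_le_of_le_one_left (norm_nonneg _) ?_
      rw [Real.norm_of_nonneg (hχ01 n x).1]
      exact (hχ01 n x).2
    · refine eLpNorm_le_mul_eLpNorm_of_ae_le_mul (Eventually.of_forall fun x => ?_) _
      rw [ContinuousLinearMap.norm_smulRight_apply]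
      exact mul_le_mul_of_nonneg_right (hχd n x) (norm_nonneg _)
  have hae : ∀ᵐ x : EuclideanSpace ℝ (Fin N), Tendsto (fun n => χ n x • g x) atTop (𝓝 (g x)) :=
    Eventually.of_forall fun x => by simpa using (hχl x).smul_const (g x)
  refine (Lp.eLpNorm_lim_le_liminf_eLpNorm
    (fun n => ((hχ n).continuous.smul g.continuous).aestronglyMeasurable) _ hae).trans ?_
  have hlim : Tendsto (fun n : ℕ => (C : ℝ≥0∞) * (eLpNorm (fderiv ℝ g) (ENNReal.ofReal s) volume
        + ENNReal.ofReal (B / ((n : ℝ) + 1)) * eLpNorm g (ENNReal.ofReal s) volume)) atTop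
      (𝓝 (C * (eLpNorm (fderiv ℝ g) (ENNReal.ofReal s) volume
        + ENNReal.ofReal 0 * eLpNorm g (ENNReal.ofReal s) volume))) := by
    refine ENNReal.Tendsto.const_mul (tendsto_const_nhds.add ?_) (Or.inr ENNReal.coe_ne_top)
    refine ENNReal.Tendsto.mul_const (ENNReal.tendsto_ofReal ?_)
      (Or.inr (g.memLp _ volume).eLpNorm_ne_top)
    have := (tendsto_one_div_add_atTop_nhds_zero_nat (𝕜 := ℝ)).const_mul B
    simpa [div_eq_mul_inv] using this
  rw [ENNReal.ofReal_zero, zero_mul, add_zero] at hlim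
  rw [← hlim.liminf_eq]
  exact liminf_le_liminf (Eventually.of_forall hstep)

/-- The norm of the gradient is controlled by the partial derivatives. -/
theorem eLpNorm_fderiv_le (g : 𝓢(EuclideanSpace ℝ (Fin N), ℂ)) {q : ℝ≥0∞} (hq : 1 ≤ q) :
    eLpNorm (fderiv ℝ g) q volume
      ≤ ∑ i : Fin N, eLpNorm (LineDeriv.lineDerivOp (EuclideanSpace.single i (1 : ℝ)) g) q volume := by
  have hle : ∀ x, ‖fderiv ℝ g x‖
      ≤ ∑ i : Fin N, ‖LineDeriv.lineDerivOp (EuclideanSpace.single i (1 : ℝ)) g x‖ := by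
    intro x
    refine ContinuousLinearMap.opNorm_le_bound _ (by positivity) fun y => ?_
    have hy : y = ∑ i, y i • EuclideanSpace.single i (1 : ℝ) := by
      ext j
      simp [Finset.sum_apply, Pi.single_apply]
    conv_lhs => rw [hy, map_sum]
    rw [Finset.sum_mul]
    refine (norm_sum_le _ _).trans (Finset.sum_le_sum fun i _ => ?_)
    rw [map_smul, norm_smul, mul_comm, SchwartzMap.lineDerivOp_apply_eq_fderiv]
    exact mul_le_mul_of_nonneg_left (PiLp.norm_apply_le y i) (norm_nonneg _)
  calc eLpNorm (fderiv ℝ g) q volume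
      ≤ eLpNorm (∑ i : Fin N, fun x => ‖LineDeriv.lineDerivOp (EuclideanSpace.single i (1 : ℝ)) g x‖) q
          volume := by
        refine eLpNorm_mono_real fun x => ?_
        rw [Finset.sum_apply]
        exact hle x
    _ ≤ ∑ i : Fin N, eLpNorm (fun x => ‖LineDeriv.lineDerivOp (EuclideanSpace.single i (1 : ℝ)) g x‖) q
          volume := eLpNorm_sum_le (fun i _ =>
            (SchwartzMap.continuous _).aestronglyMeasurable.norm) hq
    _ = _ := by simp only [eLpNorm_norm]

/-- The inverse Fourier transform on complex `L²`. -/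
noncomputable abbrev invF : CL2 N →L[ℂ] CL2 N := FourierTransform.fourierInvCLM ℂ (CL2 N)

/-- The Schwartz function `𝓕⁻ (f / freq ^ k)`. -/
noncomputable def besselSchwartz (k : ℕ) (f : 𝓢(EuclideanSpace ℝ (Fin N), ℂ)) :
    𝓢(EuclideanSpace ℝ (Fin N), ℂ) :=
  𝓕⁻ (SchwartzMap.smulLeftCLM ℂ
    (fun ξ => (2 * Real.pi) ^ (-(k : ℝ)) * (1 + ‖ξ‖ ^ 2) ^ (-(k : ℝ) / 2)) f)

theorem fourier_besselSchwartz (k : ℕ) (f : 𝓢(EuclideanSpace ℝ (Fin N), ℂ))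
    (ξ : EuclideanSpace ℝ (Fin N)) :
    𝓕 (besselSchwartz k f) ξ = ((freq ξ ^ k : ℝ) : ℂ)⁻¹ * f ξ := by
  rw [besselSchwartz, FourierTransform.fourier_fourierInv_eq, SchwartzMap.smulLeftCLM_apply_apply
    (by fun_prop), Complex.real_smul, ← Complex.ofReal_inv]
  congr 2
  unfold freq
  have h0 : (0 : ℝ) < 1 + ‖ξ‖ ^ 2 := by positivity
  rw [mul_pow, mul_inv, ← Real.rpow_natCast (2 * Real.pi) k,
    ← Real.rpow_natCast ((1 + ‖ξ‖ ^ 2) ^ (1 / 2 : ℝ)) k, ← Real.rpow_mul h0.le,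
    ← Real.rpow_neg Real.two_pi_pos.le, ← Real.rpow_neg h0.le]
  congr 2
  ring

theorem lineDeriv_besselSchwartz {k : ℕ} (hk : 1 ≤ k) (f : 𝓢(EuclideanSpace ℝ (Fin N), ℂ))
    (i : Fin N) :
    (LineDeriv.lineDerivOp (EuclideanSpace.single i (1 : ℝ)) (besselSchwartz k f)).toLp 2 volume
      = invF (besselMul k hk (word i) (f.toLp 2 volume)) := by
  set g := LineDeriv.lineDerivOp (EuclideanSpace.single i (1 : ℝ)) (besselSchwartz k f) with hg
  have h1 : besselMul k hk (word i) (f.toLp 2 volume) = (𝓕 g).toLp 2 volume := by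
    refine coeFn_ext_besselMul _ _ ?_
    filter_upwards [f.coeFn_toLp 2 volume, (𝓕 g).coeFn_toLp 2 volume] with ξ e1 e2
    have := fourier_iteratedLineDeriv (word i) (besselSchwartz k f) ξ
    rw [LineDeriv.iteratedLineDerivOp_one] at this
    rw [e1, e2, hg]
    refine this.trans ?_
    rw [fourier_besselSchwartz, besselSymb, mul_assoc]
  rw [h1]
  change _ = 𝓕⁻ ((𝓕 g).toLp 2 volume)
  rw [SchwartzMap.toLp_fourierInv_eq, FourierTransform.fourierInv_fourier_eq]

theorem toLp_besselSchwartz (k : ℕ) (f : 𝓢(EuclideanSpace ℝ (Fin N), ℂ)) :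
    (besselSchwartz k f).toLp 2 volume
      = invF (besselMul k (Nat.zero_le k) Fin.elim0 (f.toLp 2 volume)) := by
  have h1 : besselMul k (Nat.zero_le k) (Fin.elim0 : Fin 0 → Fin N) (f.toLp 2 volume)
      = (𝓕 (besselSchwartz k f)).toLp 2 volume := by
    refine coeFn_ext_besselMul _ _ ?_
    filter_upwards [f.coeFn_toLp 2 volume, (𝓕 (besselSchwartz k f)).coeFn_toLp 2 volume]
      with ξ e1 e2
    rw [e1, e2, fourier_besselSchwartz, besselSymb]
    simp [symb]
  rw [h1]
  change _ = 𝓕⁻ ((𝓕 (besselSchwartz k f)).toLp 2 volume)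
  rw [SchwartzMap.toLp_fourierInv_eq, FourierTransform.fourierInv_fourier_eq]

/-- The operator `(4π² - Δ)^{-k/2} 𝓕⁻` on complex `L²`. -/
noncomputable def besselOp (N k : ℕ) : CL2 N →L[ℂ] CL2 N :=
  invF ∘L besselMul k (Nat.zero_le k) Fin.elim0

theorem toL2_bessel_eq (k : ℕ) (G : CL2 N) : toL2 (bessel k G) = rePart (besselOp N k G) := by
  rw [toL2_bessel]
  have : (noDeriv N k).2 = (Fin.elim0 : Fin 0 → Fin N) := Subsingleton.elim (α := Fin 0 → Fin N) _ _
  rw [this]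
  rfl

/-- Sobolev embedding of Bessel potentials, from an `L^s` bound for the gradient. -/
theorem mapsInto_of_gradient {k : ℕ} (hk : 1 ≤ k) {s t : ℝ} (hs : 1 ≤ s) (ht : 0 < t) (hN : 0 < N)
    (hst : t⁻¹ = s⁻¹ - (N : ℝ)⁻¹)
    (h : ∀ i : Fin N, MapsInto (invF ∘L besselMul k hk (word i)) (ENNReal.ofReal s)) :
    MapsInto (besselOp N k) (ENNReal.ofReal t) := by
  obtain ⟨C, hC⟩ := schwartz_gns N hs ht hN hst
  choose D hD using h
  refine MapsInto.of_schwartz (C := C * ∑ i, D i) fun f => ?_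
  have e1 : besselOp N k (f.toLp 2 volume) = (besselSchwartz k f).toLp 2 volume :=
    (toLp_besselSchwartz k f).symm
  rw [e1, eLpNorm_congr_ae ((besselSchwartz k f).coeFn_toLp 2 volume)]
  refine (hC _).trans ?_
  rw [ENNReal.coe_mul, mul_assoc]
  gcongr
  have hs1 : (1 : ℝ≥0∞) ≤ ENNReal.ofReal s := by
    rw [← ENNReal.ofReal_one]; exact ENNReal.ofReal_le_ofReal hs
  refine (eLpNorm_fderiv_le _ hs1).trans ?_
  push_cast
  rw [Finset.sum_mul]
  refine Finset.sum_le_sum fun i _ => ?_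
  have := hD i (f.toLp 2 volume)
  rw [ContinuousLinearMap.comp_apply, ← lineDeriv_besselSchwartz hk f i,
    eLpNorm_congr_ae (SchwartzMap.coeFn_toLp _ 2 volume)] at this
  exact this

end SobolevInequality

/-! ### Sobolev embeddings and the product estimate -/

section SobolevEmbedding

variable {N : ℕ}

/-- The inclusion `H² ⊆ H¹` as a bounded operator. -/
noncomputable def toH1L (N : ℕ) : Sobolev N 2 →L[ℝ] Sobolev N 1 :=
  ContinuousLinearMap.codRestrict
    (((PiLp.continuousLinearEquiv 2 ℝ (fun _ : DerivIndex N 1 => L2 N)).symm :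
        (DerivIndex N 1 → L2 N) →L[ℝ] PiLp 2 (fun _ : DerivIndex N 1 => L2 N)) ∘L
      ContinuousLinearMap.pi fun α : DerivIndex N 1 =>
        coord (⟨Fin.castLE (by norm_num) α.1, α.2⟩ : DerivIndex N 2))
    (Sobolev N 1) fun w => (toH1 w).2

/-- In dimension at most three, `(4π² - Δ)⁻¹` maps `L²` into `L^∞`. -/
theorem mapsInto_top (hN : N ≤ 3) : MapsInto (besselOp N 2) ⊤ := by
  set h : EuclideanSpace ℝ (Fin N) → ℝ := fun ξ => (freq ξ ^ 2)⁻¹ with hh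
  have hm : Measurable h := (measurable_freq.pow_const 2).inv
  have hL : MemLp h 2 volume := by
    rw [memLp_two_iff_integrable_sq hm.aestronglyMeasurable]
    have := (integrable_rpow_neg_one_add_norm_sq (E := EuclideanSpace ℝ (Fin N)) (r := 4)
      (μ := volume) (by rw [finrank_euclideanSpace_fin]; exact_mod_cast (by omega))).const_mul
      ((4 * Real.pi ^ 2)⁻¹ ^ 2)
    refine this.congr (Eventually.of_forall fun ξ => ?_)
    have h0 : (0 : ℝ) < 1 + ‖ξ‖ ^ 2 := by positivity
    simp only [hh]
    rw [freq_sq, show (-4 / 2 : ℝ) = -(2 : ℕ) by norm_num, Real.rpow_neg h0.le, Real.rpow_natCast,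
      mul_inv (4 * Real.pi ^ 2), mul_pow _ _ 2, inv_pow (1 + ‖ξ‖ ^ 2)]
  -- The symbol `freq⁻²` is square integrable since `N < 4`, so that the inverse Fourier integral is
  -- bounded by the Cauchy–Schwarz inequality.
  refine MapsInto.of_schwartz (C := (eLpNorm h 2 volume).toNNReal) fun f => ?_
  have e1 : besselOp N 2 (f.toLp 2 volume) = (besselSchwartz 2 f).toLp 2 volume :=
    (toLp_besselSchwartz 2 f).symm
  rw [e1, eLpNorm_congr_ae ((besselSchwartz 2 f).coeFn_toLp 2 volume), eLpNorm_exponent_top,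
    ENNReal.coe_toNNReal hL.eLpNorm_ne_top]
  refine eLpNormEssSup_le_of_ae_enorm_bound (Eventually.of_forall fun x => ?_)
  have e2 : besselSchwartz 2 f x = ∫ ξ, Real.fourierChar (inner ℝ ξ x) • (h ξ • f ξ) := by
    have : besselSchwartz 2 f = 𝓕⁻ (𝓕 (besselSchwartz 2 f)) :=
      (FourierTransform.fourierInv_fourier_eq _).symm
    rw [this, SchwartzMap.fourierInv_coe, Real.fourierInv_eq]
    refine integral_congr_ae (Eventually.of_forall fun ξ => ?_)
    simp only []
    rw [fourier_besselSchwartz, Complex.real_smul, hh, Complex.ofReal_inv]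
  rw [e2]
  refine (enorm_integral_le_lintegral_enorm _).trans ?_
  have e3 : ∀ ξ, ‖Real.fourierChar (inner ℝ ξ x) • (h ξ • f ξ)‖ₑ = ‖h ξ • f ξ‖ₑ := by
    intro ξ
    rw [← ofReal_norm, ← ofReal_norm, Circle.norm_smul]
  simp only [e3]
  rw [← eLpNorm_one_eq_lintegral_enorm]
  refine (eLpNorm_smul_le_mul_eLpNorm (p := 2) (q := 2) (r := 1)
    f.continuous.aestronglyMeasurable hm.aestronglyMeasurable).trans (le_of_eq ?_)
  rw [← eLpNorm_congr_ae (f.coeFn_toLp 2 volume), eLpNorm_two_eq]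

theorem besselOp_two_eq : besselOp N 2 = besselOp N 1 ∘L divFreq := by
  ext1 G
  change invF _ = invF _
  congr 1
  refine coeFn_ext_besselMul _ _ ?_
  filter_upwards [coeFn_besselMul (Nat.zero_le 1) (Fin.elim0 : Fin 0 → Fin N) (divFreq G),
    coeFn_divFreq G] with ξ h1 h2
  refine h1.trans ?_
  rw [h2]
  simp only [besselSymb, pow_one]
  push_cast
  rw [pow_two, mul_inv]
  ring

theorem gradient_besselOp_two (i : Fin N) :
    invF ∘L besselMul 2 one_le_two (word i) = besselOp N 1 ∘L besselMul 1 le_rfl (word i) := by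
  ext1 G
  change invF _ = invF _
  congr 1
  refine coeFn_ext_besselMul _ _ ?_
  filter_upwards [coeFn_besselMul (Nat.zero_le 1) (Fin.elim0 : Fin 0 → Fin N)
    (besselMul 1 le_rfl (word i) G), coeFn_besselMul le_rfl (word i) G] with ξ h1 h2
  refine h1.trans ?_
  rw [h2]
  simp only [besselSymb, pow_one, symb, Finset.univ_eq_empty, Finset.prod_empty]
  push_cast
  rw [pow_two, mul_inv]
  ring

/-- Sobolev embedding of `H¹` into `L^q` for `1/q ≥ 1/2 - 1/N`. -/
theorem mapsInto_one (hN : 3 ≤ N) {q : ℝ} (hq : 2 ≤ q)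
    (hqN : (2 : ℝ)⁻¹ - (N : ℝ)⁻¹ ≤ q⁻¹) : MapsInto (besselOp N 1) (ENNReal.ofReal q) := by
  have hN0 : (3 : ℝ) ≤ N := by exact_mod_cast hN
  have h1 : (N : ℝ)⁻¹ ≤ 3⁻¹ := inv_anti₀ (by norm_num) hN0
  have hpos : 0 < (2 : ℝ)⁻¹ - (N : ℝ)⁻¹ := by
    norm_num at h1 ⊢
    linarith
  refine MapsInto.interpolate hq (b := ((2 : ℝ)⁻¹ - (N : ℝ)⁻¹)⁻¹) ?_ ?_
  · exact (le_inv_comm₀ hpos (by linarith)).1 hqN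
  · refine mapsInto_of_gradient le_rfl (s := 2) (by norm_num) (inv_pos.2 hpos) (by omega)
      (inv_inv _) fun i => ?_
    exact mapsInto_two _

/-- Sobolev embedding of `H²` into `L^q` for `1/q ≥ 1/2 - 2/N`. For `N = 4` this is every finite
`q`. -/
theorem mapsInto_two_of_le (hN : 4 ≤ N) {q : ℝ} (hq : 2 ≤ q)
    (hqN : (2 : ℝ)⁻¹ - 2 * (N : ℝ)⁻¹ ≤ q⁻¹) : MapsInto (besselOp N 2) (ENNReal.ofReal q) := by
  rcases le_total ((2 : ℝ)⁻¹ - (N : ℝ)⁻¹) q⁻¹ with h | h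
  · rw [besselOp_two_eq]
    exact (mapsInto_one (by omega) hq h).comp _
  · have hN0 : (0 : ℝ) < (N : ℝ)⁻¹ := inv_pos.2 (by exact_mod_cast (by omega : 0 < N))
    have hq0 : 0 < q⁻¹ := inv_pos.2 (by linarith)
    have hs : 0 < q⁻¹ + (N : ℝ)⁻¹ := by positivity
    have h2 : 2 ≤ (q⁻¹ + (N : ℝ)⁻¹)⁻¹ := by
      rw [le_inv_comm₀ (by norm_num) hs]
      linarith
    refine mapsInto_of_gradient one_le_two (s := (q⁻¹ + (N : ℝ)⁻¹)⁻¹) (by linarith) (by linarith)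
      (by omega) (by rw [inv_inv]; ring) fun i => ?_
    rw [gradient_besselOp_two]
    refine (mapsInto_one (by omega) h2 ?_).comp _
    rw [inv_inv]
    linarith

/-- A Hölder triple of exponents adapted to the product `|u|^(p-1) y`. -/
theorem exists_holder_exponents {p : ℝ} (hp : 1 < p)
    (hpN : 5 ≤ N → p ≤ ((N : ℝ) - 2) / ((N : ℝ) - 4)) :
    ∃ r t : ℝ≥0∞, ENNReal.HolderTriple r t 2 ∧
      MapsInto (besselOp N 2) (r * ENNReal.ofReal (p - 1)) ∧ MapsInto (besselOp N 1) t := by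
  have hp0 : 0 < p - 1 := by linarith
  by_cases hN : N ≤ 3
  · refine ⟨⊤, 2, inferInstance, ?_, ?_⟩
    · rw [ENNReal.top_mul (by simpa using hp0)]
      exact mapsInto_top hN
    · have := mapsInto_two (besselOp N 1)
      simpa using this
  have hN4 : 4 ≤ N := by omega
  have hNR : (4 : ℝ) ≤ N := by exact_mod_cast hN4
  -- `|u|^(p-1)` is taken in `L^r`. For `r ≥ N` the complementary exponent is admissible for `H¹`, and
  -- `r (p - 1) ≥ 2` is needed to use the embedding of `H²` into `L^(r (p - 1))`.
  set r : ℝ := max N (2 / (p - 1)) with hr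
  have hrN : (N : ℝ) ≤ r := le_max_left _ _
  have hr0 : 0 < r := by linarith
  have hrinv : r⁻¹ ≤ (N : ℝ)⁻¹ := inv_anti₀ (by linarith) hrN
  have hN4' : (N : ℝ)⁻¹ ≤ 4⁻¹ := inv_anti₀ (by norm_num) hNR
  have hrpos : 0 < r⁻¹ := inv_pos.2 hr0
  have hd : 0 < (2 : ℝ)⁻¹ - r⁻¹ := by
    have h : r⁻¹ ≤ 4⁻¹ := hrinv.trans hN4'
    norm_num at h ⊢
    linarith
  refine ⟨ENNReal.ofReal r, ENNReal.ofReal ((2 : ℝ)⁻¹ - r⁻¹)⁻¹, ⟨?_⟩, ?_, ?_⟩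
  · rw [← ENNReal.ofReal_inv_of_pos hr0, ← ENNReal.ofReal_inv_of_pos (inv_pos.2 hd), inv_inv,
      ← ENNReal.ofReal_add hrpos.le hd.le, show (2 : ℝ≥0∞) = ENNReal.ofReal 2 by norm_num,
      ← ENNReal.ofReal_inv_of_pos two_pos]
    congr 1
    ring
  · rw [← ENNReal.ofReal_mul hr0.le]
    refine mapsInto_two_of_le hN4 ?_ ?_
    · calc (2 : ℝ) = 2 / (p - 1) * (p - 1) := by field_simp
        _ ≤ r * (p - 1) := by gcongr; exact le_max_right _ _
    · rcases le_total (N : ℝ) (2 / (p - 1)) with h | h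
      · rw [hr, max_eq_right h, div_mul_cancel₀ _ hp0.ne']
        have : (0 : ℝ) < (N : ℝ)⁻¹ := inv_pos.2 (by linarith)
        linarith
      · rw [hr, max_eq_left h]
        -- `1 / (N (p - 1)) ≥ (N - 4) / (2 N)` is the hypothesis on `p`
        have hN0 : (0 : ℝ) < N := by linarith
        have h5 : ((N : ℝ) - 4) * (p - 1) ≤ 2 := by
          rcases hN4.eq_or_lt with h4 | h4
          · rw [← h4]; norm_num
          · have h6 : (5 : ℝ) ≤ N := by exact_mod_cast h4
            have h7 := (le_div_iff₀ (by linarith)).1 (hpN h4)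
            nlinarith
        rw [show (2 : ℝ)⁻¹ - 2 * (N : ℝ)⁻¹ = (N - 4) / (2 * N) by field_simp; ring, ← one_div,
          div_le_div_iff₀ (by positivity) (by positivity)]
        nlinarith
  · refine mapsInto_one (by omega) ?_ ?_
    · rw [le_inv_comm₀ (by norm_num) hd]
      linarith
    · rw [inv_inv]
      linarith

/-- The product estimate `‖ |u|^(p-1) y ‖_{L²} ≤ C ‖u‖_{H²}^(p-1) ‖y‖_{H¹}`. -/
theorem exists_product_estimate {p : ℝ} (hp : 1 < p)
    (hpN : 5 ≤ N → p ≤ ((N : ℝ) - 2) / ((N : ℝ) - 4)) :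
    ∃ C : ℝ, 0 ≤ C ∧ ∀ (u : Sobolev N 2) (y : Sobolev N 1),
      eLpNorm (fun x => |toL2 u x| ^ (p - 1) * |toL2 y x|) 2 volume
        ≤ ENNReal.ofReal (C * (‖u‖ ^ (p - 1) * ‖y‖)) := by
  have hp0 : 0 < p - 1 := by linarith
  obtain ⟨r, t, hrt, ⟨D₂, hD₂⟩, ⟨D₁, hD₁⟩⟩ := exists_holder_exponents hp hpN
  obtain ⟨B₂, hB₂0, hB₂⟩ := exists_bessel_two N
  obtain ⟨B₁, hB₁0, hB₁⟩ := exists_bessel_one N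
  refine ⟨(D₂ * B₂) ^ (p - 1) * (D₁ * B₁), by positivity, fun u y => ?_⟩
  obtain ⟨G, hG, hGn⟩ := hB₂ u
  obtain ⟨H, hH, hHn⟩ := hB₁ y
  have hre : ∀ (K : CL2 N) (q : ℝ≥0∞), eLpNorm (rePart K) q volume ≤ eLpNorm K q volume := by
    intro K q
    refine eLpNorm_mono_ae ?_
    filter_upwards [coeFn_rePart K] with x hx
    rw [hx]
    exact Complex.abs_re_le_norm _
  have h1 : eLpNorm (fun x => ‖toL2 u x‖ ^ (p - 1)) r volume
      ≤ ENNReal.ofReal ((D₂ * B₂ * ‖u‖) ^ (p - 1)) := by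
    rw [eLpNorm_norm_rpow _ hp0, ← ENNReal.ofReal_rpow_of_nonneg (by positivity) hp0.le]
    gcongr
    rw [← hG, toL2_bessel_eq]
    refine (hre _ _).trans ((hD₂ G).trans ?_)
    rw [← ofReal_norm, ← ENNReal.ofReal_coe_nnreal, ← ENNReal.ofReal_mul (by positivity), mul_assoc]
    apply ENNReal.ofReal_le_ofReal
    gcongr
    rwa [hG]
  have h2 : eLpNorm (fun x => ‖toL2 y x‖) t volume ≤ ENNReal.ofReal (D₁ * B₁ * ‖y‖) := by
    rw [eLpNorm_norm, ← hH, toL2_bessel_eq]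
    refine (hre _ _).trans ((hD₁ H).trans ?_)
    rw [← ofReal_norm, ← ENNReal.ofReal_coe_nnreal, ← ENNReal.ofReal_mul (by positivity), mul_assoc]
    apply ENNReal.ofReal_le_ofReal
    gcongr
    rwa [hH]
  have hu : AEStronglyMeasurable (fun x => ‖toL2 u x‖ ^ (p - 1)) volume :=
    ((Lp.aestronglyMeasurable (toL2 u)).norm.aemeasurable.pow_const _).aestronglyMeasurable
  refine (eLpNorm_smul_le_mul_eLpNorm (p := r) (q := t) (r := 2)
    (φ := fun x => ‖toL2 u x‖ ^ (p - 1)) (f := fun x => ‖toL2 y x‖)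
    (Lp.aestronglyMeasurable (toL2 y)).norm hu).trans ((mul_le_mul' h1 h2).trans (le_of_eq ?_))
  rw [← ENNReal.ofReal_mul (by positivity), Real.mul_rpow (by positivity) (by positivity)]
  congr 1
  ring

/-- The embedding `H² ⊆ L^(2p)`. -/
theorem exists_embedding {p : ℝ} (hp : 1 < p)
    (hpN : 5 ≤ N → p ≤ ((N : ℝ) - 2) / ((N : ℝ) - 4)) :
    ∃ C : ℝ, 0 ≤ C ∧ ∀ u : Sobolev N 2,
      eLpNorm (toL2 u) (ENNReal.ofReal (2 * p)) volume ≤ ENNReal.ofReal (C * ‖u‖) := by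
  obtain ⟨C, hC0, hC⟩ := exists_product_estimate hp hpN
  have hp0 : 0 < p := by linarith
  refine ⟨(C * ‖toH1L N‖) ^ p⁻¹, by positivity, fun u => ?_⟩
  have h := hC u (toH1 u)
  rw [toL2_toH1] at h
  have e : (fun x => |toL2 u x| ^ (p - 1) * |toL2 u x|) = fun x => ‖toL2 u x‖ ^ p := by
    funext x
    rw [Real.norm_eq_abs]
    rcases (abs_nonneg (toL2 u x)).eq_or_lt with h0 | h0
    · rw [← h0, mul_zero, Real.zero_rpow hp0.ne']
    · rw [← Real.rpow_add_one h0.ne', sub_add_cancel]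
  have e2 : (2 : ℝ≥0∞) * ENNReal.ofReal p = ENNReal.ofReal (2 * p) := by
    rw [ENNReal.ofReal_mul (by norm_num)]
    norm_num
  rw [e, eLpNorm_norm_rpow _ hp0, e2, ← ENNReal.le_rpow_inv_iff hp0] at h
  refine h.trans ?_
  rw [ENNReal.ofReal_rpow_of_nonneg (by positivity) (by positivity)]
  apply ENNReal.ofReal_le_ofReal
  have h3 : C * (‖u‖ ^ (p - 1) * ‖toH1 u‖) ≤ (C * ‖toH1L N‖) * ‖u‖ ^ p := by
    have : ‖toH1 u‖ ≤ ‖toH1L N‖ * ‖u‖ := (toH1L N).le_opNorm u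
    calc C * (‖u‖ ^ (p - 1) * ‖toH1 u‖) ≤ C * (‖u‖ ^ (p - 1) * (‖toH1L N‖ * ‖u‖)) := by gcongr
      _ = (C * ‖toH1L N‖) * (‖u‖ ^ (p - 1) * ‖u‖) := by ring
      _ = _ := by
        congr 1
        rcases (norm_nonneg u).eq_or_lt with h0 | h0
        · rw [← h0, mul_zero, Real.zero_rpow hp0.ne']
        · rw [← Real.rpow_add_one h0.ne', sub_add_cancel]
  refine (Real.rpow_le_rpow (by positivity) h3 (by positivity)).trans (le_of_eq ?_)
  rw [Real.mul_rpow (by positivity) (by positivity), ← Real.rpow_mul (norm_nonneg _),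
    mul_inv_cancel₀ hp0.ne', Real.rpow_one]

end SobolevEmbedding

/-! ### Products of groups -/

section ProductGroup

variable {E₁ E₂ : Type*} [NormedAddCommGroup E₁] [NormedSpace ℝ E₁] [NormedAddCommGroup E₂]
  [NormedSpace ℝ E₂]

/-- The product of two isometry groups. -/
def IsometryGroup.prod (R₁ : IsometryGroup E₁) (R₂ : IsometryGroup E₂) :
    IsometryGroup (E₁ × E₂) where
  toFun t :=
    { LinearMap.prodMap (R₁.toFun t).toLinearMap (R₂.toFun t).toLinearMap with
      norm_map' := fun z => by
        change ‖(R₁.toFun t z.1, R₂.toFun t z.2)‖ = ‖z‖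
        rw [Prod.norm_def, Prod.norm_def, R₁.norm_apply, R₂.norm_apply] }
  map_zero' z := Prod.ext (R₁.map_zero' z.1) (R₂.map_zero' z.2)
  map_add' s t z := Prod.ext (R₁.map_add' s t z.1) (R₂.map_add' s t z.2)
  continuous' z := (R₁.continuous' z.1).prodMk (R₂.continuous' z.2)

variable {R₁ : IsometryGroup E₁} {R₂ : IsometryGroup E₂}

theorem IsometryGroup.prod_apply (t : ℝ) (z : E₁ × E₂) :
    (R₁.prod R₂).toFun t z = (R₁.toFun t z.1, R₂.toFun t z.2) := rfl

theorem IsometryGroup.fav_prod {K : ℝ} {z : E₁ × E₂} :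
    (R₁.prod R₂).Fav K z ↔ R₁.Fav K z.1 ∧ R₂.Fav K z.2 := by
  constructor
  · intro h
    exact ⟨fun t ht => (norm_fst_le _).trans (h t ht), fun t ht => (norm_snd_le _).trans (h t ht)⟩
  · rintro ⟨h1, h2⟩ t ht
    exact max_le (h1 t ht) (h2 t ht)

variable [CompleteSpace E₁] [CompleteSpace E₂]

theorem IsometryGroup.duhamel_prod {F : ℝ → E₁ × E₂} (hF : Continuous F) (t : ℝ) :
    (R₁.prod R₂).duhamel F t
      = (R₁.duhamel (fun s => (F s).1) t, R₂.duhamel (fun s => (F s).2) t) := by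
  have hi := ((R₁.prod R₂).continuous_integrand hF t).intervalIntegrable (μ := volume) 0 t
  exact Prod.ext ((ContinuousLinearMap.fst ℝ E₁ E₂).intervalIntegral_comp_comm hi).symm
    ((ContinuousLinearMap.snd ℝ E₁ E₂).intervalIntegral_comp_comm hi).symm

end ProductGroup

section Generator

variable {α : Type*} [MeasurableSpace α] {μ : Measure α} {θ : α → ℝ}

theorem gen_smul (c : ℂ) {z : Lp ℂ 2 μ} (hz : InDom θ z) :
    InDom θ (c • z) ∧ gen θ (c • z) = c • gen θ z := by
  refine gen_eq_of_ae ?_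
  filter_upwards [coeFn_gen hz, Lp.coeFn_smul c z, Lp.coeFn_smul c (gen θ z)] with x h1 h2 h3
  rw [h3, h2, Pi.smul_apply, Pi.smul_apply, h1, smul_eq_mul, smul_eq_mul, mul_left_comm]

theorem gen_neg_symbol {z : Lp ℂ 2 μ} (hz : InDom (fun x => -θ x) z) :
    InDom θ z ∧ gen θ z = -gen (fun x => -θ x) z := by
  refine gen_eq_of_ae ?_
  filter_upwards [coeFn_gen hz, Lp.coeFn_neg (gen (fun x => -θ x) z)] with x h1 h2
  rw [h2, Pi.neg_apply, h1]
  push_cast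
  ring

theorem inDom_neg_symbol {z : Lp ℂ 2 μ} (hz : InDom θ z) :
    InDom (fun x => -θ x) z ∧ gen (fun x => -θ x) z = -gen θ z := by
  refine gen_eq_of_ae ?_
  filter_upwards [coeFn_gen hz, Lp.coeFn_neg (gen θ z)] with x h1 h2
  rw [h2, Pi.neg_apply, h1]
  push_cast
  ring

end Generator

/-! ### The power nonlinearity -/

section PowerNonlinearity

variable {N : ℕ}

open Classical in
/-- The function `|u|^p` as an element of `L²`, with value `0` when it is not square integrable. -/
noncomputable def powL2 (p : ℝ) (u : L2 N) : L2 N :=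
  if h : MemLp (fun x => |u x| ^ p) 2 volume then h.toLp else 0

theorem coeFn_powL2 {p : ℝ} {u : L2 N} (h : MemLp (fun x => |u x| ^ p) 2 volume) :
    powL2 p u =ᵐ[volume] fun x => |u x| ^ p := by
  unfold powL2
  rw [dif_pos h]
  exact h.coeFn_toLp

/-- The mean value estimate for the power nonlinearity. -/
theorem abs_rpow_sub_rpow_le {p : ℝ} (hp : 1 ≤ p) (a b : ℝ) :
    |(|a| ^ p - |b| ^ p)| ≤ p * ((|a| ^ (p - 1) + |b| ^ (p - 1)) * |a - b|) := by
  have key : ∀ x y : ℝ, 0 ≤ x → x ≤ y → y ^ p - x ^ p ≤ p * (y ^ (p - 1) * (y - x)) := by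
    intro x y hx hxy
    have := (convex_Icc x y).image_sub_le_mul_sub_of_deriv_le (f := fun s => s ^ p)
      (C := p * y ^ (p - 1))
      (Real.continuous_rpow_const (by linarith)).continuousOn
      (fun s _ => (Real.differentiable_rpow_const hp s).differentiableWithinAt) ?_ x
      (left_mem_Icc.2 hxy) y (right_mem_Icc.2 hxy) hxy
    · rw [mul_assoc] at this
      exact this
    · intro s hs
      rw [interior_Icc] at hs
      rw [Real.deriv_rpow_const]
      have : s ^ (p - 1) ≤ y ^ (p - 1) :=
        Real.rpow_le_rpow (hx.trans hs.1.le) hs.2.le (by linarith)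
      gcongr
  have ha : 0 ≤ |a| ^ (p - 1) := by positivity
  have hb : 0 ≤ |b| ^ (p - 1) := by positivity
  have h0 := abs_nonneg (a - b)
  rcases le_total |a| |b| with h | h
  · rw [abs_sub_comm, abs_of_nonneg (sub_nonneg.2 (Real.rpow_le_rpow (abs_nonneg _) h (by linarith)))]
    refine (key _ _ (abs_nonneg _) h).trans ?_
    have h1 : |b| - |a| ≤ |a - b| := by
      rw [abs_sub_comm a b]
      exact abs_sub_abs_le_abs_sub b a
    gcongr
    linarith
  · rw [abs_of_nonneg (sub_nonneg.2 (Real.rpow_le_rpow (abs_nonneg _) h (by linarith)))]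
    refine (key _ _ (abs_nonneg _) h).trans ?_
    have h1 : |a| - |b| ≤ |a - b| := abs_sub_abs_le_abs_sub a b
    gcongr
    linarith

theorem abs_rpow_eq_mul {p : ℝ} (hp : 0 < p) (a : ℝ) : |a| ^ p = |a| ^ (p - 1) * |a| := by
  rcases (abs_nonneg a).eq_or_lt with h0 | h0
  · rw [← h0, mul_zero, Real.zero_rpow hp.ne']
  · rw [← Real.rpow_add_one h0.ne', sub_add_cancel]

/-- The power nonlinearity is well defined on `H²`, and Lipschitz on bounded subsets of `H²` from
the `H¹` distance to `L²`. -/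
theorem exists_powL2_estimate {p : ℝ} (hp : 1 < p)
    (hpN : 5 ≤ N → p ≤ ((N : ℝ) - 2) / ((N : ℝ) - 4)) :
    (∀ u : Sobolev N 2, MemLp (fun x => |toL2 u x| ^ p) 2 volume) ∧
    ∃ C : ℝ, 0 ≤ C ∧ ∀ u w : Sobolev N 2, ‖powL2 p (toL2 u) - powL2 p (toL2 w)‖
      ≤ C * ((‖u‖ ^ (p - 1) + ‖w‖ ^ (p - 1)) * ‖toH1 u - toH1 w‖) := by
  obtain ⟨C, hC0, hC⟩ := exists_product_estimate (N := N) hp hpN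
  have hp0 : 0 < p := by linarith
  have hm : ∀ (u : Sobolev N 2) (y : Sobolev N 1),
      AEStronglyMeasurable (fun x => |toL2 u x| ^ (p - 1) * |toL2 y x|) volume := fun u y =>
    (((Lp.aestronglyMeasurable (toL2 u)).norm.aemeasurable.pow_const _).mul
      (Lp.aestronglyMeasurable (toL2 y)).norm.aemeasurable).aestronglyMeasurable
  have hM : ∀ u : Sobolev N 2, MemLp (fun x => |toL2 u x| ^ p) 2 volume := by
    intro u
    have h := hC u (toH1 u)
    have hm' := hm u (toH1 u)
    rw [toL2_toH1] at h hm'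
    have e : (fun x => |toL2 u x| ^ p) = fun x => |toL2 u x| ^ (p - 1) * |toL2 u x| :=
      funext fun x => abs_rpow_eq_mul hp0 _
    rw [e]
    exact ⟨hm', h.trans_lt ENNReal.ofReal_lt_top⟩
  refine ⟨hM, p * C, by positivity, fun u w => ?_⟩
  set y := toH1 u - toH1 w with hy
  have hyae : toL2 y =ᵐ[volume] fun x => toL2 u x - toL2 w x := by
    have : toL2 y = toL2 u - toL2 w := by
      rw [← coord_noDeriv, hy, map_sub, coord_noDeriv, coord_noDeriv, toL2_toH1, toL2_toH1]
    rw [this]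
    exact Lp.coeFn_sub _ _
  have h1 : eLpNorm (powL2 p (toL2 u) - powL2 p (toL2 w) : L2 N) 2 volume
      ≤ eLpNorm (p • ((fun x => |toL2 u x| ^ (p - 1) * |toL2 y x|)
        + fun x => |toL2 w x| ^ (p - 1) * |toL2 y x|)) 2 volume := by
    refine eLpNorm_mono_ae ?_
    filter_upwards [Lp.coeFn_sub (powL2 p (toL2 u)) (powL2 p (toL2 w)), coeFn_powL2 (hM u),
      coeFn_powL2 (hM w), hyae] with x e1 e2 e3 e4
    rw [e1, Pi.sub_apply, e2, e3, Pi.smul_apply, Pi.add_apply, e4, smul_eq_mul, Real.norm_eq_abs,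
      Real.norm_of_nonneg (by positivity), ← add_mul]
    exact abs_rpow_sub_rpow_le hp.le _ _
  have h2 : eLpNorm (powL2 p (toL2 u) - powL2 p (toL2 w) : L2 N) 2 volume
      ≤ ENNReal.ofReal (p * C * ((‖u‖ ^ (p - 1) + ‖w‖ ^ (p - 1)) * ‖y‖)) := by
    refine h1.trans ?_
    rw [eLpNorm_const_smul]
    have h3 := (eLpNorm_add_le (hm u y) (hm w y) (by norm_num : (1 : ℝ≥0∞) ≤ 2)).trans
      (add_le_add (hC u y) (hC w y))
    rw [← ENNReal.ofReal_add (by positivity) (by positivity)] at h3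
    rw [mul_assoc, ENNReal.ofReal_mul hp0.le, ← ofReal_norm, Real.norm_of_nonneg hp0.le]
    gcongr
    refine h3.trans (le_of_eq ?_)
    congr 1
    ring
  rw [Lp.norm_def]
  exact ENNReal.toReal_le_of_le_ofReal (by positivity) h2

end PowerNonlinearity

theorem norm_smul_sub_smul_le {E : Type*} [NormedAddCommGroup E] [NormedSpace ℝ E]
    {x y : ℝ} {u w : E} {d e L₁ M₁ L₂ M₂ : ℝ} (h1 : |x - y| ≤ L₁ * d) (h2 : |y| ≤ M₁)
    (h3 : ‖u - w‖ ≤ L₂ * e) (h4 : ‖u‖ ≤ M₂) (hd : 0 ≤ d) (he : 0 ≤ e) (hL₁ : 0 ≤ L₁)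
    (hL₂ : 0 ≤ L₂) : ‖x • u - y • w‖ ≤ (L₁ * M₂ + M₁ * L₂) * (d + e) := by
  have e1 : x • u - y • w = (x - y) • u + y • (u - w) := by
    rw [sub_smul, smul_sub]; abel
  have hM₂ : 0 ≤ M₂ := (norm_nonneg _).trans h4
  have hM₁ : 0 ≤ M₁ := (abs_nonneg _).trans h2
  rw [e1]
  refine (norm_add_le _ _).trans ?_
  rw [norm_smul, norm_smul, Real.norm_eq_abs, Real.norm_eq_abs]
  calc |x - y| * ‖u‖ + |y| * ‖u - w‖ ≤ L₁ * d * M₂ + M₁ * (L₂ * e) := by gcongr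
    _ ≤ (L₁ * M₂ + M₁ * L₂) * (d + e) := by
      have : 0 ≤ L₁ * M₂ * e + M₁ * L₂ * d := by positivity
      nlinarith

/-! ### The half-wave group -/

section WaveGroup

variable {N : ℕ}

theorem laplacian_eq_sum (w : Sobolev N 2) :
    laplacian w = ∑ i : Fin N, coord (⟨2, fun _ => i⟩ : DerivIndex N 2) w := rfl

/-- `-Δ + 4π²` inverts the Bessel potential of order two. -/
theorem laplacian_bessel (G : CL2 N) :
    laplacian (bessel 2 G) = (4 * Real.pi ^ 2) • toL2 (bessel 2 G) - reFourierInv G := by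
  rw [laplacian_eq_sum]
  simp only [coord_bessel]
  rw [toL2_bessel, ← map_sum, ← map_smul, ← map_sub]
  congr 1
  apply Lp.ext
  have h2 : ∀ᵐ ξ, ∀ i : Fin N, besselMul 2 le_rfl (fun _ : Fin 2 => i) G ξ
      = besselSymb 2 (fun _ : Fin 2 => i) ξ * G ξ := by
    rw [ae_all_iff]
    exact fun i => coeFn_besselMul le_rfl (fun _ : Fin 2 => i) G
  filter_upwards [h2, coeFn_besselMul (Nat.zero_le 2) (noDeriv N 2).2 G,
    Lp.coeFn_sub ((4 * Real.pi ^ 2 : ℝ) • besselMul 2 (Nat.zero_le 2) (noDeriv N 2).2 G) G,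
    Lp.coeFn_smul (4 * Real.pi ^ 2 : ℝ) (besselMul 2 (Nat.zero_le 2) (noDeriv N 2).2 G),
    Lp.coeFn_fun_finsetSum Finset.univ (fun i : Fin N => besselMul 2 le_rfl (fun _ : Fin 2 => i) G)]
    with ξ e1 e2 e3 e4 e5
  refine e5.trans ?_
  rw [e3, Pi.sub_apply, e4, Pi.smul_apply, e2]
  simp only [e1]
  have h3 : (freq ξ : ℂ) ≠ 0 := by exact_mod_cast (freq_pos ξ).ne'
  have h4 := freq_sq_eq ξ
  have h5 : symb (j := 0) (noDeriv N 2).2 ξ = 1 := by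
    unfold symb
    exact Fin.prod_univ_zero _
  simp only [besselSymb, h5, Complex.real_smul]
  rw [← Finset.sum_mul, ← Finset.sum_mul]
  push_cast at h4 ⊢
  have h6 : ∑ i, symb (fun _ : Fin 2 => i) ξ = 4 * Real.pi ^ 2 - (freq ξ : ℂ) ^ 2 := by
    rw [h4]; ring
  rw [h6]
  field_simp

/-- The group `e^{∓it(4π²-Δ)^{1/2}}` on the Fourier side. -/
noncomputable def waveGroup (N : ℕ) : IsometryGroup (CL2 N × CL2 N) :=
  (phaseGroup volume (measurable_freq (N := N))).prod
    (phaseGroup volume (measurable_freq (N := N)).neg)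

/-- With `z = (V - iU, V + iU)`, this is `U`. -/
noncomputable def displacementPart (N : ℕ) : CL2 N × CL2 N →L[ℝ] CL2 N :=
  ((((Complex.I / 2) • ContinuousLinearMap.id ℂ (CL2 N)).restrictScalars ℝ : CL2 N →L[ℝ] CL2 N)) ∘L
    (ContinuousLinearMap.fst ℝ (CL2 N) (CL2 N) - ContinuousLinearMap.snd ℝ (CL2 N) (CL2 N))

/-- With `z = (V - iU, V + iU)`, this is `V`. -/
noncomputable def velocityPart (N : ℕ) : CL2 N × CL2 N →L[ℝ] CL2 N :=
  ((((1 / 2 : ℂ) • ContinuousLinearMap.id ℂ (CL2 N)).restrictScalars ℝ : CL2 N →L[ℝ] CL2 N)) ∘L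
    (ContinuousLinearMap.fst ℝ (CL2 N) (CL2 N) + ContinuousLinearMap.snd ℝ (CL2 N) (CL2 N))

theorem displacementPart_apply (z : CL2 N × CL2 N) :
    displacementPart N z = (Complex.I / 2) • (z.1 - z.2) := rfl

theorem velocityPart_apply (z : CL2 N × CL2 N) :
    velocityPart N z = (1 / 2 : ℂ) • (z.1 + z.2) := rfl

theorem norm_displacementPart_le (z : CL2 N × CL2 N) : ‖displacementPart N z‖ ≤ ‖z‖ := by
  rw [displacementPart_apply, norm_smul]
  have h := norm_sub_le z.1 z.2
  have h1 := norm_fst_le z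
  have h2 := norm_snd_le z
  norm_num
  linarith

theorem norm_velocityPart_le (z : CL2 N × CL2 N) : ‖velocityPart N z‖ ≤ ‖z‖ := by
  rw [velocityPart_apply, norm_smul]
  have h := norm_add_le z.1 z.2
  have h1 := norm_fst_le z
  have h2 := norm_snd_le z
  norm_num
  linarith

/-- The generator of the wave group in the variables `U`, `V`. -/
theorem gen_parts {z : CL2 N × CL2 N} {g₁ g₂ : CL2 N}
    (h₁ : InDom freq z.1 ∧ gen freq z.1 = g₁) (h₂ : InDom freq z.2 ∧ gen freq z.2 = g₂) :
    (InDom freq (displacementPart N z) ∧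
      gen freq (displacementPart N z) = displacementPart N (g₁, g₂)) ∧
    (InDom freq (velocityPart N z) ∧ gen freq (velocityPart N z) = velocityPart N (g₁, g₂)) := by
  obtain ⟨a1, rfl⟩ := h₁
  obtain ⟨a2, rfl⟩ := h₂
  obtain ⟨b1, b2⟩ := gen_smul (-1) a2
  obtain ⟨c1, c2⟩ := gen_add a1 b1
  obtain ⟨d1, d2⟩ := gen_smul (Complex.I / 2) c1
  obtain ⟨e1, e2⟩ := gen_add a1 a2
  obtain ⟨f1, f2⟩ := gen_smul (1 / 2) e1
  rw [c2, b2] at d2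
  rw [e2] at f2
  rw [neg_one_smul, ← sub_eq_add_neg] at d1 d2
  rw [neg_one_smul, ← sub_eq_add_neg] at d2
  exact ⟨⟨d1, d2⟩, ⟨f1, f2⟩⟩

theorem inDom_of_fav {K : ℝ} {z : CL2 N × CL2 N} (hz : (waveGroup N).Fav K z) :
    InDom freq z.1 ∧ InDom freq z.2 ∧ ‖gen freq z.1‖ ≤ K ∧ ‖gen freq z.2‖ ≤ K := by
  obtain ⟨h1, h2⟩ := IsometryGroup.fav_prod.1 hz
  obtain ⟨a1, a2⟩ := Fav.inDom measurable_freq h1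
  obtain ⟨b1, b2⟩ := Fav.inDom measurable_freq.neg h2
  obtain ⟨c1, c2⟩ := gen_neg_symbol b1
  refine ⟨a1, c1, a2, ?_⟩
  rw [c2, norm_neg]
  exact b2

/-- On the domain, the displacement is the Bessel potential of an `L²` function. -/
theorem displacement_eq {z : CL2 N × CL2 N} (h₁ : InDom freq z.1) (h₂ : InDom freq z.2) :
    toH1 (bessel 2 (displacementPart N (gen freq z.1, gen freq z.2)))
        = bessel 1 (displacementPart N z) ∧
    toL2 (bessel 2 (displacementPart N (gen freq z.1, gen freq z.2)))
        = reFourierInv (divFreq (displacementPart N z)) := by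
  obtain ⟨⟨a, b⟩, -⟩ := gen_parts ⟨h₁, rfl⟩ ⟨h₂, rfl⟩
  have h : toH1 (bessel 2 (displacementPart N (gen freq z.1, gen freq z.2)))
      = bessel 1 (displacementPart N z) := by
    rw [toH1_bessel, ← b, divFreq_gen a]
  refine ⟨h, ?_⟩
  rw [← toL2_toH1, h, toL2_bessel_zero_one]

/-- The forcing `-β v + 4π² u + c |u|^p` as a function of the state; the term `4π² u` compensates
for the mass in the symbol of the wave group. -/
noncomputable def waveForcing (p : ℝ) (β c : ℝ → ℝ) (t : ℝ) (z : CL2 N × CL2 N) : L2 N :=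
  (4 * Real.pi ^ 2) • reFourierInv (divFreq (displacementPart N z))
    - β t • reFourierInv (velocityPart N z)
    + c t • powL2 p (reFourierInv (divFreq (displacementPart N z)))

/-- The isometric embedding of forcings into the state space. -/
noncomputable def embedForcing (N : ℕ) (f : L2 N) : CL2 N × CL2 N :=
  (𝓕 (toComplex f), 𝓕 (toComplex f))

theorem embedForcing_sub (f g : L2 N) :
    embedForcing N f - embedForcing N g = embedForcing N (f - g) := by
  have h : (𝓕 (toComplex (f - g)) : CL2 N) = 𝓕 (toComplex f) - 𝓕 (toComplex g) := by
    rw [map_sub]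
    exact map_sub (FourierTransform.fourierCLM ℂ (CL2 N)) _ _
  unfold embedForcing
  rw [h]
  rfl

theorem norm_embedForcing (f : L2 N) : ‖embedForcing N f‖ = ‖f‖ := by
  unfold embedForcing
  rw [Prod.norm_def]
  simp only [max_self]
  rw [Lp.norm_fourier_eq, norm_toComplex]

theorem displacementPart_embedForcing (f : L2 N) : displacementPart N (embedForcing N f) = 0 := by
  rw [displacementPart_apply]
  unfold embedForcing
  simp

theorem reFourierInv_velocityPart_embedForcing (f : L2 N) :
    reFourierInv (velocityPart N (embedForcing N f)) = f := by
  have : velocityPart N (embedForcing N f) = 𝓕 (toComplex f) := by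
    rw [velocityPart_apply]
    unfold embedForcing
    simp only
    rw [← two_smul ℂ, smul_smul]
    norm_num
  rw [this, reFourierInv_apply, FourierTransform.fourierInv_fourier_eq, rePart_toComplex]

/-- The nonlinearity is Lipschitz on bounded subsets of the Favard class: there the displacement is
bounded in `H²`, and its differences are controlled in `H¹` by the distance of the states. -/
theorem locLip_waveForcing {p : ℝ} (hp : 1 < p)
    (hpN : 5 ≤ N → p ≤ ((N : ℝ) - 2) / ((N : ℝ) - 4)) {S : ℝ} {β c : ℝ → ℝ} {L M : ℝ}
    (hL : 0 ≤ L) (hM : 0 ≤ M) (hβ : ∀ t ∈ Icc 0 S, |β t| ≤ M) (hc : ∀ t ∈ Icc 0 S, |c t| ≤ M)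
    (hβl : ∀ s ∈ Icc 0 S, ∀ t ∈ Icc 0 S, |β s - β t| ≤ L * |s - t|)
    (hcl : ∀ s ∈ Icc 0 S, ∀ t ∈ Icc 0 S, |c s - c t| ≤ L * |s - t|) :
    (waveGroup N).LocLip S fun t z => embedForcing N (waveForcing p β c t z) := by
  intro K
  obtain ⟨-, C, hC0, hC⟩ := exists_powL2_estimate (N := N) hp hpN
  set B₁ := ‖(bessel 1 : CL2 N →L[ℝ] Sobolev N 1)‖ with hB₁
  set B₂ := ‖(bessel 2 : CL2 N →L[ℝ] Sobolev N 2)‖ with hB₂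
  set K' := max K 0 with hK'
  have hK'0 : 0 ≤ K' := le_max_right _ _
  set Q := C * (((B₂ * K') ^ (p - 1) + (B₂ * K') ^ (p - 1)) * B₁) with hQ
  have hp0 : 0 ≤ p - 1 := by linarith
  have hQ0 : 0 ≤ Q := by positivity
  have hp00 : powL2 p (0 : L2 N) = 0 := by
    have h := hC 0 0
    have h0 : toL2 (0 : Sobolev N 2) = 0 := rfl
    have hm : MemLp (fun x => |(0 : L2 N) x| ^ p) 2 volume := by
      rw [← h0]
      exact (exists_powL2_estimate (N := N) hp hpN).1 0
    apply Lp.ext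
    filter_upwards [coeFn_powL2 hm, Lp.coeFn_zero ℝ 2 (volume : Measure (EuclideanSpace ℝ (Fin N)))]
      with x h1 h2
    rw [h1, h2, Pi.zero_apply, abs_zero, Real.zero_rpow (by linarith)]
  have hre : ∀ G : CL2 N, ‖reFourierInv (divFreq G)‖ ≤ ‖G‖ := fun G =>
    (norm_reFourierInv_le _).trans (norm_divFreq_le _)
  -- the power is Lipschitz on the bounded part of the Favard class
  have hpow : ∀ z w : CL2 N × CL2 N, (waveGroup N).Fav K z → (waveGroup N).Fav K w →
      ‖powL2 p (reFourierInv (divFreq (displacementPart N z)))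
        - powL2 p (reFourierInv (divFreq (displacementPart N w)))‖ ≤ Q * ‖z - w‖ := by
    intro z w hz hw
    obtain ⟨z1, z2, z3, z4⟩ := inDom_of_fav hz
    obtain ⟨w1, w2, w3, w4⟩ := inDom_of_fav hw
    obtain ⟨za, zb⟩ := displacement_eq z1 z2
    obtain ⟨wa, wb⟩ := displacement_eq w1 w2
    have hn : ∀ g₁ g₂ : CL2 N, ‖g₁‖ ≤ K → ‖g₂‖ ≤ K →
        ‖bessel 2 (displacementPart N (g₁, g₂))‖ ≤ B₂ * K' := by
      intro g₁ g₂ h1 h2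
      refine (ContinuousLinearMap.le_opNorm _ _).trans ?_
      refine mul_le_mul_of_nonneg_left ((norm_displacementPart_le _).trans ?_) (by positivity)
      exact (max_le h1 h2).trans (le_max_left _ _)
    rw [← zb, ← wb]
    refine (hC _ _).trans ?_
    rw [za, wa, ← map_sub, ← map_sub, hQ, mul_assoc, mul_assoc]
    have h5 : ‖bessel 1 (displacementPart N (z - w))‖ ≤ B₁ * ‖z - w‖ :=
      (ContinuousLinearMap.le_opNorm _ _).trans
        (mul_le_mul_of_nonneg_left (norm_displacementPart_le _) (by positivity))
    have h6 := hn _ _ z3 z4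
    have h7 := hn _ _ w3 w4
    gcongr
  refine ⟨4 * Real.pi ^ 2 + (L * K' + M * 1) + (L * (Q * K') + M * Q), ?_, ?_⟩
  · positivity
  intro s hs t ht z w hz hzF hw hwF
  rw [embedForcing_sub, norm_embedForcing]
  have hzK : ‖z‖ ≤ K' := hz.trans (le_max_left _ _)
  have hwK : ‖w‖ ≤ K' := hw.trans (le_max_left _ _)
  have e : waveForcing p β c s z - waveForcing p β c t w
      = (4 * Real.pi ^ 2) • reFourierInv (divFreq (displacementPart N (z - w)))
        - (β s • reFourierInv (velocityPart N z) - β t • reFourierInv (velocityPart N w))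
        + (c s • powL2 p (reFourierInv (divFreq (displacementPart N z)))
          - c t • powL2 p (reFourierInv (divFreq (displacementPart N w)))) := by
    unfold waveForcing
    rw [map_sub, map_sub, map_sub, smul_sub]
    abel
  have h1 : ‖(4 * Real.pi ^ 2) • reFourierInv (divFreq (displacementPart N (z - w)))‖
      ≤ 4 * Real.pi ^ 2 * (|s - t| + ‖z - w‖) := by
    rw [norm_smul, Real.norm_of_nonneg (by positivity)]
    have := (hre _).trans (norm_displacementPart_le (z - w))
    have h0 := abs_nonneg (s - t)
    gcongr
    linarith
  have h2 : ‖β s • reFourierInv (velocityPart N z) - β t • reFourierInv (velocityPart N w)‖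
      ≤ (L * K' + M * 1) * (|s - t| + ‖z - w‖) := by
    refine norm_smul_sub_smul_le (hβl s hs t ht) (hβ t ht) ?_ ?_ (abs_nonneg _) (norm_nonneg _) hL
      zero_le_one
    · rw [← map_sub, ← map_sub, one_mul]
      exact (norm_reFourierInv_le _).trans (norm_velocityPart_le _)
    · exact (norm_reFourierInv_le _).trans ((norm_velocityPart_le _).trans hzK)
  have hfav0 : (waveGroup N).Fav K (0 : CL2 N × CL2 N) := by
    intro h hh
    rw [map_zero, sub_zero, norm_zero]
    exact mul_nonneg ((norm_nonneg _).trans hz) hh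
  have h3 : ‖c s • powL2 p (reFourierInv (divFreq (displacementPart N z)))
      - c t • powL2 p (reFourierInv (divFreq (displacementPart N w)))‖
      ≤ (L * (Q * K') + M * Q) * (|s - t| + ‖z - w‖) := by
    refine norm_smul_sub_smul_le (hcl s hs t ht) (hc t ht) (hpow z w hzF hwF) ?_ (abs_nonneg _)
      (norm_nonneg _) hL hQ0
    have := hpow z 0 hzF hfav0
    rw [map_zero, map_zero, map_zero, hp00, sub_zero, sub_zero] at this
    exact this.trans (mul_le_mul_of_nonneg_left hzK hQ0)
  rw [e]
  refine (norm_add_le _ _).trans ((add_le_add_left (norm_sub_le _ _) _).trans ?_)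
  rw [add_mul, add_mul]
  exact add_le_add (add_le_add h1 h2) h3

end WaveGroup

/-! ### Local existence for the wave equation with constant speed -/

section WaveExistence

variable {N : ℕ}

theorem HasDerivWithinAt.continuousLinear {E F : Type*} [NormedAddCommGroup E] [NormedSpace ℝ E]
    [NormedAddCommGroup F] [NormedSpace ℝ F] (Φ : E →L[ℝ] F) {f : ℝ → E} {f' : E} {s : Set ℝ}
    {t : ℝ} (h : HasDerivWithinAt f f' s t) :
    HasDerivWithinAt (fun t => Φ (f t)) (Φ f') s t := Φ.hasFDerivAt.comp_hasDerivWithinAt t h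

/-- Mild solutions of the first order system with Lipschitz forcing are classical. -/
theorem waveGroup_regularity {F z : ℝ → CL2 N × CL2 N} {z₀ : CL2 N × CL2 N} {ℓ T K : ℝ}
    (hFl : ∀ s t, ‖F s - F t‖ ≤ ℓ * |s - t|)
    (hzt : ∀ t ∈ Icc 0 T, z t = (waveGroup N).toFun t z₀ + (waveGroup N).duhamel F t)
    (hK : ∀ t ∈ Icc 0 T, (waveGroup N).Fav K (z t)) :
    ContinuousOn (fun t => (gen freq (z t).1, gen freq (z t).2)) (Icc 0 T) ∧
    ∀ t ∈ Icc 0 T, HasDerivWithinAt z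
      (((-Complex.I) • gen freq (z t).1, Complex.I • gen freq (z t).2) + F t) (Icc 0 T) t := by
  have hFc := continuous_of_lipschitz hFl
  have hzt' : ∀ t ∈ Icc 0 T, z t
      = ((phaseGroup volume (measurable_freq (N := N))).toFun t z₀.1
          + (phaseGroup volume (measurable_freq (N := N))).duhamel (fun s => (F s).1) t,
        (phaseGroup volume (measurable_freq (N := N)).neg).toFun t z₀.2
          + (phaseGroup volume (measurable_freq (N := N)).neg).duhamel (fun s => (F s).2) t) := by
    intro t ht
    rw [hzt t ht, waveGroup, IsometryGroup.prod_apply, IsometryGroup.duhamel_prod hFc]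
    rfl
  have hfav := fun t ht => IsometryGroup.fav_prod.1 (hK t ht)
  obtain ⟨hc1, hd1⟩ := mild_regularity (measurable_freq (N := N)) (F := fun s => (F s).1)
    (z := fun t => (z t).1) (z₀ := z₀.1) (fun s t => (norm_fst_le (F s - F t)).trans (hFl s t))
    (fun t ht => by simp only [hzt' t ht]) (fun t ht => (hfav t ht).1)
  obtain ⟨hc2, hd2⟩ := mild_regularity (measurable_freq (N := N)).neg (F := fun s => (F s).2)
    (z := fun t => (z t).2) (z₀ := z₀.2) (fun s t => (norm_snd_le (F s - F t)).trans (hFl s t))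
    (fun t ht => by simp only [hzt' t ht]) (fun t ht => (hfav t ht).2)
  have hneg : ∀ t ∈ Icc 0 T, gen freq (z t).2 = -gen (fun x => -freq x) (z t).2 := fun t ht =>
    (gen_neg_symbol (Fav.inDom measurable_freq.neg (hfav t ht).2).1).2
  have hc2' : ContinuousOn (fun t => gen freq (z t).2) (Icc 0 T) :=
    hc2.neg.congr fun t ht => hneg t ht
  refine ⟨hc1.prodMk hc2', fun t ht => ?_⟩
  have e : -Complex.I • gen (fun x => -freq x) (z t).2 + (F t).2
      = Complex.I • gen freq (z t).2 + (F t).2 := by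
    rw [hneg t ht, smul_neg, neg_smul]
  exact (hd1 t ht).prodMk ((hd2 t ht).congr_deriv e)

theorem displacementPart_system (g : CL2 N × CL2 N) (f : L2 N) :
    displacementPart N (((-Complex.I) • g.1, Complex.I • g.2) + embedForcing N f)
      = velocityPart N g := by
  rw [map_add, displacementPart_embedForcing, add_zero, displacementPart_apply, velocityPart_apply]
  simp only
  rw [smul_sub, smul_smul, smul_smul, smul_add]
  have e1 : Complex.I / 2 * -Complex.I = 1 / 2 := by linear_combination (-1 / 2 : ℂ) * Complex.I_sq
  have e2 : Complex.I / 2 * Complex.I = -(1 / 2) := by linear_combination (1 / 2 : ℂ) * Complex.I_sq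
  rw [e1, e2, neg_smul, sub_neg_eq_add]

theorem velocityPart_system (g : CL2 N × CL2 N) (f : L2 N) :
    reFourierInv (velocityPart N (((-Complex.I) • g.1, Complex.I • g.2) + embedForcing N f))
      = -reFourierInv (displacementPart N g) + f := by
  rw [map_add, map_add, reFourierInv_velocityPart_embedForcing, ← map_neg]
  congr 2
  rw [displacementPart_apply, velocityPart_apply]
  simp only
  rw [smul_add, smul_smul, smul_smul, ← smul_neg, neg_sub, smul_sub]
  have e1 : 1 / 2 * -Complex.I = -(Complex.I / 2) := by ring
  have e2 : 1 / 2 * Complex.I = Complex.I / 2 := by ring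
  rw [e1, e2, neg_smul]
  abel

/-- The initial state of the first order system for the data `(u₀, u₁)`, with bounds. -/
theorem exists_initial_state (N : ℕ) : ∃ C : ℝ, 0 ≤ C ∧
    ∀ (u₀ : Sobolev N 2) (u₁ : Sobolev N 1) (K₀ : ℝ), ‖u₀‖ ≤ K₀ → ‖u₁‖ ≤ K₀ →
      ∃ z : CL2 N × CL2 N, ‖z‖ ≤ C * K₀ ∧ (waveGroup N).Fav (C * K₀) z ∧
        bessel 2 (displacementPart N (gen freq z.1, gen freq z.2)) = u₀ ∧
        bessel 1 (velocityPart N (gen freq z.1, gen freq z.2)) = u₁ := by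
  obtain ⟨B₂, hB₂0, hB₂⟩ := exists_bessel_two N
  obtain ⟨B₁, hB₁0, hB₁⟩ := exists_bessel_one N
  refine ⟨B₁ + B₂, by positivity, fun u₀ u₁ K₀ hu₀ hu₁ => ?_⟩
  rw [add_mul]
  obtain ⟨G, hG, hGn⟩ := hB₂ u₀
  obtain ⟨H, hH, hHn⟩ := hB₁ u₁
  have hGK : ‖G‖ ≤ B₂ * K₀ := hGn.trans (mul_le_mul_of_nonneg_left hu₀ hB₂0)
  have hHK : ‖H‖ ≤ B₁ * K₀ := hHn.trans (mul_le_mul_of_nonneg_left hu₁ hB₁0)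
  obtain ⟨g1, g2⟩ := gen_divFreq G
  obtain ⟨k1, k2⟩ := gen_divFreq H
  obtain ⟨i1, i2⟩ := gen_smul (-Complex.I) g1
  obtain ⟨j1, j2⟩ := gen_smul Complex.I g1
  obtain ⟨m1, m2⟩ := gen_add k1 i1
  obtain ⟨n1, n2⟩ := gen_add k1 j1
  rw [i2, g2, k2] at m2
  rw [j2, g2, k2] at n2
  have hIG : ∀ (c : ℂ) (A B : CL2 N), ‖c‖ = 1 → ‖A‖ ≤ B₁ * K₀ → ‖B‖ ≤ B₂ * K₀ →
      ‖A + c • B‖ ≤ B₁ * K₀ + B₂ * K₀ := by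
    intro c A B hc hA hB
    refine (norm_add_le _ _).trans (add_le_add hA ?_)
    rw [norm_smul, hc, one_mul]
    exact hB
  have hI : ‖Complex.I‖ = 1 := Complex.norm_I
  have hI' : ‖-Complex.I‖ = 1 := by rw [norm_neg, hI]
  have hdG := (norm_divFreq_le G).trans hGK
  have hdH := (norm_divFreq_le H).trans hHK
  -- `z = V ∓ i U`, where `U` and `V` are the data on the Fourier side with one frequency divided out
  refine ⟨(divFreq H + (-Complex.I) • divFreq G, divFreq H + Complex.I • divFreq G),
    max_le (hIG _ _ _ hI' hdH hdG) (hIG _ _ _ hI hdH hdG), IsometryGroup.fav_prod.2 ⟨?_, ?_⟩,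
    ?_, ?_⟩
  · refine (InDom.fav measurable_freq m1).mono ?_
    rw [m2]
    exact hIG _ _ _ hI' hHK hGK
  · obtain ⟨a1, a2⟩ := inDom_neg_symbol n1
    refine (InDom.fav measurable_freq.neg a1).mono ?_
    change ‖gen (fun x => -freq x) _‖ ≤ _
    rw [a2, norm_neg, n2]
    exact hIG _ _ _ hI hHK hGK
  · rw [← hG, m2, n2, displacementPart_apply]
    congr 1
    simp only
    rw [add_sub_add_left_eq_sub, ← sub_smul, smul_smul]
    have : Complex.I / 2 * (-Complex.I - Complex.I) = 1 := by
      linear_combination (-1 : ℂ) * Complex.I_sq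
    rw [this, one_smul]
  · rw [← hH, m2, n2, velocityPart_apply]
    congr 1
    simp only
    rw [add_add_add_comm, ← add_smul, neg_add_cancel, zero_smul, add_zero, ← two_smul ℂ, smul_smul]
    norm_num

/-- The first order system, rewritten as the wave equation for the displacement. -/
theorem wave_of_system {z : ℝ → CL2 N × CL2 N} {f : ℝ → L2 N} {T : ℝ}
    (hdom : ∀ t ∈ Icc 0 T, InDom freq (z t).1 ∧ InDom freq (z t).2)
    (hzd : ∀ t ∈ Icc 0 T, HasDerivWithinAt z
      (((-Complex.I) • gen freq (z t).1, Complex.I • gen freq (z t).2) + embedForcing N (f t))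
      (Icc 0 T) t) :
    (∀ t ∈ Icc 0 T, HasDerivWithinAt
      (fun s => toH1 (bessel 2 (displacementPart N (gen freq (z s).1, gen freq (z s).2))))
      (bessel 1 (velocityPart N (gen freq (z t).1, gen freq (z t).2))) (Icc 0 T) t) ∧
    (∀ t ∈ Icc 0 T, toL2 (bessel 1 (velocityPart N (gen freq (z t).1, gen freq (z t).2)))
      = reFourierInv (velocityPart N (z t))) ∧
    ∀ t ∈ Icc 0 T, HasDerivWithinAt
      (fun s => toL2 (bessel 1 (velocityPart N (gen freq (z s).1, gen freq (z s).2))))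
      (-reFourierInv (displacementPart N (gen freq (z t).1, gen freq (z t).2)) + f t)
      (Icc 0 T) t := by
  have hy : ∀ t ∈ Icc 0 T, toL2 (bessel 1 (velocityPart N (gen freq (z t).1, gen freq (z t).2)))
      = reFourierInv (velocityPart N (z t)) := by
    intro t ht
    obtain ⟨-, a, b⟩ := gen_parts ⟨(hdom t ht).1, rfl⟩ ⟨(hdom t ht).2, rfl⟩
    rw [toL2_bessel_zero_one, ← b, divFreq_gen a]
  refine ⟨fun t ht => ?_, hy, fun t ht => ?_⟩
  · have h1 := HasDerivWithinAt.continuousLinear (bessel 1 ∘L displacementPart N) (hzd t ht)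
    refine (h1.congr (fun s hs => (displacement_eq (hdom s hs).1 (hdom s hs).2).1)
      (displacement_eq (hdom t ht).1 (hdom t ht).2).1).congr_deriv ?_
    rw [ContinuousLinearMap.comp_apply, displacementPart_system (_, _)]
  · have h1 := HasDerivWithinAt.continuousLinear (reFourierInv ∘L velocityPart N) (hzd t ht)
    refine (h1.congr (fun s hs => hy s hs) (hy t ht)).congr_deriv ?_
    rw [ContinuousLinearMap.comp_apply, velocityPart_system (_, _)]

/-- Local existence for `w'' - Δw = -β w' + c |w|^p`, on a time interval that depends only on a
bound for the data. -/
theorem exists_wave_solution {p : ℝ} (hp : 1 < p)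
    (hpN : 5 ≤ N → p ≤ ((N : ℝ) - 2) / ((N : ℝ) - 4)) {S : ℝ} (hS : 0 < S) {β c : ℝ → ℝ} {L M : ℝ}
    (hL : 0 ≤ L) (hM : 0 ≤ M) (hβ : ∀ t ∈ Icc 0 S, |β t| ≤ M) (hc : ∀ t ∈ Icc 0 S, |c t| ≤ M)
    (hβl : ∀ s ∈ Icc 0 S, ∀ t ∈ Icc 0 S, |β s - β t| ≤ L * |s - t|)
    (hcl : ∀ s ∈ Icc 0 S, ∀ t ∈ Icc 0 S, |c s - c t| ≤ L * |s - t|) (K₀ : ℝ) :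
    ∃ T > 0, T ≤ S ∧ ∀ (u₀ : Sobolev N 2) (u₁ : Sobolev N 1), ‖u₀‖ ≤ K₀ → ‖u₁‖ ≤ K₀ →
      ∃ (w : ℝ → Sobolev N 2) (y : ℝ → Sobolev N 1), ContinuousOn w (Icc 0 T) ∧
        ContinuousOn y (Icc 0 T) ∧ w 0 = u₀ ∧ y 0 = u₁ ∧
        (∀ t ∈ Icc 0 T, HasDerivWithinAt (fun s => toH1 (w s)) (y t) (Icc 0 T) t) ∧
        ∀ t ∈ Icc 0 T, HasDerivWithinAt (fun s => toL2 (y s))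
          (laplacian (w t) - β t • toL2 (y t) + c t • powL2 p (toL2 (w t))) (Icc 0 T) t := by
  obtain ⟨C, hC0, hinit⟩ := exists_initial_state N
  have hloc := locLip_waveForcing (N := N) hp hpN hL hM hβ hc hβl hcl
  obtain ⟨T, hT, hTS, K, hsol⟩ := (waveGroup N).exists_mild hS hloc (C * K₀)
  refine ⟨T, hT, hTS, fun u₀ u₁ hu₀ hu₁ => ?_⟩
  obtain ⟨z₀, hz₀, hz₀F, e₀, e₁⟩ := hinit u₀ u₁ K₀ hu₀ hu₁
  obtain ⟨z, hz, hzt⟩ := hsol z₀ hz₀ hz₀F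
  have h0T : (0 : ℝ) ∈ Icc 0 T := ⟨le_rfl, hT.le⟩
  have hK0 : 0 ≤ K := (norm_nonneg _).trans (hz.norm_le 0 h0T)
  obtain ⟨L', hL'0, hL'⟩ := hloc K
  obtain ⟨hΓ, hzd⟩ := waveGroup_regularity
    (IsometryGroup.forcing_lipschitz hT.le hTS hL'0 hL' hz hK0) hzt hz.fav
  have hdom := fun t ht => inDom_of_fav (hz.fav t ht)
  obtain ⟨hw, hy, hyd⟩ := wave_of_system (f := fun t => waveForcing p β c t (z t))
    (fun t ht => ⟨(hdom t ht).1, (hdom t ht).2.1⟩) (fun t ht => by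
      have := hzd t ht
      rwa [IsometryGroup.clamp_of_mem ht] at this)
  have hz0 : z 0 = z₀ := by
    rw [hzt 0 h0T, (waveGroup N).map_zero']
    simp [IsometryGroup.duhamel]
  refine ⟨fun t => bessel 2 (displacementPart N (gen freq (z t).1, gen freq (z t).2)),
    fun t => bessel 1 (velocityPart N (gen freq (z t).1, gen freq (z t).2)),
    (bessel 2).continuous.comp_continuousOn ((displacementPart N).continuous.comp_continuousOn hΓ),
    (bessel 1).continuous.comp_continuousOn ((velocityPart N).continuous.comp_continuousOn hΓ),
    ?_, ?_, hw, fun t ht => ?_⟩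
  · simp only [hz0]
    exact e₀
  · simp only [hz0]
    exact e₁
  · refine (hyd t ht).congr_deriv ?_
    rw [hy t ht, laplacian_bessel, (displacement_eq (hdom t ht).1 (hdom t ht).2.1).2, waveForcing]
    abel

end WaveExistence

/-! ### The coefficients -/

section Coefficients

variable {a b : ℝ → ℝ}

theorem hasDerivWithinAt_integral_Ici {h : ℝ → ℝ} (hh : ContinuousOn h (Ici 0)) {t : ℝ}
    (ht : 0 ≤ t) : HasDerivWithinAt (fun t => ∫ r in (0 : ℝ)..t, h r) (h t) (Ici 0) t := by
  set e : ℝ → ℝ := fun t => h (max t 0) with he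
  have hc : Continuous e := hh.comp_continuous (by fun_prop) fun t => le_max_right t 0
  have heq : ∀ t ∈ Ici (0 : ℝ), ∫ r in (0 : ℝ)..t, h r = ∫ r in (0 : ℝ)..t, e r := by
    intro t ht
    refine intervalIntegral.integral_congr fun r hr => ?_
    rw [uIcc_of_le ht] at hr
    rw [he]
    simp only [max_eq_left hr.1]
  have h1 := (intervalIntegral.integral_hasDerivAt_right (hc.intervalIntegrable 0 t)
    (hc.stronglyMeasurableAtFilter _ _) hc.continuousAt).hasDerivWithinAt (s := Ici 0)
  have h2 : e t = h t := by rw [he]; simp only [max_eq_left ht]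
  rw [h2] at h1
  exact h1.congr heq (heq t ht)

theorem AssumptionA1.continuousOn_a (h : AssumptionA1 a b) : ContinuousOn a (Ici 0) :=
  h.a_smooth.continuousOn

theorem AssumptionA1.continuousOn_b (h : AssumptionA1 a b) : ContinuousOn b (Ici 0) :=
  h.b_smooth.continuousOn

theorem AssumptionA1.hasDeriv_a (h : AssumptionA1 a b) {t : ℝ} (ht : 0 ≤ t) :
    HasDerivWithinAt a (derivWithin a (Ici 0) t) (Ici 0) t :=
  (h.a_smooth.differentiableOn (by norm_num) t ht).hasDerivWithinAt

theorem AssumptionA1.contDiffOn_deriv_a (h : AssumptionA1 a b) :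
    ContDiffOn ℝ 1 (derivWithin a (Ici 0)) (Ici 0) :=
  h.a_smooth.derivWithin (uniqueDiffOn_Ici 0) (by norm_num)

theorem AssumptionA1.hasDeriv_primitiveA (h : AssumptionA1 a b) {t : ℝ} (ht : 0 ≤ t) :
    HasDerivWithinAt (primitiveA a) (a t) (Ici 0) t :=
  hasDerivWithinAt_integral_Ici h.continuousOn_a ht

theorem primitiveA_zero (a : ℝ → ℝ) : primitiveA a 0 = 0 := by simp [primitiveA]

theorem AssumptionA1.continuousOn_primitiveA (h : AssumptionA1 a b) :
    ContinuousOn (primitiveA a) (Ici 0) := fun _ ht =>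
  (h.hasDeriv_primitiveA ht).continuousWithinAt

theorem AssumptionA1.intervalIntegrable_a (h : AssumptionA1 a b) {s t : ℝ} (hs : 0 ≤ s)
    (ht : 0 ≤ t) : IntervalIntegrable a volume s t :=
  (h.continuousOn_a.mono fun _ hr => (le_min hs ht).trans hr.1).intervalIntegrable

theorem AssumptionA1.primitiveA_sub (h : AssumptionA1 a b) {s t : ℝ} (hs : 0 ≤ s) (ht : 0 ≤ t) :
    primitiveA a t - primitiveA a s = ∫ r in s..t, a r := by
  rw [primitiveA, primitiveA, intervalIntegral.integral_interval_sub_left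
    (h.intervalIntegrable_a le_rfl ht) (h.intervalIntegrable_a le_rfl hs)]

theorem AssumptionA1.strictMonoOn_primitiveA (h : AssumptionA1 a b) :
    StrictMonoOn (primitiveA a) (Ici 0) := by
  intro s hs t ht hst
  rw [← sub_pos, h.primitiveA_sub hs ht]
  exact intervalIntegral.intervalIntegral_pos_of_pos_on (h.intervalIntegrable_a hs ht)
    (fun r hr => h.a_pos r (le_trans hs hr.1.le)) hst

theorem AssumptionA1.primitiveA_nonneg (h : AssumptionA1 a b) {t : ℝ} (ht : 0 ≤ t) :
    0 ≤ primitiveA a t := by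
  rw [← primitiveA_zero a]
  exact h.strictMonoOn_primitiveA.monotoneOn (mem_Ici.2 le_rfl) ht ht

theorem AssumptionA1.primitiveA_pos (h : AssumptionA1 a b) {t : ℝ} (ht : 0 < t) :
    0 < primitiveA a t := by
  rw [← primitiveA_zero a]
  exact h.strictMonoOn_primitiveA (mem_Ici.2 le_rfl) ht.le ht

theorem exists_lipschitz_of_contDiffOn {h : ℝ → ℝ} (hh : ContDiffOn ℝ 1 h (Ici 0)) (T : ℝ) :
    ∃ L, 0 ≤ L ∧ (∀ s ∈ Icc 0 T, |h s| ≤ L) ∧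
      ∀ s ∈ Icc 0 T, ∀ t ∈ Icc 0 T, |h s - h t| ≤ L * |s - t| := by
  have hsub : Icc 0 T ⊆ Ici (0 : ℝ) := fun t ht => ht.1
  obtain ⟨C, hC⟩ := isCompact_Icc.exists_bound_of_continuousOn (hh.continuousOn.mono hsub)
  obtain ⟨D, hD⟩ := isCompact_Icc.exists_bound_of_continuousOn
    ((hh.continuousOn_derivWithin (uniqueDiffOn_Ici 0) le_rfl).mono hsub)
  refine ⟨max (max C D) 0, le_max_right _ _, fun s hs => (hC s hs).trans
    ((le_max_left _ _).trans (le_max_left _ _)), fun s hs t ht => ?_⟩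
  have h1 := (convex_Icc 0 T).norm_image_sub_le_of_norm_hasDerivWithin_le
    (fun r hr => ((hh.differentiableOn (by norm_num) r (hsub hr)).hasDerivWithinAt).mono hsub)
    hD ht hs
  refine h1.trans (mul_le_mul_of_nonneg_right ?_ (abs_nonneg _))
  exact (le_max_right _ _).trans (le_max_left _ _)

theorem contDiffOn_of_hasDerivWithinAt {F : Type*} [NormedAddCommGroup F] [NormedSpace ℝ F]
    {f f' : ℝ → F} {s : Set ℝ} (hs : UniqueDiffOn ℝ s) (h : ∀ t ∈ s, HasDerivWithinAt f (f' t) s t)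
    (hc : ContinuousOn f' s) :
    ContDiffOn ℝ 1 f s ∧ ∀ t ∈ s, derivWithin f s t = f' t := by
  have hd : ∀ t ∈ s, derivWithin f s t = f' t := fun t ht => (h t ht).derivWithin (hs t ht)
  exact ⟨(contDiffOn_one_iff_derivWithin hs).2
    ⟨fun t ht => (h t ht).differentiableWithinAt, hc.congr hd⟩, hd⟩

theorem contDiffOn_two_of_hasDerivWithinAt {F : Type*} [NormedAddCommGroup F] [NormedSpace ℝ F]
    {f f' f'' : ℝ → F} {s : Set ℝ} (hs : UniqueDiffOn ℝ s)
    (h : ∀ t ∈ s, HasDerivWithinAt f (f' t) s t) (h' : ∀ t ∈ s, HasDerivWithinAt f' (f'' t) s t)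
    (hc : ContinuousOn f'' s) :
    ContDiffOn ℝ 2 f s ∧ ∀ t ∈ s, iteratedDerivWithin 2 f s t = f'' t := by
  have hd : ∀ t ∈ s, derivWithin f s t = f' t := fun t ht => (h t ht).derivWithin (hs t ht)
  obtain ⟨h1, h2⟩ := contDiffOn_of_hasDerivWithinAt hs h' hc
  constructor
  · rw [show (2 : WithTop ℕ∞) = 1 + 1 by norm_num, contDiffOn_succ_iff_derivWithin hs]
    exact ⟨fun t ht => (h t ht).differentiableWithinAt, by simp, h1.congr hd⟩
  · intro t ht
    rw [iteratedDerivWithin_succ, iteratedDerivWithin_one, derivWithin_congr hd (hd t ht)]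
    exact h2 t ht

end Coefficients

/-! ### Local existence of strong solutions -/

section LocalExistence

variable {N : ℕ}

/-- The Laplacian as a bounded operator. -/
noncomputable def laplacianL (N : ℕ) : Sobolev N 2 →L[ℝ] L2 N :=
  ∑ i : Fin N, coord (⟨2, fun _ => i⟩ : DerivIndex N 2)

theorem laplacianL_apply (w : Sobolev N 2) : laplacianL N w = laplacian w := by
  rw [laplacianL, laplacian_eq_sum, sum_apply]

theorem continuousOn_powL2 {p : ℝ} (hp : 1 < p)
    (hpN : 5 ≤ N → p ≤ ((N : ℝ) - 2) / ((N : ℝ) - 4)) {w : ℝ → Sobolev N 2} {s : Set ℝ}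
    (hw : ContinuousOn w s) : ContinuousOn (fun t => powL2 p (toL2 (w t))) s := by
  obtain ⟨-, C, hC0, hC⟩ := exists_powL2_estimate (N := N) hp hpN
  intro t ht
  rw [ContinuousWithinAt, tendsto_iff_norm_sub_tendsto_zero]
  have hwt := hw t ht
  have h1 : Tendsto (fun r => C * ((‖w r‖ ^ (p - 1) + ‖w t‖ ^ (p - 1))
      * ‖toH1L N (w r) - toH1L N (w t)‖)) (𝓝[s] t) (𝓝 0) := by
    have h2 : ContinuousWithinAt (fun r => C * ((‖w r‖ ^ (p - 1) + ‖w t‖ ^ (p - 1))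
      * ‖toH1L N (w r) - toH1L N (w t)‖)) s t :=
      ContinuousWithinAt.mul continuousWithinAt_const (ContinuousWithinAt.mul
        ((hwt.norm.rpow_const (Or.inr (by linarith))).add continuousWithinAt_const)
        ((((toH1L N).continuous.continuousAt.comp_continuousWithinAt hwt).sub
          continuousWithinAt_const).norm))
    have h3 := h2.tendsto
    simpa using h3
  exact squeeze_zero (fun _ => norm_nonneg _) (fun r => hC _ _) h1

/-- Local existence of strong solutions, on a time interval that does not depend on the size
`ε ≤ 1` of the data. -/
theorem exists_local_solution {a b : ℝ → ℝ} {p : ℝ} (hp : 1 < p)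
    (hpN : 5 ≤ N → p ≤ ((N : ℝ) - 2) / ((N : ℝ) - 4)) (h : AssumptionA1 a b)
    (f : Sobolev N 2) (g : Sobolev N 1) : ∃ T₀ > 0, ∀ ε : ℝ, 0 < ε → ε ≤ 1 →
      ∃ u : ℝ → Sobolev N 2, IsStrongSolution N a b p (ε • f) (ε • g) T₀ u := by
  set A := primitiveA a with hA
  set a' := derivWithin a (Ici 0) with ha'
  have hsub : Icc 0 1 ⊆ Ici (0 : ℝ) := fun t ht => ht.1
  have hA0 : A 0 = 0 := primitiveA_zero a
  have hS : 0 < A 1 := h.primitiveA_pos one_pos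
  have ha0 : ∀ t ∈ Ici (0 : ℝ), a t ≠ 0 := fun t ht => (h.a_pos t ht).ne'
  have hcinv : ContDiffOn ℝ 2 (fun t => (a t)⁻¹) (Ici 0) := h.a_smooth.inv ha0
  -- the inverse of `A` on `[0, A 1]`
  have himg : A '' Icc 0 1 = Icc 0 (A 1) := by
    have hc : ContinuousOn A (Icc 0 1) := h.continuousOn_primitiveA.mono hsub
    have hm : MonotoneOn A (Icc 0 1) := h.strictMonoOn_primitiveA.monotoneOn.mono hsub
    have := hc.image_Icc_of_monotoneOn zero_le_one hm
    rwa [hA0] at this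
  set τ := Function.invFunOn A (Icc 0 1) with hτ
  have hτmem : ∀ σ ∈ Icc 0 (A 1), τ σ ∈ Icc (0 : ℝ) 1 := fun σ hσ => by
    rw [← himg] at hσ
    exact Function.invFunOn_mem hσ
  have hAτ : ∀ σ ∈ Icc 0 (A 1), A (τ σ) = σ := fun σ hσ => by
    rw [← himg] at hσ
    exact Function.invFunOn_eq hσ
  obtain ⟨m, hm, hma⟩ : ∃ m > 0, ∀ t ∈ Icc (0 : ℝ) 1, m ≤ a t := by
    obtain ⟨t₀, ht₀, hmin⟩ := isCompact_Icc.exists_isMinOn (nonempty_Icc.2 zero_le_one)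
      (h.continuousOn_a.mono hsub)
    exact ⟨a t₀, h.a_pos t₀ ht₀.1, fun t ht => hmin ht⟩
  have hτl : ∀ s ∈ Icc 0 (A 1), ∀ t ∈ Icc 0 (A 1), |τ s - τ t| ≤ m⁻¹ * |s - t| := by
    have key : ∀ s ∈ Icc (0 : ℝ) 1, ∀ t ∈ Icc (0 : ℝ) 1, s ≤ t → m * (t - s) ≤ A t - A s := by
      intro s hs t ht hst
      rw [hA, h.primitiveA_sub hs.1 ht.1, mul_comm, ← smul_eq_mul,
        ← intervalIntegral.integral_const]
      exact intervalIntegral.integral_mono_on hst (by simp) (h.intervalIntegrable_a hs.1 ht.1)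
        fun r hr => hma r ⟨hs.1.trans hr.1, hr.2.trans ht.2⟩
    intro s hs t ht
    rw [inv_mul_eq_div, le_div_iff₀' hm]
    rcases le_total (τ s) (τ t) with hst | hst
    · have := key _ (hτmem s hs) _ (hτmem t ht) hst
      rw [hAτ s hs, hAτ t ht] at this
      rw [abs_sub_comm, abs_of_nonneg (sub_nonneg.2 hst), abs_sub_comm]
      exact this.trans (le_abs_self _)
    · have := key _ (hτmem t ht) _ (hτmem s hs) hst
      rw [hAτ s hs, hAτ t ht] at this
      rw [abs_of_nonneg (sub_nonneg.2 hst)]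
      exact this.trans (le_abs_self _)
  -- the coefficients of the equation after the change of variables `σ = A t`
  set β₀ : ℝ → ℝ := fun t => a' t * ((a t)⁻¹ * (a t)⁻¹) + b t * (a t)⁻¹ with hβ₀
  set c₀ : ℝ → ℝ := fun t => (a t)⁻¹ * (a t)⁻¹ with hc₀
  have h12 : (1 : WithTop ℕ∞) ≤ 2 := by norm_num
  have hβs : ContDiffOn ℝ 1 β₀ (Ici 0) :=
    (h.contDiffOn_deriv_a.mul ((hcinv.of_le h12).mul (hcinv.of_le h12))).add
      (h.b_smooth.mul (hcinv.of_le h12))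
  have hcs : ContDiffOn ℝ 1 c₀ (Ici 0) := (hcinv.of_le h12).mul (hcinv.of_le h12)
  obtain ⟨Lβ, hLβ0, hβb, hβl⟩ := exists_lipschitz_of_contDiffOn hβs 1
  obtain ⟨Lc, hLc0, hcb, hcl⟩ := exists_lipschitz_of_contDiffOn hcs 1
  have hcomp : ∀ (L : ℝ) (k : ℝ → ℝ), 0 ≤ L → L ≤ Lβ + Lc →
      (∀ s ∈ Icc (0 : ℝ) 1, ∀ t ∈ Icc (0 : ℝ) 1, |k s - k t| ≤ L * |s - t|) →
      ∀ s ∈ Icc 0 (A 1), ∀ t ∈ Icc 0 (A 1), |k (τ s) - k (τ t)| ≤ (Lβ + Lc) * m⁻¹ * |s - t| := by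
    intro L k hL hL' hk s hs t ht
    refine (hk _ (hτmem s hs) _ (hτmem t ht)).trans ?_
    rw [mul_assoc]
    have := hτl s hs t ht
    gcongr
  -- The data of `w` are `(ε f, ε g / a 0)`. Their bound is uniform in `ε ≤ 1`, and so is the time of
  -- existence `T₁`.
  obtain ⟨T₁, hT₁, hT₁S, hsol⟩ := exists_wave_solution (N := N) hp hpN hS
    (β := fun σ => β₀ (τ σ)) (c := fun σ => c₀ (τ σ)) (L := (Lβ + Lc) * m⁻¹) (M := Lβ + Lc)
    (by positivity) (by positivity)
    (fun σ hσ => (hβb _ (hτmem σ hσ)).trans (by linarith))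
    (fun σ hσ => (hcb _ (hτmem σ hσ)).trans (by linarith))
    (hcomp Lβ β₀ hLβ0 (by linarith) hβl) (hcomp Lc c₀ hLc0 (by linarith) hcl)
    (max ‖f‖ ((a 0)⁻¹ * ‖g‖))
  have hT₁mem : T₁ ∈ Icc 0 (A 1) := ⟨hT₁.le, hT₁S⟩
  set T₀ := τ T₁ with hT₀
  have hT₀1 : T₀ ∈ Icc (0 : ℝ) 1 := hτmem T₁ hT₁mem
  have hAT₀ : A T₀ = T₁ := hAτ T₁ hT₁mem
  have hT₀pos : 0 < T₀ := by
    rcases hT₀1.1.eq_or_lt with h0 | h0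
    · rw [← h0, hA0] at hAT₀
      exact absurd hAT₀ hT₁.ne
    · exact h0
  refine ⟨T₀, hT₀pos, fun ε hε hε1 => ?_⟩
  have ha00 : 0 < a 0 := h.a_pos 0 le_rfl
  obtain ⟨w, y, hwc, hyc, hw0, hy0, hwd, hyd⟩ := hsol (ε • f) ((a 0)⁻¹ • ε • g)
    (by
      rw [norm_smul, Real.norm_of_nonneg hε.le]
      exact (mul_le_of_le_one_left (norm_nonneg _) hε1).trans (le_max_left _ _))
    (by
      rw [norm_smul, norm_smul, Real.norm_of_nonneg hε.le, Real.norm_of_nonneg (by positivity)]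
      refine le_trans ?_ (le_max_right _ _)
      exact mul_le_mul_of_nonneg_left (mul_le_of_le_one_left (norm_nonneg _) hε1) (by positivity))
  have hIco : Ico 0 T₀ ⊆ Ici 0 := fun t ht => ht.1
  have hmaps : MapsTo A (Ico 0 T₀) (Icc 0 T₁) := fun t ht =>
    ⟨h.primitiveA_nonneg ht.1, by
      rw [← hAT₀]
      exact h.strictMonoOn_primitiveA.monotoneOn ht.1 hT₀1.1 ht.2.le⟩
  have hτA : ∀ t ∈ Ico 0 T₀, τ (A t) = t := fun t ht => by
    have hm' := hmaps ht
    have h1 : A t ∈ Icc 0 (A 1) := ⟨hm'.1, hm'.2.trans hT₁S⟩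
    exact h.strictMonoOn_primitiveA.injOn (hsub (hτmem _ h1)) ht.1 (hAτ _ h1)
  have hAd : ∀ t ∈ Ico 0 T₀, HasDerivWithinAt A (a t) (Ico 0 T₀) t := fun t ht =>
    (h.hasDeriv_primitiveA ht.1).mono hIco
  have had : ∀ t ∈ Ico 0 T₀, HasDerivWithinAt a (a' t) (Ico 0 T₀) t := fun t ht =>
    (h.hasDeriv_a ht.1).mono hIco
  have hAc : ContinuousOn A (Ico 0 T₀) := h.continuousOn_primitiveA.mono hIco
  have hac : ContinuousOn a (Ico 0 T₀) := h.continuousOn_a.mono hIco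
  have hbc : ContinuousOn b (Ico 0 T₀) := h.continuousOn_b.mono hIco
  have hud := uniqueDiffOn_Ico (0 : ℝ) T₀
  have huc : ContinuousOn (fun t => w (A t)) (Ico 0 T₀) := hwc.comp hAc hmaps
  have hvc : ContinuousOn (fun t => y (A t)) (Ico 0 T₀) := hyc.comp hAc hmaps
  have hd1 : ∀ t ∈ Ico 0 T₀, HasDerivWithinAt (fun s => toH1 (w (A s))) (a t • y (A t))
      (Ico 0 T₀) t := fun t ht =>
    HasDerivWithinAt.scomp t (hwd _ (hmaps ht)) (hAd t ht) hmaps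
  have hd1' : ∀ t ∈ Ico 0 T₀, HasDerivWithinAt (fun s => toL2 (w (A s))) (a t • toL2 (y (A t)))
      (Ico 0 T₀) t := fun t ht => by
    have h1 := HasDerivWithinAt.continuousLinear (coord (noDeriv N 1)) (hd1 t ht)
    rw [map_smul] at h1
    exact h1
  -- the second derivative, by the equation for `w`
  set u₂ : ℝ → L2 N := fun t => a t ^ 2 • laplacian (w (A t)) - b t • (a t • toL2 (y (A t)))
    + powL2 p (toL2 (w (A t))) with hu₂
  have hd2 : ∀ t ∈ Ico 0 T₀, HasDerivWithinAt (fun s => a s • toL2 (y (A s))) (u₂ t)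
      (Ico 0 T₀) t := by
    intro t ht
    have h1 : HasDerivWithinAt (fun s => toL2 (y (A s))) _ (Ico 0 T₀) t :=
      HasDerivWithinAt.scomp t (hyd _ (hmaps ht)) (hAd t ht) hmaps
    refine ((had t ht).smul h1).congr_deriv ?_
    rw [hu₂]
    simp only [hτA t ht, hβ₀, hc₀]
    have h2 : a t ≠ 0 := ha0 t ht.1
    simp only [smul_add, smul_sub, smul_smul]
    have e1 : a t * a t * (a' t * ((a t)⁻¹ * (a t)⁻¹) + b t * (a t)⁻¹) = a' t + b t * a t := by
      field_simp
    have e2 : a t * a t * ((a t)⁻¹ * (a t)⁻¹) = 1 := by field_simp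
    rw [← mul_assoc (a t) (a t) (_ + _), e1, ← mul_assoc (a t) (a t) (_ * _), e2, one_smul, add_smul,
      ← pow_two]
    abel
  have hu₂c : ContinuousOn u₂ (Ico 0 T₀) := by
    refine (((hac.pow 2).smul ?_).sub (hbc.smul (hac.smul ?_))).add (continuousOn_powL2 hp hpN huc)
    · exact ((laplacianL N).continuous.comp_continuousOn huc).congr fun t _ =>
        (laplacianL_apply _).symm
    · exact (coord (noDeriv N 1)).continuous.comp_continuousOn hvc
  obtain ⟨hC1, hder1⟩ := contDiffOn_of_hasDerivWithinAt hud hd1 (hac.smul hvc)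
  obtain ⟨hC2, hder2⟩ := contDiffOn_two_of_hasDerivWithinAt hud hd1' hd2 hu₂c
  obtain ⟨hpow, -⟩ := exists_powL2_estimate (N := N) hp hpN
  obtain ⟨C, hC0, hC⟩ := exists_embedding (N := N) hp hpN
  have h0mem : (0 : ℝ) ∈ Ico 0 T₀ := ⟨le_rfl, hT₀pos⟩
  refine ⟨fun t => w (A t), huc, hC1, hC2, fun t ht => ⟨Lp.aestronglyMeasurable _,
    (hC _).trans_lt ENNReal.ofReal_lt_top⟩, fun t ht => ?_, fun t ht => ?_, ?_, ?_⟩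
  · have h1 : Tendsto (fun s => ENNReal.ofReal (C * ‖w (A s) - w (A t)‖)) (𝓝[Ico 0 T₀] t) (𝓝 0) := by
      have h2 : Tendsto (fun s => C * ‖w (A s) - w (A t)‖) (𝓝[Ico 0 T₀] t) (𝓝 0) := by
        have h3 := (((huc t ht).sub (continuousWithinAt_const (b := w (A t)))).norm.const_mul C)
        simpa using h3.tendsto
      simpa using ENNReal.tendsto_ofReal h2
    refine tendsto_of_tendsto_of_tendsto_of_le_of_le tendsto_const_nhds h1 (fun _ => zero_le)
      fun s => ?_
    have e : toL2 (w (A s)) - toL2 (w (A t)) = toL2 (w (A s) - w (A t)) :=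
      (map_sub (coord (noDeriv N 2)) (w (A s)) (w (A t))).symm
    simp only [e]
    exact hC _
  · have e : iteratedDerivWithin 2 (fun s => toL2 (w (A s))) (Ico 0 T₀) t
        - a t ^ 2 • laplacian (w (A t))
        + b t • derivWithin (fun s => toL2 (w (A s))) (Ico 0 T₀) t = powL2 p (toL2 (w (A t))) := by
      rw [hder2 t ht, (hd1' t ht).derivWithin (hud t ht), hu₂]
      module
    rw [e]
    exact coeFn_powL2 (hpow _)
  · simp only [hA0]
    exact hw0
  · rw [hder1 0 h0mem, hA0, hy0, smul_smul, mul_inv_cancel₀ ha00.ne', one_smul]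

end LocalExistence

/-! ### Exponential weights -/

section Weights

variable {N : ℕ}

theorem inner_mulOp_left {m : EuclideanSpace ℝ (Fin N) → ℝ} (hm : AEStronglyMeasurable m volume)
    {C : ℝ} (hC : ∀ x, ‖m x‖ ≤ C) (f g : L2 N) :
    inner ℝ (mulOp m hm C hC f) g = inner ℝ f (mulOp m hm C hC g) := by
  rw [inner_eq_integral, inner_eq_integral]
  refine integral_congr_ae ?_
  filter_upwards [coeFn_mulOp hm hC f, coeFn_mulOp hm hC g] with x h1 h2
  rw [h1, h2]
  ring

/-- The Leibniz rule for the product of a weakly differentiable function and a smooth one. -/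
theorem HasWeakDeriv.mul_smooth {i : Fin N} {w w' : L2 N} (h : HasWeakDeriv (word i) w w')
    {m : EuclideanSpace ℝ (Fin N) → ℝ} (hm : ContDiff ℝ ∞ m) {y y' : L2 N}
    (hy : y =ᵐ[volume] fun x => m x * w x)
    (hy' : y' =ᵐ[volume] fun x => m x * w' x + partialDeriv (word i) m x * w x) :
    HasWeakDeriv (word i) y y' := by
  intro φ hφ hc
  have h1 := h (fun x => m x * φ x) (hm.mul hφ) hc.mul_left
  have hcm : Continuous (partialDeriv (word i) m) := continuous_partialDeriv _ hm
  simp only [partialDeriv_word_mul i hm hφ] at h1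
  have e1 : ∫ x, y x * partialDeriv (word i) φ x
      = (∫ x, w x * (m x * partialDeriv (word i) φ x + partialDeriv (word i) m x * φ x))
        - ∫ x, w x * (partialDeriv (word i) m x * φ x) := by
    rw [← integral_sub]
    · refine integral_congr_ae ?_
      filter_upwards [hy] with x hx
      rw [hx]
      ring
    · exact integrable_mul_test w ((hm.continuous.mul (continuous_partialDeriv _ hφ)).add
        (hcm.mul hφ.continuous)) (((hasCompactSupport_partialDeriv _ hc).mul_left).add hc.mul_left)
    · exact integrable_mul_test w (hcm.mul hφ.continuous) hc.mul_left
  have e2 : ∫ x, y' x * φ x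
      = (∫ x, w' x * (m x * φ x)) + ∫ x, w x * (partialDeriv (word i) m x * φ x) := by
    rw [← integral_add]
    · refine integral_congr_ae ?_
      filter_upwards [hy'] with x hx
      rw [hx]
      ring
    · exact integrable_mul_test w' (hm.continuous.mul hφ.continuous) hc.mul_left
    · exact integrable_mul_test w (hcm.mul hφ.continuous) hc.mul_left
  rw [e1, e2, h1]
  ring

/-- An `L²` function with first weak derivatives in `L²` defines an element of `H¹`. -/
theorem exists_sobolev_one {w : L2 N} {w' : Fin N → L2 N} (h : ∀ i, HasWeakDeriv (word i) w (w' i)) :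
    ∃ y : Sobolev N 1, toL2 y = w ∧ ‖y‖ ≤ ‖w‖ + ∑ i, ‖w' i‖ := by
  have hword : ∀ β : Fin 1 → Fin N, β = word (β 0) := fun β => by
    ext l; rw [word, Subsingleton.elim l 0]
  set F : DerivIndex N 1 → L2 N := fun α =>
    if hα : (α.1 : ℕ) = 1 then w' (α.2 ⟨0, by omega⟩) else w with hF
  have hF0 : F (noDeriv N 1) = w := by simp [hF, noDeriv]
  have hFd : ∀ α : DerivIndex N 1, HasWeakDeriv α.2 w (F α) := by
    rintro ⟨⟨j, hj⟩, β⟩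
    interval_cases j
    · have : F ⟨⟨0, hj⟩, β⟩ = w := by simp [hF]
      rw [this]
      intro φ hφ hc
      change ∫ x, w x * partialDeriv (j := 0) β φ x = (-1 : ℝ) ^ 0 * ∫ x, w x * φ x
      rw [partialDeriv_zero, pow_zero, one_mul]
    · have : F ⟨⟨1, hj⟩, β⟩ = w' (β 0) := by simp [hF]
      rw [this]
      have h2 := h (β 0)
      rw [← hword β] at h2
      exact h2
  refine ⟨⟨WithLp.toLp 2 F, fun α => ?_⟩, hF0, ?_⟩
  · change HasWeakDeriv α.2 (F (noDeriv N 1)) (F α)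
    rw [hF0]
    exact hFd α
  · change ‖WithLp.toLp 2 F‖ ≤ _
    have h0 : 0 ≤ ‖w‖ + ∑ i, ‖w' i‖ := by positivity
    rw [PiLp.norm_eq_of_L2]
    have hsum : ∑ α, ‖F α‖ ^ 2 = ‖w‖ ^ 2 + ∑ i, ‖w' i‖ ^ 2 := by
      rw [Fintype.sum_sigma, Fin.sum_univ_two]
      congr 1
      · change ∑ β : Fin 0 → Fin N, ‖F ⟨0, β⟩‖ ^ 2 = _
        rw [Fintype.sum_unique]
        simp [hF]
      · change ∑ β : Fin 1 → Fin N, ‖F ⟨1, β⟩‖ ^ 2 = _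
        rw [← (Equiv.funUnique (Fin 1) (Fin N)).symm.sum_comp]
        refine Finset.sum_congr rfl fun i _ => ?_
        simp [hF]
    change √(∑ α, ‖F α‖ ^ 2) ≤ _
    rw [hsum, Real.sqrt_le_left h0]
    have h1 : ∑ i, ‖w' i‖ ^ 2 ≤ (∑ i, ‖w' i‖) ^ 2 :=
      Finset.sum_sq_le_sq_sum_of_nonneg fun i _ => norm_nonneg _
    have h2 : 0 ≤ ‖w‖ * ∑ i, ‖w' i‖ := by positivity
    nlinarith

/-- A bounded increasing profile `L arctan (s / L)`, which tends to `s` as `L → ∞`. -/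
noncomputable def profile (L s : ℝ) : ℝ := L * Real.arctan (s / L)

/-- The weight `exp (κ L arctan (⟪e, x⟫ / L))`. -/
noncomputable def expWeight (κ L : ℝ) (e x : EuclideanSpace ℝ (Fin N)) : ℝ :=
  Real.exp (κ * profile L (inner ℝ e x))

/-- The derivative of the weight in the direction of increase of `⟪e, x⟫`. -/
noncomputable def expWeightDeriv (κ L : ℝ) (e x : EuclideanSpace ℝ (Fin N)) : ℝ :=
  κ * (1 / (1 + (inner ℝ e x / L) ^ 2)) * expWeight κ L e x

variable {κ L : ℝ} {e : EuclideanSpace ℝ (Fin N)}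

theorem contDiff_expWeight : ContDiff ℝ ∞ (expWeight κ L e) := by
  unfold expWeight profile
  refine Real.contDiff_exp.comp (contDiff_const.mul (contDiff_const.mul ?_))
  exact Real.contDiff_arctan.comp ((contDiff_const.inner ℝ contDiff_id).div_const L)

theorem continuous_expWeightDeriv : Continuous (expWeightDeriv κ L e) := by
  unfold expWeightDeriv
  have h : Continuous fun x : EuclideanSpace ℝ (Fin N) => inner ℝ e x := by fun_prop
  refine Continuous.mul (continuous_const.mul (continuous_const.div ?_ fun x => ?_))
    contDiff_expWeight.continuous
  · exact continuous_const.add ((h.div_const L).pow 2)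
  · positivity

theorem expWeight_pos (x : EuclideanSpace ℝ (Fin N)) : 0 < expWeight κ L e x := Real.exp_pos _

theorem norm_expWeight_le (hκ : 0 ≤ κ) (hL : 0 < L) (x : EuclideanSpace ℝ (Fin N)) :
    ‖expWeight κ L e x‖ ≤ Real.exp (κ * (L * (Real.pi / 2))) := by
  rw [Real.norm_of_nonneg (expWeight_pos x).le]
  unfold expWeight profile
  have := (Real.arctan_lt_pi_div_two (inner ℝ e x / L)).le
  gcongr

theorem abs_expWeightDeriv_le (hκ : 0 ≤ κ) (x : EuclideanSpace ℝ (Fin N)) :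
    ‖expWeightDeriv κ L e x‖ ≤ κ * expWeight κ L e x := by
  have h0 := expWeight_pos (κ := κ) (L := L) (e := e) x
  unfold expWeightDeriv
  rw [Real.norm_of_nonneg (by positivity)]
  have : 1 / (1 + (inner ℝ e x / L) ^ 2) ≤ (1 : ℝ) := by
    rw [div_le_one (by positivity)]
    nlinarith [sq_nonneg (inner ℝ e x / L)]
  calc κ * (1 / (1 + (inner ℝ e x / L) ^ 2)) * expWeight κ L e x
      ≤ κ * 1 * expWeight κ L e x := by gcongr
    _ = _ := by ring

theorem partialDeriv_expWeight (hL : 0 < L) (i : Fin N) (x : EuclideanSpace ℝ (Fin N)) :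
    partialDeriv (word i) (expWeight κ L e) x = e i * expWeightDeriv κ L e x := by
  rw [partialDeriv_word]
  have h1 : HasFDerivAt (fun x : EuclideanSpace ℝ (Fin N) => inner ℝ e x) (innerSL ℝ e) x :=
    (innerSL ℝ e).hasFDerivAt
  have h3 : HasDerivAt (fun s : ℝ => Real.exp (κ * profile L s))
      (Real.exp (κ * profile L (inner ℝ e x)) * (κ * (L * (1 / (1 + (inner ℝ e x / L) ^ 2) * (1 / L)))))
      (inner ℝ e x) := by
    have h4 : HasDerivAt (fun s : ℝ => s / L) (1 / L) (inner ℝ e x) :=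
      (hasDerivAt_id _).div_const L
    exact ((((Real.hasDerivAt_arctan _).comp _ h4).const_mul L).const_mul κ).exp
  have h5 := h3.comp_hasFDerivAt x h1
  have h6 : fderiv ℝ (expWeight κ L e) x = _ := h5.fderiv
  rw [h6]
  have h7 : (innerSL ℝ e) (EuclideanSpace.single i (1 : ℝ)) = e i := by
    simp [EuclideanSpace.inner_single_right]
  rw [smul_apply, h7, smul_eq_mul, expWeightDeriv, expWeight]
  field_simp

/-- Multiplication by the weight. -/
noncomputable def weightOp (hκ : 0 ≤ κ) (hL : 0 < L) (e : EuclideanSpace ℝ (Fin N)) :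
    L2 N →L[ℝ] L2 N :=
  mulOp (expWeight κ L e) contDiff_expWeight.continuous.aestronglyMeasurable _
    (norm_expWeight_le hκ hL)

/-- Multiplication by the derivative of the weight. -/
noncomputable def weightDerivOp (hκ : 0 ≤ κ) (hL : 0 < L) (e : EuclideanSpace ℝ (Fin N)) :
    L2 N →L[ℝ] L2 N :=
  mulOp (expWeightDeriv κ L e) continuous_expWeightDeriv.aestronglyMeasurable
    (κ * Real.exp (κ * (L * (Real.pi / 2)))) fun x =>
      (abs_expWeightDeriv_le hκ x).trans (mul_le_mul_of_nonneg_left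
        ((le_abs_self _).trans (norm_expWeight_le hκ hL x)) hκ)

variable (hκ : 0 ≤ κ) (hL : 0 < L)

theorem coeFn_weightOp (f : L2 N) :
    weightOp hκ hL e f =ᵐ[volume] fun x => expWeight κ L e x * f x := coeFn_mulOp _ _ _

theorem coeFn_weightDerivOp (f : L2 N) :
    weightDerivOp hκ hL e f =ᵐ[volume] fun x => expWeightDeriv κ L e x * f x := coeFn_mulOp _ _ _

theorem inner_weightOp (f g : L2 N) :
    inner ℝ (weightOp hκ hL e f) g = inner ℝ f (weightOp hκ hL e g) := inner_mulOp_left _ _ _ _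

theorem inner_weightDerivOp (f g : L2 N) :
    inner ℝ (weightDerivOp hκ hL e f) g = inner ℝ f (weightDerivOp hκ hL e g) :=
  inner_mulOp_left _ _ _ _

theorem norm_weightDerivOp_le (f : L2 N) :
    ‖weightDerivOp hκ hL e f‖ ≤ κ * ‖weightOp hκ hL e f‖ := by
  refine Lp.norm_le_mul_norm_of_ae_le_mul ?_
  filter_upwards [coeFn_weightOp (e := e) hκ hL f, coeFn_weightDerivOp (e := e) hκ hL f] with x h1 h2
  rw [h1, h2, norm_mul, norm_mul, ← mul_assoc, Real.norm_of_nonneg (expWeight_pos x).le]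
  exact mul_le_mul_of_nonneg_right (abs_expWeightDeriv_le hκ x) (norm_nonneg _)

theorem HasWeakDeriv.weight {i : Fin N} {w w' : L2 N} (h : HasWeakDeriv (word i) w w') :
    HasWeakDeriv (word i) (weightOp hκ hL e w)
      (weightOp hκ hL e w' + e i • weightDerivOp hκ hL e w) := by
  refine h.mul_smooth (contDiff_expWeight (κ := κ) (L := L) (e := e)) (coeFn_weightOp hκ hL w) ?_
  filter_upwards [Lp.coeFn_add (weightOp hκ hL e w') (e i • weightDerivOp hκ hL e w),
    Lp.coeFn_smul (e i) (weightDerivOp hκ hL e w), coeFn_weightOp (e := e) hκ hL w',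
    coeFn_weightDerivOp (e := e) hκ hL w] with x h1 h2 h3 h4
  rw [h1, Pi.add_apply, h2, Pi.smul_apply, h3, h4, partialDeriv_expWeight hL, smul_eq_mul]
  ring

theorem abs_coord_le_one (he : ‖e‖ ≤ 1) (i : Fin N) : |e i| ≤ 1 :=
  (PiLp.norm_apply_le e i).trans he

/-- A combination of vectors with coefficients in the unit ball. -/
theorem norm_sum_smul_le {E : Type*} [NormedAddCommGroup E] [NormedSpace ℝ E] (he : ‖e‖ ≤ 1)
    (f : Fin N → E) : ‖∑ i, e i • f i‖ ≤ √(∑ i, ‖f i‖ ^ 2) := by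
  have h1 : ‖∑ i, e i • f i‖ ≤ ∑ i, |e i| * ‖f i‖ := by
    refine (norm_sum_le _ _).trans (le_of_eq ?_)
    simp only [norm_smul, Real.norm_eq_abs]
  refine Real.le_sqrt_of_sq_le ?_
  have h2 := Finset.sum_mul_sq_le_sq_mul_sq Finset.univ (fun i => |e i|) fun i => ‖f i‖
  have h3 : ∑ i, |e i| ^ 2 ≤ 1 := by
    have := EuclideanSpace.norm_sq_eq e
    simp only [Real.norm_eq_abs] at this
    rw [← this]
    exact pow_le_one₀ (norm_nonneg _) he
  have h4 : 0 ≤ ∑ i, ‖f i‖ ^ 2 := by positivity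
  calc ‖∑ i, e i • f i‖ ^ 2 ≤ (∑ i, |e i| * ‖f i‖) ^ 2 := by gcongr
    _ ≤ (∑ i, |e i| ^ 2) * ∑ i, ‖f i‖ ^ 2 := h2
    _ ≤ ∑ i, ‖f i‖ ^ 2 := mul_le_of_le_one_left h4 h3

/-- The weighted power nonlinearity is controlled by the weighted `H¹` norm. -/
theorem exists_weighted_power_estimate {p : ℝ} (hp : 1 < p)
    (hpN : 5 ≤ N → p ≤ ((N : ℝ) - 2) / ((N : ℝ) - 4)) :
    ∃ C : ℝ, 0 ≤ C ∧ ∀ {κ L : ℝ} (hκ : 0 ≤ κ) (hL : 0 < L) {e : EuclideanSpace ℝ (Fin N)},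
      ‖e‖ ≤ 1 → ∀ u : Sobolev N 2, ‖weightOp hκ hL e (powL2 p (toL2 u))‖
        ≤ C * (‖u‖ ^ (p - 1) * (‖weightOp hκ hL e (toL2 u)‖
          + ∑ i, (‖weightOp hκ hL e (coord (firstIndex i) u)‖
            + κ * ‖weightOp hκ hL e (toL2 u)‖))) := by
  obtain ⟨C, hC0, hC⟩ := exists_product_estimate (N := N) hp hpN
  obtain ⟨hpow, -⟩ := exists_powL2_estimate (N := N) hp hpN
  refine ⟨C, hC0, fun {κ L} hκ hL {e} he u => ?_⟩
  obtain ⟨y, hy, hyn⟩ := exists_sobolev_one fun i =>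
    (hasWeakDeriv_first (k := 1) i u).weight (e := e) hκ hL
  have h1 : ‖weightOp hκ hL e (powL2 p (toL2 u))‖ ≤ C * (‖u‖ ^ (p - 1) * ‖y‖) := by
    rw [Lp.norm_def]
    refine ENNReal.toReal_le_of_le_ofReal (by positivity) (le_trans ?_ (hC u y))
    refine eLpNorm_mono_ae ?_
    rw [hy]
    filter_upwards [coeFn_weightOp (e := e) hκ hL (powL2 p (toL2 u)), coeFn_powL2 (hpow u),
      coeFn_weightOp (e := e) hκ hL (toL2 u)] with x e1 e2 e3
    rw [e1, e2, e3, abs_rpow_eq_mul (by linarith), abs_mul, norm_mul, norm_mul, norm_mul,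
      norm_mul, Real.norm_eq_abs, Real.norm_eq_abs, Real.norm_eq_abs, Real.norm_eq_abs, abs_abs,
      abs_abs]
    exact le_of_eq (by ring)
  refine h1.trans ?_
  have h2 : ‖y‖ ≤ ‖weightOp hκ hL e (toL2 u)‖
      + ∑ i, (‖weightOp hκ hL e (coord (firstIndex i) u)‖ + κ * ‖weightOp hκ hL e (toL2 u)‖) := by
    refine hyn.trans ?_
    gcongr with i _
    refine (norm_add_le _ _).trans ?_
    gcongr
    rw [norm_smul, Real.norm_eq_abs]
    exact (mul_le_of_le_one_left (norm_nonneg _) (abs_coord_le_one he i)).trans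
      (norm_weightDerivOp_le hκ hL _)
  gcongr

end Weights

/-! ### The velocity of a strong solution -/

section Velocity

variable {N : ℕ} {a b : ℝ → ℝ} {p T : ℝ} {u₀ : Sobolev N 2} {u₁ : Sobolev N 1}
  {u : ℝ → Sobolev N 2}

/-- The velocity of a strong solution, as a curve in `H¹`. -/
structure IsVelocity (a b : ℝ → ℝ) (p T : ℝ) (u : ℝ → Sobolev N 2) (v : ℝ → Sobolev N 1) :
    Prop where
  hasDeriv_u : ∀ t ∈ Ico 0 T, HasDerivWithinAt (fun s => toH1 (u s)) (v t) (Ico 0 T) t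
  hasDeriv_v : ∀ t ∈ Ico 0 T, HasDerivWithinAt (fun s => toL2 (v s))
    (a t ^ 2 • laplacian (u t) - b t • toL2 (v t) + powL2 p (toL2 (u t))) (Ico 0 T) t

/-- A strong solution is a first order system for the displacement and its velocity. -/
theorem IsStrongSolution.exists_velocity (hp : 1 < p)
    (hpN : 5 ≤ N → p ≤ ((N : ℝ) - 2) / ((N : ℝ) - 4))
    (hu : IsStrongSolution N a b p u₀ u₁ T u) :
    ∃ v : ℝ → Sobolev N 1, v 0 = u₁ ∧ IsVelocity a b p T u v := by
  have hud := uniqueDiffOn_Ico (0 : ℝ) T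
  set v : ℝ → Sobolev N 1 := derivWithin (fun s => toH1 (u s)) (Ico 0 T) with hv
  have hd : ∀ t ∈ Ico 0 T, HasDerivWithinAt (fun s => toH1 (u s)) (v t) (Ico 0 T) t := fun t ht =>
    (hu.contDiff_H1.differentiableOn (by norm_num) t ht).hasDerivWithinAt
  have hd' : ∀ t ∈ Ico 0 T, HasDerivWithinAt (fun s => toL2 (u s)) (toL2 (v t)) (Ico 0 T) t := by
    intro t ht
    have h1 := HasDerivWithinAt.continuousLinear (coord (noDeriv N 1)) (hd t ht)
    simp only [coord_noDeriv, toL2_toH1] at h1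
    exact h1
  have hvd : ∀ t ∈ Ico 0 T, derivWithin (fun s => toL2 (u s)) (Ico 0 T) t = toL2 (v t) :=
    fun t ht => (hd' t ht).derivWithin (hud t ht)
  have hC1 : ContDiffOn ℝ 1 (fun t => toL2 (v t)) (Ico 0 T) :=
    (hu.contDiff_L2.derivWithin hud (by norm_num)).congr fun t ht => (hvd t ht).symm
  obtain ⟨hpow, -⟩ := exists_powL2_estimate (N := N) hp hpN
  refine ⟨v, hu.initial_ut, hd, fun t ht => ?_⟩
  have h1 := (hC1.differentiableOn (by norm_num) t ht).hasDerivWithinAt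
  refine h1.congr_deriv ?_
  have h2 : iteratedDerivWithin 2 (fun s => toL2 (u s)) (Ico 0 T) t
      = derivWithin (fun t => toL2 (v t)) (Ico 0 T) t := by
    rw [iteratedDerivWithin_succ, iteratedDerivWithin_one, derivWithin_congr hvd (hvd t ht)]
  have h3 := hu.equation t ht
  rw [h2, hvd t ht] at h3
  have h4 : derivWithin (fun t => toL2 (v t)) (Ico 0 T) t - a t ^ 2 • laplacian (u t)
      + b t • toL2 (v t) = powL2 p (toL2 (u t)) :=
    Lp.ext (h3.trans (coeFn_powL2 (hpow _)).symm)
  rw [← h4]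
  abel

theorem IsVelocity.hasDeriv_toL2 {v : ℝ → Sobolev N 1} (hv : IsVelocity a b p T u v) {t : ℝ}
    (ht : t ∈ Ico 0 T) :
    HasDerivWithinAt (fun s => toL2 (u s)) (toL2 (v t)) (Ico 0 T) t := by
  have h1 := HasDerivWithinAt.continuousLinear (coord (noDeriv N 1)) (hv.hasDeriv_u t ht)
  simp only [coord_noDeriv, toL2_toH1] at h1
  exact h1

theorem IsVelocity.hasDeriv_first {v : ℝ → Sobolev N 1} (hv : IsVelocity a b p T u v) {t : ℝ}
    (ht : t ∈ Ico 0 T) (i : Fin N) :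
    HasDerivWithinAt (fun s => coord (firstIndex (k := 1) i) (u s))
      (coord (firstIndex (k := 0) i) (v t)) (Ico 0 T) t :=
  HasDerivWithinAt.continuousLinear (coord (firstIndex (k := 0) i)) (hv.hasDeriv_u t ht)

end Velocity

/-! ### Finite speed of propagation -/

section FiniteSpeed

variable {N : ℕ} {κ L : ℝ} (hκ : 0 ≤ κ) (hL : 0 < L) {e : EuclideanSpace ℝ (Fin N)}

/-- Integration by parts against the square of a self-adjoint multiplier `M`, whose commutator with
the derivative is `c M'`. -/
theorem inner_commutator {E : Type*} [NormedAddCommGroup E] [InnerProductSpace ℝ E]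
    {M M' : E →L[ℝ] E} (hM : ∀ f g, inner ℝ (M f) g = inner ℝ f (M g))
    (hM' : ∀ f g, inner ℝ (M' f) g = inner ℝ f (M' g)) {y dy z dz : E} {c : ℝ}
    (h : inner ℝ (M (M y)) dz = -inner ℝ (M (M dy + c • M' y) + c • M' (M y)) z) :
    inner ℝ (M y) (M dz) = -inner ℝ (M z) (M dy) - c * inner ℝ (M' y) (M z)
      - c * inner ℝ (M y) (M' z) := by
  rw [← hM (M y) dz, h, map_add, map_smul, inner_add_left, inner_add_left, real_inner_smul_left,
    real_inner_smul_left, hM (M dy) z, hM (M' y) z, hM' (M y) z, real_inner_comm (M z) (M dy)]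
  ring

theorem neg_inner_sub_inner_le {E : Type*} [NormedAddCommGroup E] [InnerProductSpace ℝ E]
    {y y' z z' : E} {G : ℝ} (hκ : 0 ≤ κ) (hy : ‖y'‖ ≤ κ * ‖y‖) (hz : ‖z‖ ≤ G) (hz' : ‖z'‖ ≤ κ * G) :
    -inner ℝ y' z - inner ℝ y z' ≤ 2 * κ * (‖y‖ * G) := by
  have h1 : -inner ℝ y' z ≤ ‖y'‖ * ‖z‖ := (neg_le_abs _).trans (abs_real_inner_le_norm _ _)
  have h2 : -inner ℝ y z' ≤ ‖y‖ * ‖z'‖ := (neg_le_abs _).trans (abs_real_inner_le_norm _ _)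
  have h3 : ‖y'‖ * ‖z‖ ≤ κ * ‖y‖ * G := by gcongr
  have h4 : ‖y‖ * ‖z'‖ ≤ ‖y‖ * (κ * G) := by gcongr
  linarith

theorem norm_sum_smul_weightDerivOp_le (he : ‖e‖ ≤ 1) (d : Fin N → L2 N) :
    ‖∑ i, e i • weightDerivOp hκ hL e (d i)‖
      ≤ κ * √(∑ i, ‖weightOp hκ hL e (d i)‖ ^ 2) := by
  refine (norm_sum_smul_le he _).trans ?_
  rw [Real.sqrt_le_left (by positivity), mul_pow,
    Real.sq_sqrt (Finset.sum_nonneg fun i _ => sq_nonneg _), Finset.mul_sum]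
  refine Finset.sum_le_sum fun i _ => ?_
  rw [← mul_pow]
  exact pow_le_pow_left₀ (norm_nonneg _) (norm_weightDerivOp_le hκ hL _) 2

/-- The commutator of the weight with the gradient costs a factor `2 κ`. -/
theorem weighted_flux_le (he : ‖e‖ ≤ 1) (w : Sobolev N 2) (y : Sobolev N 1) :
    inner ℝ (weightOp hκ hL e (toL2 y)) (weightOp hκ hL e (laplacian w))
      + ∑ i, inner ℝ (weightOp hκ hL e (coord (firstIndex (k := 1) i) w))
          (weightOp hκ hL e (coord (firstIndex (k := 0) i) y))
      ≤ 2 * κ * (‖weightOp hκ hL e (toL2 y)‖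
          * √(∑ i, ‖weightOp hκ hL e (coord (firstIndex (k := 1) i) w)‖ ^ 2)) := by
  have hterm : ∀ i : Fin N, inner ℝ (weightOp hκ hL e (toL2 y))
        (weightOp hκ hL e (coord (⟨2, fun _ => i⟩ : DerivIndex N 2) w))
      = -inner ℝ (weightOp hκ hL e (coord (firstIndex (k := 1) i) w))
          (weightOp hκ hL e (coord (firstIndex (k := 0) i) y))
        - e i * inner ℝ (weightDerivOp hκ hL e (toL2 y))
          (weightOp hκ hL e (coord (firstIndex (k := 1) i) w))
        - e i * inner ℝ (weightOp hκ hL e (toL2 y))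
          (weightDerivOp hκ hL e (coord (firstIndex (k := 1) i) w)) := by
    intro i
    have h1 := ((hasWeakDeriv_first (k := 0) i y).weight (e := e) hκ hL).weight (e := e) hκ hL
    have h2 := (hasWeakDeriv_coord (⟨2, fun _ => i⟩ : DerivIndex N 2) w).tail
      (hasWeakDeriv_first (k := 1) i w)
    have h3 := h1.inner_eq_neg h2
    exact inner_commutator (inner_weightOp hκ hL) (inner_weightDerivOp hκ hL) h3
  have hsum : inner ℝ (weightOp hκ hL e (toL2 y)) (weightOp hκ hL e (laplacian w))
      + ∑ i, inner ℝ (weightOp hκ hL e (coord (firstIndex (k := 1) i) w))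
          (weightOp hκ hL e (coord (firstIndex (k := 0) i) y))
      = -inner ℝ (weightDerivOp hκ hL e (toL2 y))
          (∑ i, e i • weightOp hκ hL e (coord (firstIndex (k := 1) i) w))
        - inner ℝ (weightOp hκ hL e (toL2 y))
          (∑ i, e i • weightDerivOp hκ hL e (coord (firstIndex (k := 1) i) w)) := by
    rw [laplacian_eq_sum, map_sum, inner_sum, inner_sum, inner_sum,
      Finset.sum_congr rfl fun i _ => hterm i]
    simp only [real_inner_smul_right, Finset.sum_sub_distrib, Finset.sum_neg_distrib]
    ring
  rw [hsum]
  exact neg_inner_sub_inner_le hκ (norm_weightDerivOp_le hκ hL _) (norm_sum_smul_le he _)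
    (norm_sum_smul_weightDerivOp_le hκ hL he _)

/-- The weighted energy. The zeroth order term carries the factor `κ`, so that it dominates the
`H¹` norm of the weighted solution up to a factor `√κ` only. -/
noncomputable def weightedEnergy (e : EuclideanSpace ℝ (Fin N)) (α : ℝ) (w : Sobolev N 2)
    (y : Sobolev N 1) : ℝ :=
  (‖weightOp hκ hL e (toL2 y)‖ ^ 2
    + α ^ 2 * ∑ i, ‖weightOp hκ hL e (coord (firstIndex (k := 1) i) w)‖ ^ 2
    + κ * ‖weightOp hκ hL e (toL2 w)‖ ^ 2) / 2

variable {a b : ℝ → ℝ} {p T : ℝ} {u : ℝ → Sobolev N 2} {v : ℝ → Sobolev N 1}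

theorem hasDeriv_weightedEnergy (h : AssumptionA1 a b) (hv : IsVelocity a b p T u v) {t : ℝ}
    (ht : t ∈ Ico 0 T) :
    HasDerivWithinAt (fun s => weightedEnergy hκ hL e (a s) (u s) (v s))
      (a t ^ 2 * (inner ℝ (weightOp hκ hL e (toL2 (v t))) (weightOp hκ hL e (laplacian (u t)))
          + ∑ i, inner ℝ (weightOp hκ hL e (coord (firstIndex (k := 1) i) (u t)))
            (weightOp hκ hL e (coord (firstIndex (k := 0) i) (v t))))
        - b t * ‖weightOp hκ hL e (toL2 (v t))‖ ^ 2
        + inner ℝ (weightOp hκ hL e (toL2 (v t))) (weightOp hκ hL e (powL2 p (toL2 (u t))))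
        + a t * derivWithin a (Ici 0) t
          * ∑ i, ‖weightOp hκ hL e (coord (firstIndex (k := 1) i) (u t))‖ ^ 2
        + κ * inner ℝ (weightOp hκ hL e (toL2 (u t))) (weightOp hκ hL e (toL2 (v t))))
      (Ico 0 T) t := by
  have hsub : Ico 0 T ⊆ Ici 0 := fun t ht => ht.1
  have h1 := (HasDerivWithinAt.continuousLinear (weightOp hκ hL e) (hv.hasDeriv_v t ht)).norm_sq
  have h2 : HasDerivWithinAt
      (fun s => ∑ i, ‖weightOp hκ hL e (coord (firstIndex (k := 1) i) (u s))‖ ^ 2)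
      (∑ i, 2 * inner ℝ (weightOp hκ hL e (coord (firstIndex (k := 1) i) (u t)))
        (weightOp hκ hL e (coord (firstIndex (k := 0) i) (v t)))) (Ico 0 T) t :=
    HasDerivWithinAt.fun_sum fun i _ =>
      (HasDerivWithinAt.continuousLinear (weightOp hκ hL e) (hv.hasDeriv_first ht i)).norm_sq
  have h3 := (HasDerivWithinAt.continuousLinear (weightOp hκ hL e) (hv.hasDeriv_toL2 ht)).norm_sq
  have h4 := ((h.hasDeriv_a ht.1).mono hsub).pow 2
  refine (((h1.add (h4.mul h2)).add (h3.const_mul κ)).div_const 2).congr_deriv ?_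
  simp only [map_add, map_sub, map_smul, inner_add_right, inner_sub_right, inner_smul_right,
    real_inner_self_eq_norm_sq, ← Finset.mul_sum, Pi.pow_apply]
  push_cast
  ring

/-- The differential inequality for the weighted energy, reduced to the sizes `X`, `G`, `Z` of
its three parts. -/
theorem energy_inequality {α α' β c m D s X G Z F n P : ℝ} (hα : 0 < α) (hm : 0 < m) (hmα : m ≤ α)
    (hc : 0 ≤ c) (hα' : |α'| ≤ c * α) (hβ : 0 ≤ β) (hs : 1 ≤ s) (hX : 0 ≤ X) (hG : 0 ≤ G)
    (hZ : 0 ≤ Z) (hn : 0 ≤ n) (hP : 0 ≤ P) (hF : F ≤ P * (Z + n * (G + s ^ 2 * Z)))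
    (hD : D = 2 * c + 1 + P * (1 + n) + P * n / m) :
    α ^ 2 * (2 * s ^ 2 * (X * G)) - β * X ^ 2 + X * F + α * α' * G ^ 2 + s ^ 2 * (Z * X)
      ≤ (2 * s ^ 2 * α + D * s) * ((X ^ 2 + α ^ 2 * G ^ 2 + s ^ 2 * Z ^ 2) / 2) := by
  set E := (X ^ 2 + α ^ 2 * G ^ 2 + s ^ 2 * Z ^ 2) / 2 with hE
  have hE0 : 0 ≤ E := by positivity
  have hsE : E ≤ s * E := le_mul_of_one_le_left hE0 hs
  -- the flux term gives the main rate `2 s² α`; the remaining terms are of order `s`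
  have i1 : α ^ 2 * (2 * s ^ 2 * (X * G)) ≤ 2 * s ^ 2 * α * E := by
    have : 2 * (X * (α * G)) ≤ 2 * E := by nlinarith [sq_nonneg (X - α * G), sq_nonneg (s * Z)]
    calc α ^ 2 * (2 * s ^ 2 * (X * G)) = s ^ 2 * α * (2 * (X * (α * G))) := by ring
      _ ≤ s ^ 2 * α * (2 * E) := by gcongr
      _ = _ := by ring
  have i2 : α * α' * G ^ 2 ≤ 2 * c * (s * E) := by
    have h1 : α' ≤ c * α := (le_abs_self _).trans hα'
    calc α * α' * G ^ 2 ≤ α * (c * α) * G ^ 2 := by gcongr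
      _ = c * (α ^ 2 * G ^ 2) := by ring
      _ ≤ c * (2 * E) :=
        mul_le_mul_of_nonneg_left (by nlinarith [sq_nonneg X, sq_nonneg (s * Z)]) hc
      _ ≤ 2 * c * (s * E) := by nlinarith
  have i0 : s * Z * X ≤ E := by
    nlinarith [sq_nonneg (X - s * Z), sq_nonneg (α * G)]
  have i3 : s ^ 2 * (Z * X) ≤ s * E := by
    calc s ^ 2 * (Z * X) = s * (s * Z * X) := by ring
      _ ≤ s * E := by gcongr
  have i4 : X * G ≤ E / m := by
    rw [le_div_iff₀ hm]
    have : X * G * m ≤ X * (α * G) := by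
      calc X * G * m ≤ X * G * α := by gcongr
        _ = _ := by ring
    nlinarith [sq_nonneg (X - α * G), sq_nonneg (s * Z)]
  have i5 : X * F ≤ (P * (1 + n) + P * n / m) * (s * E) := by
    have hZX : Z * X ≤ s * E := by
      have : Z * X ≤ s * Z * X := by
        have := mul_nonneg hZ hX
        nlinarith
      linarith
    calc X * F ≤ X * (P * (Z + n * (G + s ^ 2 * Z))) := by gcongr
      _ = P * (Z * X) + P * n * (X * G) + P * n * (s ^ 2 * (Z * X)) := by ring
      _ ≤ P * (s * E) + P * n * (s * E / m) + P * n * (s * E) := by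
        have : X * G ≤ s * E / m := i4.trans (by gcongr)
        gcongr
      _ = _ := by ring
  have i6 : 0 ≤ β * X ^ 2 := by positivity
  rw [hD]
  calc _ ≤ 2 * s ^ 2 * α * E + (P * (1 + n) + P * n / m) * (s * E) + 2 * c * (s * E) + s * E := by
        linarith
    _ = _ := by ring

/-- Grönwall's inequality with a variable rate `γ'`. -/
theorem le_exp_of_hasDeriv_le {f f' γ γ' : ℝ → ℝ} {t₁ : ℝ} (ht₁ : 0 ≤ t₁)
    (hf : ∀ t ∈ Icc 0 t₁, HasDerivWithinAt f (f' t) (Icc 0 t₁) t)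
    (hγ : ∀ t ∈ Icc 0 t₁, HasDerivWithinAt γ (γ' t) (Icc 0 t₁) t)
    (h : ∀ t ∈ Icc 0 t₁, f' t ≤ γ' t * f t) : f t₁ ≤ f 0 * Real.exp (γ t₁ - γ 0) := by
  have hd : ∀ t ∈ Icc 0 t₁, HasDerivWithinAt (fun t => f t * Real.exp (-γ t))
      (f' t * Real.exp (-γ t) + f t * (Real.exp (-γ t) * -γ' t)) (Icc 0 t₁) t := fun t ht =>
    (hf t ht).mul (hγ t ht).neg.exp
  have hanti : AntitoneOn (fun t => f t * Real.exp (-γ t)) (Icc 0 t₁) := by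
    refine antitoneOn_of_hasDerivWithinAt_nonpos (convex_Icc 0 t₁)
      (fun t ht => (hd t ht).continuousWithinAt)
      (fun t ht => (hd t (interior_subset ht)).mono interior_subset) fun t ht => ?_
    have h1 := h t (interior_subset ht)
    have h2 := Real.exp_pos (-γ t)
    nlinarith
  have h1 := hanti ⟨le_rfl, ht₁⟩ ⟨ht₁, le_rfl⟩ ht₁
  simp only at h1
  rw [sub_eq_add_neg, Real.exp_add, ← mul_assoc]
  have h2 := Real.exp_pos (γ t₁)
  have h3 : Real.exp (-γ t₁) * Real.exp (γ t₁) = 1 := by rw [← Real.exp_add]; simp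
  calc f t₁ = f t₁ * Real.exp (-γ t₁) * Real.exp (γ t₁) := by rw [mul_assoc, h3, mul_one]
    _ ≤ f 0 * Real.exp (-γ 0) * Real.exp (γ t₁) := by gcongr
    _ = _ := by ring

/-- Growth of the weighted energy: the rate is `2 κ a` up to an error of order `√κ`. -/
theorem exists_energy_growth (hp : 1 < p)
    (hpN : 5 ≤ N → p ≤ ((N : ℝ) - 2) / ((N : ℝ) - 4)) (h : AssumptionA1 a b)
    (hu : ContinuousOn u (Ico 0 T)) (hv : IsVelocity a b p T u v) {t₁ : ℝ} (ht₁ : t₁ ∈ Ico 0 T) :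
    ∃ D : ℝ, ∀ (s L : ℝ) (_ : 1 ≤ s) (hL : 0 < L) (e : EuclideanSpace ℝ (Fin N)), ‖e‖ ≤ 1 →
      weightedEnergy (sq_nonneg s) hL e (a t₁) (u t₁) (v t₁)
        ≤ weightedEnergy (sq_nonneg s) hL e (a 0) (u 0) (v 0)
          * Real.exp (2 * s ^ 2 * primitiveA a t₁ + D * s * t₁) := by
  obtain ⟨C, hC0, hC⟩ := exists_weighted_power_estimate (N := N) hp hpN
  have hsubT : Icc 0 t₁ ⊆ Ico 0 T := fun t ht => ⟨ht.1, ht.2.trans_lt ht₁.2⟩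
  have hsub : Icc 0 t₁ ⊆ Ici 0 := fun t ht => ht.1
  -- On the compact interval `[0, t₁]` the solution is bounded in `H²` by `Q`, the speed is at least
  -- `m`, and its logarithmic derivative is at most `c`.
  obtain ⟨Q, hQ⟩ := isCompact_Icc.exists_bound_of_continuousOn (hu.mono hsubT)
  have hQ0 : 0 ≤ Q := (norm_nonneg _).trans (hQ 0 ⟨le_rfl, ht₁.1⟩)
  obtain ⟨m, hm, hma⟩ : ∃ m > 0, ∀ t ∈ Icc (0 : ℝ) t₁, m ≤ a t := by
    obtain ⟨t₀, ht₀, hmin⟩ := isCompact_Icc.exists_isMinOn (nonempty_Icc.2 ht₁.1)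
      (h.continuousOn_a.mono hsub)
    exact ⟨a t₀, h.a_pos t₀ ht₀.1, fun t ht => hmin ht⟩
  obtain ⟨c, hc⟩ := isCompact_Icc.exists_bound_of_continuousOn
    ((h.contDiffOn_deriv_a.continuousOn.mono hsub).div (h.continuousOn_a.mono hsub)
      fun t ht => (h.a_pos t ht.1).ne')
  have hc0 : 0 ≤ c := (norm_nonneg _).trans (hc 0 ⟨le_rfl, ht₁.1⟩)
  set P := C * Q ^ (p - 1) with hP
  set D := 2 * c + 1 + P * (1 + N) + P * N / m with hD
  refine ⟨D, fun s L hs hL e he => ?_⟩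
  have hγ : ∀ t ∈ Icc 0 t₁, HasDerivWithinAt (fun t => 2 * s ^ 2 * primitiveA a t + D * s * t)
      (2 * s ^ 2 * a t + D * s) (Icc 0 t₁) t := by
    intro t ht
    have h1 := ((h.hasDeriv_primitiveA ht.1).mono hsub).const_mul (2 * s ^ 2)
    have h2 := (hasDerivWithinAt_id t (Icc 0 t₁)).const_mul (D * s)
    exact (h1.add h2).congr_deriv (by ring)
  have key := le_exp_of_hasDeriv_le ht₁.1
    (fun t ht => (hasDeriv_weightedEnergy (sq_nonneg s) hL (e := e) h hv (hsubT ht)).mono hsubT) hγ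
    ?_
  · simp only [primitiveA_zero, mul_zero, add_zero, sub_zero] at key
    exact key
  intro t ht
  have ha := h.a_pos t ht.1
  set M := weightOp (sq_nonneg s) hL e with hM
  set G := √(∑ i, ‖M (coord (firstIndex (k := 1) i) (u t))‖ ^ 2) with hG
  have hG2 : ∑ i, ‖M (coord (firstIndex (k := 1) i) (u t))‖ ^ 2 = G ^ 2 :=
    (Real.sq_sqrt (Finset.sum_nonneg fun i _ => sq_nonneg _)).symm
  have hGi : ∀ i, ‖M (coord (firstIndex (k := 1) i) (u t))‖ ≤ G := fun i => by
    refine Real.le_sqrt_of_sq_le ?_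
    exact Finset.single_le_sum (f := fun i => ‖M (coord (firstIndex (k := 1) i) (u t))‖ ^ 2)
      (fun i _ => sq_nonneg _) (Finset.mem_univ i)
  have hF : ‖M (powL2 p (toL2 (u t)))‖
      ≤ P * (‖M (toL2 (u t))‖ + N * (G + s ^ 2 * ‖M (toL2 (u t))‖)) := by
    refine (hC (sq_nonneg s) hL he (u t)).trans ?_
    rw [hP, mul_assoc]
    have h1 : ‖u t‖ ^ (p - 1) ≤ Q ^ (p - 1) :=
      Real.rpow_le_rpow (norm_nonneg _) (hQ t ht) (by linarith)
    have h2 : ∑ i, (‖M (coord (firstIndex (k := 1) i) (u t))‖ + s ^ 2 * ‖M (toL2 (u t))‖)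
        ≤ N * (G + s ^ 2 * ‖M (toL2 (u t))‖) := by
      refine (Finset.sum_le_sum fun i _ => add_le_add_left (hGi i) _).trans (le_of_eq ?_)
      rw [Finset.sum_const, Finset.card_univ, Fintype.card_fin, nsmul_eq_mul]
    gcongr
  have hα' : |derivWithin a (Ici 0) t| ≤ c * a t := by
    have := hc t ht
    rw [Pi.div_apply, norm_div, Real.norm_eq_abs, Real.norm_of_nonneg ha.le, div_le_iff₀ ha] at this
    exact this
  have hmain := energy_inequality (X := ‖M (toL2 (v t))‖) (G := G) (Z := ‖M (toL2 (u t))‖)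
    (α' := derivWithin a (Ici 0) t) ha hm (hma t ht) hc0 hα' (h.b_nonneg t ht.1) hs (norm_nonneg _)
    (Real.sqrt_nonneg _) (norm_nonneg _) (Nat.cast_nonneg N) (by positivity) hF hD
  have f1 := weighted_flux_le (sq_nonneg s) hL he (u t) (v t)
  have f2 := real_inner_le_norm (M (toL2 (v t))) (M (powL2 p (toL2 (u t))))
  have f3 := real_inner_le_norm (M (toL2 (u t))) (M (toL2 (v t)))
  rw [weightedEnergy, ← hM, hG2]
  refine le_trans ?_ hmain
  have f1' := mul_le_mul_of_nonneg_left f1 (sq_nonneg (a t))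
  have f3' := mul_le_mul_of_nonneg_left f3 (sq_nonneg s)
  gcongr

end FiniteSpeed

/-! ### The support of a solution -/

section Support

variable {N : ℕ}

/-- Weak derivatives are local. -/
theorem HasWeakDeriv.ae_eq_zero_on {i : Fin N} {w v : L2 N} (h : HasWeakDeriv (word i) w v)
    {U : Set (EuclideanSpace ℝ (Fin N))} (hU : IsOpen U) (hw : ∀ᵐ x, x ∈ U → w x = 0) :
    ∀ᵐ x, x ∈ U → v x = 0 := by
  refine hU.ae_eq_zero_of_integral_contDiff_smul_eq_zero
    (((Lp.memLp v).locallyIntegrable (by norm_num)).locallyIntegrableOn U) fun g hg hc hgU => ?_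
  have h1 := h g hg hc
  have h2 : ∫ x, w x * partialDeriv (word i) g x = 0 := by
    refine (integral_congr_ae ?_).trans (integral_zero _ _)
    filter_upwards [hw] with x hx
    by_cases hxU : x ∈ U
    · simp [hx hxU]
    · have : fderiv ℝ g x = 0 := by
        by_contra hne
        exact hxU (hgU (support_fderiv_subset ℝ hne))
      simp [partialDeriv_word, this]
  rw [h2] at h1
  have h3 : ∫ x, v x * g x = 0 := by simpa using h1.symm
  rw [← h3]
  exact integral_congr_ae (ae_of_all _ fun x => by simp [mul_comm])

theorem profile_mono {L : ℝ} (hL : 0 < L) {s t : ℝ} (h : s ≤ t) : profile L s ≤ profile L t := by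
  unfold profile
  refine mul_le_mul_of_nonneg_left (Real.arctan_strictMono.monotone ?_) hL.le
  gcongr

theorem profile_le_self {L : ℝ} (hL : 0 < L) {s : ℝ} (hs : 0 ≤ s) : profile L s ≤ s := by
  unfold profile
  have h1 : Real.arctan (s / L) ≤ s / L := by
    have h := Real.le_tan (Real.arctan_nonneg.2 (by positivity : 0 ≤ s / L))
      (Real.arctan_lt_pi_div_two _)
    rwa [Real.tan_arctan] at h
  calc L * Real.arctan (s / L) ≤ L * (s / L) := by gcongr
    _ = s := by field_simp

theorem exists_lt_profile {R s : ℝ} (h : R < s) : ∃ L > 0, R < profile L s := by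
  have hd : HasDerivAt (fun x : ℝ => Real.arctan (s * x)) s 0 := by
    have h1 : HasDerivAt (fun x : ℝ => s * x) s 0 := by
      simpa using (hasDerivAt_id (0 : ℝ)).const_mul s
    simpa using h1.arctan
  have h2 := hd.tendsto_slope_zero_right
  obtain ⟨x, hx, hx0⟩ := ((h2.eventually (lt_mem_nhds h)).and self_mem_nhdsWithin).exists
  have hx0 : 0 < x := hx0
  refine ⟨x⁻¹, by positivity, ?_⟩
  simpa [profile, div_eq_mul_inv] using hx

variable {κ L : ℝ} (hκ : 0 ≤ κ) (hL : 0 < L) {e : EuclideanSpace ℝ (Fin N)}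

theorem norm_weightOp_le_of_support (he : ‖e‖ ≤ 1) {r₀ : ℝ} (hr : 0 ≤ r₀) {w : L2 N}
    (hw : ∀ᵐ x, r₀ < ‖x‖ → w x = 0) : ‖weightOp hκ hL e w‖ ≤ Real.exp (κ * r₀) * ‖w‖ := by
  refine Lp.norm_le_mul_norm_of_ae_le_mul ?_
  filter_upwards [coeFn_weightOp (e := e) hκ hL w, hw] with x h1 h2
  rw [h1, norm_mul]
  by_cases hx : r₀ < ‖x‖
  · simp [h2 hx]
  · refine mul_le_mul_of_nonneg_right ?_ (norm_nonneg _)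
    rw [Real.norm_of_nonneg (expWeight_pos x).le]
    unfold expWeight
    have h3 : inner ℝ e x ≤ r₀ := by
      refine (real_inner_le_norm e x).trans ?_
      have := mul_le_mul he (not_lt.1 hx) (norm_nonneg x) zero_le_one
      linarith
    have h4 := (profile_mono hL h3).trans (profile_le_self hL hr)
    gcongr

theorem norm_indicator_le_weightOp {s₀ : ℝ} {w z : L2 N}
    (hz : z =ᵐ[volume] fun x => {x | s₀ ≤ inner ℝ e x}.indicator (fun _ => (1 : ℝ)) x * w x) :
    ‖z‖ ≤ Real.exp (-(κ * profile L s₀)) * ‖weightOp hκ hL e w‖ := by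
  refine Lp.norm_le_mul_norm_of_ae_le_mul ?_
  filter_upwards [coeFn_weightOp (e := e) hκ hL w, hz] with x h1 h2
  rw [h1, h2, norm_mul, norm_mul, ← mul_assoc]
  refine mul_le_mul_of_nonneg_right ?_ (norm_nonneg _)
  rw [Real.norm_of_nonneg (expWeight_pos x).le]
  unfold expWeight
  by_cases hx : s₀ ≤ inner ℝ e x
  · rw [Set.indicator_of_mem (by exact hx), norm_one, ← Real.exp_add]
    refine Real.one_le_exp ?_
    have := mul_le_mul_of_nonneg_left (profile_mono hL hx) hκ
    linarith
  · rw [Set.indicator_of_notMem (by exact hx), norm_zero]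
    positivity

/-- A function vanishing on every half space that misses a ball vanishes off the ball. -/
theorem ae_eq_zero_of_half_spaces {R : ℝ} (hR : 0 ≤ R) {w : EuclideanSpace ℝ (Fin N) → ℝ}
    (h : ∀ e : EuclideanSpace ℝ (Fin N), ‖e‖ ≤ 1 → ∀ s₀, R < s₀ →
      ∀ᵐ x, s₀ ≤ inner ℝ e x → w x = 0) : ∀ᵐ x, R < ‖x‖ → w x = 0 := by
  set d : ℕ → EuclideanSpace ℝ (Fin N) := TopologicalSpace.denseSeq _ with hd
  have hall : ∀ᵐ x, ∀ (n : ℕ) (q : ℚ), R < q → (q : ℝ) ≤ inner ℝ (‖d n‖⁻¹ • d n) x → w x = 0 := by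
    rw [ae_all_iff]
    intro n
    rw [ae_all_iff]
    intro q
    by_cases hq : R < q
    · filter_upwards [h (‖d n‖⁻¹ • d n) (by
        rw [norm_smul, norm_inv, norm_norm]; exact inv_mul_le_one) q hq] with x hx _ using hx
    · exact ae_of_all _ fun x h => absurd h hq
  filter_upwards [hall] with x hx hRx
  have hx0 : ‖x‖ ≠ 0 := by linarith
  obtain ⟨q, hq1, hq2⟩ := exists_rat_btwn hRx
  have hcont : ContinuousAt (fun y : EuclideanSpace ℝ (Fin N) => inner ℝ (‖y‖⁻¹ • y) x) x := by
    refine ContinuousAt.inner ((continuous_norm.continuousAt.inv₀ hx0).smul continuousAt_id)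
      continuousAt_const
  have hval : (q : ℝ) < inner ℝ (‖x‖⁻¹ • x) x := by
    rw [real_inner_smul_left, real_inner_self_eq_norm_sq]
    field_simp
    exact hq2
  have hnhds := hcont.eventually (lt_mem_nhds hval)
  obtain ⟨n, hn⟩ := (TopologicalSpace.denseRange_denseSeq _).exists_mem_open
    isOpen_interior ⟨x, mem_interior_iff_mem_nhds.2 hnhds⟩
  have hn2 : (q : ℝ) < inner ℝ (‖d n‖⁻¹ • d n) x := by
    have h3 := interior_subset hn
    exact h3
  exact hx n q hq1 hn2.le

theorem tendsto_exp_linear_sub_quadratic {δ : ℝ} (hδ : 0 < δ) (c : ℝ) :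
    Tendsto (fun s : ℝ => Real.exp (c * s - δ * s ^ 2)) atTop (𝓝 0) := by
  refine Real.tendsto_exp_atBot.comp ?_
  have h1 : Tendsto (fun s : ℝ => c + -δ * s) atTop atBot :=
    tendsto_atBot_add_const_left _ _ (tendsto_id.const_mul_atTop_of_neg (by linarith))
  refine (tendsto_id.atTop_mul_atBot₀ h1).congr fun s => ?_
  simp only [id]
  ring

end Support

section FiniteSpeed

variable {N : ℕ} {a b : ℝ → ℝ} {p T : ℝ} {u : ℝ → Sobolev N 2} {v : ℝ → Sobolev N 1}

theorem sq_le_weightedEnergy {κ L : ℝ} (hκ : 0 ≤ κ) (hL : 0 < L) {e : EuclideanSpace ℝ (Fin N)}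
    (α : ℝ) (w : Sobolev N 2) (y : Sobolev N 1) :
    κ * ‖weightOp hκ hL e (toL2 w)‖ ^ 2 / 2 ≤ weightedEnergy hκ hL e α w y := by
  have h1 : 0 ≤ α ^ 2 * ∑ i, ‖weightOp hκ hL e (coord (firstIndex (k := 1) i) w)‖ ^ 2 :=
    mul_nonneg (sq_nonneg _) (Finset.sum_nonneg fun i _ => sq_nonneg _)
  have h2 := sq_nonneg ‖weightOp hκ hL e (toL2 y)‖
  unfold weightedEnergy
  linarith

theorem energy_le_of_parts {α κ E x y z x' y' z' : ℝ} (hκ : 1 ≤ κ) (hE : 0 ≤ E) (hx : 0 ≤ x)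
    (hα : 0 ≤ α) (hy : 0 ≤ y) (h1 : x' ≤ E * x) (h2 : z' ≤ E * z) (h3 : y' ≤ E * y) :
    (x' + α * y' + κ * z') / 2 ≤ (x + α * y + z) / 2 * κ * E := by
  have h4 : E * x ≤ κ * (E * x) := le_mul_of_one_le_left (by positivity) hκ
  have h5 : α * (E * y) ≤ κ * (α * (E * y)) := le_mul_of_one_le_left (by positivity) hκ
  have h6 : α * y' ≤ α * (E * y) := mul_le_mul_of_nonneg_left h3 hα
  have h7 : κ * z' ≤ κ * (E * z) := mul_le_mul_of_nonneg_left h2 (zero_le_one.trans hκ)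
  linarith

/-- Data supported in the ball of radius `r₀` have weighted energy of order `s² e^{2 s² r₀}`,
uniformly in the direction and in the truncation of the weight. -/
theorem exists_initial_energy_le {α r₀ : ℝ} (hr : 0 ≤ r₀) {w : Sobolev N 2} {y : Sobolev N 1}
    (hw : ∀ᵐ x, r₀ < ‖x‖ → toL2 w x = 0) (hy : ∀ᵐ x, r₀ < ‖x‖ → toL2 y x = 0) :
    ∃ C, 0 ≤ C ∧ ∀ (s L : ℝ) (_ : 1 ≤ s) (hL : 0 < L) (e : EuclideanSpace ℝ (Fin N)), ‖e‖ ≤ 1 →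
      weightedEnergy (sq_nonneg s) hL e α w y ≤ C * s ^ 2 * Real.exp (2 * (s ^ 2 * r₀)) := by
  have hopen : IsOpen {x : EuclideanSpace ℝ (Fin N) | r₀ < ‖x‖} :=
    isOpen_lt continuous_const continuous_norm
  have hd : ∀ i, ∀ᵐ x, r₀ < ‖x‖ → coord (firstIndex (k := 1) i) w x = 0 := fun i =>
    (hasWeakDeriv_first (k := 1) i w).ae_eq_zero_on hopen hw
  refine ⟨(‖toL2 y‖ ^ 2 + α ^ 2 * ∑ i, ‖coord (firstIndex (k := 1) i) w‖ ^ 2 + ‖toL2 w‖ ^ 2) / 2,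
    by positivity, fun s L hs hL e he => ?_⟩
  have key : ∀ f : L2 N, (∀ᵐ x, r₀ < ‖x‖ → f x = 0) →
      ‖weightOp (sq_nonneg s) hL e f‖ ^ 2 ≤ Real.exp (2 * (s ^ 2 * r₀)) * ‖f‖ ^ 2 := by
    intro f hf
    have h1 := norm_weightOp_le_of_support (sq_nonneg s) hL he hr hf
    have h2 : Real.exp (2 * (s ^ 2 * r₀)) = Real.exp (s ^ 2 * r₀) ^ 2 := by
      rw [← Real.exp_nat_mul]; norm_num
    rw [h2, ← mul_pow]
    gcongr
  have h3 : ∑ i, ‖weightOp (sq_nonneg s) hL e (coord (firstIndex (k := 1) i) w)‖ ^ 2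
      ≤ Real.exp (2 * (s ^ 2 * r₀)) * ∑ i, ‖coord (firstIndex (k := 1) i) w‖ ^ 2 := by
    rw [Finset.mul_sum]
    exact Finset.sum_le_sum fun i _ => key _ (hd i)
  exact energy_le_of_parts (one_le_pow₀ hs) (Real.exp_pos _).le (sq_nonneg _) (sq_nonneg _)
    (Finset.sum_nonneg fun i _ => sq_nonneg _) (key _ hy) (key _ hw) h3

/-- Comparison of the growth of the weighted energy with the size of the weight at distance `ρ`:
the mass `Z` beyond that distance is exponentially small in `s²` once `ρ > r + A`. -/
theorem sq_le_of_energy_le {Z W C s r A D t ρ δ : ℝ} (hZ : 0 ≤ Z) (hs : 0 < s ^ 2)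
    (h1 : Z ≤ Real.exp (-(s ^ 2 * ρ)) * W)
    (h2 : s ^ 2 * W ^ 2 / 2
      ≤ C * s ^ 2 * Real.exp (2 * (s ^ 2 * r)) * Real.exp (2 * s ^ 2 * A + D * s * t))
    (hδ : δ = ρ - (r + A)) : Z ^ 2 ≤ 2 * C * Real.exp (D * t * s - 2 * δ * s ^ 2) := by
  have h3 : W ^ 2 ≤ 2 * (C * Real.exp (2 * (s ^ 2 * r))
      * Real.exp (2 * s ^ 2 * A + D * s * t)) := le_of_mul_le_mul_left (by linarith) hs
  calc Z ^ 2 ≤ (Real.exp (-(s ^ 2 * ρ)) * W) ^ 2 := by gcongr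
    _ = Real.exp (-(s ^ 2 * ρ)) ^ 2 * W ^ 2 := mul_pow _ _ _
    _ ≤ Real.exp (-(s ^ 2 * ρ)) ^ 2 * (2 * (C * Real.exp (2 * (s ^ 2 * r))
      * Real.exp (2 * s ^ 2 * A + D * s * t))) := by gcongr
    _ = 2 * C * (Real.exp (-(s ^ 2 * ρ)) * Real.exp (-(s ^ 2 * ρ)) * Real.exp (2 * (s ^ 2 * r))
      * Real.exp (2 * s ^ 2 * A + D * s * t)) := by ring
    _ = _ := by
      rw [← Real.exp_add, ← Real.exp_add, ← Real.exp_add, hδ]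
      congr 2
      ring

/-- Finite speed of propagation: the exponential weights `e^{s² ⟪e, x⟫}`, `s → ∞`, detect
any mass beyond `r₀ + A(t)`. -/
theorem IsVelocity.finite_speed (hp : 1 < p)
    (hpN : 5 ≤ N → p ≤ ((N : ℝ) - 2) / ((N : ℝ) - 4)) (h : AssumptionA1 a b)
    (hu : ContinuousOn u (Ico 0 T)) (hv : IsVelocity a b p T u v) {r₀ : ℝ} (hr : 0 ≤ r₀)
    (hu0 : ∀ᵐ x, r₀ < ‖x‖ → toL2 (u 0) x = 0) (hv0 : ∀ᵐ x, r₀ < ‖x‖ → toL2 (v 0) x = 0)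
    {t : ℝ} (ht : t ∈ Ico 0 T) :
    ∀ᵐ x, r₀ + primitiveA a t < ‖x‖ → toL2 (u t) x = 0 := by
  obtain ⟨D, hD⟩ := exists_energy_growth hp hpN h hu hv ht
  obtain ⟨C, hC0, hC⟩ := exists_initial_energy_le (α := a 0) hr hu0 hv0
  refine ae_eq_zero_of_half_spaces (add_nonneg hr (h.primitiveA_nonneg ht.1)) fun e he s₀ hs₀ => ?_
  -- The truncation `L` of the weight is fixed so that the profile at `s₀` still exceeds `r₀ + A`. Then
  -- the mass `z` beyond `s₀` vanishes in the limit `s → ∞`.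
  obtain ⟨L, hL, hLs⟩ := exists_lt_profile hs₀
  set δ := profile L s₀ - (r₀ + primitiveA a t) with hδ
  have hδ0 : 0 < δ := by simp only [hδ]; linarith
  have hmeas : MeasurableSet {x : EuclideanSpace ℝ (Fin N) | s₀ ≤ inner ℝ e x} :=
    (isClosed_le continuous_const (continuous_const.inner continuous_id)).measurableSet
  set m : EuclideanSpace ℝ (Fin N) → ℝ :=
    {x : EuclideanSpace ℝ (Fin N) | s₀ ≤ inner ℝ e x}.indicator fun _ => (1 : ℝ) with hm
  have hmm : AEStronglyMeasurable m volume :=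
    (measurable_const.indicator hmeas).aestronglyMeasurable
  have hmC : ∀ x, ‖m x‖ ≤ 1 := fun x =>
    (norm_indicator_le_norm_self (fun _ : EuclideanSpace ℝ (Fin N) => (1 : ℝ)) x).trans (by simp)
  set z := mulOp m hmm 1 hmC (toL2 (u t)) with hz
  have hzm := coeFn_mulOp hmm hmC (toL2 (u t))
  have hbound : ∀ s : ℝ, 1 ≤ s →
      ‖z‖ ^ 2 ≤ 2 * C * Real.exp (D * t * s - 2 * δ * s ^ 2) := by
    intro s hs
    have hs2 : 0 < s ^ 2 := by positivity
    have h1 := norm_indicator_le_weightOp (sq_nonneg s) hL hzm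
    have h2 := (hD s L hs hL e he).trans (mul_le_mul_of_nonneg_right (hC s L hs hL e he)
      (Real.exp_pos _).le)
    exact sq_le_of_energy_le (norm_nonneg _) hs2 h1
      ((sq_le_weightedEnergy (sq_nonneg s) hL _ (u t) (v t)).trans h2) hδ
  have hlim := (tendsto_exp_linear_sub_quadratic (by positivity : 0 < 2 * δ) (D * t)).const_mul
    (2 * C)
  have hz0 : ‖z‖ ^ 2 ≤ 2 * C * 0 :=
    ge_of_tendsto hlim ((eventually_ge_atTop 1).mono hbound)
  have hz1 : z = 0 := by
    rw [← norm_eq_zero]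
    exact pow_eq_zero_iff (two_ne_zero) |>.1 (le_antisymm (by simpa using hz0) (sq_nonneg _))
  filter_upwards [hzm, Lp.coeFn_zero ℝ 2 (volume : Measure (EuclideanSpace ℝ (Fin N)))] with x h1 h2 h3
  rw [← hz, hz1, h2, hm, Set.indicator_of_mem (by exact h3)] at h1
  simpa using h1.symm

end FiniteSpeed

/-! ### Moments of a solution against a smooth function -/

section Moments

variable {N : ℕ}

theorem exists_smooth_cutoff (N : ℕ) (R : ℝ) : ∃ χ : EuclideanSpace ℝ (Fin N) → ℝ,
    ContDiff ℝ ∞ χ ∧ HasCompactSupport χ ∧ ∀ x, ‖x‖ < R → χ =ᶠ[𝓝 x] fun _ => 1 := by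
  obtain ⟨C, χ, h1, h2, h3, h4, -⟩ := exists_cutoff N
  obtain ⟨n, hn⟩ := exists_nat_ge R
  refine ⟨χ n, h1 n, h2 n, fun x hx => ?_⟩
  have hopen : IsOpen {y : EuclideanSpace ℝ (Fin N) | ‖y‖ < R} :=
    isOpen_lt continuous_norm continuous_const
  filter_upwards [hopen.mem_nhds hx] with y hy
  refine h4 n y ?_
  have : ‖y‖ < R := hy
  linarith

theorem partialDeriv_congr {j : ℕ} (α : Fin j → Fin N) {φ ψ : EuclideanSpace ℝ (Fin N) → ℝ}
    {x : EuclideanSpace ℝ (Fin N)} (h : φ =ᶠ[𝓝 x] ψ) : partialDeriv α φ x = partialDeriv α ψ x := by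
  unfold partialDeriv
  rw [(Filter.EventuallyEq.iteratedFDeriv (𝕜 := ℝ) h j).eq_of_nhds]

theorem integral_mul_congr_of_support {R : ℝ} {w : EuclideanSpace ℝ (Fin N) → ℝ}
    (hw : ∀ᵐ x, R < ‖x‖ → w x = 0) {φ ψ : EuclideanSpace ℝ (Fin N) → ℝ}
    (h : ∀ x, ‖x‖ ≤ R → φ x = ψ x) : ∫ x, w x * φ x = ∫ x, w x * ψ x := by
  refine integral_congr_ae ?_
  filter_upwards [hw] with x hx
  rcases lt_or_ge R ‖x‖ with h1 | h1
  · rw [hx h1, zero_mul, zero_mul]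
  · rw [h x h1]

/-- The `L²` class of a test function. -/
noncomputable def testL2 {ψ : EuclideanSpace ℝ (Fin N) → ℝ} (hψ : Continuous ψ)
    (hc : HasCompactSupport ψ) : L2 N :=
  (hψ.memLp_of_hasCompactSupport hc : MemLp ψ 2 volume).toLp ψ

theorem inner_testL2 {ψ : EuclideanSpace ℝ (Fin N) → ℝ} (hψ : Continuous ψ)
    (hc : HasCompactSupport ψ) (w : L2 N) : inner ℝ (testL2 hψ hc) w = ∫ x, w x * ψ x := by
  rw [inner_eq_integral]
  refine integral_congr_ae ?_
  filter_upwards [MemLp.coeFn_toLp (hψ.memLp_of_hasCompactSupport hc : MemLp ψ 2 volume)] with x hx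
  rw [testL2, hx, mul_comm]

theorem inner_testL2_laplacian {ψ : EuclideanSpace ℝ (Fin N) → ℝ} (hψ : ContDiff ℝ ∞ ψ)
    (hc : HasCompactSupport ψ) (w : Sobolev N 2) :
    inner ℝ (testL2 hψ.continuous hc) (laplacian w)
      = ∫ x, toL2 w x * ∑ i : Fin N, partialDeriv (fun _ : Fin 2 => i) ψ x := by
  rw [laplacian_eq_sum, inner_sum]
  simp only [Finset.mul_sum]
  rw [integral_finsetSum]
  · refine Finset.sum_congr rfl fun i _ => ?_
    rw [inner_testL2]
    have := hasWeakDeriv_coord (⟨2, fun _ => i⟩ : DerivIndex N 2) w ψ hψ hc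
    have h2 : ((-1 : ℝ) ^ (((⟨2, fun _ => i⟩ : DerivIndex N 2).1 : Fin 3) : ℕ)) = 1 := by
      change (-1 : ℝ) ^ 2 = 1
      norm_num
    rw [h2, one_mul] at this
    exact this.symm
  · intro i _
    exact integrable_mul_test _ (continuous_partialDeriv _ hψ) (hasCompactSupport_partialDeriv _ hc)

variable {a b : ℝ → ℝ} {p T : ℝ} {u : ℝ → Sobolev N 2} {v : ℝ → Sobolev N 1}

/-- The moment `∫ u φ` against an eigenfunction `Δ φ = ℓ φ` solves an ordinary differential
equation of second order. By finite speed of propagation `φ` need not have compact support. -/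
theorem IsVelocity.exists_moment_ode (hp : 1 < p)
    (hpN : 5 ≤ N → p ≤ ((N : ℝ) - 2) / ((N : ℝ) - 4)) (h : AssumptionA1 a b)
    (hu : ContinuousOn u (Ico 0 T)) (hv : IsVelocity a b p T u v) {r₀ : ℝ} (hr : 0 ≤ r₀)
    (hu0 : ∀ᵐ x, r₀ < ‖x‖ → toL2 (u 0) x = 0) (hv0 : ∀ᵐ x, r₀ < ‖x‖ → toL2 (v 0) x = 0)
    {φ : EuclideanSpace ℝ (Fin N) → ℝ} (hφ : ContDiff ℝ ∞ φ) {ℓ : ℝ}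
    (hΔ : ∀ x, ∑ i : Fin N, partialDeriv (fun _ : Fin 2 => i) φ x = ℓ * φ x)
    {t₁ : ℝ} (ht₁ : t₁ ∈ Ico 0 T) :
    ContinuousOn (fun t => ∫ x, |toL2 (u t) x| ^ p * φ x) (Icc 0 t₁) ∧
    ∃ y' : ℝ → ℝ, y' 0 = ∫ x, toL2 (v 0) x * φ x ∧
      ∀ t ∈ Icc 0 t₁,
        HasDerivWithinAt (fun s => ∫ x, toL2 (u s) x * φ x) (y' t) (Icc 0 t₁) t ∧
        HasDerivWithinAt y' (a t ^ 2 * (ℓ * ∫ x, toL2 (u t) x * φ x) - b t * y' t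
          + ∫ x, |toL2 (u t) x| ^ p * φ x) (Icc 0 t₁) t := by
  obtain ⟨hpow, -⟩ := exists_powL2_estimate (N := N) hp hpN
  have hsubT : Icc 0 t₁ ⊆ Ico 0 T := fun t ht => ⟨ht.1, ht.2.trans_lt ht₁.2⟩
  set R := r₀ + primitiveA a t₁ with hR
  -- `ψ = χ φ` agrees with `φ` near the support of `u` up to the time `t₁`, and so do its derivatives.
  obtain ⟨χ, hχ, hχc, hχ1⟩ := exists_smooth_cutoff N (R + 1)
  set ψ : EuclideanSpace ℝ (Fin N) → ℝ := fun x => χ x * φ x with hψdef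
  have hψ : ContDiff ℝ ∞ ψ := hχ.mul hφ
  have hψc : HasCompactSupport ψ := hχc.mul_right
  have hψφ : ∀ x, ‖x‖ ≤ R → ψ =ᶠ[𝓝 x] φ := fun x hx => by
    filter_upwards [hχ1 x (by linarith)] with y hy
    simp [hψdef, hy]
  have hmono : ∀ t ∈ Icc 0 t₁, primitiveA a t ≤ primitiveA a t₁ := fun t ht =>
    h.strictMonoOn_primitiveA.monotoneOn ht.1 ht₁.1 ht.2
  have hsupp : ∀ t ∈ Icc 0 t₁, ∀ᵐ x, R < ‖x‖ → toL2 (u t) x = 0 := fun t ht => by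
    filter_upwards [hv.finite_speed hp hpN h hu hr hu0 hv0 (hsubT ht)] with x hx hxR
    refine hx (lt_of_le_of_lt ?_ hxR)
    have := hmono t ht
    linarith
  have hv0' : ∀ᵐ x, R < ‖x‖ → toL2 (v 0) x = 0 := by
    filter_upwards [hv0] with x hx hxR
    refine hx (lt_of_le_of_lt ?_ hxR)
    have := h.primitiveA_nonneg ht₁.1
    linarith
  set Ψ := testL2 hψ.continuous hψc with hΨ
  have e1 : ∀ t ∈ Icc 0 t₁, ∫ x, toL2 (u t) x * φ x = innerSL ℝ Ψ (toL2 (u t)) := fun t ht => by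
    rw [innerSL_apply_apply, inner_testL2]
    exact (integral_mul_congr_of_support (hsupp t ht) fun x hx => (hψφ x hx).eq_of_nhds).symm
  have e2 : ∀ t ∈ Icc 0 t₁, ∫ x, |toL2 (u t) x| ^ p * φ x = innerSL ℝ Ψ (powL2 p (toL2 (u t))) := by
    intro t ht
    rw [innerSL_apply_apply, inner_testL2]
    have h0 : ∀ᵐ x, R < ‖x‖ → |toL2 (u t) x| ^ p = 0 := by
      filter_upwards [hsupp t ht] with x hx hxR
      rw [hx hxR, abs_zero, Real.zero_rpow (by linarith)]
    rw [← integral_mul_congr_of_support h0 fun x hx => (hψφ x hx).eq_of_nhds]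
    refine integral_congr_ae ?_
    filter_upwards [coeFn_powL2 (hpow (u t))] with x hx
    rw [hx]
  have e3 : ∀ t ∈ Icc 0 t₁,
      innerSL ℝ Ψ (laplacian (u t)) = ℓ * ∫ x, toL2 (u t) x * φ x := by
    intro t ht
    rw [innerSL_apply_apply, inner_testL2_laplacian hψ hψc,
      integral_mul_congr_of_support (ψ := fun x => ℓ * φ x) (hsupp t ht), ← integral_const_mul]
    · exact integral_congr_ae (ae_of_all _ fun x => by simp only; ring)
    · intro x hx
      rw [← hΔ x]
      exact Finset.sum_congr rfl fun i _ => partialDeriv_congr _ (hψφ x hx)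
  refine ⟨?_, fun t => innerSL ℝ Ψ (toL2 (v t)), ?_, fun t ht => ⟨?_, ?_⟩⟩
  · have hc : ContinuousOn (fun t => innerSL ℝ Ψ (powL2 p (toL2 (u t)))) (Icc 0 t₁) :=
      (innerSL ℝ Ψ).continuous.comp_continuousOn
        ((continuousOn_powL2 hp hpN hu).mono hsubT)
    exact hc.congr fun t ht => e2 t ht
  · beta_reduce
    rw [innerSL_apply_apply, inner_testL2]
    exact integral_mul_congr_of_support hv0' fun x hx => (hψφ x hx).eq_of_nhds
  · exact ((HasDerivWithinAt.continuousLinear (innerSL ℝ Ψ) (hv.hasDeriv_toL2 (hsubT ht))).mono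
      hsubT).congr (fun s hs => e1 s hs) (e1 t ht)
  · refine ((HasDerivWithinAt.continuousLinear (innerSL ℝ Ψ) (hv.hasDeriv_v t (hsubT ht))).mono
      hsubT).congr_deriv ?_
    rw [map_add, map_sub, map_smul, map_smul, e3 t ht, ← e2 t ht, smul_eq_mul, smul_eq_mul]

/-- Hölder's inequality for the moments. -/
theorem moment_le (hp : 1 < p) {w : L2 N} {R : ℝ} (hw : ∀ᵐ x, R < ‖x‖ → w x = 0)
    (hwp : MemLp (fun x => |w x| ^ p) 2) {φ : EuclideanSpace ℝ (Fin N) → ℝ} (hφ : Continuous φ)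
    (hφ1 : ∀ x, 1 ≤ φ x) :
    ∫ x, w x * φ x ≤ (∫ x, |w x| ^ p) ^ (1 / p)
      * (∫ x in Metric.closedBall 0 R, φ x ^ (p / (p - 1))) ^ (1 / (p / (p - 1))) := by
  have hpq : p.HolderConjugate (p / (p - 1)) := Real.HolderConjugate.conjExponent hp
  set B : Set (EuclideanSpace ℝ (Fin N)) := Metric.closedBall 0 R with hB
  have hBm : MeasurableSet B := Metric.isClosed_closedBall.measurableSet
  have hw' : ∀ᵐ x, x ∉ B → w x = 0 := by
    filter_upwards [hw] with x hx hxB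
    exact hx (by simpa [hB] using hxB)
  have hwB : ∫ x, |w x| ^ p = ∫ x in B, |w x| ^ p := by
    refine (setIntegral_eq_integral_of_ae_compl_eq_zero ?_).symm
    filter_upwards [hw'] with x hx hxB
    rw [hx hxB, abs_zero, Real.zero_rpow (by linarith)]
  have hφB : ∫ x, w x * φ x = ∫ x in B, w x * φ x := by
    refine (setIntegral_eq_integral_of_ae_compl_eq_zero ?_).symm
    filter_upwards [hw'] with x hx hxB
    rw [hx hxB, zero_mul]
  have : IsFiniteMeasure (volume.restrict B) :=
    ⟨by rw [Measure.restrict_apply_univ]; exact measure_closedBall_lt_top⟩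
  have hp0 : ENNReal.ofReal p ≠ 0 := by simp; linarith
  have hq1 : 1 < p / (p - 1) := hpq.symm.lt
  have m1 : MemLp w (ENNReal.ofReal p) (volume.restrict B) := by
    rw [← integrable_norm_rpow_iff (Lp.aestronglyMeasurable w).restrict hp0 ENNReal.ofReal_ne_top,
      ENNReal.toReal_ofReal (by linarith)]
    exact (hwp.restrict B).integrable (by norm_num)
  have m2 : MemLp φ (ENNReal.ofReal (p / (p - 1))) (volume.restrict B) := by
    rw [← integrable_norm_rpow_iff hφ.aestronglyMeasurable.restrict (by simp; linarith)
      ENNReal.ofReal_ne_top, ENNReal.toReal_ofReal (by linarith)]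
    have : Continuous fun x => ‖φ x‖ ^ (p / (p - 1)) :=
      hφ.norm.rpow_const fun x => Or.inr (by linarith)
    exact (this.continuousOn.integrableOn_compact (isCompact_closedBall _ _))
  have key := integral_mul_norm_le_Lp_mul_Lq (μ := volume.restrict B) (f := fun x => w x) (g := φ)
    hpq m1 m2
  rw [hwB, hφB]
  have e : ∫ x in B, φ x ^ (p / (p - 1)) = ∫ x in B, ‖φ x‖ ^ (p / (p - 1)) :=
    integral_congr_ae (ae_of_all _ fun x => by
      simp only
      rw [Real.norm_of_nonneg (zero_le_one.trans (hφ1 x))])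
  rw [e]
  refine le_trans ((le_abs_self _).trans ?_) key
  rw [← Real.norm_eq_abs]
  refine (norm_integral_le_integral_norm _).trans (le_of_eq ?_)
  exact integral_congr_ae (ae_of_all _ fun x => by simp)

end Moments

/-! ### A radial solution of `Δ φ = φ` -/

section BesselSeries

/-- The coefficients of the series `∑ c_k s^k`, which at `s = |x|²` is the radial
eigenfunction of the Laplacian in dimension `d`. -/
noncomputable def besselCoeff (d k : ℕ) : ℝ :=
  ∏ j ∈ Finset.range k, (((j : ℝ) + 1) * (4 * j + 2 * d))⁻¹

/-- The entire function `∑ c_k s^k`. -/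
noncomputable def besselSeries (d : ℕ) (s : ℝ) : ℝ := ∑' k, besselCoeff d k * s ^ k

variable {d : ℕ}

theorem besselCoeff_zero : besselCoeff d 0 = 1 := by simp [besselCoeff]

theorem besselCoeff_succ (k : ℕ) :
    besselCoeff d (k + 1) = besselCoeff d k * (((k : ℝ) + 1) * (4 * k + 2 * d))⁻¹ := by
  rw [besselCoeff, Finset.prod_range_succ, besselCoeff]

theorem besselCoeff_nonneg (k : ℕ) : 0 ≤ besselCoeff d k :=
  Finset.prod_nonneg fun j _ => by positivity

theorem besselCoeff_le (hd : 1 ≤ d) (k : ℕ) : besselCoeff d k ≤ ((k.factorial : ℕ) : ℝ)⁻¹ := by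
  induction k with
  | zero => simp [besselCoeff_zero]
  | succ k ih =>
    have hd' : (1 : ℝ) ≤ d := by exact_mod_cast hd
    have h1 : (((k : ℝ) + 1) * (4 * k + 2 * d))⁻¹ ≤ ((k : ℝ) + 1)⁻¹ := by
      refine inv_anti₀ (by positivity) (le_mul_of_one_le_right (by positivity) ?_)
      have : (0 : ℝ) ≤ k := Nat.cast_nonneg k
      linarith
    rw [besselCoeff_succ]
    refine (mul_le_mul ih h1 (inv_nonneg.2 (by positivity)) (by positivity)).trans (le_of_eq ?_)
    rw [Nat.factorial_succ]
    push_cast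
    rw [mul_comm ((k : ℝ) + 1), mul_inv]

theorem succ_mul_besselCoeff (hd : 1 ≤ d) (k : ℕ) :
    ((k : ℝ) + 1) * besselCoeff d (k + 1) = besselCoeff (d + 2) k / (2 * d) := by
  have hd' : (0 : ℝ) < d := by exact_mod_cast hd
  induction k with
  | zero => simp [besselCoeff_succ, besselCoeff_zero, div_eq_inv_mul]
  | succ k ih =>
    have h1 : besselCoeff d (k + 1) = besselCoeff (d + 2) k / (2 * d) / ((k : ℝ) + 1) := by
      rw [← ih]; field_simp
    rw [besselCoeff_succ (d := d) (k + 1), h1, besselCoeff_succ (d := d + 2)]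
    push_cast
    have : (0 : ℝ) < 4 * ((k : ℝ) + 1) + 2 * d := by positivity
    have h2 : (0 : ℝ) < 4 * (k : ℝ) + 2 * (d + 2) := by positivity
    field_simp
    ring

theorem summable_besselSeries (hd : 1 ≤ d) (s : ℝ) : Summable fun k => besselCoeff d k * s ^ k := by
  refine Summable.of_norm_bounded (Real.summable_pow_div_factorial |s|) fun k => ?_
  rw [norm_mul, Real.norm_of_nonneg (besselCoeff_nonneg k), norm_pow, Real.norm_eq_abs, mul_comm,
    div_eq_mul_inv]
  exact mul_le_mul_of_nonneg_left (besselCoeff_le hd k) (by positivity)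

/-- Differentiation shifts the dimension by two. -/
theorem hasDerivAt_besselSeries (hd : 1 ≤ d) (s : ℝ) :
    HasDerivAt (besselSeries d) (besselSeries (d + 2) s / (2 * d)) s := by
  set R := |s| + 1 with hR
  have hR0 : 0 < R := by positivity
  have hterm : ∀ (k : ℕ) (y : ℝ), HasDerivAt (fun y => besselCoeff d k * y ^ k)
      (besselCoeff d k * (k * y ^ (k - 1))) y := fun k y => (hasDerivAt_pow k y).const_mul _
  have hu : Summable fun k : ℕ => besselCoeff d k * (k * R ^ (k - 1)) := by
    rw [← summable_nat_add_iff 1]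
    refine ((summable_besselSeries (by omega : 1 ≤ d + 2) R).div_const (2 * d)).congr fun k => ?_
    have := succ_mul_besselCoeff hd k
    rw [Nat.add_sub_cancel]
    push_cast
    calc _ = (besselCoeff (d + 2) k / (2 * d)) * R ^ k := by ring
      _ = _ := by rw [← this]; ring
  have key := hasDerivAt_tsum_of_isPreconnected hu Metric.isOpen_ball
    (convex_ball (0 : ℝ) R).isPreconnected (fun k y _ => hterm k y) (fun k y hy => ?_)
    (Metric.mem_ball_self hR0) (summable_besselSeries hd 0) (y := s) (by simp [hR])
  · refine key.congr_deriv ?_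
    rw [(hu.of_norm_bounded_eventually_nat ?_).tsum_eq_zero_add]
    · simp only [Nat.cast_zero, zero_mul, mul_zero, zero_add, Nat.add_sub_cancel]
      rw [besselSeries, ← tsum_div_const]
      refine tsum_congr fun k => ?_
      have := succ_mul_besselCoeff hd k
      push_cast
      calc _ = (((k : ℝ) + 1) * besselCoeff d (k + 1)) * s ^ k := by ring
        _ = _ := by rw [this]; ring
    · refine Eventually.of_forall fun k => ?_
      rw [norm_mul, norm_mul, norm_pow, Real.norm_of_nonneg (besselCoeff_nonneg k), Real.norm_natCast]
      have h1 : ‖s‖ ≤ R := by simp [hR]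
      have := besselCoeff_nonneg (d := d) k
      gcongr
  · rw [norm_mul, norm_mul, norm_pow, Real.norm_of_nonneg (besselCoeff_nonneg k), Real.norm_natCast]
    have h1 : ‖y‖ ≤ R := (mem_ball_zero_iff.1 hy).le
    have := besselCoeff_nonneg (d := d) k
    gcongr

theorem contDiff_besselSeries (hd : 1 ≤ d) : ContDiff ℝ ∞ (besselSeries d) := by
  rw [contDiff_infty]
  intro n
  induction n generalizing d with
  | zero =>
    rw [Nat.cast_zero, contDiff_zero]
    exact continuous_iff_continuousAt.2 fun s => (hasDerivAt_besselSeries hd s).continuousAt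
  | succ n ih =>
    rw [Nat.cast_succ, contDiff_succ_iff_deriv]
    refine ⟨fun s => (hasDerivAt_besselSeries hd s).differentiableAt, by simp, ?_⟩
    rw [funext fun s => (hasDerivAt_besselSeries hd s).deriv]
    exact (ih (by omega)).div_const _

/-- Three-term recurrence: the differential equation `4 s h'' + 2 d h' = h`. -/
theorem besselSeries_recurrence (hd : 1 ≤ d) (s : ℝ) :
    besselSeries d s = besselSeries (d + 2) s + s / (d * (d + 2)) * besselSeries (d + 4) s := by
  have hd' : (0 : ℝ) < d := by exact_mod_cast hd
  have e := (summable_besselSeries (by omega : 1 ≤ d + 4) s).mul_left (s / (d * (d + 2)))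
  have e2 := (summable_besselSeries (by omega : 1 ≤ d + 2) s)
  rw [besselSeries, besselSeries, besselSeries, ← tsum_mul_left,
    (summable_besselSeries hd s).tsum_eq_zero_add, e2.tsum_eq_zero_add,
    add_assoc, ← Summable.tsum_add ((summable_nat_add_iff 1).2 e2) e]
  simp only [besselCoeff_zero]
  congr 1
  refine tsum_congr fun k => ?_
  have h1 := succ_mul_besselCoeff hd k
  have h2 := succ_mul_besselCoeff (by omega : 1 ≤ d + 2) k
  have h3 := besselCoeff_succ (d := d + 2) k
  have h4 : besselCoeff (d + 2) k = 2 * d * (((k : ℝ) + 1) * besselCoeff d (k + 1)) := by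
    rw [h1]; field_simp
  have h5 : besselCoeff (d + 4) k
      = 2 * (d + 2) * (((k : ℝ) + 1) * besselCoeff (d + 2) (k + 1)) := by
    rw [h2]; push_cast; field_simp
  rw [h5, h3, h4]
  push_cast
  have h6 : (0 : ℝ) < 4 * (k : ℝ) + 2 * (d + 2) := by positivity
  have h7 : (0 : ℝ) < (d : ℝ) + 2 := by positivity
  field_simp
  ring

theorem one_le_besselSeries (hd : 1 ≤ d) {s : ℝ} (hs : 0 ≤ s) : 1 ≤ besselSeries d s := by
  have h := (summable_besselSeries hd s).le_tsum 0 fun k _ =>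
    mul_nonneg (besselCoeff_nonneg k) (pow_nonneg hs k)
  rw [besselCoeff_zero, pow_zero, one_mul] at h
  exact h

theorem besselSeries_mono (hd : 1 ≤ d) {s t : ℝ} (hs : 0 ≤ s) (hst : s ≤ t) :
    besselSeries d s ≤ besselSeries d t :=
  (summable_besselSeries hd s).tsum_le_tsum (fun k =>
    mul_le_mul_of_nonneg_left (pow_le_pow_left₀ hs hst k) (besselCoeff_nonneg k))
    (summable_besselSeries hd t)

theorem hasDerivAt_besselSeries_sq (hd : 1 ≤ d) (r : ℝ) :
    HasDerivAt (fun r => besselSeries d (r ^ 2)) (r / d * besselSeries (d + 2) (r ^ 2)) r := by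
  have hd' : (0 : ℝ) < d := by exact_mod_cast hd
  refine ((hasDerivAt_besselSeries hd (r ^ 2)).comp r (hasDerivAt_pow 2 r)).congr_deriv ?_
  push_cast
  field_simp

/-- The growth of the radial eigenfunction: with `n = (d - 1) / 2`, the quantity
`r^n (g' + (1 + n / r) g)` grows at the rate `1 + O(r⁻²)`. -/
theorem exists_besselSeries_growth (hd : 1 ≤ d) : ∃ C : ℝ, 0 < C ∧ ∀ r : ℝ, 0 ≤ r →
    besselSeries d (r ^ 2) ≤ C * ((1 + r) ^ (-(((d : ℝ) - 1) / 2)) * Real.exp r) := by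
  have hd' : (1 : ℝ) ≤ d := by exact_mod_cast hd
  set n : ℝ := ((d : ℝ) - 1) / 2 with hn
  have hn0 : 0 ≤ n := by simp only [hn]; linarith
  set g : ℝ → ℝ := fun r => besselSeries d (r ^ 2) with hg
  -- `k` is the companion of `g` with `g' = (r / d) k` and `k' = (d / r) (g - k)`
  set k : ℝ → ℝ := fun r => besselSeries (d + 2) (r ^ 2) with hk
  have hg1 : ∀ r, 1 ≤ g r := fun r => one_le_besselSeries hd (sq_nonneg r)
  have hk1 : ∀ r, 1 ≤ k r := fun r => one_le_besselSeries (by omega) (sq_nonneg r)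
  have hgd : ∀ r, HasDerivAt g (r / d * k r) r := hasDerivAt_besselSeries_sq hd
  have hkd : ∀ r, 0 < r → HasDerivAt k (d / r * (g r - k r)) r := fun r hr => by
    refine (hasDerivAt_besselSeries_sq (by omega : 1 ≤ d + 2) r).congr_deriv ?_
    have h1 := besselSeries_recurrence hd (r ^ 2)
    simp only [hg, hk]
    rw [h1]
    push_cast
    have : (0 : ℝ) < d := by linarith
    field_simp
    ring
  set q : ℝ → ℝ := fun r => r / d * k r + (1 + n / r) * g r with hq
  have hqd : ∀ r, 0 < r → HasDerivAt q (1 / d * k r + r / d * (d / r * (g r - k r))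
      + (-n / r ^ 2 * g r + (1 + n / r) * (r / d * k r))) r := by
    intro r hr
    have h1 : HasDerivAt (fun r : ℝ => 1 + n / r) (-n / r ^ 2) r := by
      have := ((hasDerivAt_inv hr.ne').const_mul n).const_add 1
      refine (this.congr_deriv (by field_simp)).congr_of_eventuallyEq (Eventually.of_forall fun x => ?_)
      simp [div_eq_mul_inv]
    exact (((hasDerivAt_id r).div_const (d : ℝ)).mul (hkd r hr)).add (h1.mul (hgd r))
  have hPd : ∀ r, 0 < r → HasDerivAt (fun r => r ^ n * q r * Real.exp (-r + n ^ 2 * r⁻¹))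
      ((n * r ^ (n - 1) * q r + r ^ n * (1 / d * k r + r / d * (d / r * (g r - k r))
        + (-n / r ^ 2 * g r + (1 + n / r) * (r / d * k r)))) * Real.exp (-r + n ^ 2 * r⁻¹)
        + r ^ n * q r * (Real.exp (-r + n ^ 2 * r⁻¹) * (-1 + n ^ 2 * -(r ^ 2)⁻¹))) r := by
    intro r hr
    have h1 : HasDerivAt (fun r : ℝ => r ^ n) (n * r ^ (n - 1)) r :=
      Real.hasDerivAt_rpow_const (Or.inl hr.ne')
    have h2 : HasDerivAt (fun r : ℝ => -r + n ^ 2 * r⁻¹) (-1 + n ^ 2 * -(r ^ 2)⁻¹) r :=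
      (hasDerivAt_neg r).add ((hasDerivAt_inv hr.ne').const_mul _)
    exact (h1.mul (hqd r hr)).mul h2.exp
  -- `e^{-r + n²/r}` is an integrating factor: the error `n²/r²` in the growth rate is integrable at
  -- infinity.
  have hanti : AntitoneOn (fun r => r ^ n * q r * Real.exp (-r + n ^ 2 * r⁻¹)) (Ici 1) := by
    refine antitoneOn_of_hasDerivWithinAt_nonpos (convex_Ici 1)
      (fun r hr => (hPd r (one_pos.trans_le hr)).continuousAt.continuousWithinAt)
      (fun r hr => (hPd r (one_pos.trans_le (interior_subset hr))).hasDerivWithinAt) fun r hr => ?_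
    have hr1 : (1 : ℝ) ≤ r := interior_subset hr
    have hr0 : 0 < r := by linarith
    have hE := Real.exp_pos (-r + n ^ 2 * r⁻¹)
    have hrn : r ^ (n - 1) = r ^ n / r := Real.rpow_sub_one hr0.ne' n
    have hd0 : (0 : ℝ) < d := by linarith
    have hdn : (d : ℝ) = 2 * n + 1 := by simp only [hn]; ring
    have e : (n * r ^ (n - 1) * q r + r ^ n * (1 / d * k r + r / d * (d / r * (g r - k r))
        + (-n / r ^ 2 * g r + (1 + n / r) * (r / d * k r)))) * Real.exp (-r + n ^ 2 * r⁻¹)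
        + r ^ n * q r * (Real.exp (-r + n ^ 2 * r⁻¹) * (-1 + n ^ 2 * -(r ^ 2)⁻¹))
        = -(r ^ n * Real.exp (-r + n ^ 2 * r⁻¹)
          * (n / r ^ 2 * g r + n ^ 2 / r ^ 2 * (r / d * k r) + n ^ 3 / r ^ 3 * g r)) := by
      rw [hrn]
      simp only [hq]
      rw [hdn]
      have : (2 * n + 1) ≠ 0 := by positivity
      field_simp
      ring
    rw [e, neg_nonpos]
    have := hg1 r
    have := hk1 r
    positivity
  have hq1 : 0 < q 1 := by
    have := hg1 1
    have := hk1 1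
    simp only [hq]
    positivity
  set C₁ := q 1 * Real.exp (n ^ 2) with hC1
  have hC1p : 0 < C₁ := by positivity
  have hlarge : ∀ r, 1 ≤ r → r ^ n * g r ≤ C₁ * Real.exp r := by
    intro r hr
    have hr0 : 0 < r := by linarith
    have h1 := hanti (mem_Ici.2 le_rfl) (mem_Ici.2 hr) hr
    simp only [Real.one_rpow, one_mul, inv_one, mul_one] at h1
    have h2 : g r ≤ q r := by
      have := hg1 r
      have := hk1 r
      have h3 : 0 ≤ r / d * k r := by positivity
      have h4 : 0 ≤ n / r * g r := by positivity
      simp only [hq]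
      linarith
    have h5 : r ^ n * q r = r ^ n * q r * Real.exp (-r + n ^ 2 * r⁻¹)
        * Real.exp (r - n ^ 2 * r⁻¹) := by
      rw [mul_assoc, ← Real.exp_add]
      simp
    calc r ^ n * g r ≤ r ^ n * q r := by gcongr
      _ ≤ q 1 * Real.exp (-1 + n ^ 2) * Real.exp (r - n ^ 2 * r⁻¹) := by
        rw [h5]
        gcongr
      _ ≤ q 1 * Real.exp (n ^ 2) * Real.exp r := by
        have h6 : 0 ≤ n ^ 2 * r⁻¹ := by positivity
        gcongr <;> linarith
  refine ⟨2 ^ n * (g 1 + C₁), by have := hg1 1; positivity, fun r hr => ?_⟩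
  have h1r : 0 < 1 + r := by linarith
  rw [Real.rpow_neg h1r.le, ← mul_assoc, ← div_eq_mul_inv, div_mul_eq_mul_div,
    le_div_iff₀ (Real.rpow_pos_of_pos h1r n)]
  rcases le_total r 1 with h | h
  · have h1 : besselSeries d (r ^ 2) ≤ g 1 :=
      besselSeries_mono hd (sq_nonneg r) (pow_le_pow_left₀ hr h 2)
    have h2 : (1 + r) ^ n ≤ 2 ^ n := Real.rpow_le_rpow h1r.le (by linarith) hn0
    have h3 := Real.one_le_exp hr
    have h4 := hg1 1
    calc besselSeries d (r ^ 2) * (1 + r) ^ n ≤ g 1 * 2 ^ n := by gcongr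
      _ ≤ 2 ^ n * (g 1 + C₁) * 1 := by
        have : 0 ≤ (2 : ℝ) ^ n * C₁ := by positivity
        linarith
      _ ≤ _ := by gcongr
  · have h2 : (1 + r) ^ n ≤ 2 ^ n * r ^ n := by
      rw [← Real.mul_rpow (by norm_num) hr]
      exact Real.rpow_le_rpow h1r.le (by linarith) hn0
    have h4 := hg1 1
    calc besselSeries d (r ^ 2) * (1 + r) ^ n ≤ g r * (2 ^ n * r ^ n) :=
          mul_le_mul_of_nonneg_left h2 (zero_le_one.trans (hg1 r))
      _ = 2 ^ n * (r ^ n * g r) := by ring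
      _ ≤ 2 ^ n * (C₁ * Real.exp r) := mul_le_mul_of_nonneg_left (hlarge r h) (by positivity)
      _ ≤ _ := by
        have : 0 ≤ (2 : ℝ) ^ n * g 1 * Real.exp r := by positivity
        linarith

end BesselSeries

/-! ### Integrals of the radial eigenfunction -/

section RadialEigenfunction

variable {N : ℕ}

/-- The radial function `∑ c_k |x|^(2 k)` on `ℝ^N`, with the coefficients of dimension `d`. -/
noncomputable def radialBessel (N d : ℕ) (x : EuclideanSpace ℝ (Fin N)) : ℝ :=
  besselSeries d (‖x‖ ^ 2)

theorem contDiff_radialBessel {d : ℕ} (hd : 1 ≤ d) : ContDiff ℝ ∞ (radialBessel N d) :=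
  (contDiff_besselSeries hd).comp (contDiff_norm_sq ℝ)

theorem contDiff_coordinate (i : Fin N) :
    ContDiff ℝ ∞ fun x : EuclideanSpace ℝ (Fin N) => x i :=
  (EuclideanSpace.proj (𝕜 := ℝ) i : EuclideanSpace ℝ (Fin N) →L[ℝ] ℝ).contDiff

theorem partialDeriv_coordinate (i : Fin N) (x : EuclideanSpace ℝ (Fin N)) :
    partialDeriv (word i) (fun x => x i) x = 1 := by
  rw [partialDeriv_word]
  have h : HasFDerivAt (fun x : EuclideanSpace ℝ (Fin N) => x i)
      (EuclideanSpace.proj (𝕜 := ℝ) i : EuclideanSpace ℝ (Fin N) →L[ℝ] ℝ) x :=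
    (EuclideanSpace.proj (𝕜 := ℝ) i : EuclideanSpace ℝ (Fin N) →L[ℝ] ℝ).hasFDerivAt
  rw [h.fderiv]
  simp

theorem partialDeriv_radialBessel {d : ℕ} (hd : 1 ≤ d) (i : Fin N)
    (x : EuclideanSpace ℝ (Fin N)) :
    partialDeriv (word i) (radialBessel N d) x = (d : ℝ)⁻¹ * (x i * radialBessel N (d + 2) x) := by
  have hd' : (0 : ℝ) < d := by exact_mod_cast hd
  rw [partialDeriv_word]
  have h1 : HasFDerivAt (fun x : EuclideanSpace ℝ (Fin N) => ‖x‖ ^ 2)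
      (2 • (innerSL ℝ) x) x := (hasStrictFDerivAt_norm_sq x).hasFDerivAt
  have h2 : HasFDerivAt (radialBessel N d) _ x :=
    (hasDerivAt_besselSeries hd (‖x‖ ^ 2)).comp_hasFDerivAt x h1
  rw [h2.fderiv]
  simp [EuclideanSpace.inner_single_right, radialBessel]
  field_simp

theorem partialDeriv_const_mul (c : ℝ) (i : Fin N) {φ : EuclideanSpace ℝ (Fin N) → ℝ}
    (hφ : ContDiff ℝ ∞ φ) (x : EuclideanSpace ℝ (Fin N)) :
    partialDeriv (word i) (fun x => c * φ x) x = c * partialDeriv (word i) φ x := by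
  rw [partialDeriv_word, partialDeriv_word, fderiv_const_mul (hφ.differentiable (by simp) x)]
  simp

theorem sum_partialDeriv_radialBessel (hN : 1 ≤ N) (x : EuclideanSpace ℝ (Fin N)) :
    ∑ i : Fin N, partialDeriv (fun _ : Fin 2 => i) (radialBessel N N) x = radialBessel N N x := by
  have hN' : (0 : ℝ) < N := by exact_mod_cast hN
  have key : ∀ i : Fin N, partialDeriv (fun _ : Fin 2 => i) (radialBessel N N) x
      = (N : ℝ)⁻¹ * radialBessel N (N + 2) x
        + ((N : ℝ) * (N + 2))⁻¹ * radialBessel N (N + 4) x * (x i) ^ 2 := by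
    intro i
    rw [partialDeriv_two _ (contDiff_radialBessel hN),
      funext (partialDeriv_radialBessel (N := N) hN i),
      partialDeriv_const_mul _ _
        ((contDiff_coordinate i).mul (contDiff_radialBessel (by omega : 1 ≤ N + 2))),
      partialDeriv_word_mul i (contDiff_coordinate i)
        (contDiff_radialBessel (by omega : 1 ≤ N + 2)),
      partialDeriv_coordinate, partialDeriv_radialBessel (by omega : 1 ≤ N + 2)]
    push_cast
    field_simp
    ring
  simp only [key]
  rw [Finset.sum_add_distrib, Finset.sum_const, Finset.card_univ, Fintype.card_fin, nsmul_eq_mul,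
    ← Finset.mul_sum]
  have h1 : ∑ i, (x i) ^ 2 = ‖x‖ ^ 2 := by
    rw [EuclideanSpace.norm_sq_eq]
    simp
  rw [h1, radialBessel, radialBessel, radialBessel, besselSeries_recurrence hN (‖x‖ ^ 2)]
  field_simp

theorem one_le_radialBessel (hN : 1 ≤ N) (x : EuclideanSpace ℝ (Fin N)) :
    1 ≤ radialBessel N N x := one_le_besselSeries hN (sq_nonneg _)

end RadialEigenfunction

section RadialIntegral

/-- The mass of `(1 + r)^γ e^{q r}` on `[0, R]` concentrates at the endpoint. -/
theorem exists_integral_exp_le (γ : ℝ) {q : ℝ} (hq : 0 < q) : ∃ C : ℝ, 0 < C ∧ ∀ R : ℝ, 0 ≤ R →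
    ∫ r in (0 : ℝ)..R, (1 + r) ^ γ * Real.exp (q * r) ≤ C * ((1 + R) ^ γ * Real.exp (q * R)) := by
  obtain ⟨K, hK, hKb⟩ : ∃ K : ℝ, 0 < K ∧ ∀ s : ℝ, 0 ≤ s →
      (1 + s) ^ |γ| ≤ K * Real.exp (q / 2 * s) := by
    obtain ⟨n, hn⟩ := exists_nat_ge |γ|
    refine ⟨(n.factorial : ℝ) * (2 / q) ^ n * Real.exp (q / 2), by positivity, fun s hs => ?_⟩
    have h1 : (1 + s) ^ |γ| ≤ (1 + s) ^ n := by
      rw [← Real.rpow_natCast]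
      exact Real.rpow_le_rpow_of_exponent_le (by linarith) hn
    have h2 := Real.pow_div_factorial_le_exp (q / 2 * (1 + s)) (by positivity) n
    rw [mul_add, mul_one, Real.exp_add, ← mul_one_add, mul_pow] at h2
    rw [div_le_iff₀ (by positivity)] at h2
    calc (1 + s) ^ |γ| ≤ (1 + s) ^ n := h1
      _ = (2 / q) ^ n * ((q / 2) ^ n * (1 + s) ^ n) := by
        rw [← mul_assoc, ← mul_pow]
        have : 2 / q * (q / 2) = 1 := by field_simp
        rw [this, one_pow, one_mul]
      _ ≤ (2 / q) ^ n * (Real.exp (q / 2) * Real.exp (q / 2 * s) * n.factorial) := by gcongr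
      _ = _ := by ring
  refine ⟨K * (2 / q), by positivity, fun R hR => ?_⟩
  have hpt : ∀ r ∈ Icc (0 : ℝ) R, (1 + r) ^ γ * Real.exp (q * r)
      ≤ K * ((1 + R) ^ γ * Real.exp (q / 2 * R)) * Real.exp (q / 2 * r) := by
    intro r hr
    have hr0 : 0 < 1 + r := by linarith [hr.1]
    have hR0 : 0 < 1 + R := by linarith
    have hs := hKb (R - r) (by linarith [hr.2])
    -- a polynomial weight varies slower than the exponential, which is given up by half its rate
    have h1 : (1 + r) ^ γ ≤ (1 + R) ^ γ * (1 + (R - r)) ^ |γ| := by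
      rcases le_total 0 γ with h | h
      · have h2 : (1 : ℝ) ≤ (1 + (R - r)) ^ |γ| :=
          Real.one_le_rpow (by linarith [hr.2]) (abs_nonneg _)
        calc (1 + r) ^ γ ≤ (1 + R) ^ γ := Real.rpow_le_rpow hr0.le (by linarith [hr.2]) h
          _ ≤ _ := le_mul_of_one_le_right (by positivity) h2
      · have h2 : (1 + R) ^ (-γ) ≤ (1 + r) ^ (-γ) * (1 + (R - r)) ^ (-γ) := by
          rw [← Real.mul_rpow hr0.le (by linarith [hr.2])]
          refine Real.rpow_le_rpow hR0.le ?_ (by linarith)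
          nlinarith [hr.1, hr.2, mul_nonneg hr.1 (sub_nonneg.2 hr.2)]
        rw [abs_of_nonpos h]
        rw [Real.rpow_neg hR0.le, Real.rpow_neg hr0.le] at h2
        have h3 : 0 < (1 + R) ^ γ := by positivity
        have h4 : 0 < (1 + r) ^ γ := by positivity
        rw [inv_mul_eq_div, inv_eq_one_div, div_le_div_iff₀ h3 h4] at h2
        linarith
    calc (1 + r) ^ γ * Real.exp (q * r)
        ≤ (1 + R) ^ γ * (K * Real.exp (q / 2 * (R - r))) * Real.exp (q * r) := by
          gcongr
          exact h1.trans (by gcongr)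
      _ = K * (1 + R) ^ γ * (Real.exp (q / 2 * (R - r)) * Real.exp (q * r)) := by ring
      _ = K * (1 + R) ^ γ * (Real.exp (q / 2 * R) * Real.exp (q / 2 * r)) := by
          rw [← Real.exp_add, ← Real.exp_add]
          congr 2
          ring
      _ = _ := by ring
  have hc1 : ContinuousOn (fun r : ℝ => (1 + r) ^ γ * Real.exp (q * r)) (uIcc 0 R) := by
    rw [uIcc_of_le hR]
    refine ContinuousOn.mul ?_ (by fun_prop)
    exact (by fun_prop : ContinuousOn (fun r : ℝ => 1 + r) (Icc 0 R)).rpow_const fun r hr =>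
      Or.inl (by linarith [hr.1])
  have hc2 : Continuous fun r : ℝ =>
      K * ((1 + R) ^ γ * Real.exp (q / 2 * R)) * Real.exp (q / 2 * r) := by fun_prop
  refine (intervalIntegral.integral_mono_on hR hc1.intervalIntegrable
    (hc2.intervalIntegrable _ _) hpt).trans ?_
  rw [intervalIntegral.integral_const_mul]
  have hexp : ∫ r in (0 : ℝ)..R, Real.exp (q / 2 * r) = (Real.exp (q / 2 * R) - 1) / (q / 2) := by
    rw [intervalIntegral.integral_eq_sub_of_hasDerivAt
      (f := fun r => Real.exp (q / 2 * r) / (q / 2)) (fun r _ => ?_)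
      ((by fun_prop : Continuous fun r : ℝ => Real.exp (q / 2 * r)).intervalIntegrable _ _)]
    · simp
      ring
    · refine ((((hasDerivAt_id r).const_mul (q / 2)).exp).div_const (q / 2)).congr_deriv ?_
      simp only [id]
      field_simp
  rw [hexp]
  have e : Real.exp (q * R) = Real.exp (q / 2 * R) * Real.exp (q / 2 * R) := by
    rw [← Real.exp_add]
    congr 1
    ring
  have hR1 : 0 ≤ (1 + R) ^ γ := Real.rpow_nonneg (by linarith) _
  rw [e]
  calc K * ((1 + R) ^ γ * Real.exp (q / 2 * R)) * ((Real.exp (q / 2 * R) - 1) / (q / 2))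
      ≤ K * ((1 + R) ^ γ * Real.exp (q / 2 * R)) * (Real.exp (q / 2 * R) / (q / 2)) := by
        gcongr
        linarith
    _ = _ := by
        field_simp

/-- The `L^q` mass of the radial eigenfunction on a ball. -/
theorem exists_integral_radialBessel_le {N : ℕ} (hN : 1 ≤ N) {q : ℝ} (hq : 0 < q) :
    ∃ C : ℝ, 0 < C ∧ ∀ R : ℝ, 0 ≤ R →
      ∫ x in Metric.closedBall (0 : EuclideanSpace ℝ (Fin N)) R, radialBessel N N x ^ q
        ≤ C * ((1 + R) ^ ((N : ℝ) - 1 - ((N : ℝ) - 1) / 2 * q) * Real.exp (q * R)) := by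
  obtain ⟨C₁, hC1, hC1b⟩ := exists_besselSeries_growth hN
  obtain ⟨C₂, hC2, hC2b⟩ := exists_integral_exp_le ((N : ℝ) - 1 - ((N : ℝ) - 1) / 2 * q) hq
  have : Nonempty (Fin N) := ⟨⟨0, hN⟩⟩
  have hN' : (1 : ℝ) ≤ N := by exact_mod_cast hN
  set V := (volume : Measure (EuclideanSpace ℝ (Fin N))).real (Metric.ball 0 1) with hV
  have hV0 : 0 ≤ V := measureReal_nonneg
  refine ⟨N * V * C₁ ^ q * C₂ + 1, by positivity, fun R hR => ?_⟩
  set F : ℝ → ℝ := fun r => (Iic R).indicator (fun r => besselSeries N (r ^ 2) ^ q) r with hF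
  have h1 : ∫ x in Metric.closedBall (0 : EuclideanSpace ℝ (Fin N)) R, radialBessel N N x ^ q
      = ∫ x : EuclideanSpace ℝ (Fin N), F ‖x‖ := by
    rw [← integral_indicator Metric.isClosed_closedBall.measurableSet]
    refine integral_congr_ae (ae_of_all _ fun x => ?_)
    simp only [hF, Set.indicator, mem_closedBall_zero_iff, mem_Iic]
    rfl
  have h2 : ∫ y in Ioi (0 : ℝ), y ^ (N - 1) • F y
      = ∫ y in (0 : ℝ)..R, y ^ (N - 1) * besselSeries N (y ^ 2) ^ q := by
    rw [intervalIntegral.integral_of_le hR, ← Ioi_inter_Iic, inter_comm,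
      ← Measure.restrict_restrict measurableSet_Iic, ← integral_indicator measurableSet_Iic]
    refine integral_congr_ae (ae_of_all _ fun y => ?_)
    simp only [hF, Set.indicator, mem_Iic, smul_eq_mul]
    split_ifs <;> simp
  have hcont : Continuous fun y : ℝ => y ^ (N - 1) * besselSeries N (y ^ 2) ^ q := by
    refine (continuous_pow _).mul ?_
    exact ((contDiff_besselSeries hN).continuous.comp (continuous_pow 2)).rpow_const fun _ =>
      Or.inr hq.le
  have h3 : ∫ y in (0 : ℝ)..R, y ^ (N - 1) * besselSeries N (y ^ 2) ^ q
      ≤ ∫ y in (0 : ℝ)..R, C₁ ^ q * ((1 + y) ^ ((N : ℝ) - 1 - ((N : ℝ) - 1) / 2 * q)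
        * Real.exp (q * y)) := by
    refine intervalIntegral.integral_mono_on hR (hcont.intervalIntegrable _ _) ?_ fun y hy => ?_
    · refine ContinuousOn.intervalIntegrable ?_
      rw [uIcc_of_le hR]
      refine continuousOn_const.mul (ContinuousOn.mul ?_ (by fun_prop))
      exact (by fun_prop : ContinuousOn (fun r : ℝ => 1 + r) (Icc 0 R)).rpow_const fun r hr =>
        Or.inl (by linarith [hr.1])
    · have hy0 : 0 < 1 + y := by linarith [hy.1]
      have hb := hC1b y hy.1
      have hb1 := one_le_besselSeries hN (sq_nonneg y)
      have h4 : besselSeries N (y ^ 2) ^ q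
          ≤ C₁ ^ q * ((1 + y) ^ (-(((N : ℝ) - 1) / 2 * q)) * Real.exp (q * y)) := by
        refine (Real.rpow_le_rpow (by linarith) hb hq.le).trans (le_of_eq ?_)
        rw [Real.mul_rpow hC1.le (by positivity), Real.mul_rpow (by positivity) (by positivity),
          ← Real.rpow_mul hy0.le, ← Real.exp_mul]
        congr 3
        · ring
        · ring
      have h5 : y ^ (N - 1) ≤ (1 + y) ^ ((N : ℝ) - 1) := by
        have : ((N : ℝ) - 1) = ((N - 1 : ℕ) : ℝ) := by push_cast [hN]; ring
        rw [this, Real.rpow_natCast]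
        exact pow_le_pow_left₀ hy.1 (by linarith) _
      calc y ^ (N - 1) * besselSeries N (y ^ 2) ^ q
          ≤ (1 + y) ^ ((N : ℝ) - 1)
            * (C₁ ^ q * ((1 + y) ^ (-(((N : ℝ) - 1) / 2 * q)) * Real.exp (q * y))) := by
            gcongr
        _ = C₁ ^ q * (((1 + y) ^ ((N : ℝ) - 1) * (1 + y) ^ (-(((N : ℝ) - 1) / 2 * q)))
            * Real.exp (q * y)) := by ring
        _ = _ := by rw [← Real.rpow_add hy0]; rfl
  rw [h1, integral_fun_norm_addHaar volume F, finrank_euclideanSpace_fin, h2]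
  rw [intervalIntegral.integral_const_mul] at h3
  have h6 := h3.trans (mul_le_mul_of_nonneg_left (hC2b R hR) (by positivity))
  have h7 : 0 ≤ (1 + R) ^ ((N : ℝ) - 1 - ((N : ℝ) - 1) / 2 * q) * Real.exp (q * R) := by
    have : 0 < 1 + R := by linarith
    positivity
  rw [nsmul_eq_mul, smul_eq_mul, ← hV]
  calc (N : ℝ) * (V * ∫ y in (0 : ℝ)..R, y ^ (N - 1) * besselSeries N (y ^ 2) ^ q)
      ≤ N * (V * (C₁ ^ q * (C₂ * ((1 + R) ^ ((N : ℝ) - 1 - ((N : ℝ) - 1) / 2 * q)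
        * Real.exp (q * R))))) := by gcongr
    _ ≤ _ := by
      rw [add_mul, one_mul]
      have : (N : ℝ) * (V * (C₁ ^ q * (C₂ * ((1 + R) ^ ((N : ℝ) - 1 - ((N : ℝ) - 1) / 2 * q)
        * Real.exp (q * R))))) = N * V * C₁ ^ q * C₂
          * ((1 + R) ^ ((N : ℝ) - 1 - ((N : ℝ) - 1) / 2 * q) * Real.exp (q * R)) := by ring
      linarith

end RadialIntegral

/-! ### Ordinary differential inequalities: the space average -/

section DampedODE

variable {a b : ℝ → ℝ}

/-- The integrating factor `μ = e^{∫ b}` of the damping, which is bounded, and the time scale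
`s = ∫ 1 / μ` in which the damping disappears. -/
theorem AssumptionA1.exists_integrating_factor (h : AssumptionA1 a b) :
    ∃ M : ℝ, 1 ≤ M ∧ ∃ μ s : ℝ → ℝ, μ 0 = 1 ∧ s 0 = 0 ∧ ∀ t, 0 ≤ t →
      (1 ≤ μ t ∧ μ t ≤ M) ∧ HasDerivWithinAt μ (b t * μ t) (Ici 0) t ∧
      HasDerivWithinAt s (μ t)⁻¹ (Ici 0) t ∧ t / M ≤ s t ∧ s t ≤ t := by
  set β : ℝ → ℝ := fun t => ∫ r in (0 : ℝ)..t, b r with hβ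
  set B := ∫ r in Ioi (0 : ℝ), b r with hB
  have hβd : ∀ t, 0 ≤ t → HasDerivWithinAt β (b t) (Ici 0) t := fun t ht =>
    hasDerivWithinAt_integral_Ici h.continuousOn_b ht
  have hβ0 : ∀ t, 0 ≤ t → 0 ≤ β t := fun t ht =>
    intervalIntegral.integral_nonneg ht fun r hr => h.b_nonneg r hr.1
  have hβB : ∀ t, 0 ≤ t → β t ≤ B := fun t ht => by
    simp only [hβ, hB]
    rw [intervalIntegral.integral_of_le ht]
    refine setIntegral_mono_set h.b_integrable ?_ (ae_of_all _ fun r hr => hr.1)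
    filter_upwards [ae_restrict_mem measurableSet_Ioi] with r hr
    exact h.b_nonneg r (le_of_lt hr)
  set μ : ℝ → ℝ := fun t => Real.exp (β t) with hμ
  have hμd : ∀ t, 0 ≤ t → HasDerivWithinAt μ (b t * μ t) (Ici 0) t := fun t ht =>
    (hβd t ht).exp.congr_deriv (mul_comm _ _)
  have hμ1 : ∀ t, 0 ≤ t → 1 ≤ μ t := fun t ht => Real.one_le_exp (hβ0 t ht)
  have hμM : ∀ t, 0 ≤ t → μ t ≤ Real.exp B := fun t ht => Real.exp_le_exp.2 (hβB t ht)
  have hμc : ContinuousOn (fun t => (μ t)⁻¹) (Ici 0) :=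
    ContinuousOn.inv₀ (fun t ht => (hμd t ht).continuousWithinAt) fun t _ => (Real.exp_pos _).ne'
  have hint : ∀ t, 0 ≤ t → IntervalIntegrable (fun t => (μ t)⁻¹) volume 0 t := fun t ht =>
    (hμc.mono fun r hr => by rw [uIcc_of_le ht] at hr; exact hr.1).intervalIntegrable
  refine ⟨Real.exp B, Real.one_le_exp ((hβ0 0 le_rfl).trans (hβB 0 le_rfl)), μ,
    fun t => ∫ r in (0 : ℝ)..t, (μ r)⁻¹, by simp [hμ, hβ], by simp,
    fun t ht => ⟨⟨hμ1 t ht, hμM t ht⟩, hμd t ht, hasDerivWithinAt_integral_Ici hμc ht, ?_, ?_⟩⟩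
  · have h1 : ∫ _ in (0 : ℝ)..t, (Real.exp B)⁻¹ ≤ ∫ r in (0 : ℝ)..t, (μ r)⁻¹ :=
      intervalIntegral.integral_mono_on ht (by simp) (hint t ht) fun r hr =>
        inv_anti₀ (Real.exp_pos _) (hμM r hr.1)
    simpa [div_eq_mul_inv] using h1
  · have h1 : ∫ r in (0 : ℝ)..t, (μ r)⁻¹ ≤ ∫ _ in (0 : ℝ)..t, (1 : ℝ) :=
      intervalIntegral.integral_mono_on ht (hint t ht) (by simp) fun r hr =>
        inv_le_one_of_one_le₀ (hμ1 r hr.1)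
    simpa using h1

/-- A solution of `y'' + b y' = F` on `[0, T]`, together with its velocity. -/
structure IsDampedSolution (b : ℝ → ℝ) (T : ℝ) (y y' F : ℝ → ℝ) : Prop where
  hasDeriv : ∀ t ∈ Icc 0 T, HasDerivWithinAt y (y' t) (Icc 0 T) t
  hasDeriv' : ∀ t ∈ Icc 0 T, HasDerivWithinAt y' (-(b t * y' t) + F t) (Icc 0 T) t

theorem IsDampedSolution.mono {T T' : ℝ} {y y' F : ℝ → ℝ} (hy : IsDampedSolution b T y y' F)
    (hT : T' ≤ T) : IsDampedSolution b T' y y' F := by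
  have hsub : Icc 0 T' ⊆ Icc 0 T := Icc_subset_Icc_right hT
  exact ⟨fun t ht => (hy.hasDeriv t (hsub ht)).mono hsub,
    fun t ht => (hy.hasDeriv' t (hsub ht)).mono hsub⟩

theorem IsDampedSolution.hasDeriv_mul {T : ℝ} {y y' F μ : ℝ → ℝ}
    (hy : IsDampedSolution b T y y' F)
    (hμ : ∀ t, 0 ≤ t → HasDerivWithinAt μ (b t * μ t) (Ici 0) t) {t : ℝ} (ht : t ∈ Icc 0 T) :
    HasDerivWithinAt (fun t => μ t * y' t) (μ t * F t) (Icc 0 T) t :=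
  (((hμ t ht.1).mono fun _ hr => hr.1).mul (hy.hasDeriv' t ht)).congr_deriv (by ring)

theorem monotoneOn_of_hasDerivWithin_nonneg {r T : ℝ} {f f' : ℝ → ℝ}
    (hf : ∀ t ∈ Icc r T, HasDerivWithinAt f (f' t) (Icc r T) t)
    (hf' : ∀ t ∈ Icc r T, 0 ≤ f' t) : MonotoneOn f (Icc r T) :=
  monotoneOn_of_hasDerivWithinAt_nonneg (convex_Icc r T)
    (fun t ht => (hf t ht).continuousWithinAt)
    (fun t ht => (hf t (interior_subset ht)).mono interior_subset)
    fun t ht => hf' t (interior_subset ht)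

/-- With a nonnegative forcing the damped velocity `μ y'` increases. -/
theorem IsDampedSolution.velocity_le {T : ℝ} {y y' F μ : ℝ → ℝ} (hy : IsDampedSolution b T y y' F)
    (hμ : ∀ t, 0 ≤ t → HasDerivWithinAt μ (b t * μ t) (Ici 0) t) (hμ1 : ∀ t, 0 ≤ t → 1 ≤ μ t)
    (hμ0 : μ 0 = 1) (hF : ∀ t ∈ Icc 0 T, 0 ≤ F t) {t : ℝ} (ht : t ∈ Icc 0 T) :
    y' 0 ≤ μ t * y' t := by
  have hmono := monotoneOn_of_hasDerivWithin_nonneg (fun t ht => hy.hasDeriv_mul hμ ht)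
    fun t ht => mul_nonneg (zero_le_one.trans (hμ1 t ht.1)) (hF t ht)
  have := hmono ⟨le_rfl, ht.1.trans ht.2⟩ ht ht.1
  simpa [hμ0] using this

theorem IsDampedSolution.velocity_nonneg {T : ℝ} {y y' F μ : ℝ → ℝ}
    (hy : IsDampedSolution b T y y' F)
    (hμ : ∀ t, 0 ≤ t → HasDerivWithinAt μ (b t * μ t) (Ici 0) t) (hμ1 : ∀ t, 0 ≤ t → 1 ≤ μ t)
    (hμ0 : μ 0 = 1) (hF : ∀ t ∈ Icc 0 T, 0 ≤ F t) (h0 : 0 ≤ y' 0) {t : ℝ} (ht : t ∈ Icc 0 T) :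
    0 ≤ y' t :=
  nonneg_of_mul_nonneg_right (h0.trans (hy.velocity_le hμ hμ1 hμ0 hF ht))
    (one_pos.trans_le (hμ1 t ht.1))

theorem IsDampedSolution.monotoneOn {T : ℝ} {y y' F μ : ℝ → ℝ} (hy : IsDampedSolution b T y y' F)
    (hμ : ∀ t, 0 ≤ t → HasDerivWithinAt μ (b t * μ t) (Ici 0) t) (hμ1 : ∀ t, 0 ≤ t → 1 ≤ μ t)
    (hμ0 : μ 0 = 1) (hF : ∀ t ∈ Icc 0 T, 0 ≤ F t) (h0 : 0 ≤ y' 0) : MonotoneOn y (Icc 0 T) :=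
  monotoneOn_of_hasDerivWithin_nonneg hy.hasDeriv
    fun _ ht => hy.velocity_nonneg hμ hμ1 hμ0 hF h0 ht

theorem integral_le_sub_of_le_deriv {T : ℝ} (hT : 0 ≤ T) {f f' φ : ℝ → ℝ}
    (hf : ∀ t ∈ Icc 0 T, HasDerivWithinAt f (f' t) (Icc 0 T) t) (hφ : ContinuousOn φ (Icc 0 T))
    (h : ∀ t ∈ Icc 0 T, φ t ≤ f' t) : ∫ t in (0 : ℝ)..T, φ t ≤ f T - f 0 :=
  intervalIntegral.integral_le_sub_of_hasDeriv_right_of_le hT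
    (fun t ht => (hf t ht).continuousWithinAt)
    (fun t ht => ((hf t (Ioo_subset_Icc_self ht)).hasDerivAt
      (Icc_mem_nhds ht.1 ht.2)).hasDerivWithinAt)
    (hφ.integrableOn_compact isCompact_Icc) fun t ht => h t (Ioo_subset_Icc_self ht)

/-- The pointwise estimate behind the test function method: the error term is absorbed by
Young's inequality. -/
theorem test_function_pointwise {p : ℝ} (hp : 1 < p) {k : ℕ} (hk : 2 * (p / (p - 1)) ≤ k)
    {x S G y V W μ : ℝ} (hx0 : 0 ≤ x) (hx1 : x ≤ 1) (hS : 0 < S) (hG : 0 ≤ G) (hy : 0 ≤ y)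
    (hV : 0 ≤ V) (hyG : y ≤ G ^ (1 / p) * V ^ (1 / (p / (p - 1)))) (hμ : 1 ≤ μ)
    (hW : W = 4 * (k : ℝ) ^ 2 * (S ^ 2)⁻¹ * V ^ (1 / (p / (p - 1)))) :
    (G * (1 - x ^ 2) ^ k - W ^ (p / (p - 1))) / (p / (p - 1))
      ≤ μ * G * (1 - x ^ 2) ^ k - y * ((-(2 * k) * (1 - x ^ 2) ^ (k - 1)
        + 4 * k * (k - 1) * x ^ 2 * (1 - x ^ 2) ^ (k - 2)) / S ^ 2) / μ := by
  have hpq : p.HolderConjugate (p / (p - 1)) := Real.HolderConjugate.conjExponent hp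
  set q := p / (p - 1) with hq
  have hq1 : 1 < q := hpq.symm.lt
  have hk2 : 2 < (k : ℝ) := by linarith
  have hk2' : 2 < k := by exact_mod_cast hk2
  set θ := 1 - x ^ 2 with hθ
  have hθ0 : 0 ≤ θ := by simp only [hθ]; nlinarith
  have hθ1 : θ ≤ 1 := by simp only [hθ]; nlinarith
  have hW0 : 0 ≤ W := by rw [hW]; positivity
  have hμ0 : 0 < μ := by linarith
  -- `k ≥ 2 q` makes the second derivative of the cutoff smaller than its power `1 / p`
  have h1 : θ ^ (k - 2) ≤ (θ ^ k) ^ (1 / p) := by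
    rw [← Real.rpow_natCast, ← Real.rpow_natCast, ← Real.rpow_mul hθ0]
    refine Real.rpow_le_rpow_of_exponent_ge' hθ0 hθ1 (by have := hpq.pos; positivity) ?_
    rw [Nat.cast_sub hk2'.le]
    have h2 : 1 / p = 1 - 1 / q := by
      have := hpq.inv_add_inv_eq_one
      simp only [one_div]
      linarith
    rw [h2]
    have h3 : 2 ≤ (k : ℝ) * (1 / q) := by
      rw [mul_one_div, le_div_iff₀ (by linarith)]
      exact hk
    push_cast
    linarith
  have h2 : y * ((-(2 * k) * θ ^ (k - 1) + 4 * k * (k - 1) * x ^ 2 * θ ^ (k - 2)) / S ^ 2)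
      ≤ (G * θ ^ k) ^ (1 / p) * W := by
    have h3 : -(2 * k) * θ ^ (k - 1) + 4 * k * (k - 1) * x ^ 2 * θ ^ (k - 2)
        ≤ 4 * (k : ℝ) ^ 2 * θ ^ (k - 2) := by
      have e1 : 0 ≤ 2 * k * θ ^ (k - 1) := by positivity
      have e2 : 4 * k * (k - 1) * x ^ 2 * θ ^ (k - 2) ≤ 4 * (k : ℝ) ^ 2 * θ ^ (k - 2) := by
        refine mul_le_mul_of_nonneg_right ?_ (by positivity)
        have : x ^ 2 ≤ 1 := pow_le_one₀ hx0 hx1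
        have h4 : 0 ≤ 4 * (k : ℝ) * (k - 1) := by
          have : 0 ≤ (k : ℝ) - 1 := by linarith
          positivity
        nlinarith
      linarith
    calc y * ((-(2 * k) * θ ^ (k - 1) + 4 * k * (k - 1) * x ^ 2 * θ ^ (k - 2)) / S ^ 2)
        ≤ y * (4 * (k : ℝ) ^ 2 * θ ^ (k - 2) / S ^ 2) := by gcongr
      _ ≤ (G ^ (1 / p) * V ^ (1 / q)) * (4 * (k : ℝ) ^ 2 * (θ ^ k) ^ (1 / p) / S ^ 2) := by gcongr
      _ = (G ^ (1 / p) * (θ ^ k) ^ (1 / p)) * W := by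
        rw [hW, div_eq_mul_inv]
        ring
      _ = _ := by rw [Real.mul_rpow hG (by positivity)]
  have h3 := Real.young_inequality_of_nonneg
    (Real.rpow_nonneg (by positivity : 0 ≤ G * θ ^ k) (1 / p)) hW0 hpq
  rw [← Real.rpow_mul (by positivity), one_div_mul_cancel (by linarith), Real.rpow_one] at h3
  have h4 : y * ((-(2 * k) * θ ^ (k - 1) + 4 * k * (k - 1) * x ^ 2 * θ ^ (k - 2)) / S ^ 2) / μ
      ≤ (G * θ ^ k) ^ (1 / p) * W := by
    refine (div_le_div_of_nonneg_right h2 hμ0.le).trans (div_le_self ?_ hμ)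
    positivity
  have h5 : G * θ ^ k ≤ μ * G * θ ^ k := by
    rw [mul_assoc]
    exact le_mul_of_one_le_left (by positivity) hμ
  have h6 : (G * θ ^ k) / p + (G * θ ^ k) / q = G * θ ^ k := by
    have := hpq.inv_add_inv_eq_one
    rw [div_eq_mul_inv, div_eq_mul_inv, ← mul_add, this, mul_one]
  rw [sub_div]
  linarith

/-- The test function method in the undamped time scale `s`. -/
theorem IsDampedSolution.integral_le {p : ℝ} (hp : 1 < p) {k : ℕ} (hk : 2 * (p / (p - 1)) ≤ k)
    {T M V W : ℝ} (hT : 0 < T) {y y' G μ s : ℝ → ℝ} (hy : IsDampedSolution b T y y' G)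
    (hμ : ∀ t, 0 ≤ t → HasDerivWithinAt μ (b t * μ t) (Ici 0) t)
    (hμ1 : ∀ t, 0 ≤ t → 1 ≤ μ t) (hμ0 : μ 0 = 1) (hs0 : s 0 = 0)
    (hs : ∀ t, 0 ≤ t → HasDerivWithinAt s (μ t)⁻¹ (Ici 0) t)
    (hM : 0 < M) (hsM : ∀ t, 0 ≤ t → t / M ≤ s t) (hst : ∀ t, 0 ≤ t → s t ≤ t)
    (hGc : ContinuousOn G (Icc 0 T)) (hG : ∀ t ∈ Icc 0 T, 0 ≤ G t) (h0 : 0 ≤ y 0)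
    (h0' : 0 ≤ y' 0) (hV : 0 ≤ V)
    (hyG : ∀ t ∈ Icc 0 T, y t ≤ G t ^ (1 / p) * V ^ (1 / (p / (p - 1))))
    (hW : W = 4 * (k : ℝ) ^ 2 * (s T ^ 2)⁻¹ * V ^ (1 / (p / (p - 1)))) :
    (3 / 4) ^ k * (∫ t in (0 : ℝ)..T / (2 * M), G t) + y' 0 ≤ T * W ^ (p / (p - 1)) ∧
      1 ≤ 2 * M := by
  have hpq : p.HolderConjugate (p / (p - 1)) := Real.HolderConjugate.conjExponent hp
  set q := p / (p - 1) with hq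
  have hq1 : 1 < q := hpq.symm.lt
  have hk2 : 2 < (k : ℝ) := by linarith
  have hk2' : 2 < k := by exact_mod_cast hk2
  have hsub : Icc 0 T ⊆ Ici (0 : ℝ) := fun t ht => ht.1
  set S := s T with hS
  have hS0 : 0 < S := lt_of_lt_of_le (by positivity) (hsM T hT.le)
  have hM1 : 1 ≤ 2 * M := by
    have h1 := (hsM T hT.le).trans (hst T hT.le)
    rw [div_le_iff₀ hM] at h1
    have : 1 ≤ M := by
      by_contra hlt
      nlinarith [not_le.1 hlt]
    linarith
  refine ⟨?_, hM1⟩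
  have hsmono : MonotoneOn s (Icc 0 T) := monotoneOn_of_hasDerivWithin_nonneg
    (fun t ht => (hs t ht.1).mono hsub) fun t ht =>
      inv_nonneg.2 (zero_le_one.trans (hμ1 t ht.1))
  have hx : ∀ t ∈ Icc 0 T, 0 ≤ s t / S ∧ s t / S ≤ 1 := fun t ht => by
    constructor
    · exact div_nonneg (le_trans (div_nonneg ht.1 hM.le) (hsM t ht.1)) hS0.le
    · rw [div_le_one hS0]
      exact hsmono ht ⟨hT.le, le_rfl⟩ ht.2
  have hymono := hy.monotoneOn hμ hμ1 hμ0 hG h0'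
  have hynn : ∀ t ∈ Icc 0 T, 0 ≤ y t := fun t ht =>
    h0.trans (hymono ⟨le_rfl, hT.le⟩ ht ht.1)
  -- `H` is the boundary term of the two integrations by parts against `(1 - (s / S)²)^k`; it vanishes
  -- at `T` and equals the initial velocity at `0`.
  set H : ℝ → ℝ := fun t => μ t * y' t * (1 - (s t / S) ^ 2) ^ k
    - y t * (-(2 * k) * (s t / S) * (1 - (s t / S) ^ 2) ^ (k - 1) / S) with hH
  have hHd : ∀ t ∈ Icc 0 T, HasDerivWithinAt H (μ t * G t * (1 - (s t / S) ^ 2) ^ k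
      - y t * ((-(2 * k) * (1 - (s t / S) ^ 2) ^ (k - 1)
        + 4 * k * (k - 1) * (s t / S) ^ 2 * (1 - (s t / S) ^ 2) ^ (k - 2)) / S ^ 2) / μ t)
      (Icc 0 T) t := by
    intro t ht
    have hμt : μ t ≠ 0 := (one_pos.trans_le (hμ1 t ht.1)).ne'
    have d1 := hy.hasDeriv_mul hμ ht
    have d2 : HasDerivWithinAt (fun t => s t / S) ((μ t)⁻¹ / S) (Icc 0 T) t :=
      ((hs t ht.1).mono hsub).div_const S
    have d3 : HasDerivWithinAt (fun t => 1 - (s t / S) ^ 2)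
        (-(2 * (s t / S) * ((μ t)⁻¹ / S))) (Icc 0 T) t :=
      ((d2.fun_pow 2).const_sub 1).congr_deriv (by push_cast; ring)
    have d4 := d3.fun_pow k
    have d5 := d3.fun_pow (k - 1)
    have d6 := (((d2.const_mul (-(2 * (k : ℝ)))).fun_mul d5).div_const S)
    refine ((d1.mul d4).sub ((hy.hasDeriv t ht).mul d6)).congr_deriv ?_
    have hk1 : ((k - 1 : ℕ) : ℝ) = k - 1 := by rw [Nat.cast_sub (by omega)]; simp
    have hkk : k - 1 - 1 = k - 2 := by omega
    rw [hk1, hkk]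
    generalize 1 - (s t / S) ^ 2 = θ
    field_simp
    ring
  have hc : ContinuousOn (fun t => (G t * (1 - (s t / S) ^ 2) ^ k - W ^ q) / q) (Icc 0 T) := by
    have hsc : ContinuousOn s (Icc 0 T) := fun t ht =>
      ((hs t ht.1).mono hsub).continuousWithinAt
    fun_prop
  have key := integral_le_sub_of_le_deriv hT.le hHd hc fun t ht =>
    test_function_pointwise hp hk (hx t ht).1 (hx t ht).2 hS0 (hG t ht) (hynn t ht) hV (hyG t ht)
      (hμ1 t ht.1) hW
  have hHT : H T = 0 := by
    have h1 : s T / S = 1 := div_self hS0.ne'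
    simp only [hH, h1]
    rw [one_pow, sub_self, zero_pow (by omega), zero_pow (by omega)]
    ring
  have hH0 : H 0 = y' 0 := by simp [hH, hs0, hμ0]
  rw [hHT, hH0, intervalIntegral.integral_div, zero_sub, div_le_iff₀ (by linarith)] at key
  have hGθc : ContinuousOn (fun t => G t * (1 - (s t / S) ^ 2) ^ k) (Icc 0 T) := by
    have hsc : ContinuousOn s (Icc 0 T) := fun t ht =>
      ((hs t ht.1).mono hsub).continuousWithinAt
    fun_prop
  have hii : ∀ {f : ℝ → ℝ} {r t : ℝ}, ContinuousOn f (Icc 0 T) → 0 ≤ r → r ≤ t → t ≤ T →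
      IntervalIntegrable f volume r t := fun hf hr hrt htT =>
    (hf.mono (by rw [uIcc_of_le hrt]; exact Icc_subset_Icc hr htT)).intervalIntegrable
  rw [intervalIntegral.integral_sub (hii hGθc le_rfl hT.le le_rfl) (by simp),
    intervalIntegral.integral_const, sub_zero, smul_eq_mul] at key
  set t₁ := T / (2 * M) with ht₁
  have ht10 : 0 ≤ t₁ := by positivity
  have ht1T : t₁ ≤ T := div_le_self hT.le hM1
  have hθnn : ∀ t ∈ Icc 0 T, 0 ≤ 1 - (s t / S) ^ 2 := fun t ht => by
    have := pow_le_one₀ (n := 2) (hx t ht).1 (hx t ht).2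
    linarith
  have hsplit := intervalIntegral.integral_add_adjacent_intervals
    (hii hGθc le_rfl ht10 ht1T) (hii hGθc ht10 ht1T le_rfl)
  have hrest : 0 ≤ ∫ t in t₁..T, G t * (1 - (s t / S) ^ 2) ^ k :=
    intervalIntegral.integral_nonneg ht1T fun t ht =>
      mul_nonneg (hG t ⟨ht10.trans ht.1, ht.2⟩) (pow_nonneg (hθnn t ⟨ht10.trans ht.1, ht.2⟩) k)
  -- for `t ≤ T / (2 M)` the cutoff is evaluated at `s / S ≤ 1 / 2`
  have hlow : (3 / 4) ^ k * (∫ t in (0 : ℝ)..t₁, G t)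
      ≤ ∫ t in (0 : ℝ)..t₁, G t * (1 - (s t / S) ^ 2) ^ k := by
    rw [← intervalIntegral.integral_const_mul]
    refine intervalIntegral.integral_mono_on ht10
      ((hii hGc le_rfl ht10 ht1T).const_mul _) (hii hGθc le_rfl ht10 ht1T) fun t ht => ?_
    have ht' : t ∈ Icc 0 T := ⟨ht.1, ht.2.trans ht1T⟩
    rw [mul_comm]
    refine mul_le_mul_of_nonneg_left (pow_le_pow_left₀ (by norm_num) ?_ k) (hG t ht')
    have h1 : s t / S ≤ 1 / 2 := by
      rw [div_le_iff₀ hS0]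
      have h2 := (hst t ht.1).trans ht.2
      have h3 := hsM T hT.le
      have h4 : t₁ = 1 / 2 * (T / M) := by rw [ht₁]; field_simp
      linarith
    have h5 := pow_le_pow_left₀ (hx t ht').1 h1 2
    norm_num at h5 ⊢
    linarith
  have hqy : y' 0 ≤ y' 0 * q := le_mul_of_one_le_right h0' hq1.le
  linarith

end DampedODE

/-! ### The bound for the space average -/

section AverageBound

variable {a b : ℝ → ℝ}

/-- The bounds for the space average of a solution, with constants independent of the solution and
of the time. -/
theorem AssumptionA1.exists_average_bound (h : AssumptionA1 a b) {p : ℝ} (hp : 1 < p) (N : ℕ)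
    {r₀ c T₁ : ℝ} (hr : 0 ≤ r₀) (hc : 0 ≤ c) (hT₁ : 0 < T₁) :
    ∃ κ : ℝ, 0 < κ ∧ κ ≤ 1 ∧ ∃ C : ℝ, 0 < C ∧ ∀ T, T₁ ≤ T → ∀ y y' G : ℝ → ℝ,
      IsDampedSolution b T y y' G → ContinuousOn G (Icc 0 T) → (∀ t ∈ Icc 0 T, 0 ≤ G t) →
      0 ≤ y 0 → 0 ≤ y' 0 →
      (∀ t ∈ Icc 0 T, y t ≤ G t ^ (1 / p)
        * (c * (r₀ + primitiveA a t) ^ N) ^ (1 / (p / (p - 1)))) →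
      (∫ t in (0 : ℝ)..κ * T, G t) ≤ C * (T ^ (-((p + 1) / (p - 1))) * primitiveA a T ^ N) ∧
      y' 0 + y 0 ^ p ≤ C * (T ^ (-((p + 1) / (p - 1))) * primitiveA a T ^ N) := by
  obtain ⟨M, hM1, μ, s, hμ0, hs0, hμs⟩ := h.exists_integrating_factor
  have hpq : p.HolderConjugate (p / (p - 1)) := Real.HolderConjugate.conjExponent hp
  set q := p / (p - 1) with hq
  have hq1 : 1 < q := hpq.symm.lt
  have hp0 : 0 < p := by linarith
  have hM0 : 0 < M := by linarith
  obtain ⟨k, hk⟩ := exists_nat_ge (2 * q)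
  have hA1 : 0 < primitiveA a T₁ := h.primitiveA_pos hT₁
  set c₂ := c * (r₀ / primitiveA a T₁ + 1) ^ N with hc2
  have hc20 : 0 ≤ c₂ := by positivity
  set C₀ := (4 * (k : ℝ) ^ 2 * M ^ 2) ^ q * c₂ with hC0
  have hC00 : 0 ≤ C₀ := by positivity
  set V₁ := c * (r₀ + primitiveA a T₁) ^ N with hV1
  have hV10 : 0 ≤ V₁ := by positivity
  set κ := 1 / (2 * M) with hκ
  have hκ0 : 0 < κ := by positivity
  have hκ1 : κ ≤ 1 := by
    rw [hκ, div_le_one (by positivity)]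
    linarith
  refine ⟨κ, hκ0, hκ1, C₀ + (4 / 3) ^ k * C₀ * (1 + V₁ ^ (p / q) / (κ * T₁)) + 1,
    by positivity, fun T hT y y' G hy hGc hG h0 h0' hyG => ?_⟩
  have hT0 : 0 < T := hT₁.trans_le hT
  have hAT : 0 < primitiveA a T := h.primitiveA_pos hT0
  have hAmono : ∀ r t, 0 ≤ r → r ≤ t → primitiveA a r ≤ primitiveA a t := fun r t hr hrt =>
    h.strictMonoOn_primitiveA.monotoneOn hr (hr.trans hrt) hrt
  set V := c * (r₀ + primitiveA a T) ^ N with hV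
  have hV0 : 0 ≤ V := by positivity
  have hVle : V ≤ c₂ * primitiveA a T ^ N := by
    rw [hV, hc2, mul_assoc, ← mul_pow]
    gcongr
    have h1 : r₀ ≤ r₀ / primitiveA a T₁ * primitiveA a T := by
      rw [div_mul_eq_mul_div, le_div_iff₀ hA1]
      exact mul_le_mul_of_nonneg_left (hAmono T₁ T hT₁.le hT) hr
    linarith
  have hyV : ∀ t ∈ Icc 0 T, y t ≤ G t ^ (1 / p) * V ^ (1 / q) := fun t ht => by
    refine (hyG t ht).trans ?_
    have h1 := h.primitiveA_nonneg ht.1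
    have h2 := hAmono t T ht.1 ht.2
    have h3 := hG t ht
    have h4 : 0 < q := by linarith
    have h5 : c * (r₀ + primitiveA a t) ^ N ≤ V := by rw [hV]; gcongr
    gcongr
  obtain ⟨key, -⟩ := hy.integral_le hp hk hT0 (fun t ht => (hμs t ht).2.1)
    (fun t ht => (hμs t ht).1.1) hμ0 hs0 (fun t ht => (hμs t ht).2.2.1) hM0
    (fun t ht => (hμs t ht).2.2.2.1) (fun t ht => (hμs t ht).2.2.2.2) hGc hG h0 h0' hV0 hyV rfl
  set Q := T ^ (-((p + 1) / (p - 1))) * primitiveA a T ^ N with hQ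
  have hQ0 : 0 ≤ Q := by positivity
  have hW : T * (4 * (k : ℝ) ^ 2 * (s T ^ 2)⁻¹ * V ^ (1 / q)) ^ q ≤ C₀ * Q := by
    have hsT : T / M ≤ s T := (hμs T hT0.le).2.2.2.1
    have h1 : (s T ^ 2)⁻¹ ≤ M ^ 2 * (T ^ 2)⁻¹ := by
      have : M ^ 2 * (T ^ 2)⁻¹ = ((T / M) ^ 2)⁻¹ := by field_simp
      rw [this]
      gcongr
    have h2 : (4 * (k : ℝ) ^ 2 * (s T ^ 2)⁻¹ * V ^ (1 / q)) ^ q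
        ≤ (4 * (k : ℝ) ^ 2 * M ^ 2) ^ q * ((T ^ 2)⁻¹ ^ q * V) := by
      have h3 : (V ^ (1 / q)) ^ q = V := by
        rw [← Real.rpow_mul hV0, one_div_mul_cancel (by linarith), Real.rpow_one]
      calc (4 * (k : ℝ) ^ 2 * (s T ^ 2)⁻¹ * V ^ (1 / q)) ^ q
          ≤ (4 * (k : ℝ) ^ 2 * (M ^ 2 * (T ^ 2)⁻¹) * V ^ (1 / q)) ^ q := by gcongr
        _ = ((4 * (k : ℝ) ^ 2 * M ^ 2) * ((T ^ 2)⁻¹ * V ^ (1 / q))) ^ q := by ring_nf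
        _ = _ := by
          rw [Real.mul_rpow (x := 4 * (k : ℝ) ^ 2 * M ^ 2) (by positivity) (by positivity),
            Real.mul_rpow (x := (T ^ 2)⁻¹) (by positivity) (by positivity), h3]
    -- `1 - 2 q = -(p + 1) / (p - 1)`
    have h4 : T * (T ^ 2)⁻¹ ^ q = T ^ (-((p + 1) / (p - 1))) := by
      have hp1 : p - 1 ≠ 0 := by linarith
      rw [Real.inv_rpow (by positivity), ← Real.rpow_natCast, ← Real.rpow_mul hT0.le,
        ← Real.rpow_neg hT0.le]
      nth_rewrite 1 [← Real.rpow_one T]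
      rw [← Real.rpow_add hT0, hq]
      congr 1
      push_cast
      field_simp
      ring
    calc T * (4 * (k : ℝ) ^ 2 * (s T ^ 2)⁻¹ * V ^ (1 / q)) ^ q
        ≤ T * ((4 * (k : ℝ) ^ 2 * M ^ 2) ^ q * ((T ^ 2)⁻¹ ^ q * V)) := by gcongr
      _ = (4 * (k : ℝ) ^ 2 * M ^ 2) ^ q * ((T * (T ^ 2)⁻¹ ^ q) * V) := by ring
      _ ≤ (4 * (k : ℝ) ^ 2 * M ^ 2) ^ q * (T ^ (-((p + 1) / (p - 1)))
          * (c₂ * primitiveA a T ^ N)) := by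
        rw [h4]
        gcongr
      _ = C₀ * Q := by rw [hC0, hQ]; ring
  have hκT : T / (2 * M) = κ * T := by rw [hκ]; ring
  rw [hκT, ← hq] at key
  have hκT0 : 0 ≤ κ * T := by positivity
  have hκTT : κ * T ≤ T := mul_le_of_le_one_left hT0.le hκ1
  have hii : ∀ {r t : ℝ}, 0 ≤ r → r ≤ t → t ≤ T → IntervalIntegrable G volume r t :=
    fun hr hrt htT =>
      (hGc.mono (by rw [uIcc_of_le hrt]; exact Icc_subset_Icc hr htT)).intervalIntegrable
  have hI0 : 0 ≤ ∫ t in (0 : ℝ)..κ * T, G t :=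
    intervalIntegral.integral_nonneg hκT0 fun t ht => hG t ⟨ht.1, ht.2.trans hκTT⟩
  set I := ∫ t in (0 : ℝ)..κ * T, G t with hI
  have hIle : I ≤ (4 / 3) ^ k * C₀ * Q := by
    have h1 : (3 / 4) ^ k * I ≤ C₀ * Q := by linarith
    calc I = (4 / 3) ^ k * ((3 / 4) ^ k * I) := by
          rw [← mul_assoc, ← mul_pow]; norm_num
      _ ≤ (4 / 3) ^ k * (C₀ * Q) := by gcongr
      _ = _ := by ring
  have hy'le : y' 0 ≤ C₀ * Q := by
    have : 0 ≤ (3 / 4 : ℝ) ^ k * I := by positivity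
    linarith
  -- the average stays above its initial value, hence so does the forcing
  have hylow : y 0 ^ p ≤ V₁ ^ (p / q) / (κ * T₁) * I := by
    have hymono := hy.monotoneOn (fun t ht => (hμs t ht).2.1) (fun t ht => (hμs t ht).1.1) hμ0 hG h0'
    have hκT1 : 0 < κ * T₁ := by positivity
    have hκTT1 : κ * T₁ ≤ κ * T := by gcongr
    have hpt : ∀ t ∈ Icc 0 (κ * T₁), y 0 ^ p ≤ V₁ ^ (p / q) * G t := by
      intro t ht
      have ht' : t ∈ Icc 0 T := ⟨ht.1, ht.2.trans (hκTT1.trans hκTT)⟩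
      have htT1 : t ≤ T₁ := ht.2.trans (mul_le_of_le_one_left hT₁.le hκ1)
      have h1 : y 0 ≤ G t ^ (1 / p) * V₁ ^ (1 / q) := by
        refine (hymono ⟨le_rfl, hT0.le⟩ ht' ht.1).trans ((hyG t ht').trans ?_)
        have h1 := h.primitiveA_nonneg ht.1
        have h2 := hAmono t T₁ ht.1 htT1
        have h3 := hG t ht'
        have h4 : 0 < q := by linarith
        have h5 : c * (r₀ + primitiveA a t) ^ N ≤ V₁ := by rw [hV1]; gcongr
        gcongr
      refine (Real.rpow_le_rpow h0 h1 hp0.le).trans (le_of_eq ?_)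
      have h3 := hG t ht'
      rw [Real.mul_rpow (by positivity) (by positivity), ← Real.rpow_mul h3,
        one_div_mul_cancel hp0.ne', Real.rpow_one, ← Real.rpow_mul hV10, mul_comm, one_div_mul_eq_div]
    have hint : ∫ _ in (0 : ℝ)..κ * T₁, y 0 ^ p ≤ ∫ t in (0 : ℝ)..κ * T₁, V₁ ^ (p / q) * G t :=
      intervalIntegral.integral_mono_on hκT1.le (by simp)
        ((hii le_rfl hκT1.le (hκTT1.trans hκTT)).const_mul _) hpt
    rw [intervalIntegral.integral_const, intervalIntegral.integral_const_mul, sub_zero,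
      smul_eq_mul] at hint
    have hsplit := intervalIntegral.integral_add_adjacent_intervals
      (hii le_rfl hκT1.le (hκTT1.trans hκTT)) (hii hκT1.le hκTT1 hκTT)
    have hrest : 0 ≤ ∫ t in κ * T₁..κ * T, G t :=
      intervalIntegral.integral_nonneg hκTT1 fun t ht =>
        hG t ⟨hκT1.le.trans ht.1, ht.2.trans hκTT⟩
    have h5 : ∫ t in (0 : ℝ)..κ * T₁, G t ≤ I := by linarith
    rw [div_mul_eq_mul_div, le_div_iff₀ hκT1]
    calc y 0 ^ p * (κ * T₁) = κ * T₁ * y 0 ^ p := mul_comm _ _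
      _ ≤ V₁ ^ (p / q) * ∫ t in (0 : ℝ)..κ * T₁, G t := hint
      _ ≤ V₁ ^ (p / q) * I := by gcongr
  set D := V₁ ^ (p / q) / (κ * T₁) with hD
  have hD0 : 0 ≤ D := by positivity
  have hyle : y 0 ^ p ≤ D * ((4 / 3) ^ k * C₀ * Q) :=
    hylow.trans (mul_le_mul_of_nonneg_left hIle hD0)
  have e1 : 0 ≤ C₀ * Q := by positivity
  have e2 : 0 ≤ (4 / 3) ^ k * C₀ * Q := by positivity
  have e3 : 0 ≤ D * ((4 / 3) ^ k * C₀ * Q) := by positivity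
  constructor <;> linarith

end AverageBound

/-! ### Ordinary differential inequalities: the exponential moment -/

section ExponentialMoment

variable {a b : ℝ → ℝ}

/-- A solution with positive initial value and nonnegative initial velocity cannot vanish: up to its
first zero it is nondecreasing. -/
theorem IsDampedSolution.pos (h : AssumptionA1 a b) {T : ℝ} {y y' F : ℝ → ℝ}
    (hy : IsDampedSolution b T y y' fun t => a t ^ 2 * y t + F t) (hF : ∀ t ∈ Icc 0 T, 0 ≤ F t)
    (h0 : 0 < y 0) (h0' : 0 ≤ y' 0) {t : ℝ} (ht : t ∈ Icc 0 T) : 0 < y t := by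
  by_contra hneg
  obtain ⟨M, -, μ, s, hμ0, -, hμs⟩ := h.exists_integrating_factor
  have hc : ContinuousOn y (Icc 0 T) := fun t ht => (hy.hasDeriv t ht).continuousWithinAt
  have hclosed : IsCompact (Icc 0 T ∩ y ⁻¹' Iic 0) :=
    isCompact_Icc.of_isClosed_subset (hc.preimage_isClosed_of_isClosed isClosed_Icc isClosed_Iic)
      inter_subset_left
  obtain ⟨r, ⟨hr, hyr⟩, hmin⟩ := hclosed.exists_isLeast ⟨t, ht, not_lt.1 hneg⟩
  have hnn : ∀ x ∈ Icc 0 r, 0 ≤ y x := by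
    intro x hx
    rcases hx.2.lt_or_eq with hlt | heq
    · by_contra hlt0
      exact absurd (hmin ⟨⟨hx.1, hx.2.trans hr.2⟩, (not_le.1 hlt0).le⟩) (not_le.2 hlt)
    · -- at the first zero the value is a limit of positive values
      subst heq
      have hx0 : 0 < x := by
        rcases hx.1.lt_or_eq with h1 | h1
        · exact h1
        · rw [← h1] at hyr
          exact absurd hyr (not_le.2 h0)
      have hcw : Tendsto y (𝓝[<] x) (𝓝 (y x)) := by
        refine (hc x hr).tendsto.mono_left (nhdsWithin_le_of_mem ?_)
        filter_upwards [Ioo_mem_nhdsLT hx0] with z hz using ⟨hz.1.le, hz.2.le.trans hr.2⟩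
      refine ge_of_tendsto hcw ?_
      filter_upwards [Ioo_mem_nhdsLT hx0] with z hz
      by_contra hlt0
      exact absurd (hmin ⟨⟨hz.1.le, hz.2.le.trans hr.2⟩, (not_le.1 hlt0).le⟩) (not_le.2 hz.2)
  have hmono := (hy.mono hr.2).monotoneOn (fun t ht => (hμs t ht).2.1)
    (fun t ht => (hμs t ht).1.1) hμ0 (fun x hx => add_nonneg (mul_nonneg (sq_nonneg _) (hnn x hx))
      (hF x ⟨hx.1, hx.2.trans hr.2⟩)) h0'
  have := hmono ⟨le_rfl, hr.1⟩ ⟨hr.1, le_rfl⟩ hr.1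
  exact absurd (h0.trans_le this) (not_lt.2 hyr)

/-- Nonnegative data and forcing give a nonnegative solution. The case of vanishing data is reached
by adding a small multiple of `e^{l t}`, a strict supersolution. -/
theorem IsDampedSolution.nonneg (h : AssumptionA1 a b) {T : ℝ} {y y' F : ℝ → ℝ}
    (hy : IsDampedSolution b T y y' fun t => a t ^ 2 * y t + F t) (hF : ∀ t ∈ Icc 0 T, 0 ≤ F t)
    (h0 : 0 ≤ y 0) (h0' : 0 ≤ y' 0) {t : ℝ} (ht : t ∈ Icc 0 T) : 0 ≤ y t := by
  obtain ⟨l, hl⟩ := isCompact_Icc.exists_bound_of_continuousOn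
    (h.continuousOn_a.mono (fun t ht => ht.1 : Icc 0 T ⊆ Ici (0 : ℝ)))
  have hl0 : 0 ≤ l := (norm_nonneg _).trans (hl t ht)
  have key : ∀ δ : ℝ, 0 < δ → 0 < y t + δ * Real.exp (l * t) := by
    intro δ hδ
    have hexp : ∀ x, HasDerivWithinAt (fun x => Real.exp (l * x)) (l * Real.exp (l * x))
        (Icc 0 T) x := fun x =>
      (((hasDerivAt_id x).const_mul l).exp.congr_deriv (by simp; ring)).hasDerivWithinAt
    have hsol : IsDampedSolution b T (fun x => y x + δ * Real.exp (l * x))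
        (fun x => y' x + δ * (l * Real.exp (l * x)))
        fun x => a x ^ 2 * (y x + δ * Real.exp (l * x))
          + (F x + δ * Real.exp (l * x) * (l ^ 2 - a x ^ 2 + b x * l)) := by
      refine ⟨fun x hx => (hy.hasDeriv x hx).add ((hexp x).const_mul δ), fun x hx => ?_⟩
      exact ((hy.hasDeriv' x hx).add (((hexp x).const_mul l).const_mul δ)).congr_deriv (by ring)
    refine hsol.pos h (fun x hx => ?_) ?_ ?_ ht
    · have h1 : a x ^ 2 ≤ l ^ 2 := by
        have h2 := hl x hx
        rw [Real.norm_eq_abs] at h2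
        exact sq_le_sq' (abs_le.1 h2).1 (abs_le.1 h2).2
      have h3 := hF x hx
      have h4 := mul_nonneg (h.b_nonneg x hx.1) hl0
      have h5 : 0 ≤ δ * Real.exp (l * x) * (l ^ 2 - a x ^ 2 + b x * l) :=
        mul_nonneg (by positivity) (by linarith)
      linarith
    · simp only [mul_zero, Real.exp_zero]
      linarith
    · have := mul_nonneg hδ.le hl0
      simp only [mul_zero, Real.exp_zero]
      linarith
  have hlim : Tendsto (fun δ : ℝ => y t + δ * Real.exp (l * t)) (𝓝[>] 0) (𝓝 (y t + 0 * Real.exp (l * t))) :=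
    (tendsto_const_nhds.add (tendsto_id.mul_const _)).mono_left nhdsWithin_le_nhds
  have := ge_of_tendsto hlim (eventually_mem_nhdsWithin.mono fun δ hδ => (key δ hδ).le)
  simpa using this

/-- The relative variation `q = a' / a² + b / a` of the coefficients, and its derivative. -/
theorem AssumptionA1.exists_variation (h : AssumptionA1 a b) (h2 : AssumptionA2 a b)
    (h3 : AssumptionA3 a b) : ∃ q q' : ℝ → ℝ, ∃ K : ℝ, Tendsto q atTop (𝓝 0) ∧
      (∀ t, 0 < t → HasDerivAt a (a t ^ 2 * q t - a t * b t) t ∧ HasDerivAt q (q' t) t) ∧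
      ContinuousOn q' (Ioi 0) ∧
      ∀ s t, 0 < s → s ≤ t → ∫ r in s..t, |q' r| ≤ K := by
  have hsub : Ioi (0 : ℝ) ⊆ Ici 0 := Ioi_subset_Ici_self
  have hapos : ∀ t ∈ Ioi (0 : ℝ), a t ≠ 0 := fun t ht => (h.a_pos t (le_of_lt ht)).ne'
  have hinv : ContDiffOn ℝ 2 (fun t => (a t)⁻¹) (Ioi 0) := (h.a_smooth.mono hsub).inv hapos
  have hdinv : ContDiffOn ℝ 1 (deriv fun t => (a t)⁻¹) (Ioi 0) :=
    hinv.deriv_of_isOpen isOpen_Ioi (by norm_num)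
  have hprod : ContDiffOn ℝ 1 (fun t => (a t)⁻¹ * b t) (Ioi 0) :=
    (hinv.of_le (by norm_num)).mul (h.b_smooth.mono hsub)
  have hii : iteratedDeriv 2 (fun t => (a t)⁻¹) = deriv (deriv fun t => (a t)⁻¹) := by
    rw [iteratedDeriv_succ, iteratedDeriv_one]
  set q : ℝ → ℝ := fun t => -deriv (fun t => (a t)⁻¹) t + (a t)⁻¹ * b t with hq
  set q' : ℝ → ℝ := fun t => -iteratedDeriv 2 (fun t => (a t)⁻¹) t + deriv (fun t => (a t)⁻¹ * b t) t
    with hq'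
  have hq'i : IntegrableOn q' (Ioi 0) := h2.deriv2_inv_a.neg.add h2.deriv_b_div_a
  refine ⟨q, q', ∫ t in Ioi 0, |q' t|, ?_, fun t ht => ⟨?_, ?_⟩, ?_, fun s t hs hst => ?_⟩
  · simpa using h3.deriv_inv_a.neg.add h3.b_div_a
  · have hat := hapos t ht
    have hda : HasDerivAt a (deriv a t) t :=
      ((h.a_smooth.mono hsub).differentiableOn (by norm_num) t ht).differentiableAt
        (Ioi_mem_nhds ht) |>.hasDerivAt
    refine hda.congr_deriv ?_
    have h4 : deriv (fun t => (a t)⁻¹) t = -deriv a t / a t ^ 2 := (hda.fun_inv hat).deriv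
    simp only [hq, h4]
    field_simp
    ring
  · have d1 : HasDerivAt (deriv fun t => (a t)⁻¹) (iteratedDeriv 2 (fun t => (a t)⁻¹) t) t := by
      rw [hii]
      exact ((hdinv.differentiableOn (by norm_num) t ht).differentiableAt (Ioi_mem_nhds ht)).hasDerivAt
    have d2 : HasDerivAt (fun t => (a t)⁻¹ * b t) (deriv (fun t => (a t)⁻¹ * b t) t) t :=
      ((hprod.differentiableOn (by norm_num) t ht).differentiableAt (Ioi_mem_nhds ht)).hasDerivAt
    exact d1.neg.add d2
  · have c1 : ContinuousOn (iteratedDeriv 2 fun t => (a t)⁻¹) (Ioi 0) := by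
      rw [hii]
      exact (hdinv.deriv_of_isOpen (m := 0) isOpen_Ioi (by norm_num)).continuousOn
    have c2 : ContinuousOn (deriv fun t => (a t)⁻¹ * b t) (Ioi 0) :=
      (hprod.deriv_of_isOpen (m := 0) isOpen_Ioi (by norm_num)).continuousOn
    exact c1.neg.add c2
  · rw [intervalIntegral.integral_of_le hst]
    refine setIntegral_mono_set hq'i.norm (ae_of_all _ fun r => abs_nonneg _) ?_
    exact ae_of_all _ fun r hr => lt_trans hs hr.1

/-- The derivative of the factorized quantity `m (y' / a + (q / 2 + 1) y)`, `m = √(a μ)`. -/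
theorem deriv_factorized {a b q q' m y y' F : ℝ} (ha : a ≠ 0) :
    (a * q / 2 * m) * (y' / a + (q / 2 + 1) * y)
      + m * (((-(b * y') + (a ^ 2 * y + F)) * a - y' * (a ^ 2 * q - a * b)) / a ^ 2
        + (q' / 2 * y + (q / 2 + 1) * y'))
      = a * (m * (y' / a + (q / 2 + 1) * y)) + m * (a * q ^ 2 / 4 * y + F / a + q' / 2 * y) := by
  field_simp
  ring

end ExponentialMoment

/-! ### Exponential growth -/

section ExponentialGrowth

variable {a b : ℝ → ℝ}

/-- The value of a solution at a fixed positive time is bounded below by its data. -/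
theorem IsDampedSolution.le_add {M T : ℝ} (hM : 1 ≤ M) {y y' F μ : ℝ → ℝ}
    (hy : IsDampedSolution b T y y' F)
    (hμ : ∀ t, 0 ≤ t → HasDerivWithinAt μ (b t * μ t) (Ici 0) t) (hμ1 : ∀ t, 0 ≤ t → 1 ≤ μ t)
    (hμM : ∀ t, 0 ≤ t → μ t ≤ M)
    (hμ0 : μ 0 = 1) (hF : ∀ t ∈ Icc 0 T, 0 ≤ F t) (h0' : 0 ≤ y' 0) {t : ℝ} (ht : t ∈ Icc 0 T) :
    y 0 + t / M * y' 0 ≤ y t := by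
  have hM0 : 0 < M := by linarith
  have hmono : MonotoneOn (fun t => y t - y' 0 / M * t) (Icc 0 T) := by
    refine monotoneOn_of_hasDerivWithin_nonneg (f' := fun t => y' t - y' 0 / M)
      (fun t ht => ?_) fun t ht => ?_
    · refine ((hy.hasDeriv t ht).sub ((hasDerivWithinAt_id t _).const_mul (y' 0 / M))).congr_deriv ?_
      ring
    · rw [sub_nonneg, div_le_iff₀ hM0]
      have h1 := hy.velocity_le hμ hμ1 hμ0 hF ht
      have h2 := hy.velocity_nonneg hμ hμ1 hμ0 hF h0' ht
      calc y' 0 ≤ μ t * y' t := h1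
        _ ≤ M * y' t := mul_le_mul_of_nonneg_right (hμM t ht.1) h2
        _ = y' t * M := mul_comm _ _
  have h1 := hmono ⟨le_rfl, ht.1.trans ht.2⟩ ht ht.1
  simp only [mul_zero, sub_zero] at h1
  have : t / M * y' 0 = y' 0 / M * t := by ring
  linarith

/-- Growth of the factorized quantity `m (y' / a + (q / 2 + 1) y)`, `m = √(a μ)`, and its
consequence for `y`. -/
theorem IsDampedSolution.exp_growth (h : AssumptionA1 a b) {r T K : ℝ} (hr : 0 < r)
    {y y' F μ q q' : ℝ → ℝ}
    (hy : IsDampedSolution b T y y' fun t => a t ^ 2 * y t + F t)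
    (hμ : ∀ t, 0 ≤ t → HasDerivWithinAt μ (b t * μ t) (Ici 0) t) (hμ1 : ∀ t, 0 ≤ t → 1 ≤ μ t)
    (hq : ∀ t, 0 < t → HasDerivAt a (a t ^ 2 * q t - a t * b t) t ∧ HasDerivAt q (q' t) t)
    (hq'c : ContinuousOn q' (Ioi 0)) (hK : ∀ s t, 0 < s → s ≤ t → ∫ r in s..t, |q' r| ≤ K)
    (hq1 : ∀ t, r ≤ t → |q t| ≤ 1) (hF : ∀ t ∈ Icc 0 T, 0 ≤ F t)
    (hynn : ∀ t ∈ Icc 0 T, 0 ≤ y t) (hynn' : ∀ t ∈ Icc 0 T, 0 ≤ y' t) {t : ℝ} (ht : t ∈ Icc r T) :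
    √(a r * μ r) / 2 * y r * Real.exp (-primitiveA a r - K)
        * ((Real.exp (2 * primitiveA a t) - Real.exp (2 * primitiveA a r)) / 2)
      ≤ √(a t * μ t) * y t * Real.exp (primitiveA a t) := by
  have hsub : Icc r T ⊆ Icc 0 T := Icc_subset_Icc_left hr.le
  have hsub0 : Icc r T ⊆ Ici (0 : ℝ) := fun t ht => hr.le.trans ht.1
  have hpos : ∀ t ∈ Icc r T, 0 < t := fun t ht => hr.trans_le ht.1
  have ha : ∀ t ∈ Icc r T, 0 < a t := fun t ht => h.a_pos t (hsub0 ht)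
  have haμ : ∀ t ∈ Icc r T, 0 < a t * μ t := fun t ht =>
    mul_pos (ha t ht) (one_pos.trans_le (hμ1 t (hsub0 ht)))
  set m : ℝ → ℝ := fun t => √(a t * μ t) with hm
  have hm0 : ∀ t ∈ Icc r T, 0 < m t := fun t ht => Real.sqrt_pos.2 (haμ t ht)
  have hmd : ∀ t ∈ Icc r T, HasDerivWithinAt m (a t * q t / 2 * m t) (Icc r T) t := by
    intro t ht
    have d1 : HasDerivWithinAt (fun t => a t * μ t) (a t ^ 2 * q t * μ t) (Icc r T) t :=
      (((hq t (hpos t ht)).1.hasDerivWithinAt).mul ((hμ t (hsub0 ht)).mono hsub0)).congr_deriv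
        (by ring)
    refine (d1.sqrt (haμ t ht).ne').congr_deriv ?_
    have h1 : a t * μ t = m t ^ 2 := (Real.sq_sqrt (haμ t ht).le).symm
    have h2 := (hm0 t ht).ne'
    have h3 : a t ^ 2 * q t * μ t = a t * q t * m t ^ 2 := by rw [← h1]; ring
    rw [h3]
    change a t * q t * m t ^ 2 / (2 * m t) = _
    field_simp
  have hyd : ∀ t ∈ Icc r T, HasDerivWithinAt y (y' t) (Icc r T) t := fun t ht =>
    (hy.hasDeriv t (hsub ht)).mono hsub
  have hAd : ∀ t ∈ Icc r T, HasDerivWithinAt (primitiveA a) (a t) (Icc r T) t := fun t ht =>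
    (h.hasDeriv_primitiveA (hsub0 ht)).mono hsub0
  set P : ℝ → ℝ := fun t => m t * (y' t / a t + (q t / 2 + 1) * y t) with hP
  have hPd : ∀ t ∈ Icc r T, HasDerivWithinAt P (a t * P t
      + m t * (a t * q t ^ 2 / 4 * y t + F t / a t + q' t / 2 * y t)) (Icc r T) t := by
    intro t ht
    have d1 := ((hy.hasDeriv' t (hsub ht)).mono hsub).fun_div
      ((hq t (hpos t ht)).1.hasDerivWithinAt) (ha t ht).ne'
    have d2 := (((hq t (hpos t ht)).2.hasDerivWithinAt (s := Icc r T)).div_const 2).add_const 1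
    have d3 := (hmd t ht).fun_mul (d1.fun_add (d2.fun_mul (hyd t ht)))
    exact d3.congr_deriv (deriv_factorized (ha t ht).ne')
  have hPlow : ∀ t ∈ Icc r T, m t / 2 * y t ≤ P t := by
    intro t ht
    have h1 := (abs_le.1 (hq1 t ht.1)).1
    have h2 := hynn t (hsub ht)
    have h3 : 0 ≤ y' t / a t := div_nonneg (hynn' t (hsub ht)) (ha t ht).le
    have h4 : 1 / 2 * y t ≤ (q t / 2 + 1) * y t := mul_le_mul_of_nonneg_right (by linarith) h2
    calc m t / 2 * y t = m t * (1 / 2 * y t) := by ring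
      _ ≤ m t * (y' t / a t + (q t / 2 + 1) * y t) :=
        mul_le_mul_of_nonneg_left (by linarith) (hm0 t ht).le
  set Θ : ℝ → ℝ := fun t => ∫ x in r..t, |q' x| with hΘ
  have hΘd : ∀ t ∈ Icc r T, HasDerivAt Θ (|q' t|) t := by
    intro t ht
    have hc : ContinuousOn (fun x => |q' x|) (Ioi 0) := hq'c.abs
    refine intervalIntegral.integral_hasDerivAt_right ?_
      (hc.stronglyMeasurableAtFilter isOpen_Ioi t (hpos t ht))
      (hc.continuousAt (Ioi_mem_nhds (hpos t ht)))
    refine (hc.mono fun x hx => ?_).intervalIntegrable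
    rw [uIcc_of_le ht.1] at hx
    exact hr.trans_le hx.1
  -- the derivative of `q` has no sign; the weight `e^Θ`, `Θ = ∫ |q'|`, absorbs it at a bounded cost
  have hmono : MonotoneOn (fun t => P t * Real.exp (-primitiveA a t + Θ t)) (Icc r T) := by
    refine monotoneOn_of_hasDerivWithin_nonneg (fun t ht => (hPd t ht).mul
      (((hAd t ht).neg.add (hΘd t ht).hasDerivWithinAt).exp)) fun t ht => ?_
    have h1 := hPlow t ht
    have h2 := hynn t (hsub ht)
    have h3 := (hm0 t ht).le
    have h4 := hF t (hsub ht)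
    have h5 := (ha t ht).le
    have h6 : -(|q' t| * P t) ≤ m t * (q' t / 2 * y t) := by
      have h7 : m t * (-(q' t) / 2 * y t) ≤ |q' t| * (m t / 2 * y t) := by
        have := mul_le_mul_of_nonneg_right (neg_le_abs (q' t))
          (by positivity : 0 ≤ m t / 2 * y t)
        linarith
      have h8 := mul_le_mul_of_nonneg_left h1 (abs_nonneg (q' t))
      linarith
    have h9 : 0 ≤ m t * (a t * q t ^ 2 / 4 * y t + F t / a t) := by positivity
    have h10 : 0 ≤ Real.exp ((-primitiveA a + Θ) t)
        * (m t * (a t * q t ^ 2 / 4 * y t + F t / a t) + (m t * (q' t / 2 * y t) + |q' t| * P t)) :=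
      mul_nonneg (Real.exp_pos _).le (by linarith)
    refine h10.trans (le_of_eq ?_)
    simp only [Pi.add_apply, Pi.neg_apply]
    ring
  have hrmem : ∀ {t}, t ∈ Icc r T → r ∈ Icc r T := fun ht => ⟨le_rfl, ht.1.trans ht.2⟩
  set c := √(a r * μ r) / 2 * y r * Real.exp (-primitiveA a r - K) with hc
  have hPexp : ∀ t ∈ Icc r T, c * Real.exp (primitiveA a t) ≤ P t := by
    intro t ht
    have h1 := hmono (hrmem ht) ht ht.1
    have hΘr : Θ r = 0 := by simp [hΘ]
    simp only [hΘr, add_zero] at h1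
    have h2 := hPlow r (hrmem ht)
    have h3 := hynn r (hsub (hrmem ht))
    have h4 := (hm0 r (hrmem ht)).le
    have h5 : Θ t ≤ K := hK r t hr ht.1
    have h6 : 0 ≤ P t := by
      have := hPlow t ht
      have h7 := hynn t (hsub ht)
      have h8 := (hm0 t ht).le
      exact le_trans (by positivity) this
    have h7 : m r / 2 * y r * Real.exp (-primitiveA a r)
        ≤ P t * Real.exp (-primitiveA a t + K) := by
      calc m r / 2 * y r * Real.exp (-primitiveA a r) ≤ P r * Real.exp (-primitiveA a r) := by
            gcongr
        _ ≤ P t * Real.exp (-primitiveA a t + Θ t) := h1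
        _ ≤ _ := by gcongr
    calc c * Real.exp (primitiveA a t)
        = m r / 2 * y r * Real.exp (-primitiveA a r) * Real.exp (primitiveA a t - K) := by
          rw [hc, sub_eq_add_neg, sub_eq_add_neg, Real.exp_add, Real.exp_add]
          ring
      _ ≤ P t * Real.exp (-primitiveA a t + K) * Real.exp (primitiveA a t - K) := by gcongr
      _ = P t := by
        rw [mul_assoc, ← Real.exp_add]
        simp
  -- `(m y e^A)' = a e^A P`, and `P` grows at least like `e^A`
  have hmono2 : MonotoneOn (fun t => m t * y t * Real.exp (primitiveA a t)
      - c * (Real.exp (2 * primitiveA a t) / 2)) (Icc r T) := by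
    refine monotoneOn_of_hasDerivWithin_nonneg (fun t ht =>
      (((hmd t ht).mul (hyd t ht)).mul (hAd t ht).exp).sub
        ((((hAd t ht).const_mul 2).exp.div_const 2).const_mul c)) fun t ht => ?_
    have h1 := mul_le_mul_of_nonneg_left (hPexp t ht)
      (mul_nonneg (ha t ht).le (Real.exp_pos (primitiveA a t)).le)
    have h2 : Real.exp (2 * primitiveA a t)
        = Real.exp (primitiveA a t) * Real.exp (primitiveA a t) := by
      rw [← Real.exp_add]
      congr 1
      ring
    have h3 : a t * Real.exp (primitiveA a t) * P t
        = (a t * q t / 2 * m t * y t + m t * y' t) * Real.exp (primitiveA a t)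
          + m t * y t * (Real.exp (primitiveA a t) * a t) := by
      simp only [hP]
      have := (ha t ht).ne'
      field_simp
      ring
    rw [h2]
    simp only [Pi.mul_apply]
    linarith
  have h1 := hmono2 (hrmem ht) ht ht.1
  simp only at h1
  have h2 : 0 ≤ m r * y r * Real.exp (primitiveA a r) := by
    have h3 := hynn r (hsub (hrmem ht))
    have h4 := (hm0 r (hrmem ht)).le
    positivity
  change c * _ ≤ m t * y t * Real.exp (primitiveA a t)
  linarith

/-- The exponential moment grows at least like `a^{-1/2} e^A`. -/
theorem AssumptionA1.exists_exponential_lower_bound (h : AssumptionA1 a b) (h2 : AssumptionA2 a b)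
    (h3 : AssumptionA3 a b) : ∃ t₂ > 0, ∃ c > 0, ∀ T, ∀ y y' F : ℝ → ℝ,
      (IsDampedSolution b T y y' fun t => a t ^ 2 * y t + F t) → (∀ t ∈ Icc 0 T, 0 ≤ F t) →
      0 ≤ y 0 → 0 ≤ y' 0 → ∀ t ∈ Icc t₂ T,
        c * (y 0 + y' 0) * Real.exp (primitiveA a t) ≤ √(a t) * y t := by
  obtain ⟨M, hM1, μ, s, hμ0, -, hμs⟩ := h.exists_integrating_factor
  obtain ⟨q, q', K, hq0, hq, hq'c, hK⟩ := h.exists_variation h2 h3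
  have hM0 : 0 < M := by linarith
  obtain ⟨r, hr0, hr⟩ : ∃ r > 0, ∀ t, r ≤ t → |q t| ≤ 1 := by
    have h1 : ∀ᶠ t in atTop, |q t| ≤ 1 := by
      have := hq0.abs
      rw [abs_zero] at this
      exact this.eventually_le_const one_pos
    obtain ⟨r, hr⟩ := eventually_atTop.1 h1
    exact ⟨max r 1, by positivity, fun t ht => hr t ((le_max_left _ _).trans ht)⟩
  set A := primitiveA a with hA
  have hAlt : A r < A (r + 1) := h.strictMonoOn_primitiveA hr0.le (by
    simp only [mem_Ici]; linarith) (by linarith)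
  -- after time `r + 1` the difference `e^{2 A t} - e^{2 A r}` is comparable with `e^{2 A t}`
  set δ := 1 - Real.exp (2 * A r - 2 * A (r + 1)) with hδ
  have hδ0 : 0 < δ := by
    have : Real.exp (2 * A r - 2 * A (r + 1)) < 1 := by
      have h4 := Real.exp_lt_exp.2 (by linarith : 2 * A r - 2 * A (r + 1) < 0)
      rwa [Real.exp_zero] at h4
    simp only [hδ]
    linarith
  set d := min 1 (r / M) with hd
  have hd0 : 0 < d := lt_min one_pos (by positivity)
  have har := h.a_pos r hr0.le
  have hμr : 0 < μ r := one_pos.trans_le (hμs r hr0.le).1.1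
  set c₁ := √(a r * μ r) / 2 * Real.exp (-A r - K) with hc1
  have hc10 : 0 < c₁ := by positivity
  refine ⟨r + 1, by linarith, c₁ * d * (δ / 2) / √M, by positivity,
    fun T y y' F hy hF h0 h0' t ht => ?_⟩
  have ht0 : 0 ≤ t := by linarith [ht.1]
  have htr : t ∈ Icc r T := ⟨by linarith [ht.1], ht.2⟩
  have hynn : ∀ t ∈ Icc 0 T, 0 ≤ y t := fun t ht => hy.nonneg h hF h0 h0' ht
  have hFF : ∀ t ∈ Icc 0 T, 0 ≤ a t ^ 2 * y t + F t := fun t ht =>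
    add_nonneg (mul_nonneg (sq_nonneg _) (hynn t ht)) (hF t ht)
  have hμd : ∀ t, 0 ≤ t → HasDerivWithinAt μ (b t * μ t) (Ici 0) t := fun t ht => (hμs t ht).2.1
  have hμ1 : ∀ t, 0 ≤ t → 1 ≤ μ t := fun t ht => (hμs t ht).1.1
  have key := hy.exp_growth h hr0 hμd hμ1 hq hq'c hK hr hF hynn
    (fun t ht => hy.velocity_nonneg hμd hμ1 hμ0 hFF h0' ht) htr
  have hyr : d * (y 0 + y' 0) ≤ y r := by
    have h1 := hy.le_add hM1 hμd hμ1 (fun t ht => (hμs t ht).1.2) hμ0 hFF h0'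
      (t := r) ⟨hr0.le, htr.1.trans htr.2⟩
    have h4 : d * y 0 ≤ 1 * y 0 := mul_le_mul_of_nonneg_right (min_le_left _ _) h0
    have h5 : d * y' 0 ≤ r / M * y' 0 := mul_le_mul_of_nonneg_right (min_le_right _ _) h0'
    linarith
  have hexp : δ * Real.exp (2 * A t) ≤ Real.exp (2 * A t) - Real.exp (2 * A r) := by
    have h1 : A (r + 1) ≤ A t := h.strictMonoOn_primitiveA.monotoneOn
      (by simp only [mem_Ici]; linarith) ht0 ht.1
    have h4 : Real.exp (2 * A r) ≤ Real.exp (2 * A r - 2 * A (r + 1)) * Real.exp (2 * A t) := by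
      rw [← Real.exp_add]
      exact Real.exp_le_exp.2 (by linarith)
    rw [hδ, sub_mul, one_mul]
    linarith
  have h6 : c₁ * (d * (y 0 + y' 0)) * (δ * Real.exp (2 * A t) / 2)
      ≤ √(a t * μ t) * y t * Real.exp (A t) := by
    refine le_trans ?_ key
    have e : √(a r * μ r) / 2 * y r * Real.exp (-A r - K) = c₁ * y r := by rw [hc1]; ring
    rw [e]
    have h7 := add_nonneg h0 h0'
    have h12 := hynn r ⟨hr0.le, htr.1.trans htr.2⟩
    gcongr
  have h8 : Real.exp (2 * A t) = Real.exp (A t) * Real.exp (A t) := by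
    rw [← Real.exp_add]
    congr 1
    ring
  have h9 : c₁ * d * (δ / 2) * (y 0 + y' 0) * Real.exp (A t) ≤ √(a t * μ t) * y t := by
    refine le_of_mul_le_mul_right ?_ (Real.exp_pos (A t))
    calc _ = c₁ * (d * (y 0 + y' 0)) * (δ * Real.exp (2 * A t) / 2) := by rw [h8]; ring
      _ ≤ _ := h6
  have h10 : √(a t * μ t) * y t ≤ √M * (√(a t) * y t) := by
    rw [Real.sqrt_mul (h.a_pos t ht0).le]
    have h11 := hynn t ⟨ht0, ht.2⟩
    calc √(a t) * √(μ t) * y t ≤ √(a t) * √M * y t := by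
          gcongr
          exact (hμs t ht0).1.2
      _ = _ := by ring
  have hsM : 0 < √M := Real.sqrt_pos.2 hM0
  calc c₁ * d * (δ / 2) / √M * (y 0 + y' 0) * Real.exp (A t)
      = (c₁ * d * (δ / 2) * (y 0 + y' 0) * Real.exp (A t)) / √M := by ring
    _ ≤ √(a t) * y t := by
      rw [div_le_iff₀ hsM]
      linarith

end ExponentialGrowth

/-! ### Moments of a strong solution -/

section Data

variable {N : ℕ}

theorem toL2_smul {k : ℕ} (c : ℝ) (w : Sobolev N k) : toL2 (c • w) = c • toL2 w :=
  (coord (noDeriv N k)).map_smul c w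

theorem integral_smul_mul (c : ℝ) (w : L2 N) (φ : EuclideanSpace ℝ (Fin N) → ℝ) :
    ∫ x, (c • w : L2 N) x * φ x = c * ∫ x, w x * φ x := by
  rw [← integral_const_mul]
  refine integral_congr_ae ?_
  filter_upwards [Lp.coeFn_smul c w] with x hx
  rw [hx, Pi.smul_apply, smul_eq_mul, mul_assoc]

theorem ae_smul_eq_zero {R : ℝ} {w : L2 N} (hw : ∀ᵐ x, R < ‖x‖ → w x = 0) (c : ℝ) :
    ∀ᵐ x, R < ‖x‖ → (c • w : L2 N) x = 0 := by
  filter_upwards [hw, Lp.coeFn_smul c w] with x h1 h2 h3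
  rw [h2, Pi.smul_apply, h1 h3, smul_zero]

theorem integrable_mul_of_support {R : ℝ} {w : L2 N} (hw : ∀ᵐ x, R < ‖x‖ → w x = 0)
    {φ : EuclideanSpace ℝ (Fin N) → ℝ} (hφ : Continuous φ) : Integrable fun x => w x * φ x := by
  obtain ⟨χ, hχ, hχc, hχ1⟩ := exists_smooth_cutoff N (R + 1)
  refine (integrable_mul_test w (hχ.continuous.mul hφ) hχc.mul_right).congr ?_
  filter_upwards [hw] with x hx
  rcases lt_or_ge R ‖x‖ with h1 | h1
  · rw [hx h1, zero_mul, zero_mul]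
  · rw [Pi.mul_apply, (hχ1 x (by linarith)).eq_of_nhds, one_mul]

/-- Nonnegative data that do not both vanish have positive moments. -/
theorem add_moment_pos {R : ℝ} {f g : L2 N} (hf : ∀ᵐ x, 0 ≤ f x) (hg : ∀ᵐ x, 0 ≤ g x)
    (hfg : f + g ≠ 0) (hfR : ∀ᵐ x, R < ‖x‖ → f x = 0) (hgR : ∀ᵐ x, R < ‖x‖ → g x = 0)
    {φ : EuclideanSpace ℝ (Fin N) → ℝ} (hφ : Continuous φ) (hφ1 : ∀ x, 1 ≤ φ x) :
    0 < (∫ x, f x * φ x) + ∫ x, g x * φ x := by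
  have hif := integrable_mul_of_support hfR hφ
  have hig := integrable_mul_of_support hgR hφ
  rw [← integral_add hif hig]
  have hnn : 0 ≤ᵐ[volume] fun x => f x * φ x + g x * φ x := by
    filter_upwards [hf, hg] with x h1 h2
    have := hφ1 x
    have h3 : 0 ≤ φ x := by linarith
    exact add_nonneg (mul_nonneg h1 h3) (mul_nonneg h2 h3)
  refine lt_of_le_of_ne (integral_nonneg_of_ae hnn) fun h0 => hfg ?_
  have h1 := (integral_eq_zero_iff_of_nonneg_ae hnn (hif.add hig)).1 h0.symm
  apply Lp.ext
  filter_upwards [h1, Lp.coeFn_add f g,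
    Lp.coeFn_zero ℝ 2 (volume : Measure (EuclideanSpace ℝ (Fin N)))] with x e1 e2 e3
  rw [e2, e3, Pi.add_apply, Pi.zero_apply]
  have e4 : (f x + g x) * φ x = 0 := by
    rw [add_mul]
    exact e1
  rcases mul_eq_zero.1 e4 with h | h
  · exact h
  · have := hφ1 x
    linarith

theorem integral_mul_nonneg_of_ae {w : L2 N} (hw : ∀ᵐ x, 0 ≤ w x)
    {φ : EuclideanSpace ℝ (Fin N) → ℝ} (hφ1 : ∀ x, 1 ≤ φ x) : 0 ≤ ∫ x, w x * φ x := by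
  refine integral_nonneg_of_ae ?_
  filter_upwards [hw] with x h1
  have := hφ1 x
  exact mul_nonneg h1 (by linarith)

end Data

section SolutionMoments

variable {N : ℕ} {a b : ℝ → ℝ} {p : ℝ}

/-- The two moments of a strong solution: the space average, and the moment against the radial
eigenfunction. Both are controlled by `G = ∫ |u|^p`. -/
theorem exists_solution_moments (hN : 1 ≤ N) (hp : 1 < p)
    (hpN : 5 ≤ N → p ≤ ((N : ℝ) - 2) / ((N : ℝ) - 4)) (h : AssumptionA1 a b) {r : ℝ} (hr : 0 ≤ r) :
    ∃ c : ℝ, 0 ≤ c ∧ ∃ C : ℝ, 0 < C ∧ ∀ (f : Sobolev N 2) (g : Sobolev N 1) (ε T T' : ℝ)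
      (u : ℝ → Sobolev N 2), (∀ᵐ x, r < ‖x‖ → toL2 f x = 0) → (∀ᵐ x, r < ‖x‖ → toL2 g x = 0) →
      0 ≤ T → T < T' → IsStrongSolution N a b p (ε • f) (ε • g) T' u →
      ∃ y y' z z' F G : ℝ → ℝ, IsDampedSolution b T y y' G ∧
        (IsDampedSolution b T z z' fun t => a t ^ 2 * z t + F t) ∧ ContinuousOn G (Icc 0 T) ∧
        (∀ t, 0 ≤ G t) ∧ (∀ t, 0 ≤ F t) ∧
        y 0 = ε * (∫ x, toL2 f x) ∧ y' 0 = ε * (∫ x, toL2 g x) ∧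
        z 0 = ε * (∫ x, toL2 f x * radialBessel N N x) ∧
        z' 0 = ε * (∫ x, toL2 g x * radialBessel N N x) ∧
        (∀ t ∈ Icc 0 T, y t ≤ G t ^ (1 / p)
          * (c * (r + primitiveA a t) ^ N) ^ (1 / (p / (p - 1)))) ∧
        ∀ t ∈ Icc 0 T, z t ≤ G t ^ (1 / p) * (C * ((1 + (r + primitiveA a t))
          ^ ((N : ℝ) - 1 - ((N : ℝ) - 1) / 2 * (p / (p - 1)))
            * Real.exp (p / (p - 1) * (r + primitiveA a t)))) ^ (1 / (p / (p - 1))) := by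
  have hpq : p.HolderConjugate (p / (p - 1)) := Real.HolderConjugate.conjExponent hp
  have hq0 : 0 < p / (p - 1) := hpq.symm.pos
  obtain ⟨C, hC, hCb⟩ := exists_integral_radialBessel_le hN hq0
  refine ⟨(volume : Measure (EuclideanSpace ℝ (Fin N))).real (Metric.ball 0 1), measureReal_nonneg,
    C, hC, fun f g ε T T' u hf hg hT hTT' hu => ?_⟩
  have hTmem : T ∈ Ico 0 T' := ⟨hT, hTT'⟩
  obtain ⟨v, hv0, hv⟩ := hu.exists_velocity hp hpN
  have hu0' : ∀ᵐ x, r < ‖x‖ → toL2 (u 0) x = 0 := by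
    rw [hu.initial_u, toL2_smul]
    exact ae_smul_eq_zero hf ε
  have hv0' : ∀ᵐ x, r < ‖x‖ → toL2 (v 0) x = 0 := by
    rw [hv0, toL2_smul]
    exact ae_smul_eq_zero hg ε
  have hsupp : ∀ t ∈ Icc 0 T, ∀ᵐ x, r + primitiveA a t < ‖x‖ → toL2 (u t) x = 0 := fun t ht =>
    hv.finite_speed hp hpN h hu.continuous_H2 hr hu0' hv0' ⟨ht.1, ht.2.trans_lt hTT'⟩
  obtain ⟨hpow, -⟩ := exists_powL2_estimate (N := N) hp hpN
  obtain ⟨hGc, y', hy'0, hyd⟩ := hv.exists_moment_ode hp hpN h hu.continuous_H2 hr hu0' hv0'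
    (φ := fun _ => 1) contDiff_const (ℓ := 0) (fun x => by
      rw [zero_mul]
      refine Finset.sum_eq_zero fun i _ => ?_
      rw [partialDeriv_two _ contDiff_const]
      have h1 : partialDeriv (word i) (fun _ : EuclideanSpace ℝ (Fin N) => (1 : ℝ)) = 0 := by
        ext x
        rw [partialDeriv_word]
        simp
      rw [h1, partialDeriv_word]
      simp) hTmem
  obtain ⟨-, z', hz'0, hzd⟩ := hv.exists_moment_ode hp hpN h hu.continuous_H2 hr hu0' hv0'
    (contDiff_radialBessel hN) (ℓ := 1)
    (fun x => by rw [one_mul]; exact sum_partialDeriv_radialBessel hN x) hTmem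
  have e0 : ∀ w : L2 N, ∫ x, w x * (fun _ : EuclideanSpace ℝ (Fin N) => (1 : ℝ)) x = ∫ x, w x :=
    fun w => by simp
  have hrad := one_le_radialBessel (N := N) hN
  refine ⟨fun t => ∫ x, toL2 (u t) x * 1, y', fun t => ∫ x, toL2 (u t) x * radialBessel N N x, z',
    fun t => ∫ x, |toL2 (u t) x| ^ p * radialBessel N N x, fun t => ∫ x, |toL2 (u t) x| ^ p * 1,
    ⟨fun t ht => (hyd t ht).1, fun t ht => (hyd t ht).2.congr_deriv (by ring)⟩,
    ⟨fun t ht => (hzd t ht).1, fun t ht => (hzd t ht).2.congr_deriv (by ring)⟩, hGc,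
    fun t => integral_nonneg fun x => by positivity,
    fun t => integral_nonneg fun x => mul_nonneg (by positivity) (zero_le_one.trans (hrad x)),
    ?_, ?_, ?_, ?_, fun t ht => ?_, fun t ht => ?_⟩
  · simp only
    rw [hu.initial_u, toL2_smul, integral_smul_mul]
    simp
  · rw [hy'0, hv0, toL2_smul, integral_smul_mul]
    simp
  · simp only
    rw [hu.initial_u, toL2_smul, integral_smul_mul]
  · rw [hz'0, hv0, toL2_smul, integral_smul_mul]
  · have hR : 0 ≤ r + primitiveA a t := add_nonneg hr (h.primitiveA_nonneg ht.1)
    have h1 := moment_le hp (hsupp t ht) (hpow (u t)) (φ := fun _ => (1 : ℝ)) continuous_const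
      fun _ => le_rfl
    have h2 : ∫ x in Metric.closedBall (0 : EuclideanSpace ℝ (Fin N)) (r + primitiveA a t),
        (1 : ℝ) ^ (p / (p - 1)) = (volume : Measure (EuclideanSpace ℝ (Fin N))).real
          (Metric.ball 0 1) * (r + primitiveA a t) ^ N := by
      simp only [Real.one_rpow]
      rw [setIntegral_const, smul_eq_mul, mul_one, Measure.addHaar_real_closedBall _ _ hR,
        finrank_euclideanSpace_fin, mul_comm]
    rw [h2] at h1
    simpa only [mul_one] using h1
  · have hR : 0 ≤ r + primitiveA a t := add_nonneg hr (h.primitiveA_nonneg ht.1)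
    have h1 := moment_le hp (hsupp t ht) (hpow (u t)) (contDiff_radialBessel hN).continuous hrad
    have h2 := hCb _ hR
    simp only [mul_one]
    refine h1.trans ?_
    refine mul_le_mul_of_nonneg_left (Real.rpow_le_rpow ?_ h2 (by positivity)) (by positivity)
    refine integral_nonneg fun x => Real.rpow_nonneg (zero_le_one.trans (hrad x)) _

end SolutionMoments

/-! ### The lifespan estimates -/

section Lifespan

variable {N : ℕ} {a b : ℝ → ℝ} {p : ℝ}

/-- The weight `a^{q/2} (1 + A)^γ` of the second lifespan estimate. -/
noncomputable def lifespanWeight (a : ℝ → ℝ) (q γ t : ℝ) : ℝ :=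
  a t ^ (q / 2) * (1 + primitiveA a t) ^ γ

theorem AssumptionA1.continuousOn_lifespanWeight (h : AssumptionA1 a b) (q γ : ℝ) :
    ContinuousOn (lifespanWeight a q γ) (Ici 0) := by
  refine ContinuousOn.mul (h.continuousOn_a.rpow_const fun t ht => Or.inl (h.a_pos t ht).ne')
    ((continuousOn_const.add h.continuousOn_primitiveA).rpow_const fun t ht => Or.inl ?_)
  have h0 : 0 ≤ primitiveA a t := h.primitiveA_nonneg ht
  exact (by linarith : (0 : ℝ) < 1 + primitiveA a t).ne'

theorem AssumptionA1.lifespanWeight_pos (h : AssumptionA1 a b) (q γ : ℝ) {t : ℝ} (ht : 0 ≤ t) :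
    0 < lifespanWeight a q γ t := by
  have h1 := h.a_pos t ht
  have h2 := h.primitiveA_nonneg ht
  unfold lifespanWeight
  positivity

/-- The right-hand side of the second lifespan estimate. -/
noncomputable def lifespanBound (a : ℝ → ℝ) (α β q γ T : ℝ) : ℝ :=
  T ^ α * primitiveA a T ^ β * (∫ t in (0 : ℝ)..T, lifespanWeight a q γ t) ^ (1 / q)

theorem AssumptionA1.continuousOn_Ioi_primitiveA (h : AssumptionA1 a b) :
    ContinuousOn (primitiveA a) (Ioi 0) := h.continuousOn_primitiveA.mono Ioi_subset_Ici_self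

theorem AssumptionA1.continuousOn_lifespanBound (h : AssumptionA1 a b) (α β : ℝ) {q : ℝ}
    (hq : 0 < q) (γ : ℝ) : ContinuousOn (lifespanBound a α β q γ) (Ioi 0) := by
  have hi : ContinuousOn (fun T => ∫ t in (0 : ℝ)..T, lifespanWeight a q γ t) (Ioi 0) := fun t ht =>
    ((hasDerivWithinAt_integral_Ici (h.continuousOn_lifespanWeight q γ)
      (le_of_lt ht)).continuousWithinAt).mono Ioi_subset_Ici_self
  refine ContinuousOn.mul (ContinuousOn.mul ?_ ?_) (hi.rpow_const fun _ _ => Or.inr (by positivity))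
  · exact continuousOn_id.rpow_const fun t ht => Or.inl (ne_of_gt ht)
  · exact h.continuousOn_Ioi_primitiveA.rpow_const fun t ht => Or.inl (h.primitiveA_pos ht).ne'

theorem AssumptionA1.lifespanBound_pos (h : AssumptionA1 a b) (α β q γ : ℝ) {T : ℝ} (hT : 0 < T) :
    0 < lifespanBound a α β q γ T := by
  have h1 := h.primitiveA_pos hT
  have h2 : 0 < ∫ t in (0 : ℝ)..T, lifespanWeight a q γ t :=
    intervalIntegral.intervalIntegral_pos_of_pos_on
      (((h.continuousOn_lifespanWeight q γ).mono fun r hr => by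
        rw [uIcc_of_le hT.le] at hr
        exact hr.1).intervalIntegrable) (fun t ht => h.lifespanWeight_pos q γ ht.1.le) hT
  unfold lifespanBound
  positivity

/-- A bound valid on all of `[T₁, τ)` persists at `τ`. -/
theorem holdsAtTime_of_forall {τ : ℝ≥0∞} {T₁ c : ℝ} (hT₁ : 0 < T₁) (hτ : ENNReal.ofReal T₁ < τ)
    {f : ℝ → ℝ} (hf : ContinuousOn f (Ioi 0))
    (h : ∀ T, T₁ ≤ T → ENNReal.ofReal T < τ → c ≤ f T) : HoldsAtTime τ fun T => c ≤ f T := by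
  refine ⟨fun hfin => ?_, fun hinf => ?_⟩
  · have h1 : T₁ < τ.toReal := (ENNReal.ofReal_lt_iff_lt_toReal hT₁.le hfin).1 hτ
    have hcont : ContinuousAt f τ.toReal := hf.continuousAt (Ioi_mem_nhds (hT₁.trans h1))
    refine ge_of_tendsto (hcont.tendsto.mono_left (nhdsWithin_le_nhds (s := Iio τ.toReal))) ?_
    filter_upwards [Ioo_mem_nhdsLT h1] with T hT
    exact h T hT.1.le ((ENNReal.ofReal_lt_iff_lt_toReal (hT₁.le.trans hT.1.le) hfin).2 hT.2)
  · filter_upwards [eventually_ge_atTop T₁] with T hT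
    exact h T hT (by rw [hinf]; exact ENNReal.ofReal_lt_top)

/-- Hölder's inequality on an interval, for nonnegative continuous functions. -/
theorem integral_rpow_mul_rpow_le {p q r T : ℝ} (hpq : p.HolderConjugate q) (hrT : r ≤ T)
    {G w : ℝ → ℝ} (hG : ContinuousOn G (Icc r T)) (hw : ContinuousOn w (Icc r T))
    (hG0 : ∀ t ∈ Icc r T, 0 ≤ G t) (hw0 : ∀ t ∈ Icc r T, 0 ≤ w t) :
    ∫ t in r..T, G t ^ (1 / p) * w t ^ (1 / q)
      ≤ (∫ t in r..T, G t) ^ (1 / p) * (∫ t in r..T, w t) ^ (1 / q) := by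
  have hmem : ∀ {f : ℝ → ℝ} {s : ℝ}, 0 < s → ContinuousOn f (Icc r T) → (∀ t ∈ Icc r T, 0 ≤ f t) →
      MemLp (fun t => f t ^ (1 / s)) (ENNReal.ofReal s) (volume.restrict (Ioc r T)) := by
    intro f s hs hf hf0
    have hc : ContinuousOn (fun t => f t ^ (1 / s)) (Icc r T) :=
      hf.rpow_const fun _ _ => Or.inr (by positivity)
    rw [← integrable_norm_rpow_iff
      ((hc.mono Ioc_subset_Icc_self).aestronglyMeasurable measurableSet_Ioc) (by simpa using hs)
      ENNReal.ofReal_ne_top, ENNReal.toReal_ofReal hs.le]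
    have hc2 : ContinuousOn (fun t => ‖f t ^ (1 / s)‖ ^ s) (Icc r T) :=
      hc.norm.rpow_const fun _ _ => Or.inr hs.le
    exact (hc2.integrableOn_compact isCompact_Icc).mono_set Ioc_subset_Icc_self
  have hae : ∀ {f : ℝ → ℝ}, (∀ t ∈ Icc r T, 0 ≤ f t) → ∀ s : ℝ,
      0 ≤ᵐ[volume.restrict (Ioc r T)] fun t => f t ^ s := by
    intro f hf s
    filter_upwards [ae_restrict_mem measurableSet_Ioc] with t ht
    exact Real.rpow_nonneg (hf t (Ioc_subset_Icc_self ht)) _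
  have key := integral_mul_le_Lp_mul_Lq_of_nonneg hpq (hae hG0 (1 / p)) (hae hw0 (1 / q))
    (hmem hpq.pos hG hG0) (hmem hpq.symm.pos hw hw0)
  have hcong : ∀ {f : ℝ → ℝ} {s : ℝ}, 0 < s → (∀ t ∈ Icc r T, 0 ≤ f t) →
      ∫ t in Ioc r T, (f t ^ (1 / s)) ^ s = ∫ t in Ioc r T, f t := by
    intro f s hs hf
    refine setIntegral_congr_fun measurableSet_Ioc fun t ht => ?_
    rw [← Real.rpow_mul (hf t (Ioc_subset_Icc_self ht)), one_div_mul_cancel hs.ne', Real.rpow_one]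
  rw [hcong hpq.pos hG0, hcong hpq.symm.pos hw0] at key
  simpa only [intervalIntegral.integral_of_le hrT] using key

/-- The pointwise consequence of the lower bound on the exponential moment. -/
theorem le_of_exponential_bounds {q γ r A α c K C z G p : ℝ} (hq : 0 < q) (hr : 0 ≤ r) (hA : 0 ≤ A)
    (hα : 0 < α) (hC : 0 < C) (hG : 0 ≤ G) (hlow : c * K * Real.exp A ≤ √α * z)
    (hup : z ≤ G ^ (1 / p) * (C * ((1 + (r + A)) ^ γ * Real.exp (q * (r + A)))) ^ (1 / q)) :
    c * K ≤ (C ^ (1 / q) * Real.exp r * ((1 + r) ^ |γ|) ^ (1 / q))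
      * (G ^ (1 / p) * (α ^ (q / 2) * (1 + A) ^ γ) ^ (1 / q)) := by
  have h1A : 0 < 1 + A := by linarith
  have h1r : 0 < 1 + r := by linarith
  have h1rA : 0 < 1 + (r + A) := by linarith
  have hγ : (1 + (r + A)) ^ γ ≤ (1 + r) ^ |γ| * (1 + A) ^ γ := by
    rcases le_total 0 γ with h | h
    · rw [abs_of_nonneg h, ← Real.mul_rpow h1r.le h1A.le]
      exact Real.rpow_le_rpow h1rA.le (by nlinarith [mul_nonneg hr hA]) h
    · calc (1 + (r + A)) ^ γ ≤ (1 + A) ^ γ :=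
            Real.rpow_le_rpow_of_nonpos h1A (by linarith) h
        _ ≤ _ := le_mul_of_one_le_left (by positivity)
            (Real.one_le_rpow (by linarith) (abs_nonneg _))
  have hsqrt : √α = (α ^ (q / 2)) ^ (1 / q) := by
    rw [← Real.rpow_mul hα.le, Real.sqrt_eq_rpow]
    congr 1
    field_simp
  have hE : Real.exp (q * (r + A)) ^ (1 / q) = Real.exp r * Real.exp A := by
    rw [← Real.exp_mul, ← Real.exp_add]
    congr 1
    field_simp
  have h2 : (C * ((1 + (r + A)) ^ γ * Real.exp (q * (r + A)))) ^ (1 / q)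
      ≤ C ^ (1 / q) * (((1 + r) ^ |γ|) ^ (1 / q) * ((1 + A) ^ γ) ^ (1 / q)
        * (Real.exp r * Real.exp A)) := by
    rw [Real.mul_rpow hC.le (by positivity), Real.mul_rpow (by positivity) (by positivity), hE,
      ← Real.mul_rpow (by positivity) (by positivity)]
    gcongr
  refine le_of_mul_le_mul_right ?_ (Real.exp_pos A)
  calc c * K * Real.exp A ≤ √α * z := hlow
    _ ≤ √α * (G ^ (1 / p) * (C ^ (1 / q) * (((1 + r) ^ |γ|) ^ (1 / q) * ((1 + A) ^ γ) ^ (1 / q)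
        * (Real.exp r * Real.exp A)))) := by
      gcongr
      exact hup.trans (by gcongr)
    _ = _ := by
      rw [hsqrt, Real.mul_rpow (x := α ^ (q / 2)) (by positivity) (by positivity)]
      ring

/-- Before the lifespan there is a strong solution up to a later time. -/
theorem exists_solution_of_lt_lifespan {f : Sobolev N 2} {g : Sobolev N 1} {ε T : ℝ}
    (hT : ENNReal.ofReal T < lifespan N a b p f g ε) :
    ∃ T' : ℝ, T < T' ∧ ∃ u, IsStrongSolution N a b p (ε • f) (ε • g) T' u := by
  obtain ⟨_, ⟨T', ⟨hT', u, hu⟩, rfl⟩, hlt⟩ := lt_sSup_iff.1 hT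
  exact ⟨T', (ENNReal.ofReal_lt_ofReal_iff hT').1 hlt, u, hu⟩

theorem ofReal_le_lifespan {f : Sobolev N 2} {g : Sobolev N 1} {ε T : ℝ} (hT : 0 < T)
    {u : ℝ → Sobolev N 2} (hu : IsStrongSolution N a b p (ε • f) (ε • g) T u) :
    ENNReal.ofReal T ≤ lifespan N a b p f g ε := le_sSup ⟨T, ⟨hT, u, hu⟩, rfl⟩

variable {f : Sobolev N 2} {g : Sobolev N 1} {r T₁ : ℝ}

/-- The first lifespan estimate, at all times of existence. -/
theorem exists_first_estimate (hN : 1 ≤ N) (hp : 1 < p)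
    (hpN : 5 ≤ N → p ≤ ((N : ℝ) - 2) / ((N : ℝ) - 4)) (h : AssumptionA1 a b)
    (hf : ∀ᵐ x, 0 ≤ toL2 f x) (hg : ∀ᵐ x, 0 ≤ toL2 g x) (hr : 0 ≤ r)
    (hfr : ∀ᵐ x, r < ‖x‖ → toL2 f x = 0) (hgr : ∀ᵐ x, r < ‖x‖ → toL2 g x = 0) (hT₁ : 0 < T₁) :
    ∃ C > 0, ∀ ε T, 0 < ε → T₁ ≤ T → ENNReal.ofReal T < lifespan N a b p f g ε →
      (∫ x, toL2 g x) * ε + (∫ x, toL2 f x) ^ p * ε ^ p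
        ≤ C * (T ^ (-((p + 1) / (p - 1))) * primitiveA a T ^ N) := by
  obtain ⟨c, hc, C', -, hmom⟩ := exists_solution_moments hN hp hpN h hr
  obtain ⟨κ, -, -, C, hC, hav⟩ := h.exists_average_bound hp N hr hc hT₁
  refine ⟨C, hC, fun ε T hε hT hlt => ?_⟩
  obtain ⟨T', hTT', u, hu⟩ := exists_solution_of_lt_lifespan hlt
  obtain ⟨y, y', z, z', F, G, hy, -, hGc, hG, -, hy0, hy'0, -, -, hyG, -⟩ :=
    hmom f g ε T T' u hfr hgr (hT₁.le.trans hT) hTT' hu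
  have hf0 : 0 ≤ ∫ x, toL2 f x := integral_nonneg_of_ae hf
  have hg0 : 0 ≤ ∫ x, toL2 g x := integral_nonneg_of_ae hg
  have key := (hav T hT y y' G hy hGc (fun t _ => hG t) (by rw [hy0]; positivity)
    (by rw [hy'0]; positivity) hyG).2
  rw [hy0, hy'0, Real.mul_rpow hε.le hf0] at key
  linarith

/-- The second lifespan estimate, at all times of existence. -/
theorem exists_second_estimate (hN : 1 ≤ N) (hp : 1 < p)
    (hpN : 5 ≤ N → p ≤ ((N : ℝ) - 2) / ((N : ℝ) - 4)) (h : AssumptionA1 a b)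
    (h2 : AssumptionA2 a b) (h3 : AssumptionA3 a b)
    (hf : ∀ᵐ x, 0 ≤ toL2 f x) (hg : ∀ᵐ x, 0 ≤ toL2 g x) (hfg : toL2 f + toL2 g ≠ 0) (hr : 0 ≤ r)
    (hfr : ∀ᵐ x, r < ‖x‖ → toL2 f x = 0) (hgr : ∀ᵐ x, r < ‖x‖ → toL2 g x = 0) (hT₁ : 0 < T₁) :
    ∃ C > 0, ∀ ε T, 0 < ε → ε ≤ 1 → T₁ ≤ T → ENNReal.ofReal T < lifespan N a b p f g ε →
      ε ≤ C * lifespanBound a (-((p ^ 2 + 1) / (p * (p - 1)))) ((N : ℝ) / p) (p / (p - 1))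
        ((N : ℝ) - 1 - ((N : ℝ) - 1) / 2 * (p / (p - 1))) T := by
  have hpq : p.HolderConjugate (p / (p - 1)) := Real.HolderConjugate.conjExponent hp
  obtain ⟨c, hc, C₁, hC1, hmom⟩ := exists_solution_moments hN hp hpN h hr
  obtain ⟨κ, hκ, hκ1, C, hC, hav⟩ := h.exists_average_bound hp N hr hc hT₁
  obtain ⟨t₂, ht₂, d, hd, hexp⟩ := h.exists_exponential_lower_bound h2 h3
  set q := p / (p - 1) with hq
  have hq0 : 0 < q := hpq.symm.pos
  have hp0 : 0 < p := hpq.pos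
  set γ := (N : ℝ) - 1 - ((N : ℝ) - 1) / 2 * q with hγ
  have hrad := one_le_radialBessel (N := N) hN
  have hradc : Continuous (radialBessel N N) := (contDiff_radialBessel hN).continuous
  set K := (∫ x, toL2 f x * radialBessel N N x) + ∫ x, toL2 g x * radialBessel N N x with hK
  have hK0 : 0 < K := add_moment_pos hf hg hfg hfr hgr hradc hrad
  set R := lifespanBound a (-((p ^ 2 + 1) / (p * (p - 1)))) ((N : ℝ) / p) q γ with hR
  have hRpos : ∀ T, 0 < T → 0 < R T := fun T hT => h.lifespanBound_pos _ _ _ _ hT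
  -- on a bounded range of times the right-hand side is bounded below
  set T₂ := max T₁ (2 * t₂ / κ) with hT2
  obtain ⟨m, hm0, hm⟩ : ∃ m > 0, ∀ T ∈ Icc T₁ T₂, m ≤ R T := by
    have hsub : Icc T₁ T₂ ⊆ Ioi 0 := fun T hT => hT₁.trans_le hT.1
    obtain ⟨T₀, hT0, hmin⟩ := isCompact_Icc.exists_isMinOn (nonempty_Icc.2 (le_max_left _ _))
      ((h.continuousOn_lifespanBound _ _ hq0 γ).mono hsub)
    exact ⟨R T₀, hRpos T₀ (hsub hT0), fun T hT => hmin hT⟩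
  set D := C₁ ^ (1 / q) * Real.exp r * ((1 + r) ^ |γ|) ^ (1 / q) with hD
  have hD0 : 0 < D := by positivity
  set D' := D / (d * K) * (2 / κ) * C ^ (1 / p) with hD'
  have hD'0 : 0 < D' := by positivity
  refine ⟨m⁻¹ + D', by positivity, fun ε T hε hε1 hT hlt => ?_⟩
  have hT0 : 0 < T := hT₁.trans_le hT
  rw [add_mul]
  rcases le_total T T₂ with hTT2 | hTT2
  · have h4 : 1 ≤ m⁻¹ * R T := by
      rw [inv_mul_eq_div, le_div_iff₀ hm0, one_mul]
      exact hm T ⟨hT, hTT2⟩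
    have := mul_pos hD'0 (hRpos T hT0)
    linarith
  suffices hmain : ε ≤ D' * R T by
    have := mul_pos (inv_pos.2 hm0) (hRpos T hT0)
    linarith
  obtain ⟨T', hTT', u, hu⟩ := exists_solution_of_lt_lifespan hlt
  obtain ⟨y, y', z, z', F, G, hy, hz, hGc, hG, hF, hy0, hy'0, hz0, hz'0, hyG, hzG⟩ :=
    hmom f g ε T T' u hfr hgr hT0.le hTT' hu
  have hf0 : 0 ≤ ∫ x, toL2 f x := integral_nonneg_of_ae hf
  have hg0 : 0 ≤ ∫ x, toL2 g x := integral_nonneg_of_ae hg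
  have hIle := (hav T hT y y' G hy hGc (fun t _ => hG t) (by rw [hy0]; positivity)
    (by rw [hy'0]; positivity) hyG).1
  have hlow := hexp T z z' F hz (fun t _ => hF t)
    (by rw [hz0]; exact mul_nonneg hε.le (integral_mul_nonneg_of_ae hf hrad))
    (by rw [hz'0]; exact mul_nonneg hε.le (integral_mul_nonneg_of_ae hg hrad))
  have hzK : z 0 + z' 0 = ε * K := by rw [hz0, hz'0, hK]; ring
  rw [hzK] at hlow
  set w := lifespanWeight a q γ with hw
  have hpt : ∀ t ∈ Icc t₂ T, ε ≤ D / (d * K) * (G t ^ (1 / p) * w t ^ (1 / q)) := by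
    intro t ht
    have ht0 : 0 ≤ t := ht₂.le.trans ht.1
    have h5 := le_of_exponential_bounds hq0 hr (h.primitiveA_nonneg ht0) (h.a_pos t ht0) hC1
      (hG t) (hlow t ht) (hzG t ⟨ht0, ht.2⟩)
    rw [div_mul_eq_mul_div, le_div_iff₀ (by positivity)]
    calc ε * (d * K) = d * (ε * K) := by ring
      _ ≤ _ := h5
  -- integrate over the second half of the interval `[0, κ T]`
  have hκT2 : t₂ ≤ κ * T / 2 := by
    have h6 : 2 * t₂ / κ ≤ T := (le_max_right _ _).trans hTT2
    rw [div_le_iff₀ hκ] at h6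
    linarith
  have hκT0 : 0 < κ * T / 2 := by positivity
  have hκTT : κ * T ≤ T := mul_le_of_le_one_left hT0.le hκ1
  have hhalf : κ * T / 2 ≤ κ * T := by linarith
  have hsubT : Icc (κ * T / 2) (κ * T) ⊆ Icc 0 T := Icc_subset_Icc hκT0.le hκTT
  have hwc : ContinuousOn w (Icc 0 T) :=
    (h.continuousOn_lifespanWeight q γ).mono fun t ht => ht.1
  have hw0 : ∀ t ∈ Icc 0 T, 0 ≤ w t := fun t ht => (h.lifespanWeight_pos q γ ht.1).le
  have hii : ∀ {v : ℝ → ℝ} {s t : ℝ}, ContinuousOn v (Icc 0 T) → 0 ≤ s → s ≤ t → t ≤ T →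
      IntervalIntegrable v volume s t := fun hv hs hst htT =>
    (hv.mono (by rw [uIcc_of_le hst]; exact Icc_subset_Icc hs htT)).intervalIntegrable
  have hprodc : ContinuousOn (fun t => G t ^ (1 / p) * w t ^ (1 / q)) (Icc 0 T) :=
    (hGc.rpow_const fun _ _ => Or.inr (by positivity)).mul
      (hwc.rpow_const fun _ _ => Or.inr (by positivity))
  have hint : ∫ _ in κ * T / 2..κ * T, ε
      ≤ ∫ t in κ * T / 2..κ * T, D / (d * K) * (G t ^ (1 / p) * w t ^ (1 / q)) :=
    intervalIntegral.integral_mono_on hhalf (by simp)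
      ((hii hprodc hκT0.le hhalf hκTT).const_mul _) fun t ht =>
        hpt t ⟨hκT2.trans ht.1, ht.2.trans hκTT⟩
  rw [intervalIntegral.integral_const, intervalIntegral.integral_const_mul, smul_eq_mul] at hint
  have hholder := integral_rpow_mul_rpow_le hpq hhalf (hGc.mono hsubT) (hwc.mono hsubT)
    (fun t _ => hG t) fun t ht => hw0 t (hsubT ht)
  have hpart : ∀ {v : ℝ → ℝ}, ContinuousOn v (Icc 0 T) → (∀ t ∈ Icc 0 T, 0 ≤ v t) → ∀ t,
      κ * T ≤ t → t ≤ T → ∫ x in κ * T / 2..κ * T, v x ≤ ∫ x in (0 : ℝ)..t, v x := by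
    intro v hv hv0 t ht htT
    have i1 := intervalIntegral.integral_add_adjacent_intervals
      (hii hv le_rfl hκT0.le (hhalf.trans hκTT)) (hii hv hκT0.le hhalf hκTT)
    have i2 := intervalIntegral.integral_add_adjacent_intervals
      (hii hv le_rfl (hκT0.le.trans hhalf) hκTT) (hii hv (hκT0.le.trans hhalf) ht htT)
    have i3 : 0 ≤ ∫ x in (0 : ℝ)..κ * T / 2, v x := intervalIntegral.integral_nonneg hκT0.le
      fun x hx => hv0 x ⟨hx.1, hx.2.trans (hhalf.trans hκTT)⟩
    have i4 : 0 ≤ ∫ x in κ * T..t, v x := intervalIntegral.integral_nonneg ht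
      fun x hx => hv0 x ⟨(hκT0.le.trans hhalf).trans hx.1, hx.2.trans htT⟩
    linarith
  have hGint : ∫ t in κ * T / 2..κ * T, G t
      ≤ C * (T ^ (-((p + 1) / (p - 1))) * primitiveA a T ^ N) :=
    (hpart hGc (fun t _ => hG t) (κ * T) le_rfl hκTT).trans hIle
  have hwint : ∫ t in κ * T / 2..κ * T, w t ≤ ∫ t in (0 : ℝ)..T, w t :=
    hpart hwc hw0 T hκTT le_rfl
  have hG0' : 0 ≤ ∫ t in κ * T / 2..κ * T, G t :=
    intervalIntegral.integral_nonneg hhalf fun t _ => hG t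
  have hw0' : 0 ≤ ∫ t in κ * T / 2..κ * T, w t :=
    intervalIntegral.integral_nonneg hhalf fun t ht => hw0 t (hsubT ht)
  have hAT := h.primitiveA_pos hT0
  have hp1 : 0 < p - 1 := by linarith
  -- the exponent of `T` exceeds the final one by `1`; this factor cancels the length of the interval
  have hpow : (C * (T ^ (-((p + 1) / (p - 1))) * primitiveA a T ^ N)) ^ (1 / p)
      = C ^ (1 / p) * (T * T ^ (-((p ^ 2 + 1) / (p * (p - 1)))) * primitiveA a T ^ ((N : ℝ) / p)) := by
    rw [Real.mul_rpow hC.le (by positivity), Real.mul_rpow (by positivity) (by positivity),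
      ← Real.rpow_mul hT0.le, ← Real.rpow_natCast, ← Real.rpow_mul hAT.le, mul_one_div (N : ℝ)]
    congr 2
    nth_rewrite 2 [← Real.rpow_one T]
    rw [← Real.rpow_add hT0, mul_one_div]
    congr 1
    field_simp
    ring
  have hW0 : 0 ≤ ∫ t in (0 : ℝ)..T, w t := hw0'.trans hwint
  have hfinal : κ * T / 2 * ε ≤ D / (d * K) * (C ^ (1 / p)
      * (T * T ^ (-((p ^ 2 + 1) / (p * (p - 1)))) * primitiveA a T ^ ((N : ℝ) / p))
      * (∫ t in (0 : ℝ)..T, w t) ^ (1 / q)) := by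
    have e : (κ * T - κ * T / 2) * ε = κ * T / 2 * ε := by ring
    rw [e] at hint
    refine hint.trans (mul_le_mul_of_nonneg_left (hholder.trans ?_) (by positivity))
    rw [← hpow]
    gcongr
  refine le_of_mul_le_mul_left (hfinal.trans (le_of_eq ?_)) hκT0
  rw [hD', hR]
  unfold lifespanBound
  rw [← hw]
  field_simp

end Lifespan

end SemilinearWave

theorem theorem1p1 (N : ℕ) (hN : 1 ≤ N) (a b : ℝ → ℝ) (p : ℝ) (hp : 1 < p)
    (hpN : 5 ≤ N → p ≤ ((N : ℝ) - 2) / ((N : ℝ) - 4))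
    (hA1 : SemilinearWave.AssumptionA1 a b)
    (f : SemilinearWave.Sobolev N 2) (g : SemilinearWave.Sobolev N 1)
    (hf : ∀ᵐ x, 0 ≤ SemilinearWave.toL2 f x) (hg : ∀ᵐ x, 0 ≤ SemilinearWave.toL2 g x)
    (hfg : SemilinearWave.toL2 f + SemilinearWave.toL2 g ≠ 0)
    (r₀ : ℝ) (hsupp : ∀ᵐ x, r₀ ≤ ‖x‖ → SemilinearWave.toL2 f x = 0 ∧ SemilinearWave.toL2 g x = 0) :
    ∃ ε₀ > (0 : ℝ), ∃ C > (0 : ℝ), ∀ ε : ℝ, 0 < ε → ε ≤ ε₀ →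
      SemilinearWave.HoldsAtTime (SemilinearWave.lifespan N a b p f g ε) (fun T =>
        (∫ x, SemilinearWave.toL2 g x) * ε + (∫ x, SemilinearWave.toL2 f x) ^ p * ε ^ p
          ≤ C * T ^ (-((p + 1) / (p - 1))) * SemilinearWave.primitiveA a T ^ N) ∧
      (SemilinearWave.AssumptionA2 a b → SemilinearWave.AssumptionA3 a b →
        SemilinearWave.HoldsAtTime (SemilinearWave.lifespan N a b p f g ε) (fun T =>
          ε ≤ C * T ^ (-((p ^ 2 + 1) / (p * (p - 1))))
              * SemilinearWave.primitiveA a T ^ ((N : ℝ) / p)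
              * (∫ t in (0 : ℝ)..T, a t ^ ((p / (p - 1)) / 2)
                  * (1 + SemilinearWave.primitiveA a t)
                    ^ ((N : ℝ) - 1 - ((N : ℝ) - 1) / 2 * (p / (p - 1))))
                ^ (1 / (p / (p - 1))))) := by
  obtain ⟨T₀, hT₀, hloc⟩ := SemilinearWave.exists_local_solution hp hpN hA1 f g
  have hT₁ : 0 < T₀ / 2 := half_pos hT₀
  have hr : 0 ≤ |r₀| := abs_nonneg r₀
  have hfr : ∀ᵐ x, |r₀| < ‖x‖ → SemilinearWave.toL2 f x = 0 := by
    filter_upwards [hsupp] with x hx hlt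
    exact (hx ((le_abs_self r₀).trans hlt.le)).1
  have hgr : ∀ᵐ x, |r₀| < ‖x‖ → SemilinearWave.toL2 g x = 0 := by
    filter_upwards [hsupp] with x hx hlt
    exact (hx ((le_abs_self r₀).trans hlt.le)).2
  obtain ⟨C₁, hC₁, h₁⟩ :=
    SemilinearWave.exists_first_estimate hN hp hpN hA1 hf hg hr hfr hgr hT₁
  obtain ⟨C₂, hC₂, h₂⟩ : ∃ C₂ > 0, SemilinearWave.AssumptionA2 a b →
      SemilinearWave.AssumptionA3 a b → ∀ ε T, 0 < ε → ε ≤ 1 → T₀ / 2 ≤ T →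
        ENNReal.ofReal T < SemilinearWave.lifespan N a b p f g ε →
        ε ≤ C₂ * SemilinearWave.lifespanBound a (-((p ^ 2 + 1) / (p * (p - 1)))) ((N : ℝ) / p)
          (p / (p - 1)) ((N : ℝ) - 1 - ((N : ℝ) - 1) / 2 * (p / (p - 1))) T := by
    by_cases h23 : SemilinearWave.AssumptionA2 a b ∧ SemilinearWave.AssumptionA3 a b
    · obtain ⟨C₂, hC₂, h₂⟩ := SemilinearWave.exists_second_estimate hN hp hpN hA1 h23.1 h23.2
        hf hg hfg hr hfr hgr hT₁
      exact ⟨C₂, hC₂, fun _ _ => h₂⟩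
    · exact ⟨1, one_pos, fun h2 h3 => absurd ⟨h2, h3⟩ h23⟩
  -- If (A2) or (A3) fails, `C₂` plays no role.
  -- The time `T₀ / 2` lies strictly below the lifespan for every `ε ≤ 1`.
  refine ⟨1, one_pos, C₁ + C₂, by positivity, fun ε hε hε1 => ?_⟩
  have hτ : ENNReal.ofReal (T₀ / 2) < SemilinearWave.lifespan N a b p f g ε := by
    obtain ⟨u, hu⟩ := hloc ε hε hε1
    exact ((ENNReal.ofReal_lt_ofReal_iff hT₀).2 (half_lt_self hT₀)).trans_le
      (SemilinearWave.ofReal_le_lifespan hT₀ hu)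
  have hq : 0 < p / (p - 1) := div_pos (by linarith) (by linarith)
  refine ⟨SemilinearWave.holdsAtTime_of_forall hT₁ hτ ?_ fun T hT hlt => ?_, fun h2 h3 => ?_⟩
  · exact (continuousOn_const.mul (continuousOn_id.rpow_const fun T hT => Or.inl
      (ne_of_gt hT))).mul (hA1.continuousOn_Ioi_primitiveA.pow N)
  · have hT0 : 0 < T := hT₁.trans_le hT
    have hA := hA1.primitiveA_pos hT0
    rw [mul_assoc]
    exact (h₁ ε T hε hT hlt).trans (mul_le_mul_of_nonneg_right (by linarith) (by positivity))
  · have key := SemilinearWave.holdsAtTime_of_forall (c := ε) hT₁ hτ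
      (continuousOn_const.mul (hA1.continuousOn_lifespanBound (-((p ^ 2 + 1) / (p * (p - 1))))
        ((N : ℝ) / p) hq ((N : ℝ) - 1 - ((N : ℝ) - 1) / 2 * (p / (p - 1))))) fun T hT hlt =>
      (h₂ h2 h3 ε T hε hε1 hT hlt).trans (mul_le_mul_of_nonneg_right
        (by linarith : C₂ ≤ C₁ + C₂) (hA1.lifespanBound_pos _ _ _ _ (hT₁.trans_le hT)).le)
    simpa only [Pi.mul_apply, SemilinearWave.lifespanBound, SemilinearWave.lifespanWeight, mul_assoc] using key
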